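/- **Notation.** For $x\in\mathbb C$ let $(x)_n=x(x+1)\cdots(x+n-1)$. For $z\in\mathbb C\setminus(\mathbb Z+\frac12)$ and $s\in\mathbb C$ put $$G(z;s)={}_1F_2\bigl(\tfrac12;\tfrac12-z,\tfrac12+z;-4s^2\bigr)=\sum_{m\ge0}\binom{2m}{m}\frac{s^{2m}}{(z-m+\frac12)_{2m}},$$ $$\widetilde G(z;s)={}_1F_2\bigl(\tfrac12;\tfrac12-z,\tfrac32+z;-4s^2\bigr)=\sum_{m\ge0}\binom{2m}{m}\frac{(z+\frac12)\,s^{2m}}{(z-m+\frac12)_{2m+1}},$$ $$B(z;s)=\frac12\begin{pmatrix}1+G(z;s)&\frac{4s}{1-2z}\widetilde G(z-1;s)\\[2pt] \frac{4s}{1+2z}\widetilde G(z;s)&1-G(z;s)\end{pmatrix}.$$ For $z_1,\dots,z_k\notin\mathbb Z+\frac12$ pairwise distinct let $$H_2(z_1,z_2;s)=\frac{\operatorname{tr}[B(z_1;s)B(z_2;s)]-1}{(z_1-z_2)^2},$$ $$H_k(z_1,\dots,z_k;s)=-\sum_{\sigma\in S_k/C_k}\frac{\operatorname{tr}[B(z_{\sigma(1)};s)\cdots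 B(z_{\sigma(k)};s)]}{\prod_{i=1}^k(z_{\sigma(i)}-z_{\sigma(i+1)})}\quad(k\ge3),$$ where $\sigma(k+1)=\sigma(1)$; these functions are extended continuously to the diagonals $z_i=z_j$. With $J_\nu$ the Bessel function of the first kind (principal branch) and $V(z;s)=(J_{z-\frac12}(2s),J_{z+\frac12}(2s))^T$, let $$D^*(a,b;s)=\frac{V(-a;s)^TV(b;s)}{a-b},\qquad H_1^*(z;s)=-\frac{\pi s}{\cos\pi z}\lim_{b\to z}\Bigl(D^*(z,b;s)-\frac{\cos\pi z}{\pi s\,(z-b)}\Bigr).$$ Below $q^{1/2}$ denotes a square root of $q$ satisfying $|\arg(q^{1/2}/\varepsilon)|<\pi$. For $n\ge1$, an expansion $f\sim\sum_{d\ge0}q^{-d/2}\bigl(a_{0,d}+\sum_{m=1}^{n}[a_{m,d}\cos(4mq^{1/2}/\varepsilon)+b_{m,d}\sin(4mq^{1/2}/\varepsilon)]\bigr)$ as $q\to\infty$ is a compound asymptotic expansion: $f=A_0+\sum_{m=1}^{n}[A_m\cos(4mq^{1/2}/\varepsilon)+B_m\sin(4mq^{1/2}/\varepsilon)]$ for some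 functions $A_m,B_m$ of $q^{1/2}$ such that $A_m=\sum_{d<N}a_{m,d}q^{-d/2}+O(|q|^{-N/2})$ and $B_m=\sum_{d<N}b_{m,d}q^{-d/2}+O(|q|^{-N/2})$ as $q\to\infty$, for every $N\ge 0$, uniformly in every closed subsector $|\arg(q^{1/2}/\varepsilon)|\le\pi-\delta$, $\delta>0$. **Theorem.** (i) Let $k\ge2$. There are functions $H_k^{d,m},\widetilde H_k^{d,m}$ of $(\lambda_1,\dots,\lambda_k,\varepsilon)$, continuous on the set where $\varepsilon\ne0$ and all $\lambda_i/\varepsilon\notin\mathbb Z+\frac12$, which are elements of the ring $$\mathbb Q(\lambda_1,\dots,\lambda_k,\varepsilon)\Bigl[\sin\tfrac{\pi\lambda_1}\varepsilon,\cos\tfrac{\pi\lambda_1}\varepsilon,\dots,\sin\tfrac{\pi\lambda_k}\varepsilon,\cos\tfrac{\pi\lambda_k}\varepsilon\Bigr],$$ such that for all fixed $\lambda_1,\dots,\lambda_k,\varepsilon\in\mathbb C$ with $\varepsilon\neq0$ and $\lambda_i/\varepsilon\notin\mathbb Z+\frac12$, as $q\to\infty$ with $|\arg(q^{1/2}/\varepsilon)|<\pi$,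 $$\Bigl(\prod_{i=1}^k\cos\frac{\pi\lambda_i}\varepsilon\Bigr)H_k\Bigl(\frac{\lambda_1}\varepsilon,\dots,\frac{\lambda_k}\varepsilon;\frac{q^{1/2}}\varepsilon\Bigr)\sim\sum_{d\ge0}q^{-\frac d2}H_k^{d,0}+\sum_{d\ge1}q^{-\frac d2}\sum_{m=1}^{\min\{d,k\}}\Bigl[H_k^{d,m}\cos\Bigl(4m\frac{q^{1/2}}\varepsilon\Bigr)+\widetilde H_k^{d,m}\sin\Bigl(4m\frac{q^{1/2}}\varepsilon\Bigr)\Bigr].$$ (ii) There are functions $H_1^{*\,d},\widetilde H_1^{*\,d}$ $(d\ge1)$ of $(\lambda,\varepsilon)$, $\varepsilon\ne0$, such that $\varepsilon^{d-2}H_1^{*\,d},\ \varepsilon^{d-2}\widetilde H_1^{*\,d}\in\mathbb Q[\lambda,\varepsilon]$ and, with $\mathrm{gr}=\varepsilon\partial_\varepsilon+\lambda\partial_\lambda$, $\mathrm{gr}\,H_1^{*\,d}=d\,H_1^{*\,d}$ and $\mathrm{gr}\,\widetilde H_1^{*\,d}=d\,\widetilde H_1^{*\,d}$, and such that for all fixed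 $\lambda,\varepsilon\in\mathbb C$ with $\varepsilon\ne0$ and $\lambda/\varepsilon\notin\mathbb Z+\frac12$, as $q\to\infty$ with $|\arg(q^{1/2}/\varepsilon)|<\pi$, $$\cos\Bigl(\frac{\pi\lambda}\varepsilon\Bigr)H_1^*\Bigl(\frac\lambda\varepsilon;\frac{q^{1/2}}\varepsilon\Bigr)\sim-\frac\pi2\sin\Bigl(\frac{\pi\lambda}\varepsilon\Bigr)+\sin\Bigl(\frac{\pi\lambda}\varepsilon\Bigr)\sum_{d\ge0}\frac{(2d-1)!!\,\prod_{j=-d}^{d}(\lambda-\varepsilon j)}{(2d+1)\,d!\,2^{3d+1}\,q^{d+\frac12}}+\cos\Bigl(4\frac{q^{1/2}}\varepsilon\Bigr)\sum_{d\ge1}q^{-\frac d2}H_1^{*\,d}+\sin\Bigl(4\frac{q^{1/2}}\varepsilon\Bigr)\sum_{d\ge1}q^{-\frac d2}\widetilde H_1^{*\,d},$$ where $(-1)!!=1$. -/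

import Mathlib

open Filter Topology Asymptotics
open scoped Nat

noncomputable section

namespace P1Points

/-- `z ∉ ℤ + 1/2`. -/
def NotHalfInteger (z : ℂ) : Prop := ∀ n : ℤ, z ≠ (n : ℂ) + 1 / 2

/-- Increasing Pochhammer symbol `(x)_n = x (x+1) ⋯ (x+n-1)`. -/
def poch (x : ℂ) (n : ℕ) : ℂ := (ascPochhammer ℂ n).eval x

/-- `G(z;s) = ₁F₂(1/2; 1/2 - z, 1/2 + z; -4 s²)`, as its power series in `s²`. -/
def hyperG (z s : ℂ) : ℂ :=
  ∑' m : ℕ, (Nat.choose (2 * m) m : ℂ) * s ^ (2 * m) / poch (z - m + 1 / 2) (2 * m)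

/-- `G̃(z;s) = ₁F₂(1/2; 1/2 - z, 3/2 + z; -4 s²)`, as its power series in `s²`. -/
def hyperGt (z s : ℂ) : ℂ :=
  ∑' m : ℕ, (Nat.choose (2 * m) m : ℂ) * ((z + 1 / 2) / poch (z - m + 1 / 2) (2 * m + 1)) *
    s ^ (2 * m)

/-- The meromorphic matrix `B(z;s)`. -/
def matB (z s : ℂ) : Matrix (Fin 2) (Fin 2) ℂ :=
  (1 / 2 : ℂ) •
    !![1 + hyperG z s, 4 * s / (1 - 2 * z) * hyperGt (z - 1) s;
       4 * s / (1 + 2 * z) * hyperGt z s, 1 - hyperG z s]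

/-- The defining formula of the analytic `k`-point function for pairwise distinct arguments.
For `k ≥ 3` the sum over `S_k / C_k` is written as `1/k` times the sum over `S_k`: the summand is
constant on the cosets of the cyclic group generated by `finRotate k`, each of which has `k`
elements. The matrices are multiplied in the order `B(z_{σ(1)}) B(z_{σ(2)}) ⋯ B(z_{σ(k)})`. -/
def pointFormula : (k : ℕ) → (Fin k → ℂ) → ℂ → ℂ
  | 2, z, s => (Matrix.trace (matB (z 0) s * matB (z 1) s) - 1) / (z 0 - z 1) ^ 2
  | k, z, s =>
      -((1 / (k : ℂ)) * ∑ σ : Equiv.Perm (Fin k),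
        Matrix.trace ((List.ofFn fun i : Fin k => matB (z (σ i)) s).prod) /
          ∏ i : Fin k, (z (σ i) - z (σ (finRotate k i))))

/-- The analytic `k`-point function `H_k(z_1, …, z_k; s)`, `k ≥ 2`: the continuous extension of
the defining formula from the set of tuples with pairwise distinct entries (where it agrees with
the formula) to the diagonals `z_i = z_j`. -/
def pointH (k : ℕ) (z : Fin k → ℂ) (s : ℂ) : ℂ :=
  limUnder (𝓝[{w : Fin k → ℂ | Function.Injective w}] z) fun w => pointFormula k w s

/-- The Bessel function of the first kind `J_ν(y)`, with the principal branch of `(y/2)^ν`. -/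
def besselJ (ν y : ℂ) : ℂ :=
  (y / 2) ^ ν * ∑' n : ℕ, (-1 : ℂ) ^ n * (y / 2) ^ (2 * n) / ((n ! : ℂ) * Complex.Gamma (n + ν + 1))

/-- `V(z;s) = (J_{z-1/2}(2s), J_{z+1/2}(2s))ᵀ`. -/
def vecV (z s : ℂ) : Fin 2 → ℂ := ![besselJ (z - 1 / 2) (2 * s), besselJ (z + 1 / 2) (2 * s)]

/-- `D*(a,b;s) = V(-a;s)ᵀ V(b;s) / (a - b)`. -/
def Dstar (a b s : ℂ) : ℂ := (vecV (-a) s ⬝ᵥ vecV b s) / (a - b)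

/-- The modified one-point function
`H₁*(z;s) = -(π s / cos πz) lim_{b → z} (D*(z,b;s) - cos πz / (π s (z - b)))`. -/
def pointH1star (z s : ℂ) : ℂ :=
  -((Real.pi * s / Complex.cos (Real.pi * z)) *
    limUnder (𝓝[≠] z) fun b => Dstar z b s - Complex.cos (Real.pi * z) / (Real.pi * s * (z - b)))

/-- `A(r) ∼ ∑_{d ≥ 0} c_d r^{-d}` as `r → ∞` with `|arg (r/ε)| < π`: a Poincaré expansion to all
orders, uniform in every closed subsector `|arg (r/ε)| ≤ π - δ`. -/
def HasPowerExpansion (ε : ℂ) (A : ℂ → ℂ) (c : ℕ → ℂ) : Prop :=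
  ∀ δ : ℝ, 0 < δ → ∀ N : ℕ,
    (fun r : ℂ => A r - ∑ d ∈ Finset.range N, c d * (r ^ d)⁻¹)
      =O[Bornology.cobounded ℂ ⊓ 𝓟 {r : ℂ | |Complex.arg (r / ε)| ≤ Real.pi - δ}]
    fun r : ℂ => (r ^ N)⁻¹

/-- The compound asymptotic expansion
`f(r) ∼ ∑_d a_{0,d} r^{-d}
  + ∑_{m=1}^n (cos (4mr/ε) ∑_d a_{m,d} r^{-d} + sin (4mr/ε) ∑_d b_{m,d} r^{-d})`
as `r → ∞` with `|arg (r/ε)| < π`: `f` is a trigonometric sum whose amplitudes have the displayed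
power expansions. -/
def HasTrigExpansion (ε : ℂ) (n : ℕ) (f : ℂ → ℂ) (a b : ℕ → ℕ → ℂ) : Prop :=
  ∃ A B : ℕ → ℂ → ℂ,
    (∀ r : ℂ, r / ε ∈ Complex.slitPlane →
      f r = A 0 r + ∑ m ∈ Finset.Icc 1 n,
        (A m r * Complex.cos (4 * m * (r / ε)) + B m r * Complex.sin (4 * m * (r / ε)))) ∧
    HasPowerExpansion ε (A 0) (a 0) ∧
    ∀ m ∈ Finset.Icc 1 n, HasPowerExpansion ε (A m) (a m) ∧ HasPowerExpansion ε (B m) (b m)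

/-- The admissible parameters `(λ_1, …, λ_k, ε)`. -/
def paramDomain (k : ℕ) : Set ((Fin k → ℂ) × ℂ) :=
  {p | p.2 ≠ 0 ∧ ∀ i, NotHalfInteger (p.1 i / p.2)}

/-- The values of the variables `λ_1, …, λ_k` (as `some i`) and `ε` (as `none`). -/
def ratVars {k : ℕ} (l : Fin k → ℂ) (ε : ℂ) : Option (Fin k) → ℂ
  | some i => l i
  | none => ε

/-- The values of the variables `λ_i`, `ε`, `sin (π λ_i/ε)`, `cos (π λ_i/ε)`. -/
def trigVars {k : ℕ} (l : Fin k → ℂ) (ε : ℂ) : Option (Fin k) ⊕ (Fin k ⊕ Fin k) → ℂ :=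
  Sum.elim (ratVars l ε)
    (Sum.elim (fun i => Complex.sin (Real.pi * l i / ε)) fun i => Complex.cos (Real.pi * l i / ε))

/-- The continuous function `h` of the admissible parameters is an element `P / Q` of the ring
`ℚ(λ_1, …, λ_k, ε)[sin (π λ_i/ε), cos (π λ_i/ε)]`, where `P` is a polynomial in the `λ_i`, `ε`,
`sin (π λ_i/ε)`, `cos (π λ_i/ε)` and the common denominator `Q ≠ 0` a polynomial in the `λ_i`, `ε`,
all with rational coefficients. -/
def IsTrigRational (k : ℕ) (h : (Fin k → ℂ) → ℂ → ℂ) : Prop :=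
  ContinuousOn (fun p : (Fin k → ℂ) × ℂ => h p.1 p.2) (paramDomain k) ∧
  ∃ (P : MvPolynomial (Option (Fin k) ⊕ (Fin k ⊕ Fin k)) ℚ) (Q : MvPolynomial (Option (Fin k)) ℚ),
    Q ≠ 0 ∧ ∀ p ∈ paramDomain k,
      MvPolynomial.aeval (ratVars p.1 p.2) Q * h p.1 p.2 = MvPolynomial.aeval (trigVars p.1 p.2) P

/-- The operator `gr = ε ∂/∂ε + λ ∂/∂λ` on functions of `(λ, ε)` (independent of `q`). -/
def grading (h : ℂ → ℂ → ℂ) (l ε : ℂ) : ℂ :=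
  ε * deriv (fun e => h l e) ε + l * deriv (fun x => h x ε) l

/-- `ε^{d-2} h ∈ ℚ[λ, ε]` and `gr h = d h`, for a function `h(λ, ε)`, `ε ≠ 0`. -/
def IsOnePointCoeff (d : ℕ) (h : ℂ → ℂ → ℂ) : Prop :=
  (∃ P : MvPolynomial (Fin 2) ℚ, ∀ l ε : ℂ, ε ≠ 0 →
    ε ^ ((d : ℤ) - 2) * h l ε = MvPolynomial.aeval ![l, ε] P) ∧
  ∀ l ε : ℂ, ε ≠ 0 → grading h l ε = d * h l ε

/-- The coefficients, in powers of `q^{-1/2}`, of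
`-(π/2) sin (πλ/ε) + sin (πλ/ε) ∑_{j ≥ 0}
  (2j-1)!! ∏_{i=-j}^{j} (λ - ε i) / ((2j+1) j! 2^{3j+1} q^{j+1/2})`
(with `(-1)!! = 1`): the coefficient of `q^{-n/2}` for odd `n` is the one with `j = (n-1)/2`. -/
def onePointMean (l ε : ℂ) (n : ℕ) : ℂ :=
  if n = 0 then -(Real.pi / 2) * Complex.sin (Real.pi * l / ε)
  else if Odd n then
    let j := (n - 1) / 2
    Complex.sin (Real.pi * l / ε) *
      (((2 * j - 1)‼ : ℕ) * ∏ i ∈ Finset.Icc (-(j : ℤ)) (j : ℤ), (l - ε * i)) /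
        ((2 * j + 1) * (j ! : ℂ) * 2 ^ (3 * j + 1))
  else 0

end P1Points

end

noncomputable section

namespace P1Points

/-! ### Uniform asymptotic expansions on sectors and uniqueness of compound expansions. -/

section

/-! The product formula for Bessel series shows that B(z;s) has rank one: it equals πs/cos(πz) times
V(z;s)V(-z;s)ᵀ (`matB_eq`). So the trace of a product of matrices B(z_i;s), multiplied by the
cosines, is a cyclic product of values of the scalar kernel K(a,b) = πs V(-a;s)ᵀV(b;s) (`kerD`),
which is entire in a and b and satisfies K(z,z) = cos πz.

The asymptotics of K come from √π s^{1/2} J_ν(2s) = P cos φ - Q sin φ, where P and Q have expansions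
in 1/s, uniform for bounded ν and for s in closed subsectors of the slit plane. For Re ν > 3/2 this
is Poisson's integral, pushed onto two rays whose direction depends on arg s (`poisson_eq_laplace`),
followed by Watson's lemma (`watson`); the three-term recurrence carries it to all ν
(`exists_besselAmplitude_aux`). Hence K is a trigonometric sum of degree one in 4s, and its
oscillating amplitudes are O(1/s) because the leading coefficients cancel. A cyclic product of k
kernels has degree at most k, with frequency m starting at s^{-m}. Half angles πz_i/2 occur in it,
but each z_i enters twice, so that only sin πz_i and cos πz_i survive (`trigSum_prod_kerD`).

This settles pairwise distinct arguments. The coefficients carry denominators vanishing on the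
diagonals, while the function itself has only removable singularities there: for k ≥ 3 the residues
belonging to σ and (i j)σ cancel, for k = 2 the numerator is a product of two determinants that both
vanish on the diagonal. The function is therefore its own Cauchy integral over a torus with distinct
radii (`torusCauchy_eq`), on which the arguments are separated. Integrating the amplitudes over the
torus gives an expansion at every point of the polydisc. Off the diagonals its coefficients must be
the old ones, by uniqueness of compound expansions (`trig_expansion_unique`); so the old
coefficients extend continuously to the diagonals and stay rational-trigonometric
(`TrigSum.exists_limit_expansion`).

For the one-point function, cos πz · H₁* is the b-derivative of K(z,b) at b = z, and Cauchy's
formula on the circle |b - z| = 1 differentiates the uniform expansions. The coefficients are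
computed with formal series in 1/s over ℚ[z]. The amplitudes satisfy a linear first-order system;
differentiating it in z expresses the non-oscillating part through `ZSeries.cross`, whose
coefficients obey a two-term recurrence and thus have product form (`ZSeries.theta_meanSer`,
`ZSeries.ev_cross_odd`). In the oscillating part the coefficient of s^{-d} has degree at most 2d-2
in z (`ZSeries.HasWeight`), which is the claim on powers of ε. -/

/-- The closed subsector `|arg s| ≤ π - δ`, away from the unit disc. -/
def sector (δ : ℝ) : Set ℂ := {s | 1 ≤ ‖s‖ ∧ |Complex.arg s| ≤ Real.pi - δ}

lemma sector_ne_zero {δ : ℝ} {s : ℂ} (hs : s ∈ sector δ) : s ≠ 0 := by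
  rintro rfl
  have := hs.1
  simp at this
  linarith

lemma sector_subset_slitPlane {δ : ℝ} (hδ : 0 < δ) {s : ℂ} (hs : s ∈ sector δ) :
    s ∈ Complex.slitPlane := by
  rw [Complex.mem_slitPlane_iff_arg]
  refine ⟨fun h => ?_, sector_ne_zero hs⟩
  have := hs.2
  rw [h, abs_of_pos Real.pi_pos] at this
  linarith

/-- `f(p, s) ∼ ∑ c_d(p) s^{-d}` uniformly for `p ∈ K` and `s` in closed subsectors of the slit
plane. -/
def UExp {α : Type*} (K : Set α) (f : α → ℂ → ℂ) (c : ℕ → α → ℂ) : Prop :=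
  ∀ δ : ℝ, 0 < δ → ∀ N : ℕ, ∃ C : ℝ, ∀ p ∈ K, ∀ s ∈ sector δ,
    ‖f p s - ∑ d ∈ Finset.range N, c d p * (s ^ d)⁻¹‖ ≤ C * (‖s‖ ^ N)⁻¹

section
variable {α : Type*} {K : Set α} {f g : α → ℂ → ℂ} {c e : ℕ → α → ℂ}

lemma UExp.mono {K' : Set α} (h : UExp K f c) (hK : K' ⊆ K) : UExp K' f c := fun δ hδ N => by
  obtain ⟨C, hC⟩ := h δ hδ N
  exact ⟨C, fun p hp => hC p (hK hp)⟩

lemma UExp.congr (h : UExp K f c) (hfg : ∀ p ∈ K, ∀ s ∈ Complex.slitPlane, f p s = g p s)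
    (hce : ∀ d, ∀ p ∈ K, c d p = e d p) : UExp K g e := fun δ hδ N => by
  obtain ⟨C, hC⟩ := h δ hδ N
  refine ⟨C, fun p hp s hs => ?_⟩
  simpa only [hfg p hp s (sector_subset_slitPlane hδ hs), hce _ p hp] using hC p hp s hs

lemma UExp.comp {β : Type*} {K' : Set β} (h : UExp K f c) (u : β → α) (hu : ∀ p ∈ K', u p ∈ K) :
    UExp K' (fun p => f (u p)) (fun d p => c d (u p)) := fun δ hδ N => by
  obtain ⟨C, hC⟩ := h δ hδ N
  exact ⟨C, fun p hp => hC _ (hu p hp)⟩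

lemma UExp.exists_pos (h : UExp K f c) {δ : ℝ} (hδ : 0 < δ) (N : ℕ) : ∃ C : ℝ, 0 < C ∧
    ∀ p ∈ K, ∀ s ∈ sector δ,
      ‖f p s - ∑ d ∈ Finset.range N, c d p * (s ^ d)⁻¹‖ ≤ C * (‖s‖ ^ N)⁻¹ := by
  obtain ⟨C, hC⟩ := h δ hδ N
  refine ⟨|C| + 1, by positivity, fun p hp s hs => (hC p hp s hs).trans ?_⟩
  gcongr
  linarith [le_abs_self C]

/-- At s = 1 the truncations of orders d and d + 1 differ by exactly the d-th coefficient, so the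
two error estimates bound it. Nothing needs to be assumed about the coefficients themselves. -/
lemma UExp.bounded_coeff (h : UExp K f c) (d : ℕ) : ∃ C : ℝ, 0 < C ∧ ∀ p ∈ K, ‖c d p‖ ≤ C := by
  obtain ⟨C, hC, h1⟩ := h.exists_pos Real.pi_pos d
  obtain ⟨C', hC', h2⟩ := h.exists_pos Real.pi_pos (d + 1)
  refine ⟨C + C', by positivity, fun p hp => ?_⟩
  have hs : (1 : ℂ) ∈ sector Real.pi := by simp [sector]
  have h1 := h1 p hp 1 hs
  have h2 := h2 p hp 1 hs
  rw [Finset.sum_range_succ] at h2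
  simp only [one_pow, inv_one, mul_one, norm_one] at h1 h2
  have : c d p = (f p 1 - ∑ x ∈ Finset.range d, c x p) -
    (f p 1 - (∑ x ∈ Finset.range d, c x p + c d p)) := by ring
  rw [this]
  exact (norm_sub_le _ _).trans (add_le_add h1 h2)

lemma uexp_const {a : α → ℂ} {C : ℝ} (ha : ∀ p ∈ K, ‖a p‖ ≤ C) :
    UExp K (fun p _ => a p) (fun d p => if d = 0 then a p else 0) := fun δ hδ N => by
  refine ⟨|C|, fun p hp s hs => ?_⟩
  rcases N with _ | N
  · simpa using (ha p hp).trans (le_abs_self C)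
  · have : ∑ d ∈ Finset.range (N + 1), (if d = 0 then a p else 0) * (s ^ d)⁻¹ = a p := by
      rw [Finset.sum_range_succ']
      simp
    rw [this, sub_self, norm_zero]
    positivity

lemma UExp.add (hf : UExp K f c) (hg : UExp K g e) :
    UExp K (fun p s => f p s + g p s) (fun d p => c d p + e d p) := fun δ hδ N => by
  obtain ⟨C, hC⟩ := hf δ hδ N
  obtain ⟨C', hC'⟩ := hg δ hδ N
  refine ⟨C + C', fun p hp s hs => ?_⟩
  have : f p s + g p s - ∑ d ∈ Finset.range N, (c d p + e d p) * (s ^ d)⁻¹ =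
      (f p s - ∑ d ∈ Finset.range N, c d p * (s ^ d)⁻¹) +
      (g p s - ∑ d ∈ Finset.range N, e d p * (s ^ d)⁻¹) := by
    simp only [add_mul, Finset.sum_add_distrib]
    ring
  rw [this, add_mul]
  exact (norm_add_le _ _).trans (add_le_add (hC p hp s hs) (hC' p hp s hs))

lemma UExp.smul {a : α → ℂ} {M : ℝ} (ha : ∀ p ∈ K, ‖a p‖ ≤ M) (hf : UExp K f c) :
    UExp K (fun p s => a p * f p s) (fun d p => a p * c d p) := fun δ hδ N => by
  obtain ⟨C, hC0, hC⟩ := hf.exists_pos hδ N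
  refine ⟨M * C, fun p hp s hs => ?_⟩
  have : a p * f p s - ∑ d ∈ Finset.range N, a p * c d p * (s ^ d)⁻¹ =
      a p * (f p s - ∑ d ∈ Finset.range N, c d p * (s ^ d)⁻¹) := by
    simp only [mul_sub, Finset.mul_sum, mul_assoc]
  rw [this, norm_mul, mul_assoc]
  have := (norm_nonneg _).trans (ha p hp)
  exact mul_le_mul (ha p hp) (hC p hp s hs) (norm_nonneg _) this

lemma UExp.cmul (a : ℂ) (hf : UExp K f c) :
    UExp K (fun p s => a * f p s) (fun d p => a * c d p) :=
  UExp.smul (a := fun _ => a) (M := ‖a‖) (fun _ _ => le_rfl) hf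

/-- Multiplication by `1/s` shifts the coefficients. -/
lemma UExp.div_s (hf : UExp K f c) :
    UExp K (fun p s => s⁻¹ * f p s) (fun d p => if d = 0 then 0 else c (d - 1) p) :=
  fun δ hδ N => by
  obtain ⟨C, hC0, hC⟩ := hf.exists_pos hδ (N - 1)
  refine ⟨C, fun p hp s hs => ?_⟩
  have hs0 := sector_ne_zero hs
  rcases N with _ | N
  -- For N = 0 truncated subtraction makes the order N - 1 equal to 0, and |s| ≥ 1 absorbs the extra
  -- factor.
  · have := hC p hp s hs
    simp only [zero_tsub, Finset.range_zero, Finset.sum_empty, sub_zero, pow_zero, inv_one,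
      mul_one] at this ⊢
    rw [norm_mul, norm_inv]
    have h1 : ‖s‖⁻¹ ≤ 1 := inv_le_one_of_one_le₀ hs.1
    nlinarith [norm_nonneg (f p s), norm_nonneg s]
  · rw [Finset.sum_range_succ']
    simp only [Nat.add_eq_zero_iff, one_ne_zero, and_false, if_false, Nat.add_sub_cancel, if_true,
      zero_mul, add_zero]
    have : s⁻¹ * f p s - ∑ k ∈ Finset.range N, c k p * (s ^ (k + 1))⁻¹ =
        s⁻¹ * (f p s - ∑ k ∈ Finset.range N, c k p * (s ^ k)⁻¹) := by
      rw [mul_sub, Finset.mul_sum]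
      congr 1
      refine Finset.sum_congr rfl fun k _ => ?_
      rw [pow_succ, mul_inv]
      ring
    rw [this, norm_mul, norm_inv, pow_succ, mul_inv]
    have := mul_le_mul_of_nonneg_left (hC p hp s hs) (inv_nonneg.2 (norm_nonneg s))
    simp only [Nat.add_sub_cancel] at this
    linarith

/-- Removing the leading coefficient and rescaling by s lowers the order by one; the induction in
`UExp.mul` runs on this. -/
lemma UExp.shift (hf : UExp K f c) :
    UExp K (fun p s => s * (f p s - c 0 p)) (fun d p => c (d + 1) p) := fun δ hδ N => by
  obtain ⟨C, hC⟩ := hf δ hδ (N + 1)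
  refine ⟨C, fun p hp s hs => ?_⟩
  have hs0 := sector_ne_zero hs
  have : s * (f p s - c 0 p) - ∑ d ∈ Finset.range N, c (d + 1) p * (s ^ d)⁻¹ =
      s * (f p s - ∑ d ∈ Finset.range (N + 1), c d p * (s ^ d)⁻¹) := by
    rw [Finset.sum_range_succ', pow_zero, inv_one, mul_one, ← sub_sub, mul_sub, mul_sub, mul_sub,
      Finset.mul_sum]
    have : ∀ d, s * (c (d + 1) p * (s ^ (d + 1))⁻¹) = c (d + 1) p * (s ^ d)⁻¹ := fun d => by
      rw [pow_succ]
      field_simp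
    simp only [this]
    ring
  rw [this, norm_mul]
  have hsn : 0 < ‖s‖ := norm_pos_iff.2 hs0
  calc ‖s‖ * _ ≤ ‖s‖ * (C * (‖s‖ ^ (N + 1))⁻¹) := by gcongr; exact hC p hp s hs
    _ = C * (‖s‖ ^ N)⁻¹ := by
      rw [pow_succ]
      field_simp

/-- Induction on the order, with f varying: fg = c₀ g + s⁻¹ · (s(f - c₀)) g, where s(f - c₀) again
has an expansion and its product with g is needed to one order less. -/
lemma UExp.mul (hf : UExp K f c) (hg : UExp K g e) :
    UExp K (fun p s => f p s * g p s)
      (fun d p => ∑ ij ∈ Finset.HasAntidiagonal.antidiagonal d, c ij.1 p * e ij.2 p) := fun δ hδ N => by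
  induction N generalizing f c with
  | zero =>
    obtain ⟨C, hC0, hC⟩ := hf.exists_pos hδ 0
    obtain ⟨C', hC0', hC'⟩ := hg.exists_pos hδ 0
    refine ⟨C * C', fun p hp s hs => ?_⟩
    have h1 := hC p hp s hs
    have h2 := hC' p hp s hs
    simp only [Finset.range_zero, Finset.sum_empty, sub_zero, pow_zero, inv_one, mul_one]
      at h1 h2 ⊢
    rw [norm_mul]
    gcongr
  | succ N ih =>
    obtain ⟨C, hC⟩ := ih hf.shift
    obtain ⟨M, hM, hcM⟩ := hf.bounded_coeff 0
    obtain ⟨C', hC0', hC'⟩ := hg.exists_pos hδ (N + 1)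
    refine ⟨M * C' + C, fun p hp s hs => ?_⟩
    have hs0 := sector_ne_zero hs
    have hsn : 0 < ‖s‖ := norm_pos_iff.2 hs0
    have key : f p s * g p s - ∑ d ∈ Finset.range (N + 1),
        (∑ ij ∈ Finset.HasAntidiagonal.antidiagonal d, c ij.1 p * e ij.2 p) * (s ^ d)⁻¹ =
        c 0 p * (g p s - ∑ d ∈ Finset.range (N + 1), e d p * (s ^ d)⁻¹) +
        s⁻¹ * (s * (f p s - c 0 p) * g p s - ∑ d ∈ Finset.range N,
          (∑ ij ∈ Finset.HasAntidiagonal.antidiagonal d, c (ij.1 + 1) p * e ij.2 p) * (s ^ d)⁻¹) := by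
      have h1 : ∑ d ∈ Finset.range (N + 1),
          (∑ ij ∈ Finset.HasAntidiagonal.antidiagonal d, c ij.1 p * e ij.2 p) * (s ^ d)⁻¹ =
          c 0 p * ∑ d ∈ Finset.range (N + 1), e d p * (s ^ d)⁻¹ +
          s⁻¹ * ∑ d ∈ Finset.range N,
          (∑ ij ∈ Finset.HasAntidiagonal.antidiagonal d, c (ij.1 + 1) p * e ij.2 p) * (s ^ d)⁻¹ := by
        rw [Finset.sum_range_succ' _ N, Finset.sum_range_succ' (fun d => e d p * (s ^ d)⁻¹) N]
        simp only [Finset.Nat.antidiagonal_succ, Finset.sum_cons, Finset.sum_map,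
          Function.Embedding.prodMap, Function.Embedding.coeFn_mk, Prod.map,
          Function.Embedding.refl_apply, Finset.Nat.antidiagonal_zero,
          Finset.sum_singleton, pow_zero, inv_one, mul_one, mul_add, Finset.mul_sum, add_mul,
          Finset.sum_add_distrib]
        have : ∀ d, (s ^ (d + 1))⁻¹ = s⁻¹ * (s ^ d)⁻¹ := fun d => by rw [pow_succ, mul_inv]; ring
        simp only [this, Nat.succ_eq_add_one]
        have h3 : ∀ d, (∑ x ∈ Finset.HasAntidiagonal.antidiagonal d, c (x.1 + 1) p * e x.2 p) *
            (s⁻¹ * (s ^ d)⁻¹) =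
            s⁻¹ * ((∑ x ∈ Finset.HasAntidiagonal.antidiagonal d, c (x.1 + 1) p * e x.2 p) * (s ^ d)⁻¹) :=
          fun d => by ring
        simp only [h3, mul_assoc, mul_left_comm (c 0 p)]
        ring
      rw [h1]
      field_simp
      ring
    rw [key]
    refine (norm_add_le _ _).trans ?_
    rw [add_mul, norm_mul, norm_mul, norm_inv]
    refine add_le_add ?_ ?_
    · rw [mul_assoc]
      exact mul_le_mul (hcM p hp) (hC' p hp s hs) (norm_nonneg _) hM.le
    · calc ‖s‖⁻¹ * _ ≤ ‖s‖⁻¹ * (C * (‖s‖ ^ N)⁻¹) := by gcongr; exact hC p hp s hs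
        _ = C * (‖s‖ ^ (N + 1))⁻¹ := by
          rw [pow_succ]
          field_simp

end

lemma UExp.tendsto {α : Type*} {K : Set α} {f : α → ℂ → ℂ} {c : ℕ → α → ℂ} (h : UExp K f c) {p : α}
    (hp : p ∈ K) (N : ℕ) (h0 : ∀ d < N, c d p = 0) :
    Tendsto (fun x : ℝ => (x : ℂ) ^ N * f p x) atTop (𝓝 (c N p)) := by
  obtain ⟨C, hC0, hC⟩ := h.exists_pos Real.pi_pos (N + 1)
  rw [tendsto_iff_norm_sub_tendsto_zero]
  refine squeeze_zero' (Eventually.of_forall fun _ => norm_nonneg _) ?_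
    (tendsto_const_nhds.div_atTop tendsto_id : Tendsto (fun x : ℝ => C / x) atTop (𝓝 0))
  filter_upwards [eventually_ge_atTop 1] with x hx
  have hs : (x : ℂ) ∈ sector Real.pi := by
    refine ⟨by simpa [abs_of_nonneg (zero_le_one.trans hx)] using hx, ?_⟩
    rw [Complex.arg_ofReal_of_nonneg (zero_le_one.trans hx)]
    simp
  have hx0 : (x : ℂ) ≠ 0 := sector_ne_zero hs
  have hx' : 0 < x := by linarith
  have h1 := hC p hp x hs
  rw [Finset.sum_range_succ, Finset.sum_eq_zero (fun d hd => by
    rw [h0 d (Finset.mem_range.1 hd), zero_mul]), zero_add] at h1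
  have : (x : ℂ) ^ N * f p x - c N p = (x : ℂ) ^ N * (f p x - c N p * ((x : ℂ) ^ N)⁻¹) := by
    field_simp
  rw [this, norm_mul, norm_pow]
  have hxn : ‖(x : ℂ)‖ = x := by simp [abs_of_pos hx']
  rw [hxn] at h1 ⊢
  calc x ^ N * _ ≤ x ^ N * (C * (x ^ (N + 1))⁻¹) := by gcongr
    _ = C / x := by rw [pow_succ]; field_simp

/-- A trigonometric polynomial that tends to zero at infinity has zero coefficients. -/
lemma trig_coeff_eq_zero (n : ℕ) (a b : ℕ → ℂ)
    (h : Tendsto (fun x : ℝ => ∑ m ∈ Finset.range (n + 1), (a m * Complex.cos (4 * m * x) +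
      b m * Complex.sin (4 * m * x))) atTop (𝓝 0)) :
    (∀ m ≤ n, a m = 0) ∧ ∀ m ≤ n, 1 ≤ m → b m = 0 := by
  set T : ℝ → ℂ := fun x => ∑ m ∈ Finset.range (n + 1), (a m * Complex.cos (4 * m * x) +
      b m * Complex.sin (4 * m * x)) with hT
  -- A periodic function with limit 0 at infinity is identically 0.
  have hper : Function.Periodic T (2 * Real.pi) := fun x => by
    simp only [hT]
    refine Finset.sum_congr rfl fun m _ => ?_
    have : (4 * m * ((x + 2 * Real.pi : ℝ) : ℂ) : ℂ) =
        4 * m * x + ((4 * m : ℕ) : ℂ) * (2 * Real.pi) := by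
      push_cast
      ring
    rw [this, Complex.cos_add_nat_mul_two_pi, Complex.sin_add_nat_mul_two_pi]
  have hT0 : ∀ x, T x = 0 := fun x => by
    have h1 : Tendsto (fun j : ℕ => T (x + j * (2 * Real.pi))) atTop (𝓝 0) := by
      refine h.comp (tendsto_atTop_add_const_left _ _ ?_)
      exact tendsto_natCast_atTop_atTop.atTop_mul_const (by positivity)
    have h2 : ∀ j : ℕ, T (x + j * (2 * Real.pi)) = T x := fun j => hper.nat_mul j x
    simp only [h2] at h1
    exact tendsto_nhds_unique tendsto_const_nhds h1
  -- The trigonometric sum as a Laurent polynomial in exp(4ix), times the n-th power that clears the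
  -- negative exponents.
  let p : Polynomial ℂ := ∑ m ∈ Finset.range (n + 1),
    (Polynomial.C ((a m - b m * Complex.I) / 2) * Polynomial.X ^ (n + m) +
      Polynomial.C ((a m + b m * Complex.I) / 2) * Polynomial.X ^ (n - m))
  have hp : ∀ x : ℝ, p.eval (Complex.exp (4 * x * Complex.I)) = 0 := fun x => by
    have : p.eval (Complex.exp (4 * x * Complex.I)) = Complex.exp (4 * x * Complex.I) ^ n * T x := by
      simp only [p, hT, Polynomial.eval_finsetSum, Finset.mul_sum]
      refine Finset.sum_congr rfl fun m hm => ?_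
      have hmn : m ≤ n := Nat.lt_succ_iff.1 (Finset.mem_range.1 hm)
      simp only [Polynomial.eval_add, Polynomial.eval_mul, Polynomial.eval_C, Polynomial.eval_pow,
        Polynomial.eval_X]
      have e1 : Complex.exp (4 * x * Complex.I) ^ (n - m) =
          Complex.exp (4 * x * Complex.I) ^ n * Complex.exp (-(4 * m * x) * Complex.I) := by
        rw [← Complex.exp_nat_mul, ← Complex.exp_nat_mul, ← Complex.exp_add]
        congr 1
        push_cast [hmn]
        ring
      have e2 : Complex.exp (4 * x * Complex.I) ^ (n + m) =
          Complex.exp (4 * x * Complex.I) ^ n * Complex.exp ((4 * m * x) * Complex.I) := by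
        rw [← Complex.exp_nat_mul, ← Complex.exp_nat_mul, ← Complex.exp_add]
        congr 1
        push_cast
        ring
      rw [e1, e2, Complex.cos, Complex.sin]
      ring
    rw [this, hT0, mul_zero]
  have hp0 : p = 0 := by
    -- At x = 1/(j+1) the angles 4x lie in (0,4], an interval shorter than 2π, so these zeros are
    -- distinct.
    refine Polynomial.eq_zero_of_infinite_isRoot p (Set.Infinite.mono
      (s := Set.range fun j : ℕ => Complex.exp (4 * ((1 / (j + 1) : ℝ) : ℂ) * Complex.I)) ?_ ?_)
    · rintro _ ⟨j, rfl⟩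
      exact hp _
    · refine Set.infinite_range_of_injective fun i j hij => ?_
      rw [Complex.exp_eq_exp_iff_exists_int] at hij
      obtain ⟨N, hN⟩ := hij
      have h3 : (4 * (1 / ((i : ℝ) + 1)) : ℝ) = 4 * (1 / ((j : ℝ) + 1)) + N * (2 * Real.pi) := by
        have h4 := congrArg Complex.im hN
        have e : (4 * ((1 / ((j : ℝ) + 1) : ℝ) : ℂ) * Complex.I +
            (N : ℂ) * (2 * Real.pi * Complex.I)) =
            ((4 * (1 / ((j : ℝ) + 1)) + N * (2 * Real.pi) : ℝ) : ℂ) * Complex.I := by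
          push_cast
          ring
        have e' : (4 * ((1 / ((i : ℝ) + 1) : ℝ) : ℂ) * Complex.I) =
            ((4 * (1 / ((i : ℝ) + 1)) : ℝ) : ℂ) * Complex.I := by
          push_cast
          ring
        rw [e, e'] at h4
        simpa only [Complex.mul_I_im, Complex.ofReal_re] using h4
      have hi : 0 < 1 / ((i : ℝ) + 1) ∧ 1 / ((i : ℝ) + 1) ≤ 1 :=
        ⟨by positivity, by rw [div_le_one (by positivity)]; linarith [Nat.cast_nonneg (α := ℝ) i]⟩
      have hj : 0 < 1 / ((j : ℝ) + 1) ∧ 1 / ((j : ℝ) + 1) ≤ 1 :=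
        ⟨by positivity, by rw [div_le_one (by positivity)]; linarith [Nat.cast_nonneg (α := ℝ) j]⟩
      have hN0 : N = 0 := by
        have hpi := Real.pi_gt_three
        have l1 : (N : ℝ) < 1 := by
          by_contra hc
          push Not at hc
          nlinarith
        have l2 : (-1 : ℝ) < N := by
          by_contra hc
          push Not at hc
          nlinarith
        have l1' : N < 1 := by exact_mod_cast l1
        have l2' : -1 < N := by exact_mod_cast l2
        omega
      rw [hN0] at h3
      have h4 : (1 / ((i : ℝ) + 1)) = 1 / ((j : ℝ) + 1) := by
        simp only [Int.cast_zero, zero_mul, add_zero] at h3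
        linarith
      simpa using h4
  have hc : ∀ j, ∑ m ∈ Finset.range (n + 1), ((if j = n + m then (a m - b m * Complex.I) / 2 else 0)
      + (if j = n - m then (a m + b m * Complex.I) / 2 else 0)) = 0 := fun j => by
    have := congrArg (fun q => Polynomial.coeff q j) hp0
    simpa [p, Polynomial.finsetSum_coeff, Polynomial.coeff_X_pow] using this
  have h1 : ∀ m ≤ n, 1 ≤ m → (a m - b m * Complex.I) / 2 = 0 := fun m hm hm1 => by
    have := hc (n + m)
    rw [Finset.sum_eq_single m] at this
    · rw [if_pos rfl, if_neg (by omega), add_zero] at this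
      exact this
    · intro i hi hne
      rw [if_neg (by omega), if_neg (by omega), add_zero]
    · intro hi
      simp only [Finset.mem_range] at hi
      omega
  have h2 : ∀ m ≤ n, 1 ≤ m → (a m + b m * Complex.I) / 2 = 0 := fun m hm hm1 => by
    have := hc (n - m)
    rw [Finset.sum_eq_single m] at this
    · rw [if_neg (by omega), if_pos rfl, zero_add] at this
      exact this
    · intro i hi hne
      simp only [Finset.mem_range] at hi
      rw [if_neg (by omega), if_neg (by omega), add_zero]
    · intro hi
      simp only [Finset.mem_range] at hi
      omega
  have h3 : a 0 = 0 := by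
    have := hc n
    rw [Finset.sum_eq_single 0] at this
    · simp only [add_zero, if_true, tsub_zero] at this
      linear_combination this
    · intro i hi hne
      simp only [Finset.mem_range] at hi
      rw [if_neg (by omega), if_neg (by omega), add_zero]
    · intro hi
      simp at hi
  refine ⟨fun m hm => ?_, fun m hm hm1 => ?_⟩
  · rcases Nat.eq_zero_or_pos m with rfl | hm1
    · exact h3
    · linear_combination h1 m hm hm1 + h2 m hm hm1
  · have : b m * Complex.I = 0 := by linear_combination h2 m hm hm1 - h1 m hm hm1
    exact (mul_eq_zero.1 this).resolve_right Complex.I_ne_zero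

/-- Uniqueness of compound asymptotic expansions. -/
lemma trig_expansion_unique {n : ℕ} {A B : ℕ → ℂ → ℂ} {a b : ℕ → ℕ → ℂ}
    (hA : ∀ m, UExp (Set.univ : Set Unit) (fun _ => A m) (fun d _ => a m d))
    (hB : ∀ m, UExp (Set.univ : Set Unit) (fun _ => B m) (fun d _ => b m d))
    (h : ∀ x : ℝ, 1 ≤ x → ∑ m ∈ Finset.range (n + 1), (A m x * Complex.cos (4 * m * x) +
      B m x * Complex.sin (4 * m * x)) = 0) (d : ℕ) :
    (∀ m ≤ n, a m d = 0) ∧ ∀ m ≤ n, 1 ≤ m → b m d = 0 := by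
  induction d using Nat.strong_induction_on with
  | _ d ih =>
  -- The coefficients of order below d vanish by induction, so x^d times the m-th amplitude tends to
  -- its d-th coefficient. As x^d times the whole sum is 0, the trigonometric polynomial of the d-th
  -- coefficients tends to 0.
  refine trig_coeff_eq_zero n (fun m => a m d) (fun m => b m d) ?_
  have bdd : ∀ (u v : ℝ → ℂ) (l : ℂ), Tendsto u atTop (𝓝 l) → (∀ x, ‖v x‖ ≤ 1) →
      Tendsto (fun x => (l - u x) * v x) atTop (𝓝 0) := fun u v l hu hv => by
    have h1 : Tendsto (fun x => l - u x) atTop (𝓝 0) := by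
      simpa using (tendsto_const_nhds (x := l)).sub hu
    refine squeeze_zero_norm (fun x => ?_) (tendsto_norm_zero.comp h1)
    rw [norm_mul]
    exact mul_le_of_le_one_right (norm_nonneg _) (hv x)
  have hcos : ∀ (m : ℕ) (x : ℝ), ‖Complex.cos (4 * m * x)‖ ≤ 1 := fun m x => by
    have : (4 * m * x : ℂ) = ((4 * m * x : ℝ) : ℂ) := by push_cast; ring
    rw [this, ← Complex.ofReal_cos, Complex.norm_real]
    exact Real.abs_cos_le_one _
  have hsin : ∀ (m : ℕ) (x : ℝ), ‖Complex.sin (4 * m * x)‖ ≤ 1 := fun m x => by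
    have : (4 * m * x : ℂ) = ((4 * m * x : ℝ) : ℂ) := by push_cast; ring
    rw [this, ← Complex.ofReal_sin, Complex.norm_real]
    exact Real.abs_sin_le_one _
  -- For m = 0 the sine vanishes and nothing is known about b 0; the conditionals replace both of
  -- its terms by 0, so that the limit still holds.
  have h1 : Tendsto (fun x : ℝ => ∑ m ∈ Finset.range (n + 1),
      ((a m d - (x : ℂ) ^ d * A m x) * Complex.cos (4 * m * x) +
       ((if 1 ≤ m then b m d else 0) - (if 1 ≤ m then (x : ℂ) ^ d * B m x else 0)) *
        Complex.sin (4 * m * x))) atTop (𝓝 0) := by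
    rw [← Finset.sum_const_zero (s := Finset.range (n + 1))]
    refine tendsto_finsetSum _ fun m hm => ?_
    have hmn : m ≤ n := Nat.lt_succ_iff.1 (Finset.mem_range.1 hm)
    rw [← add_zero (0 : ℂ)]
    refine Tendsto.add (bdd _ _ _ ((hA m).tendsto (p := ()) trivial d
      fun i hi => (ih i hi).1 m hmn) (hcos m)) (bdd _ _ _ ?_ (hsin m))
    split_ifs with h1m
    · exact (hB m).tendsto (p := ()) trivial d fun i hi => (ih i hi).2 m hmn h1m
    · exact tendsto_const_nhds
  refine h1.congr' ?_
  filter_upwards [eventually_ge_atTop 1] with x hx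
  have h2 := h x hx
  have h3 : ∑ m ∈ Finset.range (n + 1),
      ((a m d - (x : ℂ) ^ d * A m x) * Complex.cos (4 * m * x) +
       ((if 1 ≤ m then b m d else 0) - (if 1 ≤ m then (x : ℂ) ^ d * B m x else 0)) *
        Complex.sin (4 * m * x)) = ∑ m ∈ Finset.range (n + 1),
      ((a m d * Complex.cos (4 * m * x) + b m d * Complex.sin (4 * m * x)) -
       (x : ℂ) ^ d * (A m x * Complex.cos (4 * m * x) + B m x * Complex.sin (4 * m * x))) := by
    refine Finset.sum_congr rfl fun m _ => ?_
    rcases Nat.eq_zero_or_pos m with rfl | hm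
    · simp
    · have hm' : 1 ≤ m := hm
      simp only [hm', if_true]
      ring
  rw [h3, Finset.sum_sub_distrib, ← Finset.mul_sum, h2, mul_zero, sub_zero]

end

/-! ### Bessel series, their products and the reciprocal Gamma function. -/

section

/-- The falling factorial `x (x - 1) ⋯ (x - n + 1)`. -/
def fall (x : ℂ) (n : ℕ) : ℂ := (descPochhammer ℤ n).smeval x

@[simp] lemma fall_zero (x : ℂ) : fall x 0 = 1 := by simp [fall]

lemma fall_succ (x : ℂ) (n : ℕ) : fall x (n + 1) = fall x n * (x - n) := by
  rw [fall, fall, descPochhammer_succ_right, Polynomial.smeval_mul]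
  simp [Polynomial.smeval_sub, Polynomial.smeval_X, Polynomial.smeval_natCast]

lemma fall_natCast (N n : ℕ) : fall N n = (n ! : ℂ) * (N.choose n : ℂ) := by
  have : fall N n = (N.descFactorial n : ℂ) := by
    induction n with
    | zero => simp
    | succ n ih =>
      rw [fall_succ, ih, Nat.descFactorial_succ]
      rcases le_or_gt n N with h | h
      · push_cast [h]
        ring
      · rw [Nat.descFactorial_eq_zero_iff_lt.2 h]
        simp
  rw [this, Nat.descFactorial_eq_factorial_mul_choose]
  push_cast
  ring

lemma fall_add (x y : ℂ) (n : ℕ) :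
    fall (x + y) n = ∑ ij ∈ Finset.HasAntidiagonal.antidiagonal n,
      (n.choose ij.1 : ℂ) * (fall x ij.1 * fall y ij.2) :=
  Ring.descPochhammer_smeval_add n (Commute.all x y)

/-- The reciprocal Gamma function. -/
def rGamma (u : ℂ) : ℂ := (Complex.Gamma u)⁻¹

lemma rGamma_eq (u : ℂ) : rGamma u = u * rGamma (u + 1) :=
  Complex.one_div_Gamma_eq_self_mul_one_div_Gamma_add_one u

lemma differentiable_rGamma : Differentiable ℂ rGamma := Complex.differentiable_one_div_Gamma

lemma rGamma_sub_nat (x : ℂ) (j : ℕ) : rGamma (x - j + 1) = fall x j * rGamma (x + 1) := by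
  induction j with
  | zero => simp
  | succ j ih =>
    rw [fall_succ, mul_right_comm, ← ih, rGamma_eq]
    push_cast
    rw [show x - (j + 1) + 1 = x - j by ring]
    ring

/-- After extracting the reciprocal Gamma values at n+μ+1 and n+ν+1, the remaining factors are
falling factorials and the sum is the Chu–Vandermonde identity for (n+ν) + (n+μ). -/
lemma sum_antidiagonal_rGamma (μ ν : ℂ) (n : ℕ) :
    ∑ ij ∈ Finset.HasAntidiagonal.antidiagonal n,
      ((ij.1 ! : ℂ)⁻¹ * rGamma (ij.1 + μ + 1)) * ((ij.2 ! : ℂ)⁻¹ * rGamma (ij.2 + ν + 1)) =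
    fall (μ + ν + 2 * n) n / n ! * (rGamma (n + μ + 1) * rGamma (n + ν + 1)) := by
  rw [show μ + ν + 2 * n = (n + ν) + (n + μ) by ring, fall_add, Finset.sum_div, Finset.sum_mul]
  refine Finset.sum_congr rfl fun ij hij => ?_
  rw [Finset.HasAntidiagonal.mem_antidiagonal] at hij
  have h1 : (ij.1 : ℂ) = n - ij.2 := by rw [← hij]; push_cast; ring
  have h2 : (ij.2 : ℂ) = n - ij.1 := by rw [← hij]; push_cast; ring
  have e1 : rGamma (ij.1 + μ + 1) = fall (n + μ) ij.2 * rGamma (n + μ + 1) := by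
    rw [← rGamma_sub_nat, h1]
    ring_nf
  have e2 : rGamma (ij.2 + ν + 1) = fall (n + ν) ij.1 * rGamma (n + ν + 1) := by
    rw [← rGamma_sub_nat, h2]
    ring_nf
  have hc : (n.choose ij.1 : ℂ) * (ij.1 ! : ℂ) * (ij.2 ! : ℂ) = (n ! : ℂ) := by
    rw [← hij]
    rw [Nat.choose_symm_add]
    exact_mod_cast Nat.add_choose_mul_factorial_mul_factorial ij.1 ij.2
  have f1 : (ij.1 ! : ℂ) ≠ 0 := by exact_mod_cast Nat.factorial_ne_zero _
  have f2 : (ij.2 ! : ℂ) ≠ 0 := by exact_mod_cast Nat.factorial_ne_zero _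
  have f3 : (n ! : ℂ) ≠ 0 := by exact_mod_cast Nat.factorial_ne_zero _
  rw [e1, e2]
  field_simp
  linear_combination (-(fall (n + μ) ij.2 * rGamma (n + μ + 1) * fall (n + ν) ij.1 *
    rGamma (n + ν + 1))) * hc

/-- The terms of the entire part of the Bessel function. -/
def besselTerm (ν x : ℂ) (n : ℕ) : ℂ := (-1) ^ n * x ^ n * ((n ! : ℂ)⁻¹ * rGamma (n + ν + 1))

/-- `∑ (-x)^n / (n! Γ(n+ν+1))`. -/
def besselS (ν x : ℂ) : ℂ := ∑' n, besselTerm ν x n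

lemma besselJ_two_mul (ν s : ℂ) : besselJ ν (2 * s) = s ^ ν * besselS ν (s ^ 2) := by
  rw [besselJ, besselS, mul_div_cancel_left₀ _ two_ne_zero]
  congr 1
  refine tsum_congr fun n => ?_
  rw [besselTerm, rGamma, ← pow_mul, ← mul_inv, div_eq_mul_inv]

/-- By 1/Γ(u) = u/Γ(u+1) the modulus does not increase with n once n ≥ R + 1, since then |n+ν+1| ≥
1. The finitely many earlier n are handled by compactness. -/
lemma rGamma_bound (R : ℝ) : ∃ C : ℝ, 0 < C ∧ ∀ (n : ℕ) (ν : ℂ), ‖ν‖ ≤ R →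
    ‖rGamma (n + ν + 1)‖ ≤ C := by
  obtain ⟨m, hm⟩ := exists_nat_ge (R + 1)
  have hb : ∀ n : ℕ, ∃ C : ℝ, ∀ ν ∈ Metric.closedBall (0 : ℂ) R, ‖rGamma (n + ν + 1)‖ ≤ C :=
    fun n => (isCompact_closedBall 0 R).exists_bound_of_continuousOn
      (differentiable_rGamma.continuous.comp (by fun_prop :
        Continuous fun ν : ℂ => (n : ℂ) + ν + 1)).continuousOn
  choose C hC using hb
  have key : ∀ n ≥ m, ∀ ν : ℂ, ‖ν‖ ≤ R → ‖rGamma (n + ν + 1)‖ ≤ C m := by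
    intro n hn ν hν
    induction n, hn using Nat.le_induction with
    | base => exact hC m ν (by simpa using hν)
    | succ n hn ih =>
      refine le_trans ?_ ih
      rw [rGamma_eq (n + ν + 1), norm_mul]
      push_cast
      rw [show (n : ℂ) + ν + 1 + 1 = n + 1 + ν + 1 by ring]
      refine le_mul_of_one_le_left (norm_nonneg _) ?_
      have h1 : ‖(n : ℂ) + 1‖ = n + 1 := by
        rw [← Nat.cast_add_one, Complex.norm_natCast]
        push_cast
        ring
      have h2 := norm_sub_norm_le ((n : ℂ) + 1) (-ν)
      rw [norm_neg, h1, sub_neg_eq_add, add_right_comm] at h2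
      have : (m : ℝ) ≤ n := by exact_mod_cast hn
      linarith
  refine ⟨1 + ∑ n ∈ Finset.range (m + 1), |C n|, by positivity, fun n ν hν => ?_⟩
  have hsum : ∀ j ≤ m, C j ≤ 1 + ∑ n ∈ Finset.range (m + 1), |C n| := fun j hj => by
    have := Finset.single_le_sum (f := fun n => |C n|) (fun i _ => abs_nonneg _)
      (Finset.mem_range.2 (Nat.lt_succ_of_le hj))
    linarith [le_abs_self (C j)]
  rcases le_total n m with h | h
  · exact (hC n ν (by simpa using hν)).trans (hsum n h)
  · exact (key n h ν hν).trans (hsum m le_rfl)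

lemma besselTerm_bound (R : ℝ) : ∃ C : ℝ, 0 < C ∧ ∀ (x ν : ℂ), ‖ν‖ ≤ R → ∀ n : ℕ,
    ‖besselTerm ν x n‖ ≤ C * (‖x‖ ^ n / n !) := by
  obtain ⟨C, hC0, hC⟩ := rGamma_bound R
  refine ⟨C, hC0, fun x ν hν n => ?_⟩
  rw [besselTerm, norm_mul, norm_mul, norm_pow, norm_neg, norm_one, one_pow, one_mul, norm_pow,
    norm_mul, norm_inv, Complex.norm_natCast]
  have := hC n ν hν
  have h1 : 0 ≤ ‖x‖ ^ n * ((n ! : ℝ))⁻¹ := by positivity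
  calc ‖x‖ ^ n * ((n ! : ℝ)⁻¹ * ‖rGamma (n + ν + 1)‖) =
      (‖x‖ ^ n * (n ! : ℝ)⁻¹) * ‖rGamma (n + ν + 1)‖ := by ring
    _ ≤ (‖x‖ ^ n * (n ! : ℝ)⁻¹) * C := by gcongr
    _ = _ := by ring

lemma summable_norm_besselTerm (ν x : ℂ) : Summable fun n => ‖besselTerm ν x n‖ := by
  obtain ⟨C, hC0, hC⟩ := besselTerm_bound ‖ν‖
  exact Summable.of_nonneg_of_le (fun _ => norm_nonneg _) (hC x ν le_rfl)
    ((Real.summable_pow_div_factorial _).mul_left C)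

lemma differentiable_besselS (x : ℂ) : Differentiable ℂ fun ν => besselS ν x := fun ν₀ => by
  obtain ⟨C, hC0, hC⟩ := besselTerm_bound (‖ν₀‖ + 1)
  have hball : IsOpen (Metric.ball (0 : ℂ) (‖ν₀‖ + 1)) := Metric.isOpen_ball
  refine (Complex.differentiableOn_tsum_of_summable_norm
    ((Real.summable_pow_div_factorial ‖x‖).mul_left C)
    (fun n => ?_) hball fun n ν hν => hC x ν ?_ n).differentiableAt
    (hball.mem_nhds (by simp))
  · have : Differentiable ℂ fun ν : ℂ => rGamma (n + ν + 1) :=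
      differentiable_rGamma.comp (by fun_prop : Differentiable ℂ fun ν : ℂ => (n : ℂ) + ν + 1)
    exact ((this.const_mul _).const_mul _).differentiableOn
  · have := mem_ball_zero_iff.1 hν
    exact this.le

lemma differentiable_besselJ {s : ℂ} (hs : s ≠ 0) : Differentiable ℂ fun ν => besselJ ν (2 * s) := by
  simp only [besselJ_two_mul]
  exact fun ν => (differentiableAt_id.const_cpow (Or.inl hs)).mul (differentiable_besselS _ ν)

lemma besselS_recurrence (ν x : ℂ) :
    besselS (ν - 1) x + x * besselS (ν + 1) x = ν * besselS ν x := by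
  have h0 := (summable_norm_besselTerm (ν - 1) x).of_norm
  have h1 := (summable_norm_besselTerm (ν + 1) x).of_norm
  have h2 := (summable_norm_besselTerm ν x).of_norm
  rw [besselS, besselS, besselS, h0.tsum_eq_zero_add, h2.tsum_eq_zero_add, ← tsum_mul_left, mul_add,
    ← tsum_mul_left, add_assoc,
    ← ((summable_nat_add_iff 1).2 h0).tsum_add (h1.mul_left x)]
  congr 1
  · simp only [besselTerm, Nat.cast_zero, zero_add, sub_add_cancel, pow_zero]
    rw [rGamma_eq ν]
    ring
  · refine tsum_congr fun n => ?_
    simp only [besselTerm, Nat.factorial_succ]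
    push_cast
    have e1 : rGamma (n + 1 + (ν - 1) + 1) = (n + ν + 1) * rGamma (n + ν + 1 + 1) := by
      rw [← rGamma_eq]
      ring_nf
    rw [e1, show (n : ℂ) + (ν + 1) + 1 = n + ν + 1 + 1 by ring,
      show (n : ℂ) + 1 + ν + 1 = n + ν + 1 + 1 by ring]
    have f1 : (n ! : ℂ) ≠ 0 := by exact_mod_cast Nat.factorial_ne_zero _
    have f2 : (n : ℂ) + 1 ≠ 0 := by exact_mod_cast Nat.succ_ne_zero n
    rw [pow_succ, pow_succ]
    field_simp
    ring

lemma besselJ_recurrence {s : ℂ} (hs : s ≠ 0) (ν : ℂ) :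
    besselJ (ν - 1) (2 * s) = ν / s * besselJ ν (2 * s) - besselJ (ν + 1) (2 * s) := by
  simp only [besselJ_two_mul]
  have h := besselS_recurrence ν (s ^ 2)
  rw [Complex.cpow_sub _ _ hs, Complex.cpow_add _ _ hs, Complex.cpow_one]
  field_simp
  linear_combination s ^ ν * h

lemma besselS_mul (μ ν x : ℂ) : besselS μ x * besselS ν x = ∑' n : ℕ, (-1) ^ n * x ^ n *
    (fall (μ + ν + 2 * n) n / n ! * (rGamma (n + μ + 1) * rGamma (n + ν + 1))) := by
  rw [besselS, besselS, tsum_mul_tsum_eq_tsum_sum_antidiagonal_of_summable_norm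
    (summable_norm_besselTerm μ x) (summable_norm_besselTerm ν x)]
  refine tsum_congr fun n => ?_
  rw [← sum_antidiagonal_rGamma, Finset.mul_sum]
  refine Finset.sum_congr rfl fun ij hij => ?_
  rw [Finset.HasAntidiagonal.mem_antidiagonal] at hij
  rw [besselTerm, besselTerm, ← hij, pow_add, pow_add]
  ring

lemma poch_eq_prod (x : ℂ) (n : ℕ) : poch x (n + 1) = poch x n * (x + n) := by
  rw [poch, poch, ascPochhammer_succ_right]
  simp

/-- Euler's reflection formula, shifted by the functional equation. It turns the Gamma factors of a
product of Bessel series into the Pochhammer denominators of G and G̃; a zero u + N of the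
Pochhammer symbol would force sin πu = 0. -/
lemma rGamma_mul_rGamma (u : ℂ) (hu : Complex.sin (Real.pi * u) ≠ 0) (N : ℕ) :
    rGamma (u + N) * rGamma (1 - u) = Complex.sin (Real.pi * u) / Real.pi / poch u N ∧
      poch u N ≠ 0 := by
  induction N with
  | zero =>
    have := Complex.Gamma_mul_Gamma_one_sub u
    simp only [Nat.cast_zero, add_zero, poch, ascPochhammer_zero, Polynomial.eval_one, div_one]
    rw [rGamma, rGamma, ← mul_inv, this, inv_div]
    exact ⟨rfl, one_ne_zero⟩
  | succ N ih =>
    have hN : u + N ≠ 0 := fun h => hu (by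
      rw [show (Real.pi : ℂ) * u = -(N * Real.pi) by linear_combination (Real.pi : ℂ) * h,
        Complex.sin_neg, Complex.sin_nat_mul_pi, neg_zero])
    rw [rGamma_eq] at ih
    rw [poch_eq_prod]
    refine ⟨?_, mul_ne_zero ih.2 hN⟩
    rw [← div_div, ← ih.1]
    push_cast
    rw [← add_assoc]
    field_simp

lemma cos_ne_zero_of_notHalfInteger {z : ℂ} (hz : NotHalfInteger z) :
    Complex.cos (Real.pi * z) ≠ 0 := by
  rw [Complex.cos_ne_zero_iff]
  intro n h
  refine hz n ?_
  have hpi : (Real.pi : ℂ) ≠ 0 := by exact_mod_cast Real.pi_ne_zero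
  field_simp at h ⊢
  linear_combination h

lemma sin_shift (z : ℂ) (n : ℕ) :
    Complex.sin (Real.pi * (z - n + 1 / 2)) = (-1) ^ n * Complex.cos (Real.pi * z) := by
  rw [show (Real.pi : ℂ) * (z - n + 1 / 2) = (Real.pi * z - n * Real.pi) + Real.pi / 2 by ring,
    Complex.sin_add_pi_div_two, Complex.cos_antiperiodic.sub_nat_mul_eq]

/-! ### The matrix B(z;s) as a rank one matrix built from Bessel functions. -/

section matB
variable {z s : ℂ}

lemma neg_one_pow_eq (n : ℕ) : (-1 : ℂ) ^ n = 1 ∨ (-1 : ℂ) ^ n = -1 := neg_one_pow_eq_or ℂ n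

/-- `V(-a)ᵀ V(b)` multiplied by `π s`. -/
def kerD (a b s : ℂ) : ℂ := Real.pi * s * (vecV (-a) s ⬝ᵥ vecV b s)

lemma besselJ_mul_besselJ (hs : s ≠ 0) (μ ν : ℂ) :
    besselJ μ (2 * s) * besselJ ν (2 * s) = s ^ (μ + ν) * ∑' n : ℕ, (-1) ^ n * (s ^ 2) ^ n *
    (fall (μ + ν + 2 * n) n / n ! * (rGamma (n + μ + 1) * rGamma (n + ν + 1))) := by
  rw [besselJ_two_mul, besselJ_two_mul, mul_mul_mul_comm, ← Complex.cpow_add _ _ hs, besselS_mul]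

lemma pi_s_ne_zero (hs : s ≠ 0) : (Real.pi : ℂ) * s ≠ 0 :=
  mul_ne_zero (by exact_mod_cast Real.pi_ne_zero) hs

/-- The two orders add up to 0, so no power of s is left over and the product is a power series in
s². Its binomial factor is `fall (2n) n / n!`, the central binomial coefficient, and the series
match term by term. -/
lemma matB_offdiag₁ (hz : NotHalfInteger z) (hs : s ≠ 0) :
    Real.pi * s * (besselJ (z - 1 / 2) (2 * s) * besselJ (-z + 1 / 2) (2 * s)) =
      Complex.cos (Real.pi * z) * (1 / 2 * (4 * s / (1 - 2 * z) * hyperGt (z - 1) s)) := by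
  have hc := cos_ne_zero_of_notHalfInteger hz
  have hpi : (Real.pi : ℂ) ≠ 0 := by exact_mod_cast Real.pi_ne_zero
  rw [besselJ_mul_besselJ hs, show z - 1 / 2 + (-z + 1 / 2) = 0 by ring, Complex.cpow_zero, one_mul,
    hyperGt, ← tsum_mul_left, ← tsum_mul_left, ← tsum_mul_left, ← tsum_mul_left]
  refine tsum_congr fun n => ?_
  have hz1 : 1 - z * 2 ≠ 0 := fun h => hz 0 (by push_cast; linear_combination (-1 / 2 : ℂ) * h)
  have e0 : Complex.sin (Real.pi * (z - (n + 1 : ℕ) + 1 / 2)) ≠ 0 := by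
    rw [sin_shift]
    exact mul_ne_zero (pow_ne_zero _ (by norm_num)) hc
  obtain ⟨e1, e2⟩ := rGamma_mul_rGamma _ e0 (2 * n + 1)
  rw [sin_shift] at e1
  push_cast at e1 e2
  rw [show z - (n + 1) + 1 / 2 + (2 * n + 1) = n + (z - 1 / 2) + 1 by ring,
    show 1 - (z - (n + 1) + 1 / 2) = n + (-z + 1 / 2) + 1 by ring] at e1
  rw [e1, zero_add, show (2 * n : ℂ) = ((2 * n : ℕ) : ℂ) by push_cast; ring, fall_natCast,
    show z - 1 - n + 1 / 2 = z - (n + 1) + 1 / 2 by ring]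
  have f1 : (n ! : ℂ) ≠ 0 := by exact_mod_cast Nat.factorial_ne_zero _
  rw [← pow_mul, pow_succ]
  generalize poch _ _ = p at e2 ⊢
  rcases neg_one_pow_eq n with hm | hm <;> rw [hm] <;> field_simp <;> ring

lemma matB_offdiag₂ (hz : NotHalfInteger z) (hs : s ≠ 0) :
    Real.pi * s * (besselJ (z + 1 / 2) (2 * s) * besselJ (-z - 1 / 2) (2 * s)) =
      Complex.cos (Real.pi * z) * (1 / 2 * (4 * s / (1 + 2 * z) * hyperGt z s)) := by
  have hc := cos_ne_zero_of_notHalfInteger hz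
  have hpi : (Real.pi : ℂ) ≠ 0 := by exact_mod_cast Real.pi_ne_zero
  rw [besselJ_mul_besselJ hs, show z + 1 / 2 + (-z - 1 / 2) = 0 by ring, Complex.cpow_zero, one_mul,
    hyperGt, ← tsum_mul_left, ← tsum_mul_left, ← tsum_mul_left, ← tsum_mul_left]
  refine tsum_congr fun n => ?_
  have hz1 : 1 + z * 2 ≠ 0 := fun h => hz (-1) (by push_cast; linear_combination (1 / 2 : ℂ) * h)
  have e0 : Complex.sin (Real.pi * (z - n + 1 / 2)) ≠ 0 := by
    rw [sin_shift]
    exact mul_ne_zero (pow_ne_zero _ (by norm_num)) hc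
  obtain ⟨e1, e2⟩ := rGamma_mul_rGamma _ e0 (2 * n + 1)
  rw [sin_shift] at e1
  push_cast at e1 e2
  rw [show z - n + 1 / 2 + (2 * n + 1) = n + (z + 1 / 2) + 1 by ring,
    show 1 - (z - n + 1 / 2) = n + (-z - 1 / 2) + 1 by ring] at e1
  rw [e1, zero_add, show (2 * n : ℂ) = ((2 * n : ℕ) : ℂ) by push_cast; ring, fall_natCast]
  have f1 : (n ! : ℂ) ≠ 0 := by exact_mod_cast Nat.factorial_ne_zero _
  rw [← pow_mul]
  generalize poch _ _ = p at e2 ⊢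
  rcases neg_one_pow_eq n with hm | hm <;> rw [hm] <;> field_simp <;> ring

lemma choose_half (n : ℕ) :
    (2 : ℂ) * ((2 * n + 1).choose n : ℕ) = ((2 * (n + 1)).choose (n + 1) : ℕ) := by
  have h1 : (2 * (n + 1)).choose (n + 1) = (2 * n + 1).choose n + (2 * n + 1).choose (n + 1) := by
    rw [show 2 * (n + 1) = 2 * n + 1 + 1 by ring, Nat.choose_succ_succ]
  rw [h1, Nat.choose_symm_half]
  push_cast
  ring

/-- The orders now add up to -1 and to 1. The binomial factor is C(2n+1,n) = C(2n+2,n+1)/2, so half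
of G appears; only the constant term of the first product is 1 instead of 1/2, which produces 1 + G,
while the second product starts one term later and gives 1 - G. -/
lemma hasSum_hyperG (hz : NotHalfInteger z) (hs : s ≠ 0) :
    Real.pi * s * (besselJ (z - 1 / 2) (2 * s) * besselJ (-z - 1 / 2) (2 * s)) =
      Complex.cos (Real.pi * z) * (1 / 2 * (1 + hyperG z s)) ∧
    Real.pi * s * (besselJ (z + 1 / 2) (2 * s) * besselJ (-z + 1 / 2) (2 * s)) =
      Complex.cos (Real.pi * z) * (1 / 2 * (1 - hyperG z s)) := by
  have hc := cos_ne_zero_of_notHalfInteger hz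
  have hpi : (Real.pi : ℂ) ≠ 0 := by exact_mod_cast Real.pi_ne_zero
  have e0 : ∀ n : ℕ, Complex.sin (Real.pi * (z - n + 1 / 2)) ≠ 0 := fun n => by
    rw [sin_shift]
    exact mul_ne_zero (pow_ne_zero _ (by norm_num)) hc
  set t : ℕ → ℂ := fun m => (Nat.choose (2 * m) m : ℂ) * s ^ (2 * m) /
    poch (z - m + 1 / 2) (2 * m) with ht
  have hG : hyperG z s = ∑' m, t m := rfl
  have ht0 : t 0 = 1 := by simp [ht, poch]
  have k2 : Real.pi * s * (besselJ (z + 1 / 2) (2 * s) * besselJ (-z + 1 / 2) (2 * s)) =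
      ∑' n, -(Complex.cos (Real.pi * z) / 2 * t (n + 1)) := by
    rw [besselJ_mul_besselJ hs, show z + 1 / 2 + (-z + 1 / 2) = 1 by ring, Complex.cpow_one,
      ← tsum_mul_left, ← tsum_mul_left]
    refine tsum_congr fun n => ?_
    obtain ⟨e1, e2⟩ := rGamma_mul_rGamma _ (e0 (n + 1)) (2 * (n + 1))
    rw [sin_shift] at e1
    push_cast at e1 e2
    rw [show z - (n + 1) + 1 / 2 + (2 * (n + 1)) = n + (z + 1 / 2) + 1 by ring,
      show 1 - (z - (n + 1) + 1 / 2) = n + (-z + 1 / 2) + 1 by ring] at e1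
    have f1 : (n ! : ℂ) ≠ 0 := by exact_mod_cast Nat.factorial_ne_zero _
    have hch := choose_half n
    simp only [ht]
    rw [e1, show (1 + 2 * n : ℂ) = ((2 * n + 1 : ℕ) : ℂ) by push_cast; ring, fall_natCast, ← hch,
      ← pow_mul, pow_succ, show 2 * (n + 1) = 2 * n + 2 by ring, pow_add]
    push_cast
    rw [show 2 * (n + 1) = 2 * n + 2 by ring] at e2
    generalize poch _ _ = p at e2 ⊢
    rcases neg_one_pow_eq n with hm | hm <;> rw [hm] <;> field_simp
  have k1 : Real.pi * s * (besselJ (z - 1 / 2) (2 * s) * besselJ (-z - 1 / 2) (2 * s)) =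
      ∑' n, Complex.cos (Real.pi * z) * (if n = 0 then 1 else t n / 2) := by
    rw [besselJ_mul_besselJ hs, show z - 1 / 2 + (-z - 1 / 2) = -1 by ring, Complex.cpow_neg_one,
      ← tsum_mul_left, ← tsum_mul_left]
    refine tsum_congr fun n => ?_
    obtain ⟨e1, e2⟩ := rGamma_mul_rGamma _ (e0 n) (2 * n)
    rw [sin_shift] at e1
    push_cast at e1 e2
    rw [show z - n + 1 / 2 + (2 * n) = n + (z - 1 / 2) + 1 by ring,
      show 1 - (z - n + 1 / 2) = n + (-z - 1 / 2) + 1 by ring] at e1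
    rw [e1]
    rcases n with _ | n
    · simp only [pow_zero, fall_zero, Nat.factorial_zero, Nat.cast_one, if_true, poch, mul_zero,
        ascPochhammer_zero, Polynomial.eval_one]
      field_simp
    · rw [if_neg (Nat.succ_ne_zero n)]
      have hf : fall (-1 + 2 * ((n + 1 : ℕ) : ℂ)) (n + 1) / ((n + 1)! : ℂ) =
          ((2 * n + 1).choose n : ℕ) := by
        rw [show (-1 + 2 * ((n + 1 : ℕ) : ℂ)) = ((2 * n + 1 : ℕ) : ℂ) by push_cast; ring,
          fall_natCast, mul_div_cancel_left₀, Nat.choose_symm_half]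
        exact_mod_cast Nat.factorial_ne_zero _
      have hch := choose_half n
      simp only [ht]
      rw [hf, ← hch, ← pow_mul, pow_succ (-1 : ℂ)]
      generalize poch _ _ = p at e2 ⊢
      rcases neg_one_pow_eq n with hm | hm <;> rw [hm] <;> field_simp
  -- Up to a constant, the terms of G are those of the Cauchy product of two absolutely convergent
  -- Bessel series; this gives summability without estimating Pochhammer symbols.
  have hsum : Summable fun n => t (n + 1) := by
    have h1 := (summable_norm_besselTerm (z + 1 / 2) (s ^ 2))
    have h2 := (summable_norm_besselTerm (-z + 1 / 2) (s ^ 2))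
    have h3 := (summable_norm_sum_mul_antidiagonal_of_summable_norm h1 h2).of_norm
    refine (h3.mul_left (-2 * Real.pi * s ^ 2 / Complex.cos (Real.pi * z))).congr fun n => ?_
    have h4 : ∑ kl ∈ Finset.HasAntidiagonal.antidiagonal n, besselTerm (z + 1 / 2) (s ^ 2) kl.1 *
        besselTerm (-z + 1 / 2) (s ^ 2) kl.2 = (-1) ^ n * (s ^ 2) ^ n *
        (fall ((z + 1 / 2) + (-z + 1 / 2) + 2 * n) n / n ! *
        (rGamma (n + (z + 1 / 2) + 1) * rGamma (n + (-z + 1 / 2) + 1))) := by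
      rw [← sum_antidiagonal_rGamma, Finset.mul_sum]
      refine Finset.sum_congr rfl fun ij hij => ?_
      rw [Finset.HasAntidiagonal.mem_antidiagonal] at hij
      rw [besselTerm, besselTerm, ← hij, pow_add, pow_add]
      ring
    rw [h4]
    obtain ⟨e1, e2⟩ := rGamma_mul_rGamma _ (e0 (n + 1)) (2 * (n + 1))
    rw [sin_shift] at e1
    push_cast at e1 e2
    rw [show z - (n + 1) + 1 / 2 + (2 * (n + 1)) = n + (z + 1 / 2) + 1 by ring,
      show 1 - (z - (n + 1) + 1 / 2) = n + (-z + 1 / 2) + 1 by ring] at e1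
    have f1 : (n ! : ℂ) ≠ 0 := by exact_mod_cast Nat.factorial_ne_zero _
    have hch := choose_half n
    simp only [ht]
    rw [e1, show (z + 1 / 2) + (-z + 1 / 2) + (2 * n : ℂ) = ((2 * n + 1 : ℕ) : ℂ) by
      push_cast; ring, fall_natCast, ← hch, ← pow_mul, pow_succ,
      show 2 * (n + 1) = 2 * n + 2 by ring, pow_add]
    push_cast
    rw [show 2 * (n + 1) = 2 * n + 2 by ring] at e2
    generalize poch _ _ = p at e2 ⊢
    rcases neg_one_pow_eq n with hm | hm <;> rw [hm] <;> field_simp <;> ring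
  have hsum' : Summable t := (summable_nat_add_iff 1).1 hsum
  have hG' : hyperG z s = 1 + ∑' n, t (n + 1) := by rw [hG, hsum'.tsum_eq_zero_add, ht0]
  rw [k1, k2, hG', tsum_neg, tsum_mul_left, tsum_mul_left]
  refine ⟨?_, by ring⟩
  have h5 : Summable fun n => if n = 0 then (1 : ℂ) else t n / 2 := by
    rw [← summable_nat_add_iff 1]
    simpa using hsum.div_const 2
  rw [h5.tsum_eq_zero_add]
  simp only [if_true, Nat.succ_ne_zero, if_false, tsum_div_const]
  ring

/-- Rank one is what reduces traces of matrix products to products of scalars: only the pairings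
V(-a)ᵀV(b) remain. -/
lemma matB_eq (hz : NotHalfInteger z) (hs : s ≠ 0) :
    matB z s = (Real.pi * s / Complex.cos (Real.pi * z)) •
      Matrix.vecMulVec (vecV z s) (vecV (-z) s) := by
  have hc := cos_ne_zero_of_notHalfInteger hz
  obtain ⟨h00, h11⟩ := hasSum_hyperG hz hs
  have h01 := matB_offdiag₁ hz hs
  have h10 := matB_offdiag₂ hz hs
  ext i j
  fin_cases i <;> fin_cases j <;>
    simp only [matB, vecV, Matrix.vecMulVec, Matrix.smul_apply, Matrix.of_apply, Matrix.cons_val',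
      Matrix.cons_val_zero, Matrix.cons_val_one, Fin.zero_eta, Fin.mk_one, smul_eq_mul,
      Matrix.cons_val_fin_one, Fin.isValue] <;>
    rw [div_mul_eq_mul_div (Real.pi * s), eq_div_iff hc]
  · linear_combination -h00
  · linear_combination -h01
  · linear_combination -h10
  · linear_combination -h11

/-- This is tr B = 1: G cancels in the sum of the two diagonal entries. -/
lemma kerD_self (hz : NotHalfInteger z) (hs : s ≠ 0) :
    kerD z z s = Complex.cos (Real.pi * z) := by
  obtain ⟨h00, h11⟩ := hasSum_hyperG hz hs
  simp only [kerD, vecV, Matrix.vec2_dotProduct, Matrix.cons_val_zero, Matrix.cons_val_one]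
  linear_combination h00 + h11

end matB

end

/-! ### Poisson's integral for the Bessel functions. -/

section

lemma continuousOn_cpow_const {κ : ℂ} (hκ : 0 < κ.re) :
    ContinuousOn (fun z : ℂ => z ^ κ) (Complex.slitPlane ∪ {0}) := by
  rintro z (hz | hz)
  · exact (continuousAt_id.cpow continuousAt_const hz).continuousWithinAt
  · rw [Set.mem_singleton_iff.1 hz]
    exact ((Complex.continuousAt_cpow_zero_of_re_pos hκ).comp
      (f := fun z : ℂ => (z, κ)) (by fun_prop)).continuousWithinAt

lemma one_sub_sq_mem_of_real {t : ℝ} (ht : t ∈ Set.Icc (-1 : ℝ) 1) :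
    1 - (t : ℂ) ^ 2 ∈ Complex.slitPlane ∪ {0} := by
  have h : 0 ≤ 1 - t ^ 2 := by nlinarith [ht.1, ht.2]
  have e : 1 - (t : ℂ) ^ 2 = ((1 - t ^ 2 : ℝ) : ℂ) := by push_cast; ring
  rw [e]
  rcases h.lt_or_eq with h | h
  · exact Or.inl (Complex.ofReal_mem_slitPlane.2 h)
  · right
    rw [← h]
    simp

lemma one_sub_sq_mem_of_real' {t : ℝ} (ht : t ∈ Set.Ioo (-1 : ℝ) 1) :
    1 - (t : ℂ) ^ 2 ∈ Complex.slitPlane := by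
  have e : 1 - (t : ℂ) ^ 2 = ((1 - t ^ 2 : ℝ) : ℂ) := by push_cast; ring
  rw [e, Complex.ofReal_mem_slitPlane]
  nlinarith [ht.1, ht.2]

lemma continuousOn_poissonWeight {κ : ℂ} (hκ : 0 < κ.re) :
    ContinuousOn (fun t : ℝ => (1 - (t : ℂ) ^ 2) ^ κ) (Set.Icc (-1) 1) :=
  (continuousOn_cpow_const hκ).comp (by fun_prop) fun _ ht => one_sub_sq_mem_of_real ht

lemma intervalIntegrable_poisson {κ : ℂ} (hκ : 0 < κ.re) {f : ℝ → ℂ} (hf : Continuous f) :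
    IntervalIntegrable (fun t : ℝ => f t * (1 - (t : ℂ) ^ 2) ^ κ) MeasureTheory.volume (-1) 1 := by
  refine ContinuousOn.intervalIntegrable ?_
  rw [Set.uIcc_of_le (by norm_num)]
  exact hf.continuousOn.mul (continuousOn_poissonWeight hκ)

/-- The substitution t = 2x - 1 gives 2 · 4^κ times a Beta integral, and Legendre's duplication
formula removes Γ(2κ+2). -/
lemma integral_poissonWeight {κ : ℂ} (hκ : 0 < κ.re) :
    ∫ t in (-1 : ℝ)..1, (1 - (t : ℂ) ^ 2) ^ κ =
      (Real.sqrt Real.pi : ℂ) * Complex.Gamma (κ + 1) * rGamma (κ + 3 / 2) := by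
  have h1 : ∫ t in (-1 : ℝ)..1, (1 - (t : ℂ) ^ 2) ^ κ =
      2 * ∫ x in (0 : ℝ)..1, (1 - ((2 * x - 1 : ℝ) : ℂ) ^ 2) ^ κ := by
    have := intervalIntegral.integral_comp_mul_sub (a := 0) (b := 1)
      (fun t : ℝ => (1 - (t : ℂ) ^ 2) ^ κ) (two_ne_zero (α := ℝ)) 1
    rw [this]
    norm_num
    ring
  have h2 : ∫ x in (0 : ℝ)..1, (1 - ((2 * x - 1 : ℝ) : ℂ) ^ 2) ^ κ =
      (4 : ℂ) ^ κ * Complex.betaIntegral (κ + 1) (κ + 1) := by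
    rw [Complex.betaIntegral, ← intervalIntegral.integral_const_mul]
    refine intervalIntegral.integral_congr fun x hx => ?_
    rw [Set.uIcc_of_le (by norm_num)] at hx
    simp only [add_sub_cancel_right]
    have e : 1 - ((2 * x - 1 : ℝ) : ℂ) ^ 2 = (((4 : ℝ) : ℂ) * (x : ℂ)) * ((1 - x : ℝ) : ℂ) := by
      push_cast
      ring
    rw [e, ← Complex.ofReal_mul, Complex.mul_cpow_ofReal_nonneg (by linarith [hx.1])
      (by linarith [hx.2]), Complex.ofReal_mul,
      Complex.mul_cpow_ofReal_nonneg (by norm_num) hx.1]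
    push_cast
    ring
  have hk : 0 < (κ + 1).re := by simp; linarith
  rw [h1, h2, Complex.betaIntegral_eq_Gamma_mul_div _ _ hk hk]
  have h3 := Complex.Gamma_mul_Gamma_add_half (κ + 1)
  have g1 : Complex.Gamma (κ + 1) ≠ 0 := Complex.Gamma_ne_zero_of_re_pos hk
  have g2 : Complex.Gamma (κ + 3 / 2) ≠ 0 := Complex.Gamma_ne_zero_of_re_pos (by
    simp
    linarith)
  have g3 : Complex.Gamma (2 * (κ + 1)) ≠ 0 := Complex.Gamma_ne_zero_of_re_pos (by
    simp
    linarith)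
  rw [show κ + 1 + 1 / 2 = κ + 3 / 2 by ring] at h3
  have h4 : (2 : ℂ) ^ (1 - 2 * (κ + 1)) * (2 * (4 : ℂ) ^ κ) = 1 := by
    have : (4 : ℂ) ^ κ = (2 : ℂ) ^ (2 * κ) := by
      rw [two_mul, Complex.cpow_add _ _ two_ne_zero, show (4 : ℂ) = ((2 : ℕ) : ℂ) * ((2 : ℕ) : ℂ) by
        norm_num, Complex.natCast_mul_natCast_cpow]
      norm_num
    rw [this, show 1 - 2 * (κ + 1) = -(2 * κ + 1) by ring, Complex.cpow_neg,
      Complex.cpow_add _ _ two_ne_zero, Complex.cpow_one]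
    have : (2 : ℂ) ^ (2 * κ) ≠ 0 := by simp [Complex.cpow_eq_zero_iff]
    field_simp
  rw [rGamma, show κ + 1 + (κ + 1) = 2 * (κ + 1) by ring]
  generalize Complex.Gamma (κ + 3 / 2) = g at *
  field_simp
  linear_combination (2 * (4 : ℂ) ^ κ) * h3 +
    (Complex.Gamma (2 * (κ + 1)) * (Real.sqrt Real.pi : ℂ)) * h4

/-- Integrating the derivative of t^{2n+1}(1-t²)^{κ+1}, which vanishes at ±1, trades two powers of t
for one step in κ. Hence the induction on n is for all κ at once. -/
lemma integral_pow_mul_poissonWeight (n : ℕ) : ∀ {κ : ℂ}, 0 < κ.re →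
    ∫ t in (-1 : ℝ)..1, (t : ℂ) ^ (2 * n) * (1 - (t : ℂ) ^ 2) ^ κ =
      (Real.sqrt Real.pi : ℂ) * ((2 * n)! / (4 ^ n * n !)) * Complex.Gamma (κ + 1) *
        rGamma (n + κ + 3 / 2) := by
  induction n with
  | zero =>
    intro κ hκ
    simpa using integral_poissonWeight hκ
  | succ n ih =>
    intro κ hκ
    have hκ0 : κ + 1 ≠ 0 := fun h => by
      have := congrArg Complex.re h
      simp at this
      linarith
    have hκ1 : 0 < (κ + 1).re := by simp; linarith
    have ih' := ih hκ1
    have hFTC : ∫ t in (-1 : ℝ)..1, ((2 * n + 1) * ((t : ℂ) ^ (2 * n) * (1 - (t : ℂ) ^ 2) ^ (κ + 1)) -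
        2 * (κ + 1) * ((t : ℂ) ^ (2 * (n + 1)) * (1 - (t : ℂ) ^ 2) ^ κ)) = 0 := by
      have := intervalIntegral.integral_eq_sub_of_hasDerivAt_of_le (a := -1) (b := 1)
        (f := fun t : ℝ => (t : ℂ) ^ (2 * n + 1) * (1 - (t : ℂ) ^ 2) ^ (κ + 1))
        (f' := fun t : ℝ => (2 * n + 1) * ((t : ℂ) ^ (2 * n) * (1 - (t : ℂ) ^ 2) ^ (κ + 1)) -
          2 * (κ + 1) * ((t : ℂ) ^ (2 * (n + 1)) * (1 - (t : ℂ) ^ 2) ^ κ)) (by norm_num)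
        ((by fun_prop : Continuous fun t : ℝ => (t : ℂ) ^ (2 * n + 1)).continuousOn.mul
          (continuousOn_poissonWeight hκ1))
        (fun t ht => ?_)
        (((intervalIntegrable_poisson hκ1 (by fun_prop)).const_mul _).sub
          ((intervalIntegrable_poisson hκ (by fun_prop)).const_mul _))
      · rw [this]
        simp [Complex.zero_cpow hκ0]
      · have hm := one_sub_sq_mem_of_real' ht
        have d1 : HasDerivAt (fun z : ℂ => z ^ (2 * n + 1) * (1 - z ^ 2) ^ (κ + 1))
            (((2 * n + 1 : ℕ) : ℂ) * (t : ℂ) ^ (2 * n) * (1 - (t : ℂ) ^ 2) ^ (κ + 1) +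
              (t : ℂ) ^ (2 * n + 1) * ((κ + 1) * (1 - (t : ℂ) ^ 2) ^ (κ + 1 - 1) *
                (-(((2 : ℕ) : ℂ) * (t : ℂ) ^ 1)))) t := by
          have := (hasDerivAt_pow (2 * n + 1) (t : ℂ)).fun_mul
            (((hasDerivAt_pow 2 (t : ℂ)).const_sub 1).cpow_const (c := κ + 1) hm)
          exact this
        have d2 := d1.comp_ofReal
        refine d2.congr_deriv ?_
        rw [add_sub_cancel_right]
        push_cast
        ring
    rw [intervalIntegral.integral_sub ((intervalIntegrable_poisson hκ1 (by fun_prop)).const_mul _)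
      ((intervalIntegrable_poisson hκ (by fun_prop)).const_mul _),
      intervalIntegral.integral_const_mul, intervalIntegral.integral_const_mul, ih'] at hFTC
    have hG : Complex.Gamma (κ + 1 + 1) = (κ + 1) * Complex.Gamma (κ + 1) :=
      Complex.Gamma_add_one _ hκ0
    rw [hG] at hFTC
    have f1 : (n ! : ℂ) ≠ 0 := by exact_mod_cast Nat.factorial_ne_zero _
    have f2 : (n : ℂ) + 1 ≠ 0 := by exact_mod_cast Nat.succ_ne_zero n
    have e : ((2 * (n + 1))! : ℂ) / (4 ^ (n + 1) * (n + 1)!) =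
        (2 * n + 1) / 2 * ((2 * n)! / (4 ^ n * n !)) := by
      rw [show 2 * (n + 1) = 2 * n + 1 + 1 by ring, Nat.factorial_succ, Nat.factorial_succ,
        Nat.factorial_succ, pow_succ]
      push_cast
      field_simp
      ring
    push_cast at hFTC ⊢
    rw [e, show (n : ℂ) + 1 + κ + 3 / 2 = n + (κ + 1) + 3 / 2 by ring]
    refine mul_left_cancel₀ (mul_ne_zero two_ne_zero hκ0) ?_
    linear_combination (-1 : ℂ) * hFTC

/-- Poisson's integral. -/
lemma poisson_integral {κ : ℂ} (hκ : 0 < κ.re) (s : ℂ) :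
    ∫ t in (-1 : ℝ)..1, Complex.exp (2 * Complex.I * s * t) * (1 - (t : ℂ) ^ 2) ^ κ =
      (Real.sqrt Real.pi : ℂ) * Complex.Gamma (κ + 1) * besselS (κ + 1 / 2) (s ^ 2) := by
  -- The weight is even, so only the cosine part of the exponential contributes; its power series is
  -- then integrated termwise.
  have hodd : ∫ t in (-1 : ℝ)..1, Complex.sin (2 * s * t) * (1 - (t : ℂ) ^ 2) ^ κ = 0 := by
    have h := intervalIntegral.integral_comp_neg (a := -1) (b := 1)
      (fun t : ℝ => Complex.sin (2 * s * t) * (1 - (t : ℂ) ^ 2) ^ κ)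
    simp only [Complex.ofReal_neg, mul_neg, Complex.sin_neg, neg_sq, neg_mul, neg_neg,
      intervalIntegral.integral_neg] at h
    linear_combination (-1 / 2 : ℂ) * h
  have hsplit : ∫ t in (-1 : ℝ)..1, Complex.exp (2 * Complex.I * s * t) * (1 - (t : ℂ) ^ 2) ^ κ =
      ∫ t in (-1 : ℝ)..1, Complex.cos (2 * s * t) * (1 - (t : ℂ) ^ 2) ^ κ := by
    have : ∀ t : ℝ, Complex.exp (2 * Complex.I * s * t) * (1 - (t : ℂ) ^ 2) ^ κ =
        Complex.cos (2 * s * t) * (1 - (t : ℂ) ^ 2) ^ κ +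
        Complex.I * (Complex.sin (2 * s * t) * (1 - (t : ℂ) ^ 2) ^ κ) := fun t => by
      rw [show 2 * Complex.I * s * t = (2 * s * t) * Complex.I by ring, Complex.exp_mul_I]
      ring
    simp only [this]
    rw [intervalIntegral.integral_add (intervalIntegrable_poisson hκ (by fun_prop))
      ((intervalIntegrable_poisson hκ (by fun_prop)).const_mul _),
      intervalIntegral.integral_const_mul, hodd, mul_zero, add_zero]
  obtain ⟨W, hW⟩ := (isCompact_Icc (a := (-1 : ℝ)) (b := 1)).exists_bound_of_continuousOn
    (continuousOn_poissonWeight hκ)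
  have hsum := intervalIntegral.hasSum_integral_of_dominated_convergence (a := -1) (b := 1)
    (μ := MeasureTheory.volume)
    (F := fun (n : ℕ) (t : ℝ) => ((-1) ^ n * (2 * s * t) ^ (2 * n) / ((2 * n)! : ℂ)) *
      (1 - (t : ℂ) ^ 2) ^ κ)
    (f := fun t : ℝ => Complex.cos (2 * s * t) * (1 - (t : ℂ) ^ 2) ^ κ)
    (fun n _ => (2 * ‖s‖) ^ (2 * n) / (2 * n)! * W)
    (fun n => (intervalIntegrable_iff.1 (intervalIntegrable_poisson hκ
      (f := fun t : ℝ => (-1) ^ n * (2 * s * t) ^ (2 * n) / ((2 * n)! : ℂ))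
      (by fun_prop))).aestronglyMeasurable)
    (fun n => ?_) (Eventually.of_forall fun t _ => ?_) ?_ ?_
  · rw [hsplit, ← hsum.tsum_eq, besselS, ← tsum_mul_left]
    refine tsum_congr fun n => ?_
    have : ∀ t : ℝ, ((-1) ^ n * (2 * s * t) ^ (2 * n) / ((2 * n)! : ℂ)) * (1 - (t : ℂ) ^ 2) ^ κ =
        ((-1) ^ n * (2 * s) ^ (2 * n) / ((2 * n)! : ℂ)) *
          ((t : ℂ) ^ (2 * n) * (1 - (t : ℂ) ^ 2) ^ κ) := fun t => by
      rw [mul_pow _ (t : ℂ)]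
      ring
    simp only [this]
    rw [intervalIntegral.integral_const_mul, integral_pow_mul_poissonWeight n hκ, besselTerm,
      show (n : ℂ) + (κ + 1 / 2) + 1 = n + κ + 3 / 2 by ring]
    have f1 : ((2 * n)! : ℂ) ≠ 0 := by exact_mod_cast Nat.factorial_ne_zero _
    have f2 : (n ! : ℂ) ≠ 0 := by exact_mod_cast Nat.factorial_ne_zero _
    have e : (2 * s) ^ (2 * n) = 4 ^ n * (s ^ 2) ^ n := by
      rw [mul_pow, pow_mul, pow_mul]
      norm_num
    rw [e]
    have f3 : (4 : ℂ) ^ n ≠ 0 := pow_ne_zero _ (by norm_num)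
    field_simp
  · refine Eventually.of_forall fun t ht => ?_
    rw [Set.uIoc_of_le (by norm_num)] at ht
    have h1 : |t| ≤ 1 := abs_le.2 ⟨ht.1.le, ht.2⟩
    have h2 := hW t ⟨ht.1.le, ht.2⟩
    rw [norm_mul, norm_div, norm_mul, norm_pow, norm_neg, norm_one, one_pow, one_mul, norm_pow,
      norm_mul, norm_mul, Complex.norm_natCast, Complex.norm_real, Complex.norm_ofNat,
      Real.norm_eq_abs]
    have h3 : 2 * ‖s‖ * |t| ≤ 2 * ‖s‖ := mul_le_of_le_one_right (by positivity) h1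
    exact mul_le_mul (div_le_div_of_nonneg_right (pow_le_pow_left₀ (by positivity) h3 _)
      (by positivity)) h2 (norm_nonneg _) (by positivity)
  · refine Summable.mul_right _ ?_
    exact (Real.summable_pow_div_factorial (2 * ‖s‖)).comp_injective
      (i := fun n : ℕ => 2 * n) fun a b h => by simpa using h
  · exact intervalIntegrable_const
  · refine Eventually.of_forall fun t ht => ?_
    exact (Complex.hasSum_cos _).mul_right _

end

/-! ### Rotation of the contour: Poisson's integral as two Laplace integrals. -/

section

lemma norm_cpow_le_mul_exp (z w : ℂ) :
    ‖z ^ w‖ ≤ ‖z‖ ^ w.re * Real.exp (Real.pi * |w.im|) := by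
  refine (Complex.norm_cpow_le z w).trans ?_
  rw [div_eq_mul_inv, ← Real.exp_neg]
  refine mul_le_mul_of_nonneg_left (Real.exp_le_exp.2 ?_) (by positivity)
  rw [← neg_mul]
  refine (le_abs_self _).trans ?_
  rw [abs_mul, abs_neg]
  exact mul_le_mul_of_nonneg_right (Complex.abs_arg_le_pi z) (abs_nonneg _)

lemma one_add_pow_isLittleO (M : ℕ) {b : ℝ} (hb : 0 < b) :
    (fun u : ℝ => (1 + u) ^ M) =o[atTop] fun u => Real.exp (b * u) := by
  have h := (isLittleO_pow_exp_pos_mul_atTop M hb).comp_tendsto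
    (tendsto_atTop_add_const_left atTop (1 : ℝ) tendsto_id)
  have h2 : ((fun x : ℝ => Real.exp (b * x)) ∘ fun x : ℝ => 1 + id x) =
      fun u => Real.exp b * Real.exp (b * u) := by
    funext u
    simp [mul_add, Real.exp_add]
  rw [h2] at h
  exact h.trans_isBigO (isBigO_const_mul_self _ _ _)

lemma tendsto_one_add_pow_mul_exp_neg (M : ℕ) {b : ℝ} (hb : 0 < b) :
    Tendsto (fun u : ℝ => (1 + u) ^ M * Real.exp (-(b * u))) atTop (𝓝 0) := by
  have h := (one_add_pow_isLittleO M hb).tendsto_div_nhds_zero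
  refine h.congr fun u => ?_
  rw [Real.exp_neg, div_eq_mul_inv]

lemma integrableOn_one_add_pow_mul_exp_neg (M : ℕ) {b : ℝ} (hb : 0 < b) :
    MeasureTheory.IntegrableOn (fun u : ℝ => (1 + u) ^ M * Real.exp (-(b * u))) (Set.Ioi 0) := by
  refine integrable_of_isBigO_exp_neg (half_pos hb) (by fun_prop) ?_
  have h := (one_add_pow_isLittleO M (half_pos hb)).isBigO.mul
    (isBigO_refl (fun u : ℝ => Real.exp (-(b * u))) atTop)
  refine h.congr (fun _ => rfl) fun u => ?_
  rw [← Real.exp_add]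
  congr 1
  ring

lemma integrableOn_of_norm_le_one_add_pow_mul_exp_neg {f : ℝ → ℂ}
    (hf : ContinuousOn f (Set.Ioi 0)) {C b : ℝ} {M : ℕ} (hb : 0 < b)
    (h : ∀ u : ℝ, 0 < u → ‖f u‖ ≤ C * ((1 + u) ^ M * Real.exp (-(b * u)))) :
    MeasureTheory.IntegrableOn f (Set.Ioi 0) :=
  MeasureTheory.Integrable.mono' ((integrableOn_one_add_pow_mul_exp_neg M hb).const_mul C)
    (hf.aestronglyMeasurable measurableSet_Ioi)
    ((MeasureTheory.ae_restrict_iff' measurableSet_Ioi).2 (Eventually.of_forall h))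

/-- The integrand of the Laplace integral for the Hankel functions. -/
def laplFun (κ c η : ℂ) (u : ℝ) : ℂ :=
  Complex.exp (-(c * u)) * ((u : ℂ) ^ κ * (1 + u * η) ^ κ)

lemma one_add_mul_mem_slitPlane {η : ℂ} (hη : η.im ≠ 0) (u : ℝ) :
    1 + u * η ∈ Complex.slitPlane := by
  rw [Complex.mem_slitPlane_iff]
  rcases eq_or_ne u 0 with rfl | hu
  · left
    simp
  · right
    simp [hu, hη]

lemma le_norm_one_add_mul {η : ℂ} (u : ℝ) : |η.im| ≤ ‖1 + u * η‖ * ‖η‖ := by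
  have h := Complex.abs_im_le_norm ((1 + u * η) * (starRingEnd ℂ) η)
  rw [norm_mul, Complex.norm_conj] at h
  refine le_trans (le_of_eq ?_) h
  simp
  rw [← abs_neg]
  congr 1
  ring

lemma continuousOn_laplFun {κ c η : ℂ} (hη : η.im ≠ 0) :
    ContinuousOn (laplFun κ c η) (Set.Ioi 0) := by
  refine ContinuousOn.mul (by fun_prop) (ContinuousOn.mul ?_ ?_)
  · exact ContinuousOn.cpow_const (by fun_prop) fun u hu => Complex.ofReal_mem_slitPlane.2 hu
  · exact ContinuousOn.cpow_const (by fun_prop) fun u hu => one_add_mul_mem_slitPlane hη u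

lemma norm_one_add_cpow_le {B σ : ℝ} (hσ : 0 < σ) (hσ1 : σ ≤ 1) {κ x : ℂ} (hκ : ‖κ‖ ≤ B)
    (hx : σ ≤ ‖1 + x‖) : ‖(1 + x) ^ κ‖ ≤ (σ⁻¹ ^ B * Real.exp (Real.pi * B)) * (1 + ‖x‖) ^ B := by
  have hB : 0 ≤ B := (norm_nonneg κ).trans hκ
  have h1 : ‖1 + x‖ ≤ 1 + ‖x‖ := (norm_add_le _ _).trans (by simp)
  have hre := abs_le.1 ((Complex.abs_re_le_norm κ).trans hκ)
  have him := (Complex.abs_im_le_norm κ).trans hκ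
  refine (norm_cpow_le_mul_exp _ _).trans ?_
  have e1 : Real.exp (Real.pi * |κ.im|) ≤ Real.exp (Real.pi * B) :=
    Real.exp_le_exp.2 (mul_le_mul_of_nonneg_left him Real.pi_pos.le)
  have hs : 1 ≤ σ⁻¹ := (one_le_inv₀ hσ).2 hσ1
  have e2 : ‖1 + x‖ ^ κ.re ≤ σ⁻¹ ^ B * (1 + ‖x‖) ^ B := by
    have p1 : 1 ≤ σ⁻¹ ^ B := Real.one_le_rpow hs hB
    have p2 : 1 ≤ (1 + ‖x‖) ^ B := Real.one_le_rpow (by linarith [norm_nonneg x]) hB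
    rcases le_total 1 ‖1 + x‖ with h | h
    · calc ‖1 + x‖ ^ κ.re ≤ ‖1 + x‖ ^ B := Real.rpow_le_rpow_of_exponent_le h hre.2
        _ ≤ (1 + ‖x‖) ^ B := Real.rpow_le_rpow (norm_nonneg _) h1 hB
        _ ≤ _ := le_mul_of_one_le_left (by positivity) p1
    · have hx0 : 0 < ‖1 + x‖ := hσ.trans_le hx
      calc ‖1 + x‖ ^ κ.re ≤ ‖1 + x‖ ^ (-B) := Real.rpow_le_rpow_of_exponent_ge hx0 h hre.1
        _ ≤ σ ^ (-B) := Real.rpow_le_rpow_of_nonpos hσ hx (by linarith)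
        _ = σ⁻¹ ^ B := by rw [Real.rpow_neg hσ.le, Real.inv_rpow hσ.le]
        _ ≤ _ := le_mul_of_one_le_right (by positivity) p2
  calc _ ≤ (σ⁻¹ ^ B * (1 + ‖x‖) ^ B) * Real.exp (Real.pi * B) :=
        mul_le_mul e2 e1 (by positivity) (by positivity)
    _ = _ := by ring

lemma norm_ofReal_cpow_le {B u : ℝ} (hu : 0 < u) {κ : ℂ} (h0 : 0 ≤ κ.re) (hκ : ‖κ‖ ≤ B) :
    ‖(u : ℂ) ^ κ‖ ≤ (1 + u) ^ B := by
  rw [Complex.norm_cpow_eq_rpow_re_of_pos hu]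
  calc u ^ κ.re ≤ (1 + u) ^ κ.re := Real.rpow_le_rpow hu.le (by linarith) h0
    _ ≤ _ := Real.rpow_le_rpow_of_exponent_le (by linarith)
      ((Complex.re_le_norm κ).trans hκ)

lemma norm_laplFun_le {B : ℕ} {σ : ℝ} (hσ : 0 < σ) (hσ1 : σ ≤ 1) {κ c η : ℂ} (h0 : 0 ≤ κ.re)
    (hκ : ‖κ‖ ≤ B) (hη1 : ‖η‖ ≤ 1) (hη : σ ≤ |η.im|) {u : ℝ} (hu : 0 < u) :
    ‖laplFun κ c η u‖ ≤ (σ⁻¹ ^ B * Real.exp (Real.pi * B)) *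
      ((1 + u) ^ (2 * B) * Real.exp (-(c.re * u))) := by
  have hx : σ ≤ ‖1 + u * η‖ := hη.trans ((le_norm_one_add_mul u).trans
    (mul_le_of_le_one_right (norm_nonneg _) hη1))
  have h1 := norm_one_add_cpow_le hσ hσ1 hκ hx
  have h2 := norm_ofReal_cpow_le hu h0 hκ
  rw [Real.rpow_natCast] at h1 h2
  rw [Real.rpow_natCast] at h1
  have h3 : (1 + ‖(u : ℂ) * η‖) ^ B ≤ (1 + u) ^ B := by
    refine pow_le_pow_left₀ (by positivity) ?_ _
    rw [norm_mul, Complex.norm_real, Real.norm_of_nonneg hu.le]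
    linarith [mul_le_of_le_one_right hu.le hη1]
  rw [laplFun, norm_mul, norm_mul, Complex.norm_exp]
  have e : (-(c * u)).re = -(c.re * u) := by simp
  rw [e]
  calc _ ≤ Real.exp (-(c.re * u)) * ((1 + u) ^ B *
        ((σ⁻¹ ^ B * Real.exp (Real.pi * B)) * (1 + u) ^ B)) := by
        refine mul_le_mul_of_nonneg_left (mul_le_mul h2 (h1.trans ?_) (norm_nonneg _)
          (by positivity)) (by positivity)
        exact mul_le_mul_of_nonneg_left h3 (by positivity)
    _ = _ := by ring

lemma integrableOn_laplFun {κ c η : ℂ} (h0 : 0 ≤ κ.re) (hc : 0 < c.re) (hη1 : ‖η‖ ≤ 1)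
    (hη : η.im ≠ 0) : MeasureTheory.IntegrableOn (laplFun κ c η) (Set.Ioi 0) := by
  obtain ⟨B, hB⟩ := exists_nat_ge ‖κ‖
  exact integrableOn_of_norm_le_one_add_pow_mul_exp_neg (continuousOn_laplFun hη) hc
    fun u hu => norm_laplFun_le (abs_pos.2 hη) ((Complex.abs_im_le_norm η).trans hη1) h0 hB hη1
      le_rfl hu

/-- The principal branch of (1-z²)^κ has no cut in the upper half-plane: 1 - z² ≤ 0 forces z to be
real. -/
lemma one_sub_sq_mem_of_im_pos {z : ℂ} (hz : 0 < z.im) : 1 - z ^ 2 ∈ Complex.slitPlane := by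
  rw [Complex.mem_slitPlane_iff]
  by_cases h : z.re = 0
  · left
    simp [sq, h]
    nlinarith
  · right
    simp only [sq, Complex.sub_im, Complex.one_im, Complex.mul_im]
    intro h'
    apply mul_ne_zero h hz.ne'
    linarith

/-- The integrand of Poisson's integral. -/
def poissonFun (κ s z : ℂ) : ℂ := Complex.exp (2 * Complex.I * s * z) * (1 - z ^ 2) ^ κ

/-- The derivative of `poissonFun`. -/
def poissonDer (κ s z : ℂ) : ℂ :=
  Complex.exp (2 * Complex.I * s * z) *
    (2 * Complex.I * s * (1 - z ^ 2) ^ κ - 2 * κ * z * (1 - z ^ 2) ^ (κ - 1))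

lemma hasDerivAt_poissonFun {κ s z : ℂ} (hz : 1 - z ^ 2 ∈ Complex.slitPlane) :
    HasDerivAt (poissonFun κ s) (poissonDer κ s z) z := by
  have h := (((hasDerivAt_id z).const_mul (2 * Complex.I * s)).cexp).fun_mul
    (((hasDerivAt_pow 2 z).const_sub 1).cpow_const (c := κ) hz)
  refine h.congr_deriv ?_
  rw [poissonDer]
  simp
  ring

lemma continuousOn_poissonDer {κ : ℂ} (hκ : 1 < κ.re) (s : ℂ) :
    ContinuousOn (poissonDer κ s) {z | 1 - z ^ 2 ∈ Complex.slitPlane ∪ {0}} := by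
  have h1 : ContinuousOn (fun z : ℂ => (1 - z ^ 2) ^ κ)
      {z | 1 - z ^ 2 ∈ Complex.slitPlane ∪ {0}} :=
    (continuousOn_cpow_const (by linarith)).comp (by fun_prop) fun z hz => hz
  have h2 : ContinuousOn (fun z : ℂ => (1 - z ^ 2) ^ (κ - 1))
      {z | 1 - z ^ 2 ∈ Complex.slitPlane ∪ {0}} :=
    (continuousOn_cpow_const (by simpa using hκ)).comp (by fun_prop) fun z hz => hz
  unfold poissonDer
  fun_prop

lemma continuousOn_poissonFun {κ : ℂ} (hκ : 0 < κ.re) (s : ℂ) :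
    ContinuousOn (poissonFun κ s) {z | 1 - z ^ 2 ∈ Complex.slitPlane ∪ {0}} := by
  have h1 : ContinuousOn (fun z : ℂ => (1 - z ^ 2) ^ κ)
      {z | 1 - z ^ 2 ∈ Complex.slitPlane ∪ {0}} :=
    (continuousOn_cpow_const hκ).comp (by fun_prop) fun z hz => hz
  unfold poissonFun
  fun_prop

lemma strip_mem {ω : ℂ} (hω : 0 < ω.im) {t u : ℝ} (ht : t ∈ Set.Icc (-1 : ℝ) 1) (hu : 0 ≤ u) :
    1 - ((t : ℂ) + u * ω) ^ 2 ∈ Complex.slitPlane ∪ {0} := by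
  rcases hu.lt_or_eq with hu | rfl
  · exact Or.inl (one_sub_sq_mem_of_im_pos (by simpa using mul_pos hu hω))
  · simpa using one_sub_sq_mem_of_real ht

lemma strip_mem_of_lt {ω : ℂ} (hω : 0 < ω.im) {t u : ℝ} (ht : t ∈ Set.Ioo (-1 : ℝ) 1)
    (hu : 0 ≤ u) : 1 - ((t : ℂ) + u * ω) ^ 2 ∈ Complex.slitPlane := by
  rcases hu.lt_or_eq with hu | rfl
  · exact one_sub_sq_mem_of_im_pos (by simpa using mul_pos hu hω)
  · simpa using one_sub_sq_mem_of_real' ht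

/-- Cauchy's theorem for the parallelogram with vertices ±1 and ±1 + Tω. Since ±1 are branch points,
it is obtained by integrating the derivative in both orders (Fubini); 1 < Re κ makes the derivative
continuous up to these corners. -/
lemma poisson_strip {κ : ℂ} (hκ : 1 < κ.re) (s : ℂ) {ω : ℂ} (hω : 0 < ω.im) {T : ℝ}
    (hT : 0 ≤ T) :
    ∫ t in (-1 : ℝ)..1, poissonFun κ s t =
      (∫ t in (-1 : ℝ)..1, poissonFun κ s (t + T * ω)) +
      ω * ∫ u in (0 : ℝ)..T, (poissonFun κ s (-1 + u * ω) - poissonFun κ s (1 + u * ω)) := by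
  have hmaps : ∀ p ∈ Set.Icc (-1 : ℝ) 1 ×ˢ Set.Icc 0 T, ((p.1 : ℂ) + p.2 * ω) ∈
      {z : ℂ | 1 - z ^ 2 ∈ Complex.slitPlane ∪ {0}} := fun p hp => strip_mem hω hp.1 hp.2.1
  have hcd : ContinuousOn (fun p : ℝ × ℝ => poissonDer κ s (p.1 + p.2 * ω))
      (Set.Icc (-1 : ℝ) 1 ×ˢ Set.Icc 0 T) :=
    (continuousOn_poissonDer hκ s).comp (by fun_prop) hmaps
  have hcf : ContinuousOn (fun p : ℝ × ℝ => poissonFun κ s (p.1 + p.2 * ω))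
      (Set.Icc (-1 : ℝ) 1 ×ˢ Set.Icc 0 T) :=
    (continuousOn_poissonFun (by linarith) s).comp (by fun_prop) hmaps
  have hint : MeasureTheory.IntegrableOn
      (Function.uncurry fun t u : ℝ => poissonDer κ s (t + u * ω))
      (Set.uIoc (-1 : ℝ) 1 ×ˢ Set.uIoc 0 T) := by
    rw [Set.uIoc_of_le (by norm_num), Set.uIoc_of_le hT]
    exact (hcd.integrableOn_compact (isCompact_Icc.prod isCompact_Icc)).mono_set
      (Set.prod_mono Set.Ioc_subset_Icc_self Set.Ioc_subset_Icc_self)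
  have hswap := MeasureTheory.intervalIntegral_intervalIntegral_swap hint
  have hL : ∀ t ∈ Set.uIcc (-1 : ℝ) 1, ω * (∫ u in (0 : ℝ)..T, poissonDer κ s (t + u * ω)) =
      poissonFun κ s (t + T * ω) - poissonFun κ s t := by
    intro t ht
    rw [Set.uIcc_of_le (by norm_num)] at ht
    have hct : ContinuousOn (fun u : ℝ => poissonDer κ s (t + u * ω)) (Set.Icc 0 T) :=
      hcd.comp (f := fun u : ℝ => (t, u)) (by fun_prop) fun u hu => ⟨ht, hu⟩
    rw [← intervalIntegral.integral_const_mul]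
    have := intervalIntegral.integral_eq_sub_of_hasDerivAt_of_le hT
      (f := fun u : ℝ => poissonFun κ s (t + u * ω))
      (f' := fun u : ℝ => ω * poissonDer κ s (t + u * ω))
      (hcf.comp (f := fun u : ℝ => (t, u)) (by fun_prop) fun u hu => ⟨ht, hu⟩)
      (fun u hu => ?_) ?_
    · rw [this]
      simp
    · have hm := one_sub_sq_mem_of_im_pos (z := (t : ℂ) + u * ω) (by simpa using mul_pos hu.1 hω)
      have := (hasDerivAt_poissonFun (κ := κ) (s := s) hm).comp (u : ℂ)
        (((hasDerivAt_id (u : ℂ)).mul_const ω).const_add (t : ℂ))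
      exact (this.comp_ofReal).congr_deriv (by ring)
    · refine ContinuousOn.intervalIntegrable ?_
      rw [Set.uIcc_of_le hT]
      exact continuousOn_const.mul hct
  have hR : ∀ u ∈ Set.uIcc (0 : ℝ) T, (∫ t in (-1 : ℝ)..1, poissonDer κ s (t + u * ω)) =
      poissonFun κ s (1 + u * ω) - poissonFun κ s (-1 + u * ω) := by
    intro u hu
    rw [Set.uIcc_of_le hT] at hu
    have := intervalIntegral.integral_eq_sub_of_hasDerivAt_of_le (a := -1) (b := 1) (by norm_num)
      (f := fun t : ℝ => poissonFun κ s (t + u * ω))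
      (f' := fun t : ℝ => poissonDer κ s (t + u * ω))
      (hcf.comp (f := fun t : ℝ => (t, u)) (by fun_prop) fun t ht => ⟨ht, hu⟩)
      (fun t ht => ?_) ?_
    · rw [this]
      simp
    · have hm := strip_mem_of_lt hω ht hu.1
      have := (hasDerivAt_poissonFun (κ := κ) (s := s) hm).comp (t : ℂ)
        ((hasDerivAt_id (t : ℂ)).add_const (u * ω))
      exact (this.comp_ofReal).congr_deriv (by ring)
    · refine ContinuousOn.intervalIntegrable ?_
      rw [Set.uIcc_of_le (by norm_num)]
      exact hcd.comp (f := fun t : ℝ => (t, u)) (by fun_prop) fun t ht => ⟨ht, hu⟩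
  have hL' := intervalIntegral.integral_congr (μ := MeasureTheory.volume) hL
  have hR' := intervalIntegral.integral_congr (μ := MeasureTheory.volume) hR
  have j1 : IntervalIntegrable (fun t : ℝ => poissonFun κ s (t + T * ω)) MeasureTheory.volume
      (-1) 1 := by
    refine ContinuousOn.intervalIntegrable ?_
    rw [Set.uIcc_of_le (by norm_num)]
    exact hcf.comp (f := fun t : ℝ => (t, T)) (by fun_prop)
      fun t ht => ⟨ht, Set.right_mem_Icc.2 hT⟩
  have j2 : IntervalIntegrable (fun t : ℝ => poissonFun κ s t) MeasureTheory.volume (-1) 1 := by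
    refine ContinuousOn.intervalIntegrable ?_
    rw [Set.uIcc_of_le (by norm_num)]
    have := hcf.comp (f := fun t : ℝ => (t, (0 : ℝ))) (s := Set.Icc (-1) 1) (by fun_prop)
      fun t ht => ⟨ht, Set.left_mem_Icc.2 hT⟩
    simpa [Function.comp_def] using this
  rw [intervalIntegral.integral_const_mul, hswap, hR', intervalIntegral.integral_sub j1 j2] at hL'
  have e : ∫ u in (0 : ℝ)..T, (poissonFun κ s (-1 + u * ω) - poissonFun κ s (1 + u * ω)) =
      -∫ u in (0 : ℝ)..T, (poissonFun κ s (1 + u * ω) - poissonFun κ s (-1 + u * ω)) := by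
    rw [← intervalIntegral.integral_neg]
    simp
  rw [e]
  linear_combination hL'

/-- On the far side the exponential contributes the decaying factor exp(-cT), while the power grows
at most polynomially in T. -/
lemma tendsto_poisson_top {κ : ℂ} (hκ : 1 < κ.re) {s ω c : ℂ} (hω1 : ‖ω‖ ≤ 1)
    (hc : 0 < c.re) (h : 2 * Complex.I * s * ω = -c) :
    Tendsto (fun T : ℝ => ∫ t in (-1 : ℝ)..1, poissonFun κ s (t + T * ω)) atTop (𝓝 0) := by
  obtain ⟨B, hB⟩ := exists_nat_ge ‖κ‖
  have hre : κ.re ≤ B := (Complex.re_le_norm κ).trans hB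
  set C : ℝ := Real.exp (2 * ‖s‖) * (2 ^ B * Real.exp (Real.pi * |κ.im|)) with hC
  have key : ∀ T : ℝ, 0 ≤ T → ‖∫ t in (-1 : ℝ)..1, poissonFun κ s (t + T * ω)‖ ≤
      (2 * C) * ((1 + T) ^ (2 * B) * Real.exp (-(c.re * T))) := by
    intro T hT
    have hb : ∀ t ∈ Set.uIoc (-1 : ℝ) 1, ‖poissonFun κ s (t + T * ω)‖ ≤
        C * ((1 + T) ^ (2 * B) * Real.exp (-(c.re * T))) := by
      intro t ht
      rw [Set.uIoc_of_le (by norm_num)] at ht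
      have ht1 : |t| ≤ 1 := abs_le.2 ⟨ht.1.le, ht.2⟩
      have e1 : ‖Complex.exp (2 * Complex.I * s * (t + T * ω))‖ ≤
          Real.exp (2 * ‖s‖) * Real.exp (-(c.re * T)) := by
        rw [show 2 * Complex.I * s * (t + T * ω) = 2 * Complex.I * s * t + (-(c * T)) by
          linear_combination (T : ℂ) * h, Complex.exp_add, norm_mul]
        refine mul_le_mul ?_ (le_of_eq ?_) (norm_nonneg _) (by positivity)
        · refine (Complex.norm_exp_le_exp_norm _).trans (Real.exp_le_exp.2 ?_)
          rw [norm_mul, norm_mul, norm_mul, Complex.norm_I, Complex.norm_real, Real.norm_eq_abs,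
            Complex.norm_ofNat, mul_one]
          exact mul_le_of_le_one_right (by positivity) ht1
        · rw [Complex.norm_exp]
          simp
      have n1 : ‖(t : ℂ) + T * ω‖ ≤ 1 + T := by
        refine (norm_add_le _ _).trans (add_le_add ?_ ?_)
        · rwa [Complex.norm_real, Real.norm_eq_abs]
        · rw [norm_mul, Complex.norm_real, Real.norm_of_nonneg hT]
          exact mul_le_of_le_one_right hT hω1
      have n2 : ‖1 - ((t : ℂ) + T * ω) ^ 2‖ ≤ 2 * (1 + T) ^ 2 := by
        refine (norm_sub_le _ _).trans ?_
        rw [norm_one, norm_pow]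
        have := pow_le_pow_left₀ (norm_nonneg _) n1 2
        nlinarith
      have e2 : ‖(1 - ((t : ℂ) + T * ω) ^ 2) ^ κ‖ ≤
          (2 ^ B * (1 + T) ^ (2 * B)) * Real.exp (Real.pi * |κ.im|) := by
        refine (norm_cpow_le_mul_exp _ _).trans (mul_le_mul_of_nonneg_right ?_ (by positivity))
        calc _ ≤ (2 * (1 + T) ^ 2) ^ κ.re := Real.rpow_le_rpow (norm_nonneg _) n2 (by linarith)
          _ ≤ (2 * (1 + T) ^ 2) ^ (B : ℝ) :=
            Real.rpow_le_rpow_of_exponent_le (by nlinarith) hre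
          _ = _ := by rw [Real.rpow_natCast, mul_pow, pow_mul]
      rw [poissonFun, norm_mul]
      calc _ ≤ _ := mul_le_mul e1 e2 (norm_nonneg _) (by positivity)
        _ = _ := by
          rw [hC]
          ring
    refine (intervalIntegral.norm_integral_le_of_norm_le_const hb).trans (le_of_eq ?_)
    norm_num
    ring
  refine squeeze_zero_norm' ((eventually_ge_atTop 0).mono key) ?_
  simpa using (tendsto_one_add_pow_mul_exp_neg (2 * B) hc).const_mul (2 * C)

/-- The arguments lie in (-π,0) and [0,π], so their sum is still principal and the logarithms add.
-/
lemma mul_cpow_of_im {a b : ℂ} (ha : a.im < 0) (hb : 0 < b.im) (κ : ℂ) :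
    (a * b) ^ κ = a ^ κ * b ^ κ := by
  have ha0 : a ≠ 0 := fun h => by simp [h] at ha
  have hb0 : b ≠ 0 := fun h => by simp [h] at hb
  have h : Complex.arg a + Complex.arg b ∈ Set.Ioc (-Real.pi) Real.pi := by
    have h1 := Complex.arg_neg_iff.2 ha
    have h2 := Complex.arg_nonneg_iff.2 hb.le
    have h3 := Complex.neg_pi_lt_arg a
    have h4 := Complex.arg_le_pi b
    constructor <;> linarith
  rw [Complex.cpow_def_of_ne_zero (mul_ne_zero ha0 hb0), Complex.cpow_def_of_ne_zero ha0,
    Complex.cpow_def_of_ne_zero hb0, Complex.log_mul ha0 hb0 h, ← Complex.exp_add]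
  congr 1
  ring

lemma ofReal_mul_cpow {u : ℝ} (hu : 0 < u) {a : ℂ} (ha : a ≠ 0) (κ : ℂ) :
    (u * a) ^ κ = (u : ℂ) ^ κ * a ^ κ := by
  have hu0 : (u : ℂ) ≠ 0 := Complex.ofReal_ne_zero.2 hu.ne'
  rw [Complex.cpow_def_of_ne_zero (mul_ne_zero hu0 ha), Complex.cpow_def_of_ne_zero ha,
    Complex.cpow_def_of_ne_zero hu0, Complex.log_ofReal_mul hu ha, Complex.ofReal_log hu.le,
    ← Complex.exp_add]
  congr 1
  ring

/-- On the ray from 1 the base factors as u · (-2ω) · (1 + uω/2): a positive number, a number in the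
lower and one in the upper half-plane, so the power splits without change of branch. -/
lemma poissonFun_right {κ s ω c : ℂ} (hω : 0 < ω.im) (h : 2 * Complex.I * s * ω = -c) {u : ℝ}
    (hu : 0 < u) : poissonFun κ s (1 + u * ω) =
      Complex.exp (2 * Complex.I * s) * (-2 * ω) ^ κ * laplFun κ c (ω / 2) u := by
  have e1 : (-2 * ω).im < 0 := by simpa using hω
  have e2 : 0 < (1 + u * (ω / 2)).im := by
    simp
    positivity
  have e0 : -2 * ω * (1 + u * (ω / 2)) ≠ 0 := by
    refine mul_ne_zero (fun h => ?_) fun h => ?_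
    · rw [h] at e1
      simp at e1
    · rw [h] at e2
      simp at e2
  rw [poissonFun, laplFun, show 1 - (1 + u * ω) ^ 2 = u * (-2 * ω * (1 + u * (ω / 2))) by ring,
    ofReal_mul_cpow hu e0, mul_cpow_of_im e1 e2,
    show 2 * Complex.I * s * (1 + u * ω) = 2 * Complex.I * s + (-(c * u)) by
      linear_combination (u : ℂ) * h, Complex.exp_add]
  ring

lemma poissonFun_left {κ s ω c : ℂ} (hω : 0 < ω.im) (h : 2 * Complex.I * s * ω = -c) {u : ℝ}
    (hu : 0 < u) : poissonFun κ s (-1 + u * ω) =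
      Complex.exp (-(2 * Complex.I * s)) * (2 * ω) ^ κ * laplFun κ c (-(ω / 2)) u := by
  have e1 : 0 < (2 * ω).im := by simpa using hω
  have e2 : (1 + u * (-(ω / 2))).im < 0 := by
    simp
    positivity
  have e0 : (1 + u * (-(ω / 2))) * (2 * ω) ≠ 0 := by
    refine mul_ne_zero (fun h => ?_) fun h => ?_
    · rw [h] at e2
      simp at e2
    · rw [h] at e1
      simp at e1
  rw [poissonFun, laplFun, show 1 - (-1 + u * ω) ^ 2 = u * ((1 + u * (-(ω / 2))) * (2 * ω)) by ring,
    ofReal_mul_cpow hu e0, mul_cpow_of_im e2 e1,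
    show 2 * Complex.I * s * (-1 + u * ω) = -(2 * Complex.I * s) + (-(c * u)) by
      linear_combination (u : ℂ) * h, Complex.exp_add]
  ring

/-- Poisson's integral as a sum of two Laplace integrals. -/
lemma poisson_eq_laplace {κ : ℂ} (hκ : 1 < κ.re) {s ω c : ℂ} (hω : 0 < ω.im) (hω1 : ‖ω‖ ≤ 1)
    (hc : 0 < c.re) (h : 2 * Complex.I * s * ω = -c) :
    ∫ t in (-1 : ℝ)..1, poissonFun κ s t =
      ω * (Complex.exp (-(2 * Complex.I * s)) * (2 * ω) ^ κ *
          (∫ u in Set.Ioi (0 : ℝ), laplFun κ c (-(ω / 2)) u) -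
        Complex.exp (2 * Complex.I * s) * (-2 * ω) ^ κ *
          ∫ u in Set.Ioi (0 : ℝ), laplFun κ c (ω / 2) u) := by
  have hn : ‖ω / 2‖ ≤ 1 := by
    rw [norm_div, Complex.norm_ofNat]
    linarith
  have i1 := integrableOn_laplFun (κ := κ) (c := c) (by linarith) hc hn (by simpa using hω.ne')
  have i2 := integrableOn_laplFun (κ := κ) (c := c) (η := -(ω / 2)) (by linarith) hc
    (by rwa [norm_neg]) (by simpa using hω.ne')
  have i3 := (i2.const_mul (Complex.exp (-(2 * Complex.I * s)) * (2 * ω) ^ κ)).sub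
    (i1.const_mul (Complex.exp (2 * Complex.I * s) * (-2 * ω) ^ κ))
  have i4 : MeasureTheory.IntegrableOn
      (fun u : ℝ => poissonFun κ s (-1 + u * ω) - poissonFun κ s (1 + u * ω)) (Set.Ioi 0) := by
    refine i3.congr ?_
    filter_upwards [MeasureTheory.ae_restrict_mem measurableSet_Ioi] with u hu
    simp only [Pi.sub_apply]
    rw [poissonFun_left hω h hu, poissonFun_right hω h hu]
  have hlim := (tendsto_poisson_top hκ hω1 hc h).add
    ((MeasureTheory.intervalIntegral_tendsto_integral_Ioi 0 i4 tendsto_id).const_mul ω)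
  -- The left side of `poisson_strip` does not depend on T; letting T → ∞ removes the far side.
  have huniq := tendsto_nhds_unique (tendsto_const_nhds (x := ∫ t in (-1 : ℝ)..1, poissonFun κ s t)
    (f := atTop)) (hlim.congr' ((eventually_ge_atTop 0).mono fun T hT =>
      (poisson_strip hκ s hω hT).symm))
  have hsub := MeasureTheory.integral_sub
    (i2.const_mul (Complex.exp (-(2 * Complex.I * s)) * (2 * ω) ^ κ))
    (i1.const_mul (Complex.exp (2 * Complex.I * s) * (-2 * ω) ^ κ))
  rw [MeasureTheory.integral_const_mul, MeasureTheory.integral_const_mul] at hsub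
  rw [huniq, zero_add, ← hsub]
  congr 1
  refine MeasureTheory.setIntegral_congr_fun measurableSet_Ioi fun u hu => ?_
  rw [poissonFun_left hω h hu, poissonFun_right hω h hu]

end

/-! ### Watson's lemma for the Laplace integrals, uniformly in all parameters. -/

section

lemma norm_exp_neg_mul_cpow_le {κ c : ℂ} (h0 : 0 ≤ κ.re) {B : ℕ} (hB : ‖κ‖ ≤ B) {u : ℝ}
    (hu : 0 < u) : ‖Complex.exp (-(c * u)) * (u : ℂ) ^ κ‖ ≤
      (1 + u) ^ B * Real.exp (-(c.re * u)) := by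
  have h := norm_ofReal_cpow_le hu h0 hB
  rw [Real.rpow_natCast] at h
  rw [norm_mul, Complex.norm_exp, mul_comm]
  have e : (-(c * u)).re = -(c.re * u) := by simp
  rw [e]
  exact mul_le_mul_of_nonneg_right h (by positivity)

lemma continuousOn_exp_neg_mul_cpow (κ c : ℂ) :
    ContinuousOn (fun u : ℝ => Complex.exp (-(c * u)) * (u : ℂ) ^ κ) (Set.Ioi 0) :=
  ContinuousOn.mul (by fun_prop)
    (ContinuousOn.cpow_const (by fun_prop) fun u hu => Complex.ofReal_mem_slitPlane.2 hu)

lemma integrableOn_exp_neg_mul_cpow {κ c : ℂ} (h0 : 0 ≤ κ.re) (hc : 0 < c.re) :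
    MeasureTheory.IntegrableOn (fun u : ℝ => Complex.exp (-(c * u)) * (u : ℂ) ^ κ)
      (Set.Ioi 0) := by
  obtain ⟨B, hB⟩ := exists_nat_ge ‖κ‖
  exact integrableOn_of_norm_le_one_add_pow_mul_exp_neg (C := 1)
    (continuousOn_exp_neg_mul_cpow κ c) hc fun u hu => by
      rw [one_mul]
      exact norm_exp_neg_mul_cpow_le h0 hB hu

lemma differentiableOn_integral_exp_neg_mul_cpow {κ : ℂ} (h0 : 0 ≤ κ.re) :
    DifferentiableOn ℂ (fun c : ℂ => ∫ u in Set.Ioi (0 : ℝ),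
      Complex.exp (-(c * u)) * (u : ℂ) ^ κ) {c | 0 < c.re} := by
  intro c hc
  obtain ⟨B, hB⟩ := exists_nat_ge ‖κ‖
  have hc' : 0 < c.re / 2 := half_pos hc
  have hs : {z : ℂ | c.re / 2 < z.re} ∈ 𝓝 c :=
    (isOpen_lt continuous_const Complex.continuous_re).mem_nhds (by
      change 0 < c.re at hc
      change c.re / 2 < c.re
      linarith)
  have h := hasDerivAt_integral_of_dominated_loc_of_deriv_le
    (μ := MeasureTheory.volume.restrict (Set.Ioi (0 : ℝ)))
    (F := fun (c : ℂ) (u : ℝ) => Complex.exp (-(c * u)) * (u : ℂ) ^ κ)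
    (F' := fun (c : ℂ) (u : ℝ) => -(u : ℂ) * (Complex.exp (-(c * u)) * (u : ℂ) ^ κ))
    (bound := fun u => (1 + u) ^ (B + 1) * Real.exp (-(c.re / 2 * u))) hs
    (Eventually.of_forall fun z =>
      (continuousOn_exp_neg_mul_cpow κ z).aestronglyMeasurable measurableSet_Ioi)
    (integrableOn_exp_neg_mul_cpow h0 hc)
    ((ContinuousOn.mul (by fun_prop)
      (continuousOn_exp_neg_mul_cpow κ c)).aestronglyMeasurable measurableSet_Ioi)
    ((MeasureTheory.ae_restrict_iff' measurableSet_Ioi).2 (Eventually.of_forall ?_))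
    (integrableOn_one_add_pow_mul_exp_neg (B + 1) hc')
    ((MeasureTheory.ae_restrict_iff' measurableSet_Ioi).2 (Eventually.of_forall ?_))
  · exact h.2.differentiableAt.differentiableWithinAt
  · intro u hu z hz
    have hu' : (0 : ℝ) < u := hu
    rw [norm_mul, norm_neg, Complex.norm_real, Real.norm_of_nonneg hu'.le]
    calc _ ≤ (1 + u) * ((1 + u) ^ B * Real.exp (-(c.re / 2 * u))) := by
          refine mul_le_mul (by linarith) ((norm_exp_neg_mul_cpow_le h0 hB hu').trans ?_)
            (norm_nonneg _) (by positivity)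
          refine mul_le_mul_of_nonneg_left (Real.exp_le_exp.2 ?_) (by positivity)
          have : c.re / 2 * u ≤ z.re * u := mul_le_mul_of_nonneg_right (le_of_lt hz) hu'.le
          linarith
      _ = _ := by ring
  · intro u hu z hz
    have := ((((hasDerivAt_id z).mul_const (u : ℂ)).fun_neg).cexp).mul_const ((u : ℂ) ^ κ)
    refine this.congr_deriv ?_
    simp
    ring

/-- For real c > 0 this is the Gamma integral; both sides are holomorphic on Re c > 0 and agree near
1 on the real axis, so the identity theorem applies. -/
lemma integral_exp_neg_mul_cpow {κ c : ℂ} (h0 : 0 ≤ κ.re) (hc : 0 < c.re) :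
    ∫ u in Set.Ioi (0 : ℝ), Complex.exp (-(c * u)) * (u : ℂ) ^ κ =
      c ^ (-(κ + 1)) * Complex.Gamma (κ + 1) := by
  have hopen : IsOpen {c : ℂ | 0 < c.re} := isOpen_lt continuous_const Complex.continuous_re
  have a1 := (differentiableOn_integral_exp_neg_mul_cpow h0).analyticOnNhd hopen
  have a2 : AnalyticOnNhd ℂ (fun c : ℂ => c ^ (-(κ + 1)) * Complex.Gamma (κ + 1))
      {c | 0 < c.re} := DifferentiableOn.analyticOnNhd (fun z hz => by
    refine DifferentiableAt.differentiableWithinAt ?_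
    refine DifferentiableAt.mul_const
      (DifferentiableAt.cpow_const differentiableAt_id (Or.inl hz)) _) hopen
  refine a1.eqOn_of_preconnected_of_frequently_eq a2
    (convex_halfSpace_re_gt 0).isPreconnected (z₀ := 1) (by simp) ?_ hc
  have hreal : ∀ r : ℝ, 0 < r → (∫ u in Set.Ioi (0 : ℝ), Complex.exp (-((r : ℂ) * u)) *
      (u : ℂ) ^ κ) = (r : ℂ) ^ (-(κ + 1)) * Complex.Gamma (κ + 1) := by
    intro r hr
    have h := Complex.integral_cpow_mul_exp_neg_mul_Ioi (a := κ + 1) (r := r)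
      (by simp; linarith) hr
    rw [add_sub_cancel_right] at h
    rw [Complex.cpow_neg, ← Complex.inv_cpow _ _ (by
      rw [Complex.arg_ofReal_of_nonneg hr.le]
      exact Real.pi_pos.ne), ← one_div, ← h]
    refine MeasureTheory.setIntegral_congr_fun measurableSet_Ioi fun u _ => ?_
    rw [mul_comm]
  have ht : Tendsto (fun r : ℝ => (r : ℂ)) (𝓝[≠] 1) (𝓝[≠] 1) := by
    refine tendsto_nhdsWithin_of_tendsto_nhds_of_eventually_within _ ?_ ?_
    · have : Tendsto (fun r : ℝ => (r : ℂ)) (𝓝 1) (𝓝 ((1 : ℝ) : ℂ)) :=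
        Complex.continuous_ofReal.tendsto 1
      rw [Complex.ofReal_one] at this
      exact this.mono_left nhdsWithin_le_nhds
    · filter_upwards [self_mem_nhdsWithin] with r hr
      simpa using hr
  refine ht.frequently (Eventually.frequently ?_)
  have : ∀ᶠ r : ℝ in 𝓝 1, 0 < r := eventually_gt_nhds one_pos
  filter_upwards [this.filter_mono nhdsWithin_le_nhds] with r hr
  exact hreal r hr

/-- The generalized binomial coefficient. -/
def binCoeff (κ : ℂ) (d : ℕ) : ℂ := ∏ j ∈ Finset.range d, (κ - j) / (j + 1)

lemma binCoeff_succ (κ : ℂ) (d : ℕ) :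
    binCoeff κ (d + 1) = binCoeff κ d * ((κ - d) / (d + 1)) := Finset.prod_range_succ _ _

lemma succ_mul_binCoeff_succ (κ : ℂ) (d : ℕ) :
    (d + 1) * binCoeff κ (d + 1) = κ * binCoeff (κ - 1) d := by
  induction d with
  | zero => simp [binCoeff]
  | succ d ih =>
    have h1 : (d : ℂ) + 1 ≠ 0 := by exact_mod_cast Nat.succ_ne_zero d
    have h2 : (d : ℂ) + 1 + 1 ≠ 0 := by exact_mod_cast Nat.succ_ne_zero (d + 1)
    rw [binCoeff_succ _ (d + 1), binCoeff_succ (κ - 1) d]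
    push_cast
    field_simp
    linear_combination (κ - 1 - d) * ih

/-- The remainder of the binomial series. -/
def binRem (κ : ℂ) (N : ℕ) (x : ℂ) : ℂ :=
  (1 + x) ^ κ - ∑ d ∈ Finset.range N, binCoeff κ d * x ^ d

lemma binRem_succ_zero (κ : ℂ) (N : ℕ) : binRem κ (N + 1) 0 = 0 := by
  simp [binRem, Finset.sum_range_succ', binCoeff]

lemma hasDerivAt_binRem (κ : ℂ) (N : ℕ) {x : ℂ} (hx : 1 + x ∈ Complex.slitPlane) :
    HasDerivAt (binRem κ (N + 1)) (κ * binRem (κ - 1) N x) x := by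
  have h1 := ((hasDerivAt_id x).const_add 1).cpow_const (c := κ) hx
  have h2 : HasDerivAt (fun x : ℂ => ∑ d ∈ Finset.range (N + 1), binCoeff κ d * x ^ d)
      (∑ d ∈ Finset.range (N + 1), binCoeff κ d * (d * x ^ (d - 1))) x :=
    HasDerivAt.fun_sum fun d _ => (hasDerivAt_pow d x).const_mul _
  refine (h1.sub h2).congr_deriv ?_
  rw [Finset.sum_range_succ']
  simp only [binRem, mul_sub, Finset.mul_sum, id]
  congr 1
  · ring
  · simp only [Nat.cast_zero, zero_mul, mul_zero, add_zero, Nat.add_sub_cancel]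
    refine Finset.sum_congr rfl fun d _ => ?_
    have := succ_mul_binCoeff_succ κ d
    push_cast
    linear_combination x ^ d * this

/-- The derivative of the remainder of order N+1 is κ times the remainder of order N for κ - 1. The
induction is therefore uniform over |κ| ≤ B, with B raised by one at each step, and uses the mean
value inequality on the segment from 0 to x. -/
lemma norm_binRem_le {σ : ℝ} (hσ : 0 < σ) (hσ1 : σ ≤ 1) (N : ℕ) : ∀ B : ℕ, ∃ C : ℝ, 0 ≤ C ∧
    ∀ κ : ℂ, ‖κ‖ ≤ B → ∀ x : ℂ, (∀ τ ∈ Set.Icc (0 : ℝ) 1, σ ≤ ‖1 + τ * x‖ ∧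
      1 + τ * x ∈ Complex.slitPlane) → ‖binRem κ N x‖ ≤ C * (‖x‖ ^ N * (1 + ‖x‖) ^ (B + N)) := by
  induction N with
  | zero =>
    intro B
    refine ⟨σ⁻¹ ^ (B : ℝ) * Real.exp (Real.pi * B), by positivity, fun κ hκ x hx => ?_⟩
    have h := norm_one_add_cpow_le hσ hσ1 hκ
      (by simpa using (hx 1 (Set.right_mem_Icc.2 zero_le_one)).1)
    simp only [binRem, Finset.range_zero, Finset.sum_empty, sub_zero, pow_zero, one_mul, add_zero]
    simpa using h
  | succ N ih =>
    intro B
    obtain ⟨C, hC0, hC⟩ := ih (B + 1)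
    refine ⟨B * C, by positivity, fun κ hκ x hx => ?_⟩
    have hd : ∀ τ ∈ Set.Icc (0 : ℝ) 1, HasDerivWithinAt
        (fun τ : ℝ => binRem κ (N + 1) (τ * x)) (κ * binRem (κ - 1) N (τ * x) * x)
        (Set.Icc 0 1) τ := by
      intro τ hτ
      have h := (hasDerivAt_binRem κ N (hx τ hτ).2).comp (τ : ℂ)
        ((hasDerivAt_id (τ : ℂ)).mul_const x)
      exact (h.comp_ofReal.congr_deriv (by ring)).hasDerivWithinAt
    have hb : ∀ τ ∈ Set.Ico (0 : ℝ) 1, ‖κ * binRem (κ - 1) N (τ * x) * x‖ ≤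
        B * (C * (‖x‖ ^ N * (1 + ‖x‖) ^ (B + 1 + N))) * ‖x‖ := by
      intro τ hτ
      have hk : ‖κ - 1‖ ≤ (B + 1 : ℕ) := by
        push_cast
        exact (norm_sub_le _ _).trans (by simpa using hκ)
      have hn : ‖(τ : ℂ) * x‖ ≤ ‖x‖ := by
        rw [norm_mul, Complex.norm_real, Real.norm_of_nonneg hτ.1]
        exact mul_le_of_le_one_left (norm_nonneg _) hτ.2.le
      have h := hC (κ - 1) hk (τ * x) fun ρ hρ => by
        have := hx (ρ * τ) ⟨mul_nonneg hρ.1 hτ.1, mul_le_one₀ hρ.2 hτ.1 hτ.2.le⟩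
        rw [Complex.ofReal_mul, mul_assoc] at this
        exact this
      rw [norm_mul, norm_mul]
      refine mul_le_mul_of_nonneg_right (mul_le_mul hκ (h.trans ?_) (norm_nonneg _)
        (by positivity)) (norm_nonneg _)
      gcongr
    have h := norm_image_sub_le_of_norm_deriv_le_segment_01' hd hb
    rw [Complex.ofReal_one, one_mul, Complex.ofReal_zero, zero_mul, binRem_succ_zero, sub_zero] at h
    refine h.trans (le_of_eq ?_)
    ring

/-- The amplitude of a Hankel function. -/
def ampl (κ c η : ℂ) : ℂ :=
  c ^ (κ + 1) * rGamma (κ + 1) * ∫ u in Set.Ioi (0 : ℝ), laplFun κ c η u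

/-- The coefficients of the asymptotic expansion of `ampl`. -/
def amplCoeff (κ : ℂ) (d : ℕ) : ℂ := binCoeff κ d * poch (κ + 1) d

lemma Gamma_add_nat_eq {κ : ℂ} (h0 : 0 ≤ κ.re) (d : ℕ) :
    Complex.Gamma (κ + d + 1) = poch (κ + 1) d * Complex.Gamma (κ + 1) := by
  induction d with
  | zero => simp [poch]
  | succ d ih =>
    rw [poch_eq_prod]
    have h : κ + d + 1 ≠ 0 := fun h => by
      have := congrArg Complex.re h
      simp at this
      have : (0 : ℝ) ≤ d := Nat.cast_nonneg d
      linarith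
    rw [show κ + ((d + 1 : ℕ) : ℂ) + 1 = κ + d + 1 + 1 by push_cast; ring,
      Complex.Gamma_add_one _ h, ih]
    ring

lemma cpow_mul_rGamma_mul_integral {κ c : ℂ} (h0 : 0 ≤ κ.re) (hc : 0 < c.re) (d : ℕ) :
    c ^ (κ + 1) * rGamma (κ + 1) *
      (∫ u in Set.Ioi (0 : ℝ), Complex.exp (-(c * u)) * (u : ℂ) ^ (κ + d)) =
      poch (κ + 1) d * (c⁻¹) ^ d := by
  have hc0 : c ≠ 0 := fun h => by simp [h] at hc
  have hd : (0 : ℝ) ≤ d := Nat.cast_nonneg d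
  have hG : Complex.Gamma (κ + 1) ≠ 0 := Complex.Gamma_ne_zero_of_re_pos (by
    simp
    linarith)
  rw [integral_exp_neg_mul_cpow (by simpa using add_nonneg h0 hd) hc, Gamma_add_nat_eq h0,
    show -(κ + d + 1) = -(κ + 1) + -(d : ℂ) by ring, Complex.cpow_add (-(κ + 1)) _ hc0,
    Complex.cpow_neg, Complex.cpow_neg, Complex.cpow_natCast, rGamma, inv_pow]
  have hcp : c ^ (κ + 1) ≠ 0 := by simp [Complex.cpow_eq_zero_iff, hc0]
  generalize c ^ (κ + 1) = y at *
  field_simp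

lemma continuousOn_binRem_ray {κ η : ℂ} (N : ℕ) (hη : η.im ≠ 0) :
    Continuous fun u : ℝ => binRem κ N (u * η) := by
  unfold binRem
  refine Continuous.sub ?_ (by fun_prop)
  exact Continuous.cpow (by fun_prop) continuous_const fun u => one_add_mul_mem_slitPlane hη u

/-- Watson's lemma for the Hankel amplitudes. -/
lemma watson {σ b : ℝ} (hσ : 0 < σ) (hσ1 : σ ≤ 1) (hb : 0 < b) (B N : ℕ) : ∃ C : ℝ,
    ∀ κ c η : ℂ, 0 ≤ κ.re → ‖κ‖ ≤ B → 1 ≤ ‖c‖ → b * ‖c‖ ≤ c.re → ‖η‖ ≤ 1 → σ ≤ |η.im| →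
      ‖ampl κ c η - ∑ d ∈ Finset.range N, amplCoeff κ d * (η * c⁻¹) ^ d‖ ≤ C * (‖c‖ ^ N)⁻¹ := by
  obtain ⟨C, hC0, hC⟩ := norm_binRem_le hσ hσ1 N B
  obtain ⟨G, hG⟩ := (isCompact_closedBall (0 : ℂ) B).exists_bound_of_continuousOn
    (f := fun κ : ℂ => rGamma (κ + 1))
    (differentiable_rGamma.continuous.comp (continuous_id.add continuous_const)).continuousOn
  -- J is the error integral in the variable v = Ru with R = |c|; it involves only b, B and N.
  set J : ℝ := ∫ v in Set.Ioi (0 : ℝ), (1 + v) ^ (2 * (B + N)) * Real.exp (-(b * v)) with hJ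
  refine ⟨Real.exp (Real.pi * B) * G * (C * J), fun κ c η h0 hκ hc1 hbc hη1 hη => ?_⟩
  set R := ‖c‖ with hR
  have hR0 : 0 < R := by linarith
  have hcre : 0 < c.re := (mul_pos hb hR0).trans_le hbc
  have hηim : η.im ≠ 0 := abs_pos.1 (hσ.trans_le hη)
  set w : ℝ → ℂ := fun u => Complex.exp (-(c * u)) * (u : ℂ) ^ κ * binRem κ N (u * η) with hw
  have hdecomp : ∀ u ∈ Set.Ioi (0 : ℝ), laplFun κ c η u =
      (∑ d ∈ Finset.range N, binCoeff κ d * η ^ d *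
        (Complex.exp (-(c * u)) * (u : ℂ) ^ (κ + d))) + w u := by
    intro u hu
    have hu0 : (u : ℂ) ≠ 0 := Complex.ofReal_ne_zero.2 (ne_of_gt hu)
    simp only [hw, binRem, laplFun, mul_sub, Finset.mul_sum]
    have e : ∀ d ∈ Finset.range N, binCoeff κ d * η ^ d *
        (Complex.exp (-(c * u)) * (u : ℂ) ^ (κ + d)) =
        Complex.exp (-(c * u)) * (u : ℂ) ^ κ * (binCoeff κ d * (u * η) ^ d) := fun d _ => by
      rw [Complex.cpow_add _ _ hu0, Complex.cpow_natCast, mul_pow]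
      ring
    rw [Finset.sum_congr rfl e]
    ring
  have hi1 : ∀ d ∈ Finset.range N, MeasureTheory.IntegrableOn (fun u : ℝ => binCoeff κ d * η ^ d *
      (Complex.exp (-(c * u)) * (u : ℂ) ^ (κ + d))) (Set.Ioi 0) := fun d _ =>
    (integrableOn_exp_neg_mul_cpow (by simpa using add_nonneg h0 (Nat.cast_nonneg d))
      hcre).const_mul _
  have hκB : κ.re ≤ B := (Complex.re_le_norm κ).trans hκ
  -- The remainder is estimated in terms of Ru. Integration over u then yields R^{-(Re κ + N + 1)},
  -- which the prefactor c^{κ+1} turns into the required R^{-N}.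
  have hwb : ∀ u : ℝ, 0 < u → ‖w u‖ ≤ C * R ^ (-(κ.re + N)) *
      ((1 + R * u) ^ (2 * (B + N)) * Real.exp (-(b * (R * u)))) := by
    intro u hu
    have h := hC κ hκ (u * η) fun τ _ => by
      have e : 1 + (τ : ℂ) * (u * η) = 1 + ((τ * u : ℝ) : ℂ) * η := by
        push_cast
        ring
      rw [e]
      exact ⟨hη.trans ((le_norm_one_add_mul _).trans
        (mul_le_of_le_one_right (norm_nonneg _) hη1)), one_add_mul_mem_slitPlane hηim _⟩
    have hx : ‖(u : ℂ) * η‖ ≤ u := by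
      rw [norm_mul, Complex.norm_real, Real.norm_of_nonneg hu.le]
      exact mul_le_of_le_one_right hu.le hη1
    have h2 : ‖binRem κ N (u * η)‖ ≤ C * (u ^ N * (1 + R * u) ^ (B + N)) := by
      refine h.trans (mul_le_mul_of_nonneg_left ?_ hC0)
      have : u ≤ R * u := le_mul_of_one_le_left hu.le hc1
      gcongr
      exact hx.trans this
    have e1 : ‖Complex.exp (-(c * u))‖ ≤ Real.exp (-(b * (R * u))) := by
      rw [Complex.norm_exp]
      refine Real.exp_le_exp.2 ?_
      have : b * R * u ≤ c.re * u := mul_le_mul_of_nonneg_right hbc hu.le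
      simp
      linarith
    have e2 : u ^ κ.re * u ^ N ≤ R ^ (-(κ.re + N)) * (1 + R * u) ^ (B + N) := by
      rw [← Real.rpow_natCast u N, ← Real.rpow_add hu]
      have e3 : u ^ (κ.re + N) = R ^ (-(κ.re + N)) * (R * u) ^ (κ.re + N) := by
        rw [Real.mul_rpow hR0.le hu.le, ← mul_assoc, ← Real.rpow_add hR0]
        simp
      rw [e3]
      refine mul_le_mul_of_nonneg_left ?_ (by positivity)
      have hN : (0 : ℝ) ≤ N := Nat.cast_nonneg N
      calc (R * u) ^ (κ.re + N) ≤ (1 + R * u) ^ (κ.re + N) :=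
            Real.rpow_le_rpow (by positivity) (by linarith) (by linarith)
        _ ≤ (1 + R * u) ^ ((B + N : ℕ) : ℝ) := by
            refine Real.rpow_le_rpow_of_exponent_le ?_ (by push_cast; linarith)
            linarith [mul_pos hR0 hu]
        _ = _ := Real.rpow_natCast _ _
    rw [hw]
    simp only
    rw [norm_mul, norm_mul, Complex.norm_cpow_eq_rpow_re_of_pos hu]
    calc _ ≤ Real.exp (-(b * (R * u))) * u ^ κ.re * (C * (u ^ N * (1 + R * u) ^ (B + N))) :=
          mul_le_mul (mul_le_mul_of_nonneg_right e1 (by positivity)) h2 (norm_nonneg _)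
            (by positivity)
      _ = (C * Real.exp (-(b * (R * u))) * (1 + R * u) ^ (B + N)) * (u ^ κ.re * u ^ N) := by ring
      _ ≤ (C * Real.exp (-(b * (R * u))) * (1 + R * u) ^ (B + N)) *
          (R ^ (-(κ.re + N)) * (1 + R * u) ^ (B + N)) :=
          mul_le_mul_of_nonneg_left e2 (by positivity)
      _ = _ := by ring
  have hbound_int : MeasureTheory.IntegrableOn (fun u : ℝ => C * R ^ (-(κ.re + N)) *
      ((1 + R * u) ^ (2 * (B + N)) * Real.exp (-(b * (R * u))))) (Set.Ioi 0) := by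
    refine MeasureTheory.Integrable.const_mul ?_ _
    have := (MeasureTheory.integrableOn_Ioi_comp_mul_left_iff
      (fun v : ℝ => (1 + v) ^ (2 * (B + N)) * Real.exp (-(b * v))) 0 hR0).2
      (by simpa using integrableOn_one_add_pow_mul_exp_neg (2 * (B + N)) hb)
    exact this
  have hwc : ContinuousOn w (Set.Ioi 0) :=
    (continuousOn_exp_neg_mul_cpow κ c).mul (continuousOn_binRem_ray N hηim).continuousOn
  have hwi : MeasureTheory.IntegrableOn w (Set.Ioi 0) :=
    MeasureTheory.Integrable.mono' hbound_int (hwc.aestronglyMeasurable measurableSet_Ioi)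
      ((MeasureTheory.ae_restrict_iff' measurableSet_Ioi).2 (Eventually.of_forall hwb))
  have hwn : ‖∫ u in Set.Ioi (0 : ℝ), w u‖ ≤ C * R ^ (-(κ.re + N)) * (R⁻¹ * J) := by
    refine (MeasureTheory.norm_integral_le_of_norm_le hbound_int
      ((MeasureTheory.ae_restrict_iff' measurableSet_Ioi).2
        (Eventually.of_forall hwb))).trans (le_of_eq ?_)
    rw [MeasureTheory.integral_const_mul, MeasureTheory.integral_comp_mul_left_Ioi
      (fun v : ℝ => (1 + v) ^ (2 * (B + N)) * Real.exp (-(b * v))) 0 hR0, mul_zero, smul_eq_mul]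
  have hmain : ampl κ c η - ∑ d ∈ Finset.range N, amplCoeff κ d * (η * c⁻¹) ^ d =
      c ^ (κ + 1) * rGamma (κ + 1) * ∫ u in Set.Ioi (0 : ℝ), w u := by
    rw [ampl, MeasureTheory.setIntegral_congr_fun measurableSet_Ioi hdecomp,
      MeasureTheory.integral_add (MeasureTheory.integrable_finsetSum _ hi1) hwi,
      MeasureTheory.integral_finsetSum _ hi1, mul_add, Finset.mul_sum]
    rw [← sub_add_eq_add_sub, ← Finset.sum_sub_distrib, Finset.sum_eq_zero, zero_add]
    intro d _
    rw [MeasureTheory.integral_const_mul, amplCoeff, mul_pow]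
    linear_combination (binCoeff κ d * η ^ d) * cpow_mul_rGamma_mul_integral h0 hcre d
  rw [hmain, norm_mul, norm_mul]
  have hp : ‖c ^ (κ + 1)‖ ≤ R ^ (κ.re + 1) * Real.exp (Real.pi * B) := by
    refine (norm_cpow_le_mul_exp _ _).trans ?_
    rw [Complex.add_re, Complex.one_re, Complex.add_im, Complex.one_im, add_zero]
    refine mul_le_mul_of_nonneg_left (Real.exp_le_exp.2 (mul_le_mul_of_nonneg_left
      ((Complex.abs_im_le_norm κ).trans hκ) Real.pi_pos.le)) (by positivity)
  have hGκ : ‖rGamma (κ + 1)‖ ≤ G := hG κ (by simpa using hκ)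
  have hG0 : 0 ≤ G := (norm_nonneg _).trans hGκ
  have hJ0 : 0 ≤ J := MeasureTheory.setIntegral_nonneg measurableSet_Ioi fun v hv => by
    have : (0 : ℝ) < v := hv
    positivity
  calc _ ≤ R ^ (κ.re + 1) * Real.exp (Real.pi * B) * G *
        (C * R ^ (-(κ.re + N)) * (R⁻¹ * J)) :=
        mul_le_mul (mul_le_mul hp hGκ (norm_nonneg _) (by positivity)) hwn (norm_nonneg _)
          (by positivity)
    _ = Real.exp (Real.pi * B) * G * (C * J) *
        (R ^ (κ.re + 1) * R ^ (-(κ.re + N)) * R⁻¹) := by ring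
    _ = _ := by
      congr 1
      rw [← Real.rpow_neg_one, ← Real.rpow_add hR0, ← Real.rpow_add hR0,
        ← Real.rpow_natCast, ← Real.rpow_neg hR0.le]
      congr 1
      ring

/-- Continuity in the order is needed because amplitudes will later be integrated over circles and
tori in the parameters. -/
lemma continuousOn_ampl {c η : ℂ} (hc : 0 < c.re) (hη1 : ‖η‖ ≤ 1) (hη : η.im ≠ 0) :
    ContinuousOn (fun κ => ampl κ c η) {κ | 0 < κ.re} := by
  have hc0 : c ≠ 0 := fun h => by simp [h] at hc
  intro κ₀ h0
  obtain ⟨B, hB⟩ := exists_nat_gt ‖κ₀‖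
  have hopen : IsOpen {κ : ℂ | 0 < κ.re ∧ ‖κ‖ < B} :=
    (isOpen_lt continuous_const Complex.continuous_re).inter (isOpen_lt continuous_norm
      continuous_const)
  have h : ContinuousOn (fun κ => ∫ u in Set.Ioi (0 : ℝ), laplFun κ c η u)
      {κ : ℂ | 0 < κ.re ∧ ‖κ‖ < B} := by
    refine MeasureTheory.continuousOn_of_dominated (fun κ _ =>
        (continuousOn_laplFun hη).aestronglyMeasurable measurableSet_Ioi)
      (fun κ hκ => (MeasureTheory.ae_restrict_iff' measurableSet_Ioi).2
        (Eventually.of_forall fun u hu => norm_laplFun_le (abs_pos.2 hη)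
          ((Complex.abs_im_le_norm η).trans hη1) hκ.1.le hκ.2.le hη1 le_rfl hu))
      ((integrableOn_one_add_pow_mul_exp_neg (2 * B) hc).const_mul _)
      ((MeasureTheory.ae_restrict_iff' measurableSet_Ioi).2 (Eventually.of_forall fun u hu => ?_))
    have hu0 : (u : ℂ) ≠ 0 := Complex.ofReal_ne_zero.2 (ne_of_gt hu)
    have hx0 : 1 + u * η ≠ 0 := Complex.slitPlane_ne_zero (one_add_mul_mem_slitPlane hη u)
    unfold laplFun
    refine Continuous.continuousOn (continuous_const.mul (Continuous.mul ?_ ?_))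
    · exact continuous_id.const_cpow (Or.inl hu0)
    · exact continuous_id.const_cpow (Or.inl hx0)
  have h2 := (h.continuousAt (hopen.mem_nhds ⟨h0, hB⟩))
  refine ContinuousAt.continuousWithinAt ?_
  unfold ampl
  refine ContinuousAt.mul (Continuous.continuousAt ?_) h2
  refine Continuous.mul ?_ (differentiable_rGamma.continuous.comp
    (continuous_id.add continuous_const))
  exact (continuous_id.add continuous_const).const_cpow (Or.inl hc0)

end

/-! ### Expansions of the Bessel functions J_ν(2s) for all orders ν. -/

section

lemma exp_cpow {x : ℂ} (h1 : -Real.pi < x.im) (h2 : x.im ≤ Real.pi) (κ : ℂ) :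
    Complex.exp x ^ κ = Complex.exp (x * κ) := by
  rw [Complex.cpow_def_of_ne_zero (Complex.exp_ne_zero x), Complex.log_exp h1 h2]

/-- The direction of the rotated contour. -/
def rotDir (s : ℂ) : ℂ := Complex.exp ((Real.pi / 2 - Complex.arg s / 2 : ℝ) * Complex.I)

/-- The exponent of the Laplace integral along the rotated contour. -/
def lapExp (s : ℂ) : ℂ := 2 * ‖s‖ * Complex.exp ((Complex.arg s / 2 : ℝ) * Complex.I)

lemma norm_rotDir (s : ℂ) : ‖rotDir s‖ = 1 := Complex.norm_exp_ofReal_mul_I _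

lemma rotDir_im (s : ℂ) : (rotDir s).im = Real.cos (Complex.arg s / 2) := by
  rw [rotDir, Complex.exp_ofReal_mul_I_im, Real.sin_pi_div_two_sub]

lemma norm_lapExp (s : ℂ) : ‖lapExp s‖ = 2 * ‖s‖ := by
  rw [lapExp, norm_mul, Complex.norm_exp_ofReal_mul_I]
  simp

lemma lapExp_re (s : ℂ) : (lapExp s).re = 2 * ‖s‖ * Real.cos (Complex.arg s / 2) := by
  have : lapExp s = ((2 * ‖s‖ : ℝ) : ℂ) * Complex.exp ((Complex.arg s / 2 : ℝ) * Complex.I) := by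
    rw [lapExp]
    push_cast
    rfl
  rw [this, Complex.re_ofReal_mul, Complex.exp_ofReal_mul_I_re]

lemma abs_arg_lt_pi {s : ℂ} (hs : s ∈ Complex.slitPlane) : |Complex.arg s| < Real.pi :=
  abs_lt.2 ⟨Complex.neg_pi_lt_arg s, lt_of_le_of_ne (Complex.arg_le_pi s)
    (Complex.mem_slitPlane_iff_arg.1 hs).1⟩

lemma cos_half_arg_pos {s : ℂ} (hs : s ∈ Complex.slitPlane) :
    0 < Real.cos (Complex.arg s / 2) := by
  have := abs_lt.1 (abs_arg_lt_pi hs)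
  exact Real.cos_pos_of_mem_Ioo ⟨by linarith, by linarith⟩

/-- The reason for turning by half of arg s: Im ω = cos(arg s/2) and Re c = 2|s| cos(arg s/2) are
then both positive on the entire slit plane, and bounded below in terms of |s| on closed subsectors.
-/
lemma rotDir_mul_lapExp (s : ℂ) : 2 * Complex.I * s * rotDir s = -lapExp s := by
  have e : rotDir s = Complex.I * Complex.exp (-((Complex.arg s / 2 : ℝ) * Complex.I)) := by
    rw [rotDir, show ((Real.pi / 2 - Complex.arg s / 2 : ℝ) : ℂ) * Complex.I =
      Real.pi / 2 * Complex.I + -((Complex.arg s / 2 : ℝ) * Complex.I) by push_cast; ring,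
      Complex.exp_add, Complex.exp_pi_div_two_mul_I]
  have e2 : s = ‖s‖ * (Complex.exp ((Complex.arg s / 2 : ℝ) * Complex.I) *
      Complex.exp ((Complex.arg s / 2 : ℝ) * Complex.I)) := by
    rw [← Complex.exp_add, ← add_mul, ← Complex.ofReal_add, add_halves,
      Complex.norm_mul_exp_arg_mul_I]
  have e3 : Complex.exp ((Complex.arg s / 2 : ℝ) * Complex.I) *
      Complex.exp (-((Complex.arg s / 2 : ℝ) * Complex.I)) = 1 := by
    rw [← Complex.exp_add]
    simp
  rw [e, lapExp]
  generalize Complex.exp (-((Complex.arg s / 2 : ℝ) * Complex.I)) = Y at *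
  generalize Complex.exp ((Complex.arg s / 2 : ℝ) * Complex.I) = X at *
  linear_combination (2 * Complex.I ^ 2 * Y) * e2 + (2 * Complex.I ^ 2 * ‖s‖ * X) * e3 +
    2 * ‖s‖ * X * Complex.I_sq

/-- Watson's expansion proceeds in powers of η/c. Although η and c depend on arg s, this ratio is
i/(4s), so the result is a genuine power series in 1/s. -/
lemma rotDir_div_lapExp {s : ℂ} (hs : s ≠ 0) :
    rotDir s / 2 * (lapExp s)⁻¹ = Complex.I / 4 * s⁻¹ := by
  have h0 : lapExp s ≠ 0 := fun h => hs (by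
    have := norm_lapExp s
    rw [h, norm_zero] at this
    exact norm_eq_zero.1 (by linarith))
  have := rotDir_mul_lapExp s
  field_simp
  linear_combination -2 * Complex.I * this + 4 * rotDir s * s * Complex.I_sq

/-- The argument of the trigonometric functions in the expansion of `J_ν(2s)`. -/
def phase (ν s : ℂ) : ℂ := 2 * s - ν * Real.pi / 2 - Real.pi / 4

/-- The amplitude of the first Hankel function. -/
def hankelPlus (ν s : ℂ) : ℂ := ampl (ν - 1 / 2) (lapExp s) (rotDir s / 2)

/-- The amplitude of the second Hankel function. -/
def hankelMinus (ν s : ℂ) : ℂ := ampl (ν - 1 / 2) (lapExp s) (-(rotDir s / 2))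

lemma besselJ_eq_hankel {ν s : ℂ} (hν : 3 / 2 < ν.re) (hs : s ∈ Complex.slitPlane) :
    (Real.sqrt Real.pi : ℂ) * s ^ (1 / 2 : ℂ) * besselJ ν (2 * s) =
      (hankelPlus ν s * Complex.exp (Complex.I * phase ν s) +
        hankelMinus ν s * Complex.exp (-(Complex.I * phase ν s))) / 2 := by
  set κ := ν - 1 / 2 with hκ
  have hκre : 1 < κ.re := by
    rw [hκ]
    simp
    linarith
  have hs0 := Complex.slitPlane_ne_zero hs
  have hsn : 0 < ‖s‖ := norm_pos_iff.2 hs0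
  have hcos := cos_half_arg_pos hs
  have h1 := poisson_integral (κ := κ) (by linarith) s
  have h2 := poisson_eq_laplace hκre (by rw [rotDir_im]; exact hcos) (norm_rotDir s).le
    (by rw [lapExp_re]; positivity) (rotDir_mul_lapExp s)
  simp only [poissonFun] at h2
  rw [h1, show κ + 1 / 2 = ν by rw [hκ]; ring] at h2
  have hG : Complex.Gamma (κ + 1) ≠ 0 := Complex.Gamma_ne_zero_of_re_pos (by
    simp
    linarith)
  have hG' : rGamma (κ + 1) * Complex.Gamma (κ + 1) = 1 := inv_mul_cancel₀ hG
  have harg := abs_lt.1 (abs_arg_lt_pi hs)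
  -- Polar data: s = exp(ℓ + 2ia), c = exp(t + ℓ + ia) and ω = exp(i(π/2 - a)) with t = log 2. All
  -- imaginary parts, also that for -ω, are in the principal range, so every power becomes an
  -- exponential and the prefactors can be compared.
  obtain ⟨a, ha⟩ : ∃ a : ℝ, a = Complex.arg s / 2 := ⟨_, rfl⟩
  obtain ⟨ℓ, hℓ⟩ : ∃ ℓ : ℝ, ℓ = Real.log ‖s‖ := ⟨_, rfl⟩
  obtain ⟨t, htt⟩ : ∃ t : ℝ, t = Real.log 2 := ⟨_, rfl⟩
  have et : Complex.exp t = 2 := by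
    rw [htt, ← Complex.ofReal_exp, Real.exp_log two_pos]
    simp
  have eℓ : Complex.exp ℓ = ‖s‖ := by
    rw [hℓ, ← Complex.ofReal_exp, Real.exp_log hsn]
  have es : s = Complex.exp (ℓ + 2 * a * Complex.I) := by
    rw [Complex.exp_add, eℓ, ha]
    conv_lhs => rw [← Complex.norm_mul_exp_arg_mul_I s]
    push_cast
    ring_nf
  have ec : lapExp s = Complex.exp (t + ℓ + a * Complex.I) := by
    rw [Complex.exp_add, Complex.exp_add, et, eℓ, ha, lapExp]
  have eo : rotDir s = Complex.exp ((Real.pi / 2 - a) * Complex.I) := by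
    rw [ha, rotDir]
    push_cast
    rfl
  have eo2 : 2 * rotDir s = Complex.exp (t + (Real.pi / 2 - a) * Complex.I) := by
    rw [Complex.exp_add, et, eo]
  have eo' : -rotDir s = Complex.exp ((-Real.pi / 2 - a) * Complex.I) := by
    rw [eo, show (Real.pi / 2 - a) * Complex.I = Real.pi * Complex.I +
      (-Real.pi / 2 - a) * Complex.I by ring, Complex.exp_add, Complex.exp_pi_mul_I]
    ring
  have eo2' : -2 * rotDir s = Complex.exp (t + (-Real.pi / 2 - a) * Complex.I) := by
    rw [Complex.exp_add, et, ← eo']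
    ring
  have ps : ∀ μ : ℂ, s ^ μ = Complex.exp ((ℓ + 2 * a * Complex.I) * μ) := fun μ => by
    rw [es, exp_cpow]
    · simp; linarith
    · simp; linarith
  have pc : lapExp s ^ (κ + 1) = Complex.exp ((t + ℓ + a * Complex.I) * (κ + 1)) := by
    rw [ec, exp_cpow]
    · simp; linarith
    · simp; linarith
  have po : (2 * rotDir s) ^ κ = Complex.exp ((t + (Real.pi / 2 - a) * Complex.I) * κ) := by
    rw [eo2, exp_cpow]
    · simp; linarith
    · simp; linarith
  have po' : (-2 * rotDir s) ^ κ = Complex.exp ((t + (-Real.pi / 2 - a) * Complex.I) * κ) := by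
    rw [eo2', exp_cpow]
    · simp; linarith
    · simp; linarith
  have key : Complex.exp t * (s ^ (1 / 2 : ℂ) * s ^ ν * rotDir s * (2 * rotDir s) ^ κ) =
      lapExp s ^ (κ + 1) * Complex.exp ((κ + 1) * (Real.pi / 2 * Complex.I)) := by
    rw [ps, ps, po, pc, eo, ← Complex.exp_add, ← Complex.exp_add, ← Complex.exp_add,
      ← Complex.exp_add, ← Complex.exp_add, show ν = κ + 1 / 2 by rw [hκ]; ring]
    congr 1
    ring
  have key' : Complex.exp t * (s ^ (1 / 2 : ℂ) * s ^ ν * (-rotDir s) * (-2 * rotDir s) ^ κ) =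
      lapExp s ^ (κ + 1) * Complex.exp (-((κ + 1) * (Real.pi / 2 * Complex.I))) := by
    rw [ps, ps, po', pc, eo', ← Complex.exp_add, ← Complex.exp_add, ← Complex.exp_add,
      ← Complex.exp_add, ← Complex.exp_add, show ν = κ + 1 / 2 by rw [hκ]; ring]
    congr 1
    ring
  rw [et] at key key'
  have q1 : Complex.exp (Complex.I * phase ν s) = Complex.exp (2 * Complex.I * s) *
      Complex.exp (-((κ + 1) * (Real.pi / 2 * Complex.I))) := by
    rw [← Complex.exp_add, phase, hκ]
    congr 1
    ring
  have q2 : Complex.exp (-(Complex.I * phase ν s)) = Complex.exp (-(2 * Complex.I * s)) *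
      Complex.exp ((κ + 1) * (Real.pi / 2 * Complex.I)) := by
    rw [← Complex.exp_add, phase, hκ]
    congr 1
    ring
  rw [besselJ_two_mul, q1, q2, hankelPlus, hankelMinus, ← hκ, ampl, ampl]
  generalize besselS ν (s ^ 2) = S at *
  generalize Complex.Gamma (κ + 1) = G at *
  generalize rGamma (κ + 1) = g at *
  generalize (∫ u in Set.Ioi (0 : ℝ), laplFun κ (lapExp s) (-(rotDir s / 2)) u) = L1 at *
  generalize (∫ u in Set.Ioi (0 : ℝ), laplFun κ (lapExp s) (rotDir s / 2) u) = L2 at *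
  generalize s ^ (1 / 2 : ℂ) = s1 at *
  generalize s ^ ν = s2 at *
  generalize (2 * rotDir s) ^ κ = w1 at *
  generalize (-2 * rotDir s) ^ κ = w2 at *
  generalize lapExp s ^ (κ + 1) = c1 at *
  generalize rotDir s = w at *
  generalize (Real.sqrt Real.pi : ℂ) = r at *
  generalize Complex.exp (2 * Complex.I * s) = E1 at *
  generalize Complex.exp (-(2 * Complex.I * s)) = E2 at *
  generalize Complex.exp (-((κ + 1) * (Real.pi / 2 * Complex.I))) = E3 at *
  generalize Complex.exp ((κ + 1) * (Real.pi / 2 * Complex.I)) = E4 at *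
  linear_combination s1 * s2 * g * h2 - r * s1 * s2 * S * hG' + (g * L1 * E2 / 2) * key +
    (g * L2 * E1 / 2) * key'

/-- The coefficients of the expansions of the Hankel functions. -/
def hankelCoeff (ν : ℂ) (d : ℕ) : ℂ :=
  ∏ j ∈ Finset.range d, (ν ^ 2 - (j + 1 / 2) ^ 2) / (4 * (j + 1))

lemma hankelCoeff_succ (ν : ℂ) (d : ℕ) : hankelCoeff ν (d + 1) =
    hankelCoeff ν d * ((ν ^ 2 - (d + 1 / 2) ^ 2) / (4 * (d + 1))) := Finset.prod_range_succ _ _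

lemma hankelCoeff_neg (ν : ℂ) (d : ℕ) : hankelCoeff (-ν) d = hankelCoeff ν d := by
  simp [hankelCoeff]

/-- The j-th factors ν - 1/2 - j and ν + 1/2 + j combine to ν² - (j+1/2)², which makes the
coefficients even in ν. -/
lemma amplCoeff_eq (ν : ℂ) (d : ℕ) : amplCoeff (ν - 1 / 2) d = 4 ^ d * hankelCoeff ν d := by
  induction d with
  | zero => simp [amplCoeff, hankelCoeff, binCoeff, poch]
  | succ d ih =>
    have h1 : (d : ℂ) + 1 ≠ 0 := by exact_mod_cast Nat.succ_ne_zero d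
    rw [amplCoeff] at ih ⊢
    rw [binCoeff_succ, poch_eq_prod, hankelCoeff_succ, pow_succ]
    generalize binCoeff (ν - 1 / 2) d = x at *
    generalize poch (ν - 1 / 2 + 1) d = y at *
    field_simp
    linear_combination (2 * ν - 1 - 2 * d) * (2 * ν + 1 + 2 * d) * ih

lemma hankelCoeff_add_one (ν : ℂ) (d : ℕ) : hankelCoeff (ν + 1) (d + 1) * (4 * (d + 1)) =
    hankelCoeff ν d * ((ν + 1 / 2 + d) * (ν + 3 / 2 + d)) := by
  induction d with
  | zero =>
    simp [hankelCoeff]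
    ring
  | succ d ih =>
    have h1 : (d : ℂ) + 1 ≠ 0 := by exact_mod_cast Nat.succ_ne_zero d
    have h2 : (d : ℂ) + 1 + 1 ≠ 0 := by exact_mod_cast Nat.succ_ne_zero (d + 1)
    rw [hankelCoeff_succ (ν + 1) (d + 1), hankelCoeff_succ ν d]
    push_cast
    generalize hankelCoeff (ν + 1) (d + 1) = x at *
    generalize hankelCoeff ν d = y at *
    field_simp
    field_simp at ih
    linear_combination (2 * ν - 1 - 2 * d) * (2 * ν + 5 + 2 * d) * ih

/-- The three-term recurrence of the Bessel functions on the level of coefficients: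
`hankelCoeff_add_one` at ν + 1 and at -(ν + 1), combined with evenness. -/
lemma hankelCoeff_sub (ν : ℂ) (d : ℕ) :
    hankelCoeff (ν + 2) (d + 1) - hankelCoeff ν (d + 1) = (ν + 1) * hankelCoeff (ν + 1) d := by
  have h1 := hankelCoeff_add_one (ν + 1) d
  have h2 := hankelCoeff_add_one (-(ν + 1)) d
  rw [hankelCoeff_neg, show -(ν + 1) + 1 = -ν by ring, hankelCoeff_neg] at h2
  rw [show ν + 1 + 1 = ν + 2 by ring] at h1
  have h3 : (4 * ((d : ℂ) + 1)) ≠ 0 :=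
    mul_ne_zero (by norm_num) (by exact_mod_cast Nat.succ_ne_zero d)
  refine mul_left_cancel₀ h3 ?_
  linear_combination h1 - h2

/-- Real and imaginary part of `i^d`. -/
def iPow : ℕ → ℤ × ℤ
  | 0 => (1, 0)
  | d + 1 => (-(iPow d).2, (iPow d).1)

lemma I_pow_eq (d : ℕ) : Complex.I ^ d = (iPow d).1 + (iPow d).2 * Complex.I := by
  induction d with
  | zero => simp [iPow]
  | succ d ih =>
    rw [pow_succ, ih, iPow]
    push_cast
    linear_combination ((iPow d).2 : ℂ) * Complex.I_sq

lemma neg_I_pow_eq (d : ℕ) : (-Complex.I) ^ d = (iPow d).1 - (iPow d).2 * Complex.I := by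
  induction d with
  | zero => simp [iPow]
  | succ d ih =>
    rw [pow_succ, ih, iPow]
    push_cast
    linear_combination ((iPow d).2 : ℂ) * Complex.I_sq

/-- Uniform expansions of the Hankel amplitudes, for parameters to the right of `3/2`. -/
lemma uexp_hankel (B : ℕ) :
    UExp {ν : ℂ | 3 / 2 < ν.re ∧ ‖ν‖ ≤ B} hankelPlus
      (fun d ν => Complex.I ^ d * hankelCoeff ν d) ∧
    UExp {ν : ℂ | 3 / 2 < ν.re ∧ ‖ν‖ ≤ B} hankelMinus
      (fun d ν => (-Complex.I) ^ d * hankelCoeff ν d) := by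
  have main : ∀ δ : ℝ, 0 < δ → ∀ N : ℕ, ∃ C : ℝ, ∀ ν : ℂ, 3 / 2 < ν.re → ‖ν‖ ≤ B →
      ∀ s ∈ sector δ, ∀ ζ : ℂ, ∀ η : ℂ, ‖η‖ ≤ 1 → |η.im| = Real.cos (Complex.arg s / 2) / 2 →
        η * (lapExp s)⁻¹ = ζ / 4 * s⁻¹ →
        ‖ampl (ν - 1 / 2) (lapExp s) η -
          ∑ d ∈ Finset.range N, ζ ^ d * hankelCoeff ν d * (s ^ d)⁻¹‖ ≤ C * (‖s‖ ^ N)⁻¹ := by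
    intro δ hδ N
    -- For δ > π the sector is empty. Otherwise cos((π-δ)/2) bounds cos(arg s/2) from below on the
    -- sector.
    by_cases hδ2 : Real.pi < δ
    · refine ⟨0, fun ν _ _ s hs => ?_⟩
      have := hs.2
      have := abs_nonneg (Complex.arg s)
      linarith
    push Not at hδ2
    set σ := Real.cos ((Real.pi - δ) / 2) with hσ
    have hσ0 : 0 < σ := Real.cos_pos_of_mem_Ioo ⟨by linarith, by linarith⟩
    obtain ⟨C, hC⟩ := watson (half_pos hσ0) (by linarith [Real.cos_le_one ((Real.pi - δ) / 2)])
      hσ0 (B + 1) N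
    refine ⟨|C|, fun ν hν hνB s hs ζ η hη hηim hηc => ?_⟩
    have hs1 := hs.1
    have hcos : σ ≤ Real.cos (Complex.arg s / 2) := by
      rw [← Real.cos_abs (Complex.arg s / 2), hσ, abs_div, abs_two]
      refine Real.cos_le_cos_of_nonneg_of_le_pi (by positivity) (by linarith) ?_
      linarith [hs.2]
    have h := hC (ν - 1 / 2) (lapExp s) η (by simp; linarith) ?_ ?_ ?_ hη (by rw [hηim]; linarith)
    · have e : ∀ d ∈ Finset.range N, amplCoeff (ν - 1 / 2) d * (η * (lapExp s)⁻¹) ^ d =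
          ζ ^ d * hankelCoeff ν d * (s ^ d)⁻¹ := fun d _ => by
        rw [hηc, amplCoeff_eq, mul_pow, div_pow, inv_pow]
        field_simp
      rw [Finset.sum_congr rfl e] at h
      refine h.trans ?_
      rw [norm_lapExp]
      have h0 : 0 < ‖s‖ := by linarith
      refine mul_le_mul (le_abs_self C) ?_ (by positivity) (abs_nonneg C)
      exact inv_anti₀ (by positivity) (pow_le_pow_left₀ h0.le (by linarith) _)
    · push_cast
      refine (norm_sub_le _ _).trans (add_le_add hνB ?_)
      norm_num
    · rw [norm_lapExp]
      linarith
    · rw [norm_lapExp, lapExp_re, mul_comm]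
      exact mul_le_mul_of_nonneg_left hcos (by positivity)
  constructor
  · intro δ hδ N
    obtain ⟨C, hC⟩ := main δ hδ N
    refine ⟨C, fun ν hν s hs => hC ν hν.1 hν.2 s hs _ _ ?_ ?_
      (rotDir_div_lapExp (sector_ne_zero hs))⟩
    · rw [norm_div, norm_rotDir]
      norm_num
    · have := cos_half_arg_pos (sector_subset_slitPlane hδ hs)
      rw [Complex.div_ofNat_im, rotDir_im, abs_of_pos (by positivity)]
  · intro δ hδ N
    obtain ⟨C, hC⟩ := main δ hδ N
    refine ⟨C, fun ν hν s hs => hC ν hν.1 hν.2 s hs _ _ ?_ ?_ ?_⟩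
    · rw [norm_neg, norm_div, norm_rotDir]
      norm_num
    · have := cos_half_arg_pos (sector_subset_slitPlane hδ hs)
      rw [Complex.neg_im, Complex.div_ofNat_im, rotDir_im, abs_neg, abs_of_pos (by positivity)]
    · rw [neg_mul, rotDir_div_lapExp (sector_ne_zero hs)]
      ring

/-- `P` and `Q` are amplitudes of the Bessel functions with parameters in `K`. -/
structure IsBesselAmplitude (K : Set ℂ) (P Q : ℂ → ℂ → ℂ) : Prop where
  bessel : ∀ ν ∈ K, ∀ s ∈ Complex.slitPlane,
    (Real.sqrt Real.pi : ℂ) * s ^ (1 / 2 : ℂ) * besselJ ν (2 * s) =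
      P ν s * Complex.cos (phase ν s) - Q ν s * Complex.sin (phase ν s)
  contP : ∀ s ∈ Complex.slitPlane, ContinuousOn (fun ν => P ν s) K
  contQ : ∀ s ∈ Complex.slitPlane, ContinuousOn (fun ν => Q ν s) K
  expP : UExp K P fun d ν => hankelCoeff ν d * (iPow d).1
  expQ : UExp K Q fun d ν => hankelCoeff ν d * (iPow d).2

lemma isBesselAmplitude_right (B : ℕ) : IsBesselAmplitude {ν : ℂ | 3 / 2 < ν.re ∧ ‖ν‖ ≤ B}
    (fun ν s => 1 / 2 * (hankelPlus ν s + hankelMinus ν s))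
    (fun ν s => 1 / (2 * Complex.I) * (hankelPlus ν s + -1 * hankelMinus ν s)) := by
  obtain ⟨h1, h2⟩ := uexp_hankel B
  have hc : ∀ s ∈ Complex.slitPlane,
      ContinuousOn (fun ν => hankelPlus ν s) {ν : ℂ | 3 / 2 < ν.re ∧ ‖ν‖ ≤ B} ∧
      ContinuousOn (fun ν => hankelMinus ν s) {ν : ℂ | 3 / 2 < ν.re ∧ ‖ν‖ ≤ B} := by
    intro s hs
    have hcos := cos_half_arg_pos hs
    have hsn : 0 < ‖s‖ := norm_pos_iff.2 (Complex.slitPlane_ne_zero hs)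
    have hre : 0 < (lapExp s).re := by
      rw [lapExp_re]
      positivity
    have hn : ‖rotDir s / 2‖ ≤ 1 := by
      rw [norm_div, norm_rotDir]
      norm_num
    have him : (rotDir s / 2).im ≠ 0 := by
      rw [Complex.div_ofNat_im, rotDir_im]
      positivity
    have hm : Set.MapsTo (fun ν : ℂ => ν - 1 / 2) {ν : ℂ | 3 / 2 < ν.re ∧ ‖ν‖ ≤ B}
        {κ | 0 < κ.re} := fun ν hν => by
      have := hν.1
      simp
      linarith
    exact ⟨(continuousOn_ampl hre hn him).comp (by fun_prop) hm,
      (continuousOn_ampl hre (by rwa [norm_neg]) (by simpa using him)).comp (by fun_prop) hm⟩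
  refine ⟨fun ν hν s hs => ?_, fun s hs => ?_, fun s hs => ?_, ?_, ?_⟩
  · rw [besselJ_eq_hankel hν.1 hs, mul_comm Complex.I, Complex.exp_mul_I, ← neg_mul,
      Complex.exp_mul_I, Complex.cos_neg, Complex.sin_neg]
    have hI := Complex.I_sq
    field_simp
    linear_combination (hankelPlus ν s - hankelMinus ν s) * Complex.sin (phase ν s) * hI
  · exact continuousOn_const.mul ((hc s hs).1.add (hc s hs).2)
  · exact continuousOn_const.mul ((hc s hs).1.add (continuousOn_const.mul (hc s hs).2))
  · refine ((h1.add h2).cmul (1 / 2)).congr (fun _ _ _ _ => rfl) fun d ν _ => ?_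
    rw [I_pow_eq, neg_I_pow_eq]
    ring
  · refine ((h1.add (h2.cmul (-1))).cmul (1 / (2 * Complex.I))).congr (fun _ _ _ _ => rfl)
      fun d ν _ => ?_
    rw [I_pow_eq, neg_I_pow_eq]
    field_simp
    ring

/-- J_ν is expressed through J_{ν+1} and J_{ν+2}, so each step moves the half-plane to the left by
one, starting from a norm bound larger by 2. `hankelCoeff_sub` ensures that the amplitudes obtained
have the same formula for their coefficients. -/
lemma exists_besselAmplitude_aux (n : ℕ) : ∀ B : ℕ, ∃ P Q : ℂ → ℂ → ℂ,
    IsBesselAmplitude {ν : ℂ | 3 / 2 - n < ν.re ∧ ‖ν‖ ≤ B} P Q := by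
  induction n with
  | zero =>
    intro B
    have := isBesselAmplitude_right B
    simp only [Nat.cast_zero, sub_zero]
    exact ⟨_, _, this⟩
  | succ n ih =>
    intro B
    obtain ⟨P, Q, h⟩ := ih (B + 2)
    set K := {ν : ℂ | 3 / 2 - ((n + 1 : ℕ) : ℝ) < ν.re ∧ ‖ν‖ ≤ B} with hK
    have m1 : ∀ ν ∈ K, ν + 1 ∈ {ν : ℂ | 3 / 2 - (n : ℝ) < ν.re ∧ ‖ν‖ ≤ ((B + 2 : ℕ) : ℝ)} := by
      intro ν hν
      have h1 := hν.1
      push_cast at h1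
      refine ⟨by simp; linarith, (norm_add_le _ _).trans ?_⟩
      rw [norm_one]
      push_cast
      linarith [hν.2]
    have m2 : ∀ ν ∈ K, ν + 2 ∈ {ν : ℂ | 3 / 2 - (n : ℝ) < ν.re ∧ ‖ν‖ ≤ ((B + 2 : ℕ) : ℝ)} := by
      intro ν hν
      have h1 := hν.1
      push_cast at h1
      refine ⟨by simp; linarith, (norm_add_le _ _).trans ?_⟩
      rw [Complex.norm_ofNat]
      push_cast
      linarith [hν.2]
    have hb : ∀ ν ∈ K, ‖ν + 1‖ ≤ ((B + 2 : ℕ) : ℝ) := fun ν hν => (m1 ν hν).2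
    have hb' : ∀ ν ∈ K, ‖-(ν + 1)‖ ≤ ((B + 2 : ℕ) : ℝ) := fun ν hν => by
      rw [norm_neg]
      exact (m1 ν hν).2
    -- Raising the order by 1 and by 2 lowers the phase by π/2 and by π; this interchanges sine and
    -- cosine in the first case and changes signs in the second.
    refine ⟨fun ν s => (ν + 1) * (s⁻¹ * Q (ν + 1) s) + P (ν + 2) s,
      fun ν s => Q (ν + 2) s + -(ν + 1) * (s⁻¹ * P (ν + 1) s), fun ν hν s hs => ?_,
      fun s hs => ?_, fun s hs => ?_, ?_, ?_⟩
    · have hs0 := Complex.slitPlane_ne_zero hs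
      have hr := besselJ_recurrence hs0 (ν + 1)
      rw [add_sub_cancel_right, show ν + 1 + 1 = ν + 2 by ring] at hr
      have h1 := h.bessel _ (m1 ν hν) s hs
      have h2 := h.bessel _ (m2 ν hν) s hs
      have e1 : phase (ν + 1) s = phase ν s - Real.pi / 2 := by
        rw [phase, phase]
        ring
      have e2 : phase (ν + 2) s = phase ν s - Real.pi := by
        rw [phase, phase]
        ring
      rw [e1, Complex.cos_sub_pi_div_two, Complex.sin_sub_pi_div_two] at h1
      rw [e2, Complex.cos_sub_pi, Complex.sin_sub_pi] at h2
      change (Real.sqrt Real.pi : ℂ) * s ^ (1 / 2 : ℂ) * besselJ ν (2 * s) =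
        ((ν + 1) * (s⁻¹ * Q (ν + 1) s) + P (ν + 2) s) * Complex.cos (phase ν s) -
          (Q (ν + 2) s + -(ν + 1) * (s⁻¹ * P (ν + 1) s)) * Complex.sin (phase ν s)
      rw [hr, div_eq_mul_inv (ν + 1) s]
      generalize s ^ (1 / 2 : ℂ) = y at *
      linear_combination (ν + 1) * s⁻¹ * h1 - h2
    · have c1 : ContinuousOn (fun ν => Q (ν + 1) s) K := (h.contQ s hs).comp (by fun_prop) m1
      have c2 : ContinuousOn (fun ν => P (ν + 2) s) K := (h.contP s hs).comp (by fun_prop) m2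
      exact (ContinuousOn.mul (by fun_prop) (continuousOn_const.mul c1)).add c2
    · have c1 : ContinuousOn (fun ν => P (ν + 1) s) K := (h.contP s hs).comp (by fun_prop) m1
      have c2 : ContinuousOn (fun ν => Q (ν + 2) s) K := (h.contQ s hs).comp (by fun_prop) m2
      exact c2.add (ContinuousOn.mul (by fun_prop) (continuousOn_const.mul c1))
    · have u1 := ((h.expQ.comp (fun ν : ℂ => ν + 1) m1).div_s.smul hb).add
        (h.expP.comp (fun ν : ℂ => ν + 2) m2)
      refine u1.congr (fun _ _ _ _ => rfl) fun d ν _ => ?_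
      rcases d with _ | d
      · simp [hankelCoeff]
      · simp only [Nat.succ_ne_zero, if_false, Nat.add_sub_cancel, iPow]
        push_cast
        linear_combination (-((iPow d).2 : ℂ)) * hankelCoeff_sub ν d
    · have u1 := (h.expQ.comp (fun ν : ℂ => ν + 2) m2).add
        ((h.expP.comp (fun ν : ℂ => ν + 1) m1).div_s.smul hb')
      refine u1.congr (fun _ _ _ _ => rfl) fun d ν _ => ?_
      rcases d with _ | d
      · simp [hankelCoeff]
      · simp only [Nat.succ_ne_zero, if_false, Nat.add_sub_cancel, iPow]
        linear_combination ((iPow d).1 : ℂ) * hankelCoeff_sub ν d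

lemma IsBesselAmplitude.mono {K K' : Set ℂ} {P Q : ℂ → ℂ → ℂ} (h : IsBesselAmplitude K P Q)
    (hK : K' ⊆ K) : IsBesselAmplitude K' P Q :=
  ⟨fun ν hν => h.bessel ν (hK hν), fun s hs => (h.contP s hs).mono hK,
    fun s hs => (h.contQ s hs).mono hK, h.expP.mono hK, h.expQ.mono hK⟩

lemma exists_besselAmplitude (B : ℕ) :
    ∃ P Q : ℂ → ℂ → ℂ, IsBesselAmplitude {ν : ℂ | ‖ν‖ ≤ B} P Q := by
  obtain ⟨P, Q, h⟩ := exists_besselAmplitude_aux (B + 2) B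
  refine ⟨P, Q, h.mono fun ν hν => ⟨?_, hν⟩⟩
  have := (abs_le.1 ((Complex.abs_re_le_norm ν).trans hν)).1
  push_cast
  linarith

end

/-! ### The coefficient ring and trigonometric sums with formal amplitudes. -/

section

variable {k : ℕ}

/-- The tuples with pairwise distinct entries. -/
def injSet (k : ℕ) : Set (Fin k → ℂ) := {w | Function.Injective w}

/-- The values of the variables `w_i`, `sin (π w_i)`, `cos (π w_i)`. -/
def trigPt (w : Fin k → ℂ) : Fin k ⊕ (Fin k ⊕ Fin k) → ℂ :=
  Sum.elim w (Sum.elim (fun i => Complex.sin (Real.pi * w i)) fun i => Complex.cos (Real.pi * w i))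

lemma aeval_trigPt_rename (w : Fin k → ℂ) (Q : MvPolynomial (Fin k) ℚ) :
    MvPolynomial.aeval (trigPt w) (MvPolynomial.rename Sum.inl Q) = MvPolynomial.aeval w Q := by
  rw [MvPolynomial.aeval_rename]
  rfl

/-- The functions, continuous on the set of tuples with pairwise distinct entries, which are
rational in the `w_i` and polynomial in the `sin (π w_i)` and `cos (π w_i)`. -/
def trigRing (k : ℕ) : Subalgebra ℚ ((Fin k → ℂ) → ℂ) where
  carrier := {h | ContinuousOn h (injSet k) ∧
    ∃ (P : MvPolynomial (Fin k ⊕ (Fin k ⊕ Fin k)) ℚ) (Q : MvPolynomial (Fin k) ℚ), Q ≠ 0 ∧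
      ∀ w ∈ injSet k, MvPolynomial.aeval w Q * h w = MvPolynomial.aeval (trigPt w) P}
  mul_mem' := by
    rintro f g ⟨hf, P, Q, hQ, h⟩ ⟨hg, P', Q', hQ', h'⟩
    refine ⟨hf.mul hg, P * P', Q * Q', mul_ne_zero hQ hQ', fun w hw => ?_⟩
    rw [map_mul, map_mul, ← h w hw, ← h' w hw, Pi.mul_apply]
    ring
  add_mem' := by
    rintro f g ⟨hf, P, Q, hQ, h⟩ ⟨hg, P', Q', hQ', h'⟩
    refine ⟨hf.add hg, MvPolynomial.rename Sum.inl Q' * P + MvPolynomial.rename Sum.inl Q * P',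
      Q * Q', mul_ne_zero hQ hQ', fun w hw => ?_⟩
    rw [map_mul, map_add, map_mul, map_mul, ← h w hw, ← h' w hw, Pi.add_apply,
      aeval_trigPt_rename, aeval_trigPt_rename]
    ring
  algebraMap_mem' := fun r => ⟨continuousOn_const, MvPolynomial.C r, 1, one_ne_zero, fun w _ => by
    rw [map_one, one_mul, MvPolynomial.aeval_C]
    rfl⟩

lemma coord_mem (i : Fin k) : (fun w : Fin k → ℂ => w i) ∈ trigRing k :=
  ⟨by fun_prop, MvPolynomial.X (Sum.inl i), 1, one_ne_zero, fun w _ => by simp [trigPt]⟩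

lemma sin_mem (i : Fin k) :
    (fun w : Fin k → ℂ => Complex.sin (Real.pi * w i)) ∈ trigRing k :=
  ⟨by fun_prop, MvPolynomial.X (Sum.inr (Sum.inl i)), 1, one_ne_zero, fun w _ => by simp [trigPt]⟩

lemma cos_mem (i : Fin k) :
    (fun w : Fin k → ℂ => Complex.cos (Real.pi * w i)) ∈ trigRing k :=
  ⟨by fun_prop, MvPolynomial.X (Sum.inr (Sum.inr i)), 1, one_ne_zero, fun w _ => by simp [trigPt]⟩

lemma const_mem (r : ℚ) : (fun _ : Fin k → ℂ => (r : ℂ)) ∈ trigRing k :=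
  (trigRing k).algebraMap_mem r

lemma inv_sub_mem {i j : Fin k} (hij : i ≠ j) :
    (fun w : Fin k → ℂ => (w i - w j)⁻¹) ∈ trigRing k := by
  have h0 : ∀ w ∈ injSet k, w i - w j ≠ 0 := fun w hw => sub_ne_zero.2 fun h => hij (hw h)
  refine ⟨ContinuousOn.inv₀ (by fun_prop) h0, 1, MvPolynomial.X i - MvPolynomial.X j,
    fun h => ?_, fun w hw => ?_⟩
  · have := MvPolynomial.X_injective (sub_eq_zero.1 h)
    exact hij this
  · rw [map_sub, MvPolynomial.aeval_X, MvPolynomial.aeval_X, map_one, mul_inv_cancel₀ (h0 w hw)]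

lemma hankelCoeff_mem {g : (Fin k → ℂ) → ℂ} (hg : g ∈ trigRing k) (d : ℕ) (c : ℤ) :
    (fun w => hankelCoeff (g w) d * c) ∈ trigRing k := by
  have h : ∀ j : ℕ, (fun w => (g w ^ 2 - ((j : ℂ) + 1 / 2) ^ 2) / (4 * (j + 1))) ∈ trigRing k := by
    intro j
    have := mul_mem (sub_mem (pow_mem hg 2) (const_mem (((j : ℚ) + 1 / 2) ^ 2)))
      (const_mem (1 / (4 * ((j : ℚ) + 1))))
    convert! this using 1
    funext w
    simp [div_eq_mul_inv]
  have := mul_mem (prod_mem (t := Finset.range d) fun j _ => h j) (const_mem (c : ℚ))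
  convert! this using 1
  funext w
  simp [hankelCoeff, Finset.prod_apply]

/-- A compact set of tuples with pairwise distinct entries. -/
def sepSet (k N : ℕ) : Set (Fin k → ℂ) :=
  {w | (∀ i, ‖w i‖ ≤ N) ∧ ∀ i j, i ≠ j → ((N : ℝ) + 1)⁻¹ ≤ ‖w i - w j‖}

lemma sepSet_subset_injSet (N : ℕ) : sepSet k N ⊆ injSet k := by
  intro w hw i j hij
  by_contra hne
  have := hw.2 i j hne
  rw [hij, sub_self, norm_zero] at this
  have h : (0 : ℝ) < ((N : ℝ) + 1)⁻¹ := by positivity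
  linarith

lemma isCompact_sepSet (N : ℕ) : IsCompact (sepSet k N) := by
  refine Metric.isCompact_of_isClosed_isBounded ?_ ?_
  · have e : sepSet k N = (⋂ i, {w | ‖w i‖ ≤ N}) ∩
        ⋂ i, ⋂ j, ⋂ _ : i ≠ j, {w | ((N : ℝ) + 1)⁻¹ ≤ ‖w i - w j‖} := by
      ext w
      simp [sepSet]
    rw [e]
    exact (isClosed_iInter fun i => isClosed_le (by fun_prop) continuous_const).inter
      (isClosed_iInter fun i => isClosed_iInter fun j => isClosed_iInter fun _ =>
        isClosed_le continuous_const (by fun_prop))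
  · refine (Metric.isBounded_closedBall (x := (0 : Fin k → ℂ)) (r := N)).subset fun w hw => ?_
    rw [mem_closedBall_zero_iff, pi_norm_le_iff_of_nonneg (Nat.cast_nonneg N)]
    exact hw.1

lemma exists_mem_sepSet {w : Fin k → ℂ} (hw : w ∈ injSet k) : ∃ N, w ∈ sepSet k N := by
  have h1 : ∀ i, ∃ N : ℕ, ‖w i‖ ≤ N := fun i => exists_nat_ge _
  have h2 : ∀ p : Fin k × Fin k, ∃ N : ℕ, ‖w p.1 - w p.2‖⁻¹ ≤ N := fun p => exists_nat_ge _
  choose f hf using h1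
  choose g hg using h2
  refine ⟨∑ i, f i + ∑ p, g p, fun i => ?_, fun i j hij => ?_⟩
  · refine (hf i).trans ?_
    have := Finset.single_le_sum (f := f) (fun _ _ => Nat.zero_le _) (Finset.mem_univ i)
    exact_mod_cast this.trans (Nat.le_add_right _ _)
  · have h0 : 0 < ‖w i - w j‖ := norm_pos_iff.2 (sub_ne_zero.2 fun h => hij (hw h))
    refine inv_le_of_inv_le₀ h0 ((hg (i, j)).trans ?_)
    have := Finset.single_le_sum (f := g) (fun _ _ => Nat.zero_le _) (Finset.mem_univ (i, j))
    have h3 : g (i, j) ≤ ∑ i, f i + ∑ p, g p := this.trans (Nat.le_add_left _ _)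
    have h4 : (g (i, j) : ℝ) ≤ ((∑ i, f i + ∑ p, g p : ℕ) : ℝ) := by exact_mod_cast h3
    linarith

/-- The value of the coefficient of degree `d`. -/
def coeffAt (c : PowerSeries (trigRing k)) (d : ℕ) (w : Fin k → ℂ) : ℂ :=
  (PowerSeries.coeff d c : trigRing k).1 w

/-- A family of amplitudes, one for each of the sets `sepSet k N`, with a common formal
expansion. -/
structure Amp (f : ℕ → (Fin k → ℂ) → ℂ → ℂ) (c : PowerSeries (trigRing k)) : Prop where
  exp : ∀ N, UExp (sepSet k N) (f N) (coeffAt c)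
  cont : ∀ N, ∀ s ∈ Complex.slitPlane, ContinuousOn (fun w => f N w s) (sepSet k N)

section
variable {f g : ℕ → (Fin k → ℂ) → ℂ → ℂ} {c e : PowerSeries (trigRing k)}

lemma Amp.add (hf : Amp f c) (hg : Amp g e) :
    Amp (fun N w s => f N w s + g N w s) (c + e) :=
  ⟨fun N => ((hf.exp N).add (hg.exp N)).congr (fun _ _ _ _ => rfl) fun d w _ => by simp [coeffAt],
    fun N s hs => (hf.cont N s hs).add (hg.cont N s hs)⟩

lemma Amp.mul (hf : Amp f c) (hg : Amp g e) :
    Amp (fun N w s => f N w s * g N w s) (c * e) :=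
  ⟨fun N => ((hf.exp N).mul (hg.exp N)).congr (fun _ _ _ _ => rfl) fun d w _ => by
      simp [coeffAt, PowerSeries.coeff_mul, Finset.sum_apply],
    fun N s hs => (hf.cont N s hs).mul (hg.cont N s hs)⟩

lemma amp_const (h : trigRing k) :
    Amp (fun _ w _ => (h : (Fin k → ℂ) → ℂ) w) (PowerSeries.C h) := by
  have hc : ∀ N, ContinuousOn (h : (Fin k → ℂ) → ℂ) (sepSet k N) := fun N =>
    h.2.1.mono (sepSet_subset_injSet N)
  refine ⟨fun N => ?_, fun N s _ => hc N⟩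
  obtain ⟨M, hM⟩ := (isCompact_sepSet N).exists_bound_of_continuousOn (hc N)
  refine (uexp_const hM).congr (fun _ _ _ _ => rfl) fun d w _ => ?_
  rw [coeffAt, PowerSeries.coeff_C]
  split_ifs <;> rfl

lemma Amp.smul (hf : Amp f c) (r : ℚ) :
    Amp (fun N w s => (r : ℂ) * f N w s) (PowerSeries.C ⟨_, const_mem r⟩ * c) :=
  (amp_const ⟨_, const_mem r⟩).mul hf

lemma Amp.neg (hf : Amp f c) : Amp (fun N w s => -f N w s) (-c) := by
  refine ⟨fun N => ((hf.exp N).cmul (-1)).congr (fun _ _ _ _ => by simp) fun d w _ => by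
      simp [coeffAt],
    fun N s hs => (hf.cont N s hs).neg⟩

lemma Amp.sub (hf : Amp f c) (hg : Amp g e) :
    Amp (fun N w s => f N w s - g N w s) (c - e) := by
  simpa only [sub_eq_add_neg] using hf.add hg.neg

end

/-- Trigonometric sums of degree at most `n` in `4s`, whose amplitudes of frequency `m` start in
degree `m`. -/
inductive TrigSum (n : ℕ) : (ℕ → (Fin k → ℂ) → ℂ → ℂ) → Prop
  | cos (m : ℕ) (hm : m ≤ n) (A : ℕ → (Fin k → ℂ) → ℂ → ℂ) (a : PowerSeries (trigRing k))
      (h : Amp A a) (ha : PowerSeries.X ^ m ∣ a) :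
      TrigSum n fun N w s => A N w s * Complex.cos (4 * m * s)
  | sin (m : ℕ) (hm : m ≤ n) (A : ℕ → (Fin k → ℂ) → ℂ → ℂ) (a : PowerSeries (trigRing k))
      (h : Amp A a) (ha : PowerSeries.X ^ m ∣ a) :
      TrigSum n fun N w s => A N w s * Complex.sin (4 * m * s)
  | add (F G : ℕ → (Fin k → ℂ) → ℂ → ℂ) (hF : TrigSum n F) (hG : TrigSum n G) :
      TrigSum n fun N w s => F N w s + G N w s
  | congr (F G : ℕ → (Fin k → ℂ) → ℂ → ℂ) (hF : TrigSum n F)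
      (h : ∀ N, ∀ w ∈ sepSet k N, ∀ s ∈ Complex.slitPlane, F N w s = G N w s) : TrigSum n G

section
variable {n : ℕ} {F G : ℕ → (Fin k → ℂ) → ℂ → ℂ}

lemma TrigSum.mono {n' : ℕ} (hF : TrigSum n F) (hn : n ≤ n') : TrigSum n' F := by
  induction hF with
  | cos m hm A a h ha => exact .cos m (hm.trans hn) A a h ha
  | sin m hm A a h ha => exact .sin m (hm.trans hn) A a h ha
  | add F G _ _ h1 h2 => exact .add F G h1 h2
  | congr F G _ h ih => exact .congr F G ih h

lemma Amp.trigSum {A : ℕ → (Fin k → ℂ) → ℂ → ℂ} {a : PowerSeries (trigRing k)} (h : Amp A a)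
    (n : ℕ) : TrigSum n A :=
  .congr _ _ (.cos 0 (Nat.zero_le n) A a h (by simp)) fun N w _ s _ => by simp

lemma TrigSum.amp_mul {β : ℕ → (Fin k → ℂ) → ℂ → ℂ} {b : PowerSeries (trigRing k)}
    (hβ : Amp β b) (hF : TrigSum n F) : TrigSum n fun N w s => β N w s * F N w s := by
  induction hF with
  | cos m hm A a h ha =>
    exact .congr _ _ (.cos m hm _ _ (hβ.mul h) (ha.mul_left b)) fun N w _ s _ => by ring
  | sin m hm A a h ha =>
    exact .congr _ _ (.sin m hm _ _ (hβ.mul h) (ha.mul_left b)) fun N w _ s _ => by ring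
  | add F G _ _ h1 h2 => exact .congr _ _ (.add _ _ h1 h2) fun N w _ s _ => by ring
  | congr F G _ h ih =>
    exact .congr _ _ ih fun N w hw s hs => by rw [h N w hw s hs]

lemma TrigSum.zero : TrigSum n fun (_ : ℕ) (_ : Fin k → ℂ) (_ : ℂ) => (0 : ℂ) := by
  have := (amp_const (0 : trigRing k)).trigSum n
  simpa using this

lemma TrigSum.sum {ι : Type*} {F : ι → ℕ → (Fin k → ℂ) → ℂ → ℂ} (t : Finset ι)
    (h : ∀ i ∈ t, TrigSum n (F i)) : TrigSum n fun N w s => ∑ i ∈ t, F i N w s := by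
  classical
  induction t using Finset.induction_on with
  | empty => simpa using TrigSum.zero
  | insert i t hi ih =>
    simp only [Finset.sum_insert hi]
    exact .add _ _ (h i (Finset.mem_insert_self i t))
      (ih fun j hj => h j (Finset.mem_insert_of_mem hj))

lemma four_mul_succ (m : ℕ) (s : ℂ) :
    4 * ((m + 2 : ℕ) : ℂ) * s = 4 * ((m + 1 : ℕ) : ℂ) * s + 4 * s := by
  push_cast
  ring

lemma four_mul_pred (m : ℕ) (s : ℂ) :
    4 * (m : ℂ) * s = 4 * ((m + 1 : ℕ) : ℂ) * s - 4 * s := by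
  push_cast
  ring

lemma Amp.half_mul {A β : ℕ → (Fin k → ℂ) → ℂ → ℂ} {a b : PowerSeries (trigRing k)}
    (h : Amp A a) (hβ : Amp β b) (hb : PowerSeries.X ∣ b) {m : ℕ}
    (ha : PowerSeries.X ^ m ∣ a) : ∃ c : PowerSeries (trigRing k),
      Amp (fun N w s => ((1 / 2 : ℚ) : ℂ) * (A N w s * β N w s)) c ∧
        PowerSeries.X ^ (m + 1) ∣ c := by
  refine ⟨_, (h.mul hβ).smul (1 / 2), Dvd.dvd.mul_left ?_ _⟩
  rw [pow_succ]
  exact mul_dvd_mul ha hb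

/-- The product formula moves frequency m to m ± 1 (from 0 only to 1). Because the amplitude of the
new factor is divisible by X, the order stays at least the frequency: X^{m+1} suffices for m + 1 and
more than suffices for m - 1. -/
lemma TrigSum.mul_cos {β : ℕ → (Fin k → ℂ) → ℂ → ℂ} {b : PowerSeries (trigRing k)}
    (hβ : Amp β b) (hb : PowerSeries.X ∣ b) (hF : TrigSum n F) :
    TrigSum (n + 1) fun N w s => β N w s * Complex.cos (4 * s) * F N w s := by
  induction hF with
  | cos m hm A a h ha =>
    rcases m with _ | m
    · refine .congr _ _ (.cos 1 (by omega) _ _ (h.mul hβ) (by simpa using hb.mul_left a))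
        fun N w _ s _ => ?_
      simp
      ring
    · obtain ⟨c, hc, hcd⟩ := h.half_mul hβ hb ha
      refine .congr _ _ (.add _ _ (.cos (m + 2) (by omega) _ _ hc hcd)
        (.cos m (by omega) _ _ hc ((pow_dvd_pow _ (by omega)).trans hcd))) fun N w _ s _ => ?_
      rw [four_mul_succ m s, four_mul_pred m s, Complex.cos_add, Complex.cos_sub]
      push_cast
      ring
  | sin m hm A a h ha =>
    rcases m with _ | m
    · exact .congr _ _ .zero fun N w _ s _ => by simp
    · obtain ⟨c, hc, hcd⟩ := h.half_mul hβ hb ha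
      refine .congr _ _ (.add _ _ (.sin (m + 2) (by omega) _ _ hc hcd)
        (.sin m (by omega) _ _ hc ((pow_dvd_pow _ (by omega)).trans hcd))) fun N w _ s _ => ?_
      rw [four_mul_succ m s, four_mul_pred m s, Complex.sin_add, Complex.sin_sub]
      push_cast
      ring
  | add F G _ _ h1 h2 => exact .congr _ _ (.add _ _ h1 h2) fun N w _ s _ => by ring
  | congr F G _ h ih =>
    exact .congr _ _ ih fun N w hw s hs => by rw [h N w hw s hs]

lemma TrigSum.mul_sin {β : ℕ → (Fin k → ℂ) → ℂ → ℂ} {b : PowerSeries (trigRing k)}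
    (hβ : Amp β b) (hb : PowerSeries.X ∣ b) (hF : TrigSum n F) :
    TrigSum (n + 1) fun N w s => β N w s * Complex.sin (4 * s) * F N w s := by
  induction hF with
  | cos m hm A a h ha =>
    rcases m with _ | m
    · refine .congr _ _ (.sin 1 (by omega) _ _ (h.mul hβ) (by simpa using hb.mul_left a))
        fun N w _ s _ => ?_
      simp
      ring
    · obtain ⟨c, hc, hcd⟩ := h.half_mul hβ hb ha
      refine .congr _ _ (.add _ _ (.sin (m + 2) (by omega) _ _ hc hcd)
        (.sin m (by omega) _ _ hc.neg
          (((pow_dvd_pow _ (by omega)).trans hcd).neg_right))) fun N w _ s _ => ?_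
      rw [four_mul_succ m s, four_mul_pred m s, Complex.sin_add, Complex.sin_sub]
      push_cast
      ring
  | sin m hm A a h ha =>
    rcases m with _ | m
    · exact .congr _ _ .zero fun N w _ s _ => by simp
    · obtain ⟨c, hc, hcd⟩ := h.half_mul hβ hb ha
      refine .congr _ _ (.add _ _ (.cos (m + 2) (by omega) _ _ hc.neg hcd.neg_right)
        (.cos m (by omega) _ _ hc ((pow_dvd_pow _ (by omega)).trans hcd))) fun N w _ s _ => ?_
      rw [four_mul_succ m s, four_mul_pred m s, Complex.cos_add, Complex.cos_sub]
      push_cast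
      ring
  | add F G _ _ h1 h2 => exact .congr _ _ (.add _ _ h1 h2) fun N w _ s _ => by ring
  | congr F G _ h ih =>
    exact .congr _ _ ih fun N w hw s hs => by rw [h N w hw s hs]

/-- A trigonometric sum of degree one whose oscillating amplitudes start in degree one. -/
def IsFactor (G : ℕ → (Fin k → ℂ) → ℂ → ℂ) : Prop :=
  ∃ (α β γ : ℕ → (Fin k → ℂ) → ℂ → ℂ) (a b c : PowerSeries (trigRing k)),
    Amp α a ∧ Amp β b ∧ Amp γ c ∧ PowerSeries.X ∣ b ∧ PowerSeries.X ∣ c ∧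
    ∀ N w s, G N w s = α N w s + β N w s * Complex.cos (4 * s) + γ N w s * Complex.sin (4 * s)

lemma TrigSum.mul_factor (hG : IsFactor G) (hF : TrigSum n F) :
    TrigSum (n + 1) fun N w s => G N w s * F N w s := by
  obtain ⟨α, β, γ, a, b, c, ha, hb, hc, hbd, hcd, h⟩ := hG
  refine .congr _ _ (.add _ _ ((hF.amp_mul ha).mono (Nat.le_succ n))
    (.add _ _ (hF.mul_cos hb hbd) (hF.mul_sin hc hcd))) fun N w _ s _ => ?_
  rw [h]
  ring

lemma TrigSum.prod {ι : Type*} (t : Finset ι) {G : ι → ℕ → (Fin k → ℂ) → ℂ → ℂ}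
    (h : ∀ i ∈ t, IsFactor (G i)) : TrigSum t.card fun N w s => ∏ i ∈ t, G i N w s := by
  classical
  induction t using Finset.induction_on with
  | empty => simpa using (amp_const (1 : trigRing k)).trigSum 0
  | insert i t hi ih =>
    simp only [Finset.prod_insert hi, Finset.card_insert_of_notMem hi]
    exact (ih fun j hj => h j (Finset.mem_insert_of_mem hj)).mul_factor
      (h i (Finset.mem_insert_self i t))

lemma amp_zero : Amp (fun (_ : ℕ) (_ : Fin k → ℂ) (_ : ℂ) => (0 : ℂ)) 0 := by
  have := amp_const (0 : trigRing k)
  rw [map_zero] at this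
  exact this

/-- The amplitudes of a trigonometric sum. -/
lemma TrigSum.exists_amplitudes (hF : TrigSum n F) :
    ∃ (A B : ℕ → ℕ → (Fin k → ℂ) → ℂ → ℂ) (a b : ℕ → PowerSeries (trigRing k)),
      (∀ m, Amp (A m) (a m) ∧ Amp (B m) (b m) ∧ PowerSeries.X ^ m ∣ a m ∧
        PowerSeries.X ^ m ∣ b m) ∧
      ∀ N, ∀ w ∈ sepSet k N, ∀ s ∈ Complex.slitPlane, F N w s =
        ∑ m ∈ Finset.range (n + 1), (A m N w s * Complex.cos (4 * m * s) +
          B m N w s * Complex.sin (4 * m * s)) := by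
  induction hF with
  | cos m hm A a h ha =>
    refine ⟨fun m' => if m' = m then A else fun _ _ _ => 0, fun _ _ _ _ => 0,
      fun m' => if m' = m then a else 0, fun _ => 0, fun m' => ?_, fun N w _ s _ => ?_⟩
    · by_cases hmm : m' = m
      · subst hmm
        simpa using ⟨h, amp_zero, ha⟩
      · simpa [hmm] using amp_zero
    · rw [Finset.sum_eq_single m]
      · simp
      · intro m' _ hmm
        simp [hmm]
      · intro hmm
        exact absurd (Finset.mem_range.2 (Nat.lt_succ_of_le hm)) hmm
  | sin m hm A a h ha =>
    refine ⟨fun _ _ _ _ => 0, fun m' => if m' = m then A else fun _ _ _ => 0,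
      fun _ => 0, fun m' => if m' = m then a else 0, fun m' => ?_, fun N w _ s _ => ?_⟩
    · by_cases hmm : m' = m
      · subst hmm
        simpa using ⟨amp_zero, h, ha⟩
      · simpa [hmm] using amp_zero
    · rw [Finset.sum_eq_single m]
      · simp
      · intro m' _ hmm
        simp [hmm]
      · intro hmm
        exact absurd (Finset.mem_range.2 (Nat.lt_succ_of_le hm)) hmm
  | add F G _ _ h1 h2 =>
    obtain ⟨A, B, a, b, h, hF⟩ := h1
    obtain ⟨A', B', a', b', h', hG⟩ := h2
    refine ⟨_, _, _, _, fun m => ⟨(h m).1.add (h' m).1, (h m).2.1.add (h' m).2.1,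
      dvd_add (h m).2.2.1 (h' m).2.2.1, dvd_add (h m).2.2.2 (h' m).2.2.2⟩,
      fun N w hw s hs => ?_⟩
    change F N w s + G N w s = _
    rw [hF N w hw s hs, hG N w hw s hs, ← Finset.sum_add_distrib]
    refine Finset.sum_congr rfl fun m _ => ?_
    ring
  | congr F G _ h ih =>
    obtain ⟨A, B, a, b, h', hF⟩ := ih
    exact ⟨A, B, a, b, h', fun N w hw s hs => by rw [← h N w hw s hs, hF N w hw s hs]⟩

end

end

/-! ### Cauchy's formula on a torus for functions with removable singularities at collisions. -/

section

/-- Riemann's criterion (x - c) g(x) → 0 makes the finitely many interior singularities removable,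
and the circle does not meet them. -/
lemma circle_cauchy_removable {g : ℂ → ℂ} {R : ℝ} (S : Finset ℂ) {z : ℂ} (hz : ‖z‖ < R)
    (hzS : z ∉ S) (hd : ∀ x, ‖x‖ ≤ R → x ∉ S → DifferentiableAt ℂ g x)
    (hS : ∀ c ∈ S, Tendsto (fun x => (x - c) * g x) (𝓝[≠] c) (𝓝 0)) (hSb : ∀ c ∈ S, ‖c‖ < R) :
    (2 * Real.pi * Complex.I)⁻¹ * ∮ x in C(0, R), (x - z)⁻¹ * g x = g z := by
  have hR : 0 < R := (norm_nonneg z).trans_lt hz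
  -- Punctured limits replace the arbitrary values of g on S and leave g unchanged elsewhere on the
  -- disc.
  set G : ℂ → ℂ := fun x => limUnder (𝓝[≠] x) g with hG
  have hGg : ∀ x, ‖x‖ ≤ R → x ∉ S → G x = g x := fun x hx hxS =>
    ((hd x hx hxS).continuousAt.tendsto.mono_left nhdsWithin_le_nhds).limUnder_eq
  have hev : ∀ x, ‖x‖ < R → ∀ᶠ y in 𝓝[≠] x, ‖y‖ < R ∧ y ∉ S := by
    intro x hx
    have h1 : ∀ᶠ y in 𝓝[≠] x, ‖y‖ < R :=
      (continuous_norm.continuousAt.eventually_lt continuousAt_const hx).filter_mono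
        nhdsWithin_le_nhds
    have h2 : ∀ᶠ y in 𝓝[≠] x, y ∉ S := by
      have : (↑(S.erase x) : Set ℂ)ᶜ ∈ 𝓝 x :=
        (S.erase x).finite_toSet.isClosed.isOpen_compl.mem_nhds (by simp)
      filter_upwards [nhdsWithin_le_nhds this, self_mem_nhdsWithin] with y hy hyx hyS
      exact hy (Finset.mem_coe.2 (Finset.mem_erase.2 ⟨hyx, hyS⟩))
    exact h1.and h2
  have hSlim : ∀ c ∈ S, Tendsto g (𝓝[≠] c) (𝓝 (G c)) := by
    intro c hc
    refine Complex.tendsto_limUnder_of_differentiable_on_punctured_nhds_of_isLittleO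
      ((hev c (hSb c hc)).mono fun y hy => hd y hy.1.le hy.2) ?_
    have h1 : Tendsto (fun x => (g x - g c) / (x - c)⁻¹) (𝓝[≠] c) (𝓝 0) := by
      have h2 : Tendsto (fun x : ℂ => (x - c) * g c) (𝓝[≠] c) (𝓝 0) := by
        have : Tendsto (fun x : ℂ => (x - c) * g c) (𝓝 c) (𝓝 ((c - c) * g c)) :=
          Continuous.tendsto (by fun_prop) c
        rw [sub_self, zero_mul] at this
        exact this.mono_left nhdsWithin_le_nhds
      have h3 := (hS c hc).sub h2
      rw [sub_zero] at h3
      refine h3.congr fun x => ?_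
      rw [div_inv_eq_mul]
      ring
    refine (isLittleO_iff_tendsto' ?_).2 h1
    filter_upwards [self_mem_nhdsWithin] with x hx h0
    exact absurd (inv_eq_zero.1 h0) (sub_ne_zero.2 hx)
  have hopen : ∀ x, ‖x‖ < R → x ∉ S → G =ᶠ[𝓝 x] g := by
    intro x hx hxS
    have h1 : {y : ℂ | ‖y‖ < R} ∈ 𝓝 x :=
      (isOpen_lt continuous_norm continuous_const).mem_nhds hx
    have h2 : (↑S : Set ℂ)ᶜ ∈ 𝓝 x := S.finite_toSet.isClosed.isOpen_compl.mem_nhds (by simpa)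
    filter_upwards [h1, h2] with y hy hyS
    exact hGg y (le_of_lt hy) (by simpa using hyS)
  have hcont : ContinuousOn G (Metric.closedBall 0 R) := by
    intro x hx
    rw [mem_closedBall_zero_iff] at hx
    by_cases hxS : x ∈ S
    · refine ContinuousAt.continuousWithinAt ?_
      have h1 : Tendsto G (𝓝[≠] x) (𝓝 (G x)) :=
        (hSlim x hxS).congr' ((hev x (hSb x hxS)).mono fun y hy => (hGg y hy.1.le hy.2).symm)
      exact continuousAt_iff_punctured_nhds.2 h1
    · have h2 : (↑S : Set ℂ)ᶜ ∈ 𝓝 x := S.finite_toSet.isClosed.isOpen_compl.mem_nhds (by simpa)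
      refine (hd x hx hxS).continuousAt.continuousWithinAt.congr_of_eventuallyEq ?_ (hGg x hx hxS)
      filter_upwards [self_mem_nhdsWithin, nhdsWithin_le_nhds h2] with y hy hyS
      exact hGg y (by simpa using hy) (by simpa using hyS)
  have key := Complex.two_pi_I_inv_smul_circleIntegral_sub_inv_smul_of_differentiable_on_off_countable
    (S.finite_toSet.countable) (by simpa using hz : z ∈ Metric.ball 0 R) hcont fun x hx => by
      have hx1 : ‖x‖ < R := by simpa using hx.1
      have hx2 : x ∉ S := by simpa using hx.2
      exact ((hd x hx1.le hx2).congr_of_eventuallyEq (hopen x hx1 hx2))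
  rw [hGg z hz.le hzS] at key
  rw [← key, smul_eq_mul]
  congr 1
  refine circleIntegral.integral_congr hR.le fun x hx => ?_
  have hx1 : ‖x‖ = R := by simpa using hx
  have hx2 : x ∉ S := fun h => (hSb x h).ne hx1
  simp only [smul_eq_mul]
  rw [hGg x hx1.le hx2]

/-- The Cauchy kernel of a polydisc. -/
def cauchyKernel {n : ℕ} (w ζ : Fin n → ℂ) : ℂ := ∏ i, (ζ i - w i)⁻¹

/-- The Cauchy integral over a torus. -/
def torusCauchy {n : ℕ} (r : Fin n → ℝ) (f : (Fin n → ℂ) → ℂ) (w : Fin n → ℂ) : ℂ :=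
  ((2 * Real.pi * Complex.I) ^ n)⁻¹ * torusIntegral (fun ζ => cauchyKernel w ζ * f ζ) 0 r

/-- The distinguished boundary of a polydisc. -/
def torusSet {n : ℕ} (r : Fin n → ℝ) : Set (Fin n → ℂ) := {ζ | ∀ i, ‖ζ i‖ = r i}

section
variable {n : ℕ} {r : Fin n → ℝ} {f g : (Fin n → ℂ) → ℂ} {w : Fin n → ℂ}

lemma torusMap_mem (hr : ∀ i, 0 < r i) (θ : Fin n → ℝ) : torusMap 0 r θ ∈ torusSet r := by
  intro i
  rw [torusMap, Pi.zero_apply, zero_add, norm_mul, Complex.norm_exp_ofReal_mul_I, mul_one,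
    Complex.norm_real, Real.norm_of_nonneg (hr i).le]

lemma continuous_torusMap : Continuous (torusMap 0 r) := by
  unfold torusMap
  fun_prop

lemma continuousOn_cauchyKernel (hw : ∀ i, ‖w i‖ < r i) :
    ContinuousOn (cauchyKernel w) (torusSet r) := by
  unfold cauchyKernel
  refine continuousOn_finsetProd _ fun i _ => ContinuousOn.inv₀ (by fun_prop) fun ζ hζ h => ?_
  have := hζ i
  rw [sub_eq_zero.1 h] at this
  exact (hw i).ne this

lemma torusIntegrable_of_continuousOn (hr : ∀ i, 0 < r i) (hf : ContinuousOn f (torusSet r)) :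
    TorusIntegrable f 0 r :=
  (hf.comp_continuous continuous_torusMap (torusMap_mem hr)).continuousOn.integrableOn_compact
    isCompact_Icc

lemma torusCauchy_add (hr : ∀ i, 0 < r i) (hw : ∀ i, ‖w i‖ < r i)
    (hf : ContinuousOn f (torusSet r)) (hg : ContinuousOn g (torusSet r)) :
    torusCauchy r (fun ζ => f ζ + g ζ) w = torusCauchy r f w + torusCauchy r g w := by
  have hk := continuousOn_cauchyKernel hw
  have := torusIntegral_add (torusIntegrable_of_continuousOn hr (hk.mul hf))
    (torusIntegrable_of_continuousOn hr (hk.mul hg))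
  simp only [Pi.mul_apply] at this
  rw [torusCauchy, torusCauchy, torusCauchy, ← mul_add, ← this]
  simp only [mul_add]

lemma torusCauchy_const_mul (a : ℂ) :
    torusCauchy r (fun ζ => a * f ζ) w = a * torusCauchy r f w := by
  have := torusIntegral_const_mul a (fun ζ => cauchyKernel w ζ * f ζ) 0 r
  rw [torusCauchy, torusCauchy, mul_left_comm a, ← this]
  simp only [mul_left_comm a]

lemma torusCauchy_mul_const (a : ℂ) :
    torusCauchy r (fun ζ => f ζ * a) w = torusCauchy r f w * a := by
  rw [mul_comm, ← torusCauchy_const_mul]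
  simp only [mul_comm]

lemma torusCauchy_sum (hr : ∀ i, 0 < r i) (hw : ∀ i, ‖w i‖ < r i) {ι : Type*} (t : Finset ι)
    {F : ι → (Fin n → ℂ) → ℂ} (hF : ∀ i ∈ t, ContinuousOn (F i) (torusSet r)) :
    torusCauchy r (fun ζ => ∑ i ∈ t, F i ζ) w = ∑ i ∈ t, torusCauchy r (F i) w := by
  classical
  induction t using Finset.induction_on with
  | empty =>
    have := torusCauchy_const_mul (r := r) (f := fun _ => 0) (w := w) 0
    simpa using this
  | insert i t hi ih =>
    simp only [Finset.sum_insert hi]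
    rw [torusCauchy_add hr hw (hF i (Finset.mem_insert_self i t))
      (continuousOn_finsetSum _ fun j hj => hF j (Finset.mem_insert_of_mem hj)),
      ih fun j hj => hF j (Finset.mem_insert_of_mem hj)]

lemma torusCauchy_congr (hr : ∀ i, 0 < r i) (h : ∀ ζ ∈ torusSet r, f ζ = g ζ) :
    torusCauchy r f w = torusCauchy r g w := by
  rw [torusCauchy, torusCauchy, torusIntegral, torusIntegral]
  simp only [h _ (torusMap_mem hr _)]

lemma exists_norm_torusCauchy_le (hr : ∀ i, 0 < r i) (hw : ∀ i, ‖w i‖ < r i) :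
    ∃ M : ℝ, ∀ (f : (Fin n → ℂ) → ℂ) (C : ℝ), (∀ ζ ∈ torusSet r, ‖f ζ‖ ≤ C) →
      ‖torusCauchy r f w‖ ≤ M * C := by
  have hb : ∀ ζ ∈ torusSet r, ‖cauchyKernel w ζ‖ ≤ ∏ i, (r i - ‖w i‖)⁻¹ := by
    intro ζ hζ
    rw [cauchyKernel, norm_prod]
    refine Finset.prod_le_prod (fun _ _ => norm_nonneg _) fun i _ => ?_
    rw [norm_inv]
    refine inv_anti₀ (sub_pos.2 (hw i)) ?_
    rw [← hζ i]
    exact norm_sub_norm_le _ _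
  refine ⟨‖((2 * Real.pi * Complex.I) ^ n)⁻¹‖ * (((2 * Real.pi) ^ n * ∏ i, |r i|) *
    ∏ i, (r i - ‖w i‖)⁻¹), fun f C hf => ?_⟩
  rw [torusCauchy, norm_mul, mul_assoc, mul_assoc]
  refine mul_le_mul_of_nonneg_left ?_ (norm_nonneg _)
  rw [mul_assoc]
  refine norm_torusIntegral_le_of_norm_le_const fun θ => ?_
  have hm := torusMap_mem hr θ
  rw [norm_mul]
  exact mul_le_mul (hb _ hm) (hf _ hm) (norm_nonneg _) (Finset.prod_nonneg fun i _ =>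
    inv_nonneg.2 (sub_pos.2 (hw i)).le)

lemma continuousOn_torusCauchy (hr : ∀ i, 0 < r i) (hf : ContinuousOn f (torusSet r)) :
    ContinuousOn (torusCauchy r f) {w | ∀ i, ‖w i‖ < r i} := by
  have hopen : IsOpen {w : Fin n → ℂ | ∀ i, ‖w i‖ < r i} := by
    have : {w : Fin n → ℂ | ∀ i, ‖w i‖ < r i} = ⋂ i, {w | ‖w i‖ < r i} := by
      ext w
      simp
    rw [this]
    exact isOpen_iInter_of_finite fun i => isOpen_lt (by fun_prop) continuous_const
  have := hopen.locallyCompactSpace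
  rw [continuousOn_iff_continuous_domRestrict]
  unfold Set.domRestrict torusCauchy torusIntegral
  refine continuous_const.mul ?_
  refine continuous_parametric_integral_of_continuous ?_ isCompact_Icc
  have h1 : Continuous fun p : {w : Fin n → ℂ | ∀ i, ‖w i‖ < r i} × (Fin n → ℝ) =>
      cauchyKernel p.1.1 (torusMap 0 r p.2) := by
    unfold cauchyKernel
    refine continuous_finsetProd _ fun i _ => Continuous.inv₀ ?_ fun p h => ?_
    · exact ((continuous_apply i).comp (continuous_torusMap.comp continuous_snd)).sub
        ((continuous_apply i).comp (continuous_subtype_val.comp continuous_fst))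
    · have := torusMap_mem hr p.2 i
      rw [sub_eq_zero.1 h] at this
      exact (p.1.2 i).ne this
  have h2 : Continuous fun p : {w : Fin n → ℂ | ∀ i, ‖w i‖ < r i} × (Fin n → ℝ) =>
      f (torusMap 0 r p.2) :=
    hf.comp_continuous (continuous_torusMap.comp continuous_snd) fun p => torusMap_mem hr p.2
  have h3 : Continuous fun p : {w : Fin n → ℂ | ∀ i, ‖w i‖ < r i} × (Fin n → ℝ) =>
      (∏ i, (r i : ℂ) * Complex.exp (p.2 i * Complex.I) * Complex.I) := by fun_prop
  exact h3.smul (h1.mul h2)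

/-- The function is holomorphic in each variable away from collisions of that variable with the
others, where its singularities are removable. -/
def IsGoodOn (r : Fin n → ℝ) (f : (Fin n → ℂ) → ℂ) : Prop :=
  ∀ u : Fin n → ℂ, Function.Injective u → (∀ j, ‖u j‖ ≤ r j) → ∀ i,
    (∀ x, ‖x‖ ≤ r i → (∀ j, j ≠ i → x ≠ u j) →
      DifferentiableAt ℂ (fun x => f (Function.update u i x)) x) ∧
    ∀ j, j ≠ i → Tendsto (fun x => (x - u j) * f (Function.update u i x)) (𝓝[≠] (u j)) (𝓝 0)

end

/-- A first coordinate on the largest circle cannot collide with the others, which stay in smaller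
discs. -/
lemma IsGoodOn.cons {n : ℕ} {r : Fin (n + 1) → ℝ} {f : (Fin (n + 1) → ℂ) → ℂ}
    (hra : StrictAnti r) (hf : IsGoodOn r f) {x : ℂ} (hx : ‖x‖ = r 0) :
    IsGoodOn (r ∘ Fin.succ) fun y => f (Fin.cons x y) := by
  intro u hu hur i
  have hlt : ∀ j : Fin n, r j.succ < r 0 := fun j => hra (Fin.succ_pos j)
  have hxu : ∀ j, u j ≠ x := fun j h => by
    have := hur j
    rw [h, hx] at this
    exact absurd this (not_le.2 (hlt j))
  have hinj : Function.Injective (Fin.cons x u : Fin (n + 1) → ℂ) :=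
    Fin.cons_injective_iff.2 ⟨fun ⟨j, hj⟩ => hxu j hj, hu⟩
  obtain ⟨h1, h2⟩ := hf (Fin.cons x u) hinj
    (fun j => Fin.cases (by simpa using hx.le) (fun j => by simpa using hur j) j) i.succ
  simp only [Fin.cons_update]
  refine ⟨fun y hy hyu => h1 y hy fun j => ?_, fun j hj => ?_⟩
  · refine Fin.cases (fun _ => ?_) (fun j hj => ?_) j
    · rw [Fin.cons_zero]
      rintro rfl
      rw [hx] at hy
      exact absurd hy (not_le.2 (hlt i))
    · rw [Fin.cons_succ]
      exact hyu j fun h => hj (h ▸ rfl)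
  · have := h2 j.succ fun h => hj (Fin.succ_injective _ h)
    simpa only [Fin.cons_succ] using this

/-- One variable at a time. In the inner integrals the first variable is frozen on the largest
circle and causes no collision; in the outer integral the other entries of w are removable
singularities strictly inside the circle. This is why the radii are strictly decreasing. -/
lemma torusCauchy_eq {n : ℕ} : ∀ {r : Fin n → ℝ} {f : (Fin n → ℂ) → ℂ} {w : Fin n → ℂ},
    StrictAnti r → (∀ i, 0 < r i) → ContinuousOn f (torusSet r) → IsGoodOn r f →
    Function.Injective w → (∀ i, ‖w i‖ < r i) → torusCauchy r f w = f w := by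
  induction n with
  | zero =>
    intro r f w _ _ _ _ _ _
    rw [torusCauchy, torusIntegral_dim0]
    simp [cauchyKernel, Subsingleton.elim w 0]
  | succ n ih =>
    intro r f w hra hr hfc hf hw hwr
    have hlt : ∀ j : Fin n, r j.succ < r 0 := fun j => hra (Fin.succ_pos j)
    have hti : TorusIntegrable (fun ζ => cauchyKernel w ζ * f ζ) 0 r :=
      torusIntegrable_of_continuousOn hr ((continuousOn_cauchyKernel hwr).mul hfc)
    have hwcons : ∀ x, Function.update w 0 x = Fin.cons x (w ∘ Fin.succ) := fun x => by
      conv_lhs => rw [← Fin.cons_self_tail w, Fin.update_cons_zero]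
      rfl
    have hcons : ∀ x, ‖x‖ = r 0 → ∀ y, y ∈ torusSet (r ∘ Fin.succ) →
        (Fin.cons x y : Fin (n + 1) → ℂ) ∈ torusSet r := fun x hx y hy j =>
      Fin.cases (by simpa using hx) (fun j => by simpa using hy j) j
    have hinner : ∀ x, ‖x‖ = r 0 →
        torusIntegral (fun y => cauchyKernel w (Fin.cons x y) * f (Fin.cons x y)) 0
          (r ∘ Fin.succ) = (2 * Real.pi * Complex.I) ^ n *
            ((x - w 0)⁻¹ * f (Function.update w 0 x)) := by
      intro x hx
      have h1 := ih (r := r ∘ Fin.succ) (f := fun y => f (Fin.cons x y)) (w := w ∘ Fin.succ)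
        (fun a b hab => hra (Fin.succ_lt_succ_iff.2 hab)) (fun i => hr _)
        (hfc.comp (by fun_prop) fun y hy => hcons x hx y hy) (hf.cons hra hx)
        (hw.comp (Fin.succ_injective n)) fun i => hwr _
      rw [hwcons, ← h1, torusCauchy, ← torusIntegral_const_mul, ← torusIntegral_const_mul,
        ← torusIntegral_const_mul]
      congr 1
      funext y
      have h2 : cauchyKernel w (Fin.cons x y) =
          (x - w 0)⁻¹ * cauchyKernel (w ∘ Fin.succ) y := by
        rw [cauchyKernel, cauchyKernel, Fin.prod_univ_succ]
        simp
      have h3 : (2 * Real.pi * Complex.I) ^ n ≠ 0 :=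
        pow_ne_zero _ Complex.two_pi_I_ne_zero
      rw [h2]
      field_simp
    rw [torusCauchy, torusIntegral_succ hti]
    have h4 : (∮ x in C((0 : Fin (n + 1) → ℂ) 0, r 0),
        torusIntegral (fun y => cauchyKernel w (Fin.cons x y) * f (Fin.cons x y))
          ((0 : Fin (n + 1) → ℂ) ∘ Fin.succ) (r ∘ Fin.succ)) =
        (2 * Real.pi * Complex.I) ^ n *
          ∮ x in C(0, r 0), (x - w 0)⁻¹ * f (Function.update w 0 x) := by
      rw [← circleIntegral.integral_const_mul]
      refine circleIntegral.integral_congr (hr 0).le fun x hx => ?_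
      exact hinner x (by simpa using hx)
    rw [h4]
    obtain ⟨g1, g2⟩ := hf w hw (fun j => (hwr j).le) 0
    have h5 := circle_cauchy_removable (g := fun x => f (Function.update w 0 x)) (R := r 0)
      (Finset.univ.image fun j : Fin n => w j.succ) (z := w 0) (hwr 0)
      (by simpa using fun j h => absurd (hw h) (Fin.succ_ne_zero j))
      (fun x hx hxS => g1 x hx fun j hj => by
        obtain ⟨j', rfl⟩ := Fin.exists_succ_eq.2 hj
        rintro rfl
        exact hxS (Finset.mem_image_of_mem (fun j : Fin n => w j.succ) (Finset.mem_univ j')))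
      (fun c hc => by
        obtain ⟨j, _, rfl⟩ := Finset.mem_image.1 hc
        exact g2 j.succ (Fin.succ_ne_zero j))
      fun c hc => by
        obtain ⟨j, _, rfl⟩ := Finset.mem_image.1 hc
        exact (hwr _).trans (hlt j)
    rw [Function.update_eq_self] at h5
    rw [← h5, pow_succ]
    have h3 : (2 * Real.pi * Complex.I) ^ n ≠ 0 := pow_ne_zero _ Complex.two_pi_I_ne_zero
    have h6 := Complex.two_pi_I_ne_zero
    field_simp

end

/-! ### Extension of the expansions to the diagonals. -/

section

/-- The Cauchy integral is linear and bounded for the supremum norm on the torus, so it preserves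
expansions that are uniform there. -/
lemma UExp.torusCauchy {n : ℕ} {r : Fin n → ℝ} {w : Fin n → ℂ} (hr : ∀ i, 0 < r i)
    (hw : ∀ i, ‖w i‖ < r i) {f : (Fin n → ℂ) → ℂ → ℂ} {c : ℕ → (Fin n → ℂ) → ℂ}
    (hu : UExp (torusSet r) f c)
    (hf : ∀ s ∈ Complex.slitPlane, ContinuousOn (fun ζ => f ζ s) (torusSet r))
    (hc : ∀ d, ContinuousOn (c d) (torusSet r)) :
    UExp (Set.univ : Set Unit) (fun _ s => P1Points.torusCauchy r (fun ζ => f ζ s) w)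
      (fun d _ => P1Points.torusCauchy r (c d) w) := by
  intro δ hδ N
  obtain ⟨C, hC⟩ := hu δ hδ N
  obtain ⟨M, hM⟩ := exists_norm_torusCauchy_le hr hw
  refine ⟨M * C, fun _ _ s hs => ?_⟩
  have hsl := sector_subset_slitPlane hδ hs
  have h1 := hM (fun ζ => f ζ s + -1 * ∑ d ∈ Finset.range N, c d ζ * (s ^ d)⁻¹)
    (C * (‖s‖ ^ N)⁻¹) fun ζ hζ => by
      rw [neg_one_mul, ← sub_eq_add_neg]
      exact hC ζ hζ s hs
  have hc' : ∀ d ∈ Finset.range N, ContinuousOn (fun ζ => c d ζ * (s ^ d)⁻¹) (torusSet r) :=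
    fun d _ => (hc d).mul continuousOn_const
  rw [torusCauchy_add hr hw (hf s hsl) (continuousOn_const.fun_mul (continuousOn_finsetSum _ hc')),
    torusCauchy_const_mul, torusCauchy_sum hr hw _ hc', neg_one_mul, ← sub_eq_add_neg] at h1
  simp only [torusCauchy_mul_const] at h1
  rw [mul_assoc]
  exact h1

variable {k : ℕ}

/-- Along w_i + t·i only finitely many values of t produce a coincidence. -/
lemma dense_injSet : Dense (injSet k) := by
  intro w
  have hne : ∀ a : ℂ, ∀ᶠ t in 𝓝[≠] (0 : ℂ), t ≠ a := fun a => by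
    by_cases h : a = 0
    · rw [h]
      exact self_mem_nhdsWithin
    · exact (isOpen_ne.mem_nhds (Ne.symm h) : {t : ℂ | t ≠ a} ∈ 𝓝 0) |> fun h =>
        nhdsWithin_le_nhds h
  have hev : ∀ᶠ t in 𝓝[≠] (0 : ℂ), (fun i : Fin k => w i + t * (i : ℂ)) ∈ injSet k := by
    have : ∀ᶠ t in 𝓝[≠] (0 : ℂ), ∀ i j : Fin k, t ≠ (w i - w j) / ((j : ℂ) - (i : ℂ)) :=
      eventually_all.2 fun i => eventually_all.2 fun j => hne _
    filter_upwards [this] with t ht i j hij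
    by_contra hne
    have h0 : ((j : ℕ) : ℂ) - ((i : ℕ) : ℂ) ≠ 0 := by
      rw [sub_ne_zero]
      exact fun h => hne (Fin.ext (by exact_mod_cast h.symm))
    refine ht i j ?_
    rw [eq_div_iff h0]
    simp only at hij
    linear_combination -hij
  have hlim : Tendsto (fun t : ℂ => fun i : Fin k => w i + t * (i : ℂ)) (𝓝[≠] 0) (𝓝 w) := by
    have h : Continuous fun t : ℂ => fun i : Fin k => w i + t * (i : ℂ) := by fun_prop
    have h2 := h.tendsto 0
    simp only [zero_mul, add_zero] at h2
    exact h2.mono_left nhdsWithin_le_nhds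
  exact mem_closure_of_tendsto hlim hev

lemma neBot_nhdsWithin_injSet (w : Fin k → ℂ) : (𝓝[injSet k] w).NeBot :=
  mem_closure_iff_nhdsWithin_neBot.1 (dense_injSet w)

lemma continuous_aeval {X σ : Type*} [TopologicalSpace X] {g : X → σ → ℂ}
    (hg : ∀ i, Continuous fun x => g x i) (Q : MvPolynomial σ ℚ) :
    Continuous fun x => MvPolynomial.aeval (g x) Q := by
  induction Q using MvPolynomial.induction_on with
  | C a => simp [continuous_const]
  | add p q hp hq => simpa using hp.fun_add hq
  | mul_X p i hp => simpa using hp.fun_mul (hg i)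

/-- A function rational in the `w_i` and polynomial in the `sin (π w_i)` and `cos (π w_i)`. -/
def IsRatTrig (h : (Fin k → ℂ) → ℂ) : Prop :=
  ∃ (P : MvPolynomial (Fin k ⊕ (Fin k ⊕ Fin k)) ℚ) (Q : MvPolynomial (Fin k) ℚ), Q ≠ 0 ∧
    ∀ w, MvPolynomial.aeval w Q * h w = MvPolynomial.aeval (trigPt w) P

lemma isRatTrig_of_eqOn {f : (Fin k → ℂ) → ℂ} (hf : Continuous f) (h : trigRing k)
    (hfh : ∀ w ∈ injSet k, f w = h.1 w) : IsRatTrig f := by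
  obtain ⟨P, Q, hQ, hPQ⟩ := h.2.2
  refine ⟨P, Q, hQ, fun w => ?_⟩
  have h1 : Continuous fun w : Fin k → ℂ => MvPolynomial.aeval w Q * f w :=
    (continuous_aeval (fun i => continuous_apply i) Q).mul hf
  have h2 : Continuous fun w : Fin k → ℂ => MvPolynomial.aeval (trigPt w) P := by
    refine continuous_aeval (fun i => ?_) P
    rcases i with i | i | i
    · exact continuous_apply i
    · show Continuous fun w : Fin k → ℂ => Complex.sin (Real.pi * w i)
      fun_prop
    · show Continuous fun w : Fin k → ℂ => Complex.cos (Real.pi * w i)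
      fun_prop
  exact congrFun (h1.ext_on dense_injSet h2 fun w hw => by
    simp only
    rw [hfh w hw, hPQ w hw]) w

/-- Strictly decreasing radii. -/
def stdRadii (k ρ : ℕ) (i : Fin k) : ℝ := ρ + (k - (i : ℕ))

lemma stdRadii_pos (ρ : ℕ) (i : Fin k) : 0 < stdRadii k ρ i := by
  have h1 : ((i : ℕ) : ℝ) < k := by exact_mod_cast i.2
  have h2 : (0 : ℝ) ≤ ρ := Nat.cast_nonneg ρ
  rw [stdRadii]
  linarith

lemma lt_stdRadii {ρ : ℕ} {x : ℝ} (hx : x < ρ) (i : Fin k) : x < stdRadii k ρ i := by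
  have h1 : ((i : ℕ) : ℝ) < k := by exact_mod_cast i.2
  rw [stdRadii]
  linarith

lemma strictAnti_stdRadii (ρ : ℕ) : StrictAnti (stdRadii k ρ) := by
  intro i j hij
  have : ((i : ℕ) : ℝ) < ((j : ℕ) : ℝ) := by exact_mod_cast hij
  rw [stdRadii, stdRadii]
  linarith

/-- Distinct radii differ by at least 1, so on the torus the entries are uniformly separated and the
expansions for distinct arguments hold uniformly. -/
lemma torusSet_subset_sepSet (ρ : ℕ) : torusSet (stdRadii k ρ) ⊆ sepSet k (ρ + k) := by
  intro ζ hζ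
  refine ⟨fun i => ?_, fun i j hij => ?_⟩
  · have : (0 : ℝ) ≤ (i : ℕ) := Nat.cast_nonneg _
    rw [hζ i, stdRadii]
    push_cast
    linarith
  · have h1 := abs_norm_sub_norm_le (ζ i) (ζ j)
    rw [hζ i, hζ j, stdRadii, stdRadii] at h1
    have h2 : (1 : ℝ) ≤ |((j : ℕ) : ℝ) - ((i : ℕ) : ℝ)| := by
      have h3 : (1 : ℤ) ≤ |((j : ℕ) : ℤ) - ((i : ℕ) : ℤ)| :=
        Int.one_le_abs (sub_ne_zero.2 fun h => hij (Fin.ext (by exact_mod_cast h.symm)))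
      exact_mod_cast h3
    have h4 : (((ρ + k : ℕ) : ℝ) + 1)⁻¹ ≤ 1 := inv_le_one_of_one_le₀ (by
      have : (0 : ℝ) ≤ ((ρ + k : ℕ) : ℝ) := Nat.cast_nonneg _
      linarith)
    have h5 : (ρ : ℝ) + (k - (i : ℕ)) - (ρ + (k - (j : ℕ))) = ((j : ℕ) : ℝ) - ((i : ℕ) : ℝ) := by
      ring
    rw [h5] at h1
    linarith

lemma continuousOn_torusCauchy_polydisc {ρ : ℕ} {f : (Fin k → ℂ) → ℂ}
    (hf : ContinuousOn f (torusSet (stdRadii k ρ))) :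
    ContinuousOn (torusCauchy (stdRadii k ρ) f) {w | ∀ i, ‖w i‖ < ρ} :=
  (continuousOn_torusCauchy (stdRadii_pos ρ) hf).mono fun _ hw i => lt_stdRadii (hw i) i

lemma coeffAt_continuousOn (c : PowerSeries (trigRing k)) (d : ℕ) :
    ContinuousOn (coeffAt c d) (injSet k) := (PowerSeries.coeff d c : trigRing k).2.1

lemma ofReal_mem_slitPlane_of_one_le {x : ℝ} (hx : 1 ≤ x) : (x : ℂ) ∈ Complex.slitPlane :=
  Complex.ofReal_mem_slitPlane.2 (by linarith)

lemma isOpen_polydisc (ρ : ℝ) : IsOpen {w : Fin k → ℂ | ∀ i, ‖w i‖ < ρ} := by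
  have : {w : Fin k → ℂ | ∀ i, ‖w i‖ < ρ} = ⋂ i, {w | ‖w i‖ < ρ} := by
    ext w
    simp
  rw [this]
  exact isOpen_iInter_of_finite fun i => isOpen_lt (by fun_prop) continuous_const

lemma exists_mem_polydisc (w : Fin k → ℂ) : ∃ ρ : ℕ, ∀ i, ‖w i‖ < ρ := by
  obtain ⟨ρ, hρ⟩ := exists_nat_gt ‖w‖
  exact ⟨ρ, fun i => (norm_le_pi_norm w i).trans_lt hρ⟩

/-- Expansions of a function with removable singularities on the diagonals extend to the
diagonals. -/
lemma TrigSum.exists_limit_expansion {n : ℕ} {F : (Fin k → ℂ) → ℂ → ℂ}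
    (hT : TrigSum n fun _ => F)
    (hc : ∀ s ∈ Complex.slitPlane, ContinuousOn (fun w => F w s) (injSet k))
    (hg : ∀ s ∈ Complex.slitPlane, ∀ r, IsGoodOn r fun w => F w s) :
    ∃ Ca Cb : ℕ → ℕ → (Fin k → ℂ) → ℂ,
      (∀ m d, (Continuous (Ca m d) ∧ IsRatTrig (Ca m d)) ∧
        (Continuous (Cb m d) ∧ IsRatTrig (Cb m d))) ∧
      (∀ m d w, d < m → Ca m d w = 0 ∧ Cb m d w = 0) ∧
      ∀ w, ∃ A B : ℕ → ℂ → ℂ,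
        UExp (Set.univ : Set Unit) (fun _ => A 0) (fun d _ => Ca 0 d w) ∧
        (∀ m ∈ Finset.Icc 1 n, UExp (Set.univ : Set Unit) (fun _ => A m) (fun d _ => Ca m d w) ∧
          UExp (Set.univ : Set Unit) (fun _ => B m) (fun d _ => Cb m d w)) ∧
        ∀ s ∈ Complex.slitPlane, Tendsto (fun w => F w s) (𝓝[injSet k] w)
          (𝓝 (A 0 s + ∑ m ∈ Finset.Icc 1 n,
            (A m s * Complex.cos (4 * m * s) + B m s * Complex.sin (4 * m * s)))) := by
  obtain ⟨A, B, a, b, hab, hF⟩ := hT.exists_amplitudes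
  have hinj : ∀ ρ, torusSet (stdRadii k ρ) ⊆ injSet k := fun ρ =>
    (torusSet_subset_sepSet ρ).trans (sepSet_subset_injSet _)
  have hcoef : ∀ (c : PowerSeries (trigRing k)) d ρ,
      ContinuousOn (coeffAt c d) (torusSet (stdRadii k ρ)) := fun c d ρ =>
    (coeffAt_continuousOn c d).mono (hinj ρ)
  have hamp : ∀ {f : ℕ → (Fin k → ℂ) → ℂ → ℂ} {c : PowerSeries (trigRing k)}, Amp f c →
      ∀ ρ : ℕ, ∀ s ∈ Complex.slitPlane,
        ContinuousOn (fun ζ => f (ρ + k) ζ s) (torusSet (stdRadii k ρ)) := fun h ρ s hs =>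
    (h.cont _ s hs).mono (torusSet_subset_sepSet ρ)
  have hexp : ∀ {f : ℕ → (Fin k → ℂ) → ℂ → ℂ} {c : PowerSeries (trigRing k)}, Amp f c →
      ∀ ρ : ℕ, ∀ w : Fin k → ℂ, (∀ i, ‖w i‖ < ρ) → UExp (Set.univ : Set Unit)
        (fun _ s => torusCauchy (stdRadii k ρ) (fun ζ => f (ρ + k) ζ s) w)
        (fun d _ => torusCauchy (stdRadii k ρ) (coeffAt c d) w) := fun {f c} h ρ w hw =>
    UExp.torusCauchy (stdRadii_pos ρ) (fun i => lt_stdRadii (hw i) i)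
      ((h.exp _).mono (torusSet_subset_sepSet ρ)) (hamp h ρ) fun d => hcoef c d ρ
  -- The amplitudes need not be holomorphic in the parameters; their integrals over the torus merely
  -- serve as new amplitudes for the integral of F.
  have hTF : ∀ ρ : ℕ, ∀ w : Fin k → ℂ, (∀ i, ‖w i‖ < ρ) → ∀ s ∈ Complex.slitPlane,
      torusCauchy (stdRadii k ρ) (fun ζ => F ζ s) w = ∑ m ∈ Finset.range (n + 1),
        (torusCauchy (stdRadii k ρ) (fun ζ => A m (ρ + k) ζ s) w * Complex.cos (4 * m * s) +
          torusCauchy (stdRadii k ρ) (fun ζ => B m (ρ + k) ζ s) w * Complex.sin (4 * m * s)) := by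
    intro ρ w hw s hs
    have hr := stdRadii_pos (k := k) ρ
    have hwr : ∀ i, ‖w i‖ < stdRadii k ρ i := fun i => lt_stdRadii (hw i) i
    have cA : ∀ m, ContinuousOn (fun ζ => A m (ρ + k) ζ s * Complex.cos (4 * m * s))
        (torusSet (stdRadii k ρ)) := fun m => (hamp (hab m).1 ρ s hs).mul continuousOn_const
    have cB : ∀ m, ContinuousOn (fun ζ => B m (ρ + k) ζ s * Complex.sin (4 * m * s))
        (torusSet (stdRadii k ρ)) := fun m => (hamp (hab m).2.1 ρ s hs).mul continuousOn_const
    rw [torusCauchy_congr hr fun ζ hζ => hF (ρ + k) ζ (torusSet_subset_sepSet ρ hζ) s hs,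
      torusCauchy_sum hr hwr _ fun m _ => (cA m).fun_add (cB m)]
    refine Finset.sum_congr rfl fun m _ => ?_
    rw [torusCauchy_add hr hwr (cA m) (cB m), torusCauchy_mul_const, torusCauchy_mul_const]
  have hTFeq : ∀ ρ : ℕ, ∀ w ∈ injSet k, (∀ i, ‖w i‖ < ρ) → ∀ s ∈ Complex.slitPlane,
      torusCauchy (stdRadii k ρ) (fun ζ => F ζ s) w = F w s := fun ρ w hwi hw s hs =>
    torusCauchy_eq (strictAnti_stdRadii ρ) (stdRadii_pos ρ) ((hc s hs).mono (hinj ρ))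
      (hg s hs _) hwi fun i => lt_stdRadii (hw i) i
  -- At a point off the diagonals F has two compound expansions, the original one and the integrated
  -- one. Uniqueness identifies their coefficients, except for the sine at m = 0, where nothing is
  -- determined.
  have huniq : ∀ ρ : ℕ, ∀ w ∈ injSet k, (∀ i, ‖w i‖ < ρ) → ∀ d,
      (∀ m ≤ n, torusCauchy (stdRadii k ρ) (coeffAt (a m) d) w = coeffAt (a m) d w) ∧
      ∀ m ≤ n, 1 ≤ m → torusCauchy (stdRadii k ρ) (coeffAt (b m) d) w = coeffAt (b m) d w := by
    intro ρ w hwi hw d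
    obtain ⟨N, hN⟩ := exists_mem_sepSet hwi
    have hpt : ∀ {f : ℕ → (Fin k → ℂ) → ℂ → ℂ} {c : PowerSeries (trigRing k)}, Amp f c →
        UExp (Set.univ : Set Unit)
          (fun _ s => torusCauchy (stdRadii k ρ) (fun ζ => f (ρ + k) ζ s) w + -1 * f N w s)
          (fun d _ => torusCauchy (stdRadii k ρ) (coeffAt c d) w + -1 * coeffAt c d w) :=
      fun h => (hexp h ρ w hw).add (((h.exp N).comp (fun _ : Unit => w) fun _ _ => hN).cmul (-1))
    have h := trig_expansion_unique (fun m => hpt (hab m).1) (fun m => hpt (hab m).2.1)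
      (n := n) (fun x hx => by
        have hs := ofReal_mem_slitPlane_of_one_le hx
        have h1 := hTF ρ w hw x hs
        rw [hTFeq ρ w hwi hw x hs, hF N w hN x hs] at h1
        rw [← sub_eq_zero, ← Finset.sum_sub_distrib] at h1
        rw [← neg_eq_zero, ← Finset.sum_neg_distrib, ← h1]
        refine Finset.sum_congr rfl fun m _ => ?_
        ring) d
    refine ⟨fun m hm => ?_, fun m hm hm1 => ?_⟩
    · linear_combination h.1 m hm
    · linear_combination h.2 m hm hm1
  have hlim : ∀ (c : PowerSeries (trigRing k)) d ρ, (∀ w ∈ injSet k, (∀ i, ‖w i‖ < (ρ : ℕ)) →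
      torusCauchy (stdRadii k ρ) (coeffAt c d) w = coeffAt c d w) → ∀ w : Fin k → ℂ,
        (∀ i, ‖w i‖ < ρ) → limUnder (𝓝[injSet k] w) (coeffAt c d) =
          torusCauchy (stdRadii k ρ) (coeffAt c d) w := by
    intro c d ρ h w hw
    have := neBot_nhdsWithin_injSet w
    refine Tendsto.limUnder_eq ?_
    have hop := (isOpen_polydisc (k := k) ρ).mem_nhds hw
    have h1 : Tendsto (torusCauchy (stdRadii k ρ) (coeffAt c d)) (𝓝[injSet k] w)
        (𝓝 (torusCauchy (stdRadii k ρ) (coeffAt c d) w)) :=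
      ((continuousOn_torusCauchy_polydisc (hcoef c d ρ)).continuousAt hop).tendsto.mono_left nhdsWithin_le_nhds
    refine h1.congr' ?_
    filter_upwards [self_mem_nhdsWithin, nhdsWithin_le_nhds hop] with v hv1 hv2
    exact h v hv1 hv2
  have hgood : ∀ (c : PowerSeries (trigRing k)) d, (∀ ρ : ℕ, ∀ w ∈ injSet k, (∀ i, ‖w i‖ < ρ) →
      torusCauchy (stdRadii k ρ) (coeffAt c d) w = coeffAt c d w) →
      Continuous (fun w => limUnder (𝓝[injSet k] w) (coeffAt c d)) ∧
        IsRatTrig fun w => limUnder (𝓝[injSet k] w) (coeffAt c d) := by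
    intro c d h
    have hcont : Continuous (fun w => limUnder (𝓝[injSet k] w) (coeffAt c d)) := by
      refine continuous_iff_continuousAt.2 fun w => ?_
      obtain ⟨ρ, hρ⟩ := exists_mem_polydisc w
      have hop := (isOpen_polydisc (k := k) ρ).mem_nhds hρ
      have h1 := (continuousOn_torusCauchy_polydisc (hcoef c d ρ)).continuousAt hop
      refine h1.congr ?_
      filter_upwards [hop] with v hv
      exact (hlim c d ρ (h ρ) v hv).symm
    refine ⟨hcont, isRatTrig_of_eqOn hcont (PowerSeries.coeff d c) fun w hw => ?_⟩
    obtain ⟨ρ, hρ⟩ := exists_mem_polydisc w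
    rw [hlim c d ρ (h ρ) w hρ, h ρ w hw hρ]
    rfl
  have hzero : Continuous (fun _ : Fin k → ℂ => (0 : ℂ)) ∧
      IsRatTrig fun _ : Fin k → ℂ => (0 : ℂ) :=
    ⟨continuous_const, 0, 1, one_ne_zero, fun w => by simp⟩
  -- The coefficients at any w are the limits of those at distinct arguments; near w these coincide
  -- with a Cauchy integral, which is continuous. The undetermined sine coefficients at m = 0 are
  -- set to 0.
  refine ⟨fun m d w => if m ≤ n then limUnder (𝓝[injSet k] w) (coeffAt (a m) d) else 0,
    fun m d w => if m ≤ n ∧ 1 ≤ m then limUnder (𝓝[injSet k] w) (coeffAt (b m) d) else 0,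
    fun m d => ⟨?_, ?_⟩, fun m d w hdm => ?_, fun w => ?_⟩
  · by_cases hm : m ≤ n
    · simpa only [hm, if_true] using
        hgood (a m) d fun ρ w hw hρ => (huniq ρ w hw hρ d).1 m hm
    · simpa only [hm, if_false] using hzero
  · by_cases hm : m ≤ n ∧ 1 ≤ m
    · simpa only [if_pos hm] using
        hgood (b m) d fun ρ w hw hρ => (huniq ρ w hw hρ d).2 m hm.1 hm.2
    · simpa only [hm, if_false] using hzero
  · have hz : ∀ c : PowerSeries (trigRing k), PowerSeries.X ^ m ∣ c → coeffAt c d = 0 := by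
      intro c hcm
      have := PowerSeries.X_pow_dvd_iff.1 hcm d hdm
      show (PowerSeries.coeff d c : trigRing k).1 = 0
      rw [this]
      rfl
    have hne := neBot_nhdsWithin_injSet w
    have h0 : limUnder (𝓝[injSet k] w) (0 : (Fin k → ℂ) → ℂ) = 0 :=
      (tendsto_const_nhds (x := (0 : ℂ))).limUnder_eq
    simp only [hz _ (hab m).2.2.1, hz _ (hab m).2.2.2, h0, ite_self, and_self]
  · obtain ⟨ρ, hρ⟩ := exists_mem_polydisc w
    have hla : ∀ m ≤ n, ∀ d, limUnder (𝓝[injSet k] w) (coeffAt (a m) d) =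
        torusCauchy (stdRadii k ρ) (coeffAt (a m) d) w := fun m hm d =>
      hlim _ d ρ (fun v hv hvρ => (huniq ρ v hv hvρ d).1 m hm) w hρ
    have hlb : ∀ m ≤ n, 1 ≤ m → ∀ d, limUnder (𝓝[injSet k] w) (coeffAt (b m) d) =
        torusCauchy (stdRadii k ρ) (coeffAt (b m) d) w := fun m hm hm1 d =>
      hlim _ d ρ (fun v hv hvρ => (huniq ρ v hv hvρ d).2 m hm hm1) w hρ
    refine ⟨fun m s => torusCauchy (stdRadii k ρ) (fun ζ => A m (ρ + k) ζ s) w,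
      fun m s => torusCauchy (stdRadii k ρ) (fun ζ => B m (ρ + k) ζ s) w, ?_,
      fun m hm => ⟨?_, ?_⟩, fun s hs => ?_⟩
    · refine (hexp (hab 0).1 ρ w hρ).congr (fun _ _ _ _ => rfl) fun d _ _ => ?_
      simp only [Nat.zero_le, if_true]
      exact (hla 0 (Nat.zero_le n) d).symm
    · have hm' := Finset.mem_Icc.1 hm
      refine (hexp (hab m).1 ρ w hρ).congr (fun _ _ _ _ => rfl) fun d _ _ => ?_
      simp only [hm'.2, if_true]
      exact (hla m hm'.2 d).symm
    · have hm' := Finset.mem_Icc.1 hm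
      refine (hexp (hab m).2.1 ρ w hρ).congr (fun _ _ _ _ => rfl) fun d _ _ => ?_
      simp only [hm'.1, hm'.2, and_self, if_true]
      exact (hlb m hm'.2 hm'.1 d).symm
    · have e : ∀ f : ℕ → ℂ, ∑ m ∈ Finset.range (n + 1), f m =
          f 0 + ∑ m ∈ Finset.Icc 1 n, f m := fun f => by
        rw [Finset.range_eq_Ico, Finset.sum_eq_sum_Ico_succ_bot (Nat.succ_pos n)]
        rfl
      have h1 := hTF ρ w hρ s hs
      rw [e] at h1
      simp only [Nat.cast_zero, mul_zero, zero_mul, Complex.cos_zero, Complex.sin_zero, mul_one,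
        add_zero] at h1
      rw [← h1]
      have hop := (isOpen_polydisc (k := k) ρ).mem_nhds hρ
      have h2 : Tendsto (torusCauchy (stdRadii k ρ) fun ζ => F ζ s) (𝓝[injSet k] w)
          (𝓝 (torusCauchy (stdRadii k ρ) (fun ζ => F ζ s) w)) :=
        ((continuousOn_torusCauchy_polydisc ((hc s hs).mono (hinj ρ))).continuousAt hop).tendsto.mono_left nhdsWithin_le_nhds
      refine h2.congr' ?_
      filter_upwards [self_mem_nhdsWithin, nhdsWithin_le_nhds hop] with v hv1 hv2
      exact hTFeq ρ v hv1 hv2 s hs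

end

/-! ### The kernel and its cyclic products as trigonometric sums. -/

section

/-- Cosine amplitudes of the Bessel functions with parameters of norm at most `N + 1`. -/
def besselP (N : ℕ) : ℂ → ℂ → ℂ := (exists_besselAmplitude (N + 1)).choose

/-- Sine amplitudes of the Bessel functions with parameters of norm at most `N + 1`. -/
def besselQ (N : ℕ) : ℂ → ℂ → ℂ := (exists_besselAmplitude (N + 1)).choose_spec.choose

lemma isBesselAmplitude (N : ℕ) :
    IsBesselAmplitude {ν : ℂ | ‖ν‖ ≤ (N + 1 : ℕ)} (besselP N) (besselQ N) :=
  (exists_besselAmplitude (N + 1)).choose_spec.choose_spec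

/-- The prefactor πs is the square of √π s^{1/2}, one for each Bessel function. The orders raised by
1 have phases lowered by π/2, hence the sines in the second product. -/
lemma kerD_eq_trig {N : ℕ} {a b s : ℂ} (ha : ‖a‖ ≤ N) (hb : ‖b‖ ≤ N)
    (hs : s ∈ Complex.slitPlane) :
    kerD a b s =
      (besselP N (-a - 1 / 2) s * Complex.cos (2 * s + Real.pi * a / 2) -
        besselQ N (-a - 1 / 2) s * Complex.sin (2 * s + Real.pi * a / 2)) *
      (besselP N (b - 1 / 2) s * Complex.cos (2 * s - Real.pi * b / 2) -
        besselQ N (b - 1 / 2) s * Complex.sin (2 * s - Real.pi * b / 2)) +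
      (besselP N (-a + 1 / 2) s * Complex.sin (2 * s + Real.pi * a / 2) +
        besselQ N (-a + 1 / 2) s * Complex.cos (2 * s + Real.pi * a / 2)) *
      (besselP N (b + 1 / 2) s * Complex.sin (2 * s - Real.pi * b / 2) +
        besselQ N (b + 1 / 2) s * Complex.cos (2 * s - Real.pi * b / 2)) := by
  have hs0 := Complex.slitPlane_ne_zero hs
  have hn : ∀ z : ℂ, ‖z‖ ≤ N → ‖z - 1 / 2‖ ≤ (N + 1 : ℕ) ∧ ‖z + 1 / 2‖ ≤ (N + 1 : ℕ) := by
    intro z hz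
    have h2 : ‖(1 / 2 : ℂ)‖ ≤ 1 := by norm_num
    push_cast
    exact ⟨(norm_sub_le _ _).trans (add_le_add hz h2), (norm_add_le _ _).trans (add_le_add hz h2)⟩
  have ha' : ‖-a‖ ≤ N := by rwa [norm_neg]
  have j1 := (isBesselAmplitude N).bessel (-a - 1 / 2) (hn _ ha').1 s hs
  have j2 := (isBesselAmplitude N).bessel (-a + 1 / 2) (hn _ ha').2 s hs
  have j3 := (isBesselAmplitude N).bessel (b - 1 / 2) (hn _ hb).1 s hs
  have j4 := (isBesselAmplitude N).bessel (b + 1 / 2) (hn _ hb).2 s hs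
  have p1 : phase (-a - 1 / 2) s = 2 * s + Real.pi * a / 2 := by
    rw [phase]
    ring
  have p2 : phase (-a + 1 / 2) s = 2 * s + Real.pi * a / 2 - Real.pi / 2 := by
    rw [phase]
    ring
  have p3 : phase (b - 1 / 2) s = 2 * s - Real.pi * b / 2 := by
    rw [phase]
    ring
  have p4 : phase (b + 1 / 2) s = 2 * s - Real.pi * b / 2 - Real.pi / 2 := by
    rw [phase]
    ring
  rw [p1] at j1
  rw [p2, Complex.cos_sub_pi_div_two, Complex.sin_sub_pi_div_two] at j2
  rw [p3] at j3
  rw [p4, Complex.cos_sub_pi_div_two, Complex.sin_sub_pi_div_two] at j4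
  have hsq : ((Real.sqrt Real.pi : ℂ) * s ^ (1 / 2 : ℂ)) * (Real.sqrt Real.pi * s ^ (1 / 2 : ℂ)) =
      Real.pi * s := by
    have e1 : (Real.sqrt Real.pi : ℂ) * Real.sqrt Real.pi = Real.pi := by
      rw [← Complex.ofReal_mul, Real.mul_self_sqrt Real.pi_pos.le]
    have e2 : s ^ (1 / 2 : ℂ) * s ^ (1 / 2 : ℂ) = s := by
      rw [← Complex.cpow_add _ _ hs0, add_halves, Complex.cpow_one]
    calc _ = ((Real.sqrt Real.pi : ℂ) * Real.sqrt Real.pi) * (s ^ (1 / 2 : ℂ) * s ^ (1 / 2 : ℂ)) := by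
          ring
      _ = _ := by rw [e1, e2]
  have hk : kerD a b s = Real.pi * s * (besselJ (-a - 1 / 2) (2 * s) * besselJ (b - 1 / 2) (2 * s) +
      besselJ (-a + 1 / 2) (2 * s) * besselJ (b + 1 / 2) (2 * s)) := by
    simp [kerD, vecV]
  rw [hk, ← hsq]
  generalize (Real.sqrt Real.pi : ℂ) * s ^ (1 / 2 : ℂ) = y at *
  generalize besselJ (-a - 1 / 2) (2 * s) = J1 at *
  generalize besselJ (-a + 1 / 2) (2 * s) = J2 at *
  generalize besselJ (b - 1 / 2) (2 * s) = J3 at *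
  generalize besselJ (b + 1 / 2) (2 * s) = J4 at *
  have e2 : besselP N (-a + 1 / 2) s * Complex.sin (2 * s + Real.pi * a / 2) +
      besselQ N (-a + 1 / 2) s * Complex.cos (2 * s + Real.pi * a / 2) = y * J2 := by
    rw [j2]
    ring
  have e4 : besselP N (b + 1 / 2) s * Complex.sin (2 * s - Real.pi * b / 2) +
      besselQ N (b + 1 / 2) s * Complex.cos (2 * s - Real.pi * b / 2) = y * J4 := by
    rw [j4]
    ring
  rw [← j1, ← j3, e2, e4]
  ring

variable {k : ℕ}

lemma affine_mem (i : Fin k) (e h : ℚ) : (fun w : Fin k → ℂ => e * w i + h) ∈ trigRing k :=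
  add_mem (mul_mem (const_mem e) (coord_mem i)) (const_mem h)

/-- The formal cosine amplitude. -/
def formalP (i : Fin k) (e h : ℚ) : PowerSeries (trigRing k) :=
  PowerSeries.mk fun d => ⟨_, hankelCoeff_mem (affine_mem i e h) d (iPow d).1⟩

/-- The formal sine amplitude. -/
def formalQ (i : Fin k) (e h : ℚ) : PowerSeries (trigRing k) :=
  PowerSeries.mk fun d => ⟨_, hankelCoeff_mem (affine_mem i e h) d (iPow d).2⟩

lemma constantCoeff_formalP (i : Fin k) (e h : ℚ) :
    PowerSeries.constantCoeff (formalP i e h) = 1 := by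
  rw [← PowerSeries.coeff_zero_eq_constantCoeff_apply, formalP, PowerSeries.coeff_mk]
  ext w
  simp [hankelCoeff, iPow]

lemma constantCoeff_formalQ (i : Fin k) (e h : ℚ) :
    PowerSeries.constantCoeff (formalQ i e h) = 0 := by
  rw [← PowerSeries.coeff_zero_eq_constantCoeff_apply, formalQ, PowerSeries.coeff_mk]
  ext w
  simp [hankelCoeff, iPow]

/-- Cosine amplitude with parameter `e w_i + h`. -/
def famP (i : Fin k) (e h : ℚ) (N : ℕ) (w : Fin k → ℂ) (s : ℂ) : ℂ := besselP N (e * w i + h) s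

/-- Sine amplitude with parameter `e w_i + h`. -/
def famQ (i : Fin k) (e h : ℚ) (N : ℕ) (w : Fin k → ℂ) (s : ℂ) : ℂ := besselQ N (e * w i + h) s

lemma norm_affine_le {i : Fin k} {e h : ℚ} (he : |e| ≤ 1) (hh : |h| ≤ 1) {N : ℕ} :
    ∀ w ∈ sepSet k N, (e * w i + h : ℂ) ∈ {ν : ℂ | ‖ν‖ ≤ (N + 1 : ℕ)} := by
  intro w hw
  have he' : ‖(e : ℂ)‖ ≤ 1 := by
    rw [Complex.norm_ratCast]
    exact_mod_cast he
  have hh' : ‖(h : ℂ)‖ ≤ 1 := by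
    rw [Complex.norm_ratCast]
    exact_mod_cast hh
  refine (norm_add_le _ _).trans ?_
  push_cast
  refine add_le_add ?_ hh'
  rw [norm_mul]
  exact (mul_le_of_le_one_left (norm_nonneg _) he').trans (hw.1 i)

lemma amp_famP (i : Fin k) {e h : ℚ} (he : |e| ≤ 1) (hh : |h| ≤ 1) :
    Amp (famP i e h) (formalP i e h) := by
  refine ⟨fun N => ?_, fun N s hs => ?_⟩
  · refine ((isBesselAmplitude N).expP.comp (fun w : Fin k → ℂ => e * w i + h)
      (norm_affine_le he hh)).congr (fun _ _ _ _ => rfl) fun d w _ => ?_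
    rw [coeffAt, formalP, PowerSeries.coeff_mk]
  · exact ((isBesselAmplitude N).contP s hs).comp (by fun_prop) (norm_affine_le he hh)

lemma amp_famQ (i : Fin k) {e h : ℚ} (he : |e| ≤ 1) (hh : |h| ≤ 1) :
    Amp (famQ i e h) (formalQ i e h) := by
  refine ⟨fun N => ?_, fun N s hs => ?_⟩
  · refine ((isBesselAmplitude N).expQ.comp (fun w : Fin k → ℂ => e * w i + h)
      (norm_affine_le he hh)).congr (fun _ _ _ _ => rfl) fun d w _ => ?_
    rw [coeffAt, formalQ, PowerSeries.coeff_mk]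
  · exact ((isBesselAmplitude N).contQ s hs).comp (by fun_prop) (norm_affine_le he hh)

/-- The coefficient of `cos ψ cos ψ'` in the kernel. -/
def famE1 (i j : Fin k) (N : ℕ) (w : Fin k → ℂ) (s : ℂ) : ℂ :=
  famP i (-1) (-1 / 2) N w s * famP j 1 (-1 / 2) N w s +
    famQ i (-1) (1 / 2) N w s * famQ j 1 (1 / 2) N w s

/-- The coefficient of `sin ψ sin ψ'` in the kernel. -/
def famE2 (i j : Fin k) (N : ℕ) (w : Fin k → ℂ) (s : ℂ) : ℂ :=
  famQ i (-1) (-1 / 2) N w s * famQ j 1 (-1 / 2) N w s +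
    famP i (-1) (1 / 2) N w s * famP j 1 (1 / 2) N w s

/-- The coefficient of `cos ψ sin ψ'` in the kernel. -/
def famE3 (i j : Fin k) (N : ℕ) (w : Fin k → ℂ) (s : ℂ) : ℂ :=
  famQ i (-1) (1 / 2) N w s * famP j 1 (1 / 2) N w s -
    famP i (-1) (-1 / 2) N w s * famQ j 1 (-1 / 2) N w s

/-- The coefficient of `sin ψ cos ψ'` in the kernel. -/
def famE4 (i j : Fin k) (N : ℕ) (w : Fin k → ℂ) (s : ℂ) : ℂ :=
  famP i (-1) (1 / 2) N w s * famQ j 1 (1 / 2) N w s -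
    famQ i (-1) (-1 / 2) N w s * famP j 1 (-1 / 2) N w s

lemma exists_amp_famE (i j : Fin k) : ∃ e1 e2 e3 e4 : PowerSeries (trigRing k),
    Amp (famE1 i j) e1 ∧ Amp (famE2 i j) e2 ∧ Amp (famE3 i j) e3 ∧ Amp (famE4 i j) e4 ∧
    PowerSeries.constantCoeff e1 = 1 ∧ PowerSeries.constantCoeff e2 = 1 ∧
    PowerSeries.constantCoeff e3 = 0 ∧ PowerSeries.constantCoeff e4 = 0 := by
  have h1 : |(-1 : ℚ)| ≤ 1 := by norm_num
  have h2 : |(1 : ℚ)| ≤ 1 := by norm_num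
  have h3 : |(1 / 2 : ℚ)| ≤ 1 := by norm_num [abs_of_pos]
  have h4 : |(-1 / 2 : ℚ)| ≤ 1 := by norm_num [abs_of_pos, abs_of_neg]
  refine ⟨_, _, _, _, ((amp_famP i h1 h4).mul (amp_famP j h2 h4)).add
      ((amp_famQ i h1 h3).mul (amp_famQ j h2 h3)),
    ((amp_famQ i h1 h4).mul (amp_famQ j h2 h4)).add ((amp_famP i h1 h3).mul (amp_famP j h2 h3)),
    ((amp_famQ i h1 h3).mul (amp_famP j h2 h3)).sub ((amp_famP i h1 h4).mul (amp_famQ j h2 h4)),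
    ((amp_famP i h1 h3).mul (amp_famQ j h2 h3)).sub ((amp_famQ i h1 h4).mul (amp_famP j h2 h4)),
    ?_, ?_, ?_, ?_⟩ <;>
  simp [constantCoeff_formalP, constantCoeff_formalQ]

/-- The half-angle functions. -/
def halfTrig (p : Fin 2) (z : ℂ) : ℂ :=
  ![Complex.cos (Real.pi * z / 2), Complex.sin (Real.pi * z / 2)] p

/-- The functions of πz/2 do not occur among the generators of the ring, but products of two of them
at the same point do belong to it, by the double-angle formulas. -/
lemma halfTrig_mul_mem (i : Fin k) (p q : Fin 2) :
    (fun w : Fin k → ℂ => halfTrig p (w i) * halfTrig q (w i)) ∈ trigRing k := by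
  have e1 : ∀ z : ℂ, Complex.cos (Real.pi * z) = 2 * Complex.cos (Real.pi * z / 2) ^ 2 - 1 :=
    fun z => by
      rw [← Complex.cos_two_mul]
      congr 1
      ring
  have e2 : ∀ z : ℂ, Complex.sin (Real.pi * z) =
      2 * Complex.sin (Real.pi * z / 2) * Complex.cos (Real.pi * z / 2) := fun z => by
    rw [← Complex.sin_two_mul]
    congr 1
    ring
  have hcc : (fun w : Fin k → ℂ => (((1 / 2 : ℚ) : ℂ) * (((1 : ℚ) : ℂ) +
      Complex.cos (Real.pi * w i)))) ∈ trigRing k :=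
    mul_mem (const_mem (1 / 2)) (add_mem (const_mem 1) (cos_mem i))
  have hss : (fun w : Fin k → ℂ => (((1 / 2 : ℚ) : ℂ) * (((1 : ℚ) : ℂ) -
      Complex.cos (Real.pi * w i)))) ∈ trigRing k :=
    mul_mem (const_mem (1 / 2)) (sub_mem (const_mem 1) (cos_mem i))
  have hsc : (fun w : Fin k → ℂ => (((1 / 2 : ℚ) : ℂ) *
      Complex.sin (Real.pi * w i))) ∈ trigRing k :=
    mul_mem (const_mem (1 / 2)) (sin_mem i)
  have hp := fun z : ℂ => Complex.sin_sq_add_cos_sq (Real.pi * z / 2)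
  fin_cases p <;> fin_cases q
  · convert! hcc using 1
    funext w
    simp [halfTrig, e1]
    ring
  · convert! hsc using 1
    funext w
    simp [halfTrig, e2]
    ring
  · convert! hsc using 1
    funext w
    simp [halfTrig, e2]
    ring
  · convert! hss using 1
    funext w
    simp [halfTrig, e1]
    linear_combination hp (w i)

/-- The kernel with the half-angle functions split off. -/
def famL (i j : Fin k) (p q : Fin 2) (N : ℕ) (w : Fin k → ℂ) (s : ℂ) : ℂ :=
  !![(famE1 i j N w s + famE2 i j N w s) / 2 +
      (famE1 i j N w s - famE2 i j N w s) / 2 * Complex.cos (4 * s) +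
      (famE3 i j N w s + famE4 i j N w s) / 2 * Complex.sin (4 * s),
    (famE4 i j N w s - famE3 i j N w s) / 2 -
      (famE3 i j N w s + famE4 i j N w s) / 2 * Complex.cos (4 * s) +
      (famE1 i j N w s - famE2 i j N w s) / 2 * Complex.sin (4 * s);
    (famE4 i j N w s - famE3 i j N w s) / 2 +
      (famE3 i j N w s + famE4 i j N w s) / 2 * Complex.cos (4 * s) -
      (famE1 i j N w s - famE2 i j N w s) / 2 * Complex.sin (4 * s),
    -(famE1 i j N w s + famE2 i j N w s) / 2 +
      (famE1 i j N w s - famE2 i j N w s) / 2 * Complex.cos (4 * s) +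
      (famE3 i j N w s + famE4 i j N w s) / 2 * Complex.sin (4 * s)] p q

/-- The amplitudes of cos 4s and sin 4s are ±(e1 - e2)/2 and ±(e3 + e4)/2. All constant terms cancel
there (1 - 1 and 0 + 0), which is the origin of the rule that frequency m starts in degree m. -/
lemma isFactor_famL (i j : Fin k) (p q : Fin 2) : IsFactor (famL i j p q) := by
  obtain ⟨e1, e2, e3, e4, h1, h2, h3, h4, c1, c2, c3, c4⟩ := exists_amp_famE i j
  have hd : PowerSeries.X ∣ e1 - e2 := by
    rw [PowerSeries.X_dvd_iff, map_sub, c1, c2, sub_self]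
  have hs : PowerSeries.X ∣ e3 + e4 := by
    rw [PowerSeries.X_dvd_iff, map_add, c3, c4, add_zero]
  have A1 := (h1.add h2).smul (1 / 2)
  have A2 := (h4.sub h3).smul (1 / 2)
  have B1 := (h1.sub h2).smul (1 / 2)
  have B2 := (h3.add h4).smul (1 / 2)
  have D1 := hd.mul_left (PowerSeries.C (⟨_, const_mem (1 / 2)⟩ : trigRing k))
  have D2 := hs.mul_left (PowerSeries.C (⟨_, const_mem (1 / 2)⟩ : trigRing k))
  fin_cases p <;> fin_cases q
  · refine ⟨_, _, _, _, _, _, A1, B1, B2, D1, D2, fun N w s => ?_⟩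
    simp [famL]
    ring
  · refine ⟨_, _, _, _, _, _, A2, B2.neg, B1, D2.neg_right, D1, fun N w s => ?_⟩
    simp [famL]
    ring
  · refine ⟨_, _, _, _, _, _, A2, B2, B1.neg, D2, D1.neg_right, fun N w s => ?_⟩
    simp [famL]
    ring
  · refine ⟨_, _, _, _, _, _, A1.neg, B1, B2, D1, D2, fun N w s => ?_⟩
    simp [famL]
    ring

/-- The angles 2s ± πz/2 are separated by the addition theorems, and products of functions of 2s
become functions of 4s and constants. -/
lemma kerD_eq_sum_famL (i j : Fin k) {N : ℕ} {w : Fin k → ℂ} (hw : w ∈ sepSet k N) {s : ℂ}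
    (hs : s ∈ Complex.slitPlane) : kerD (w i) (w j) s =
      ∑ pq : Fin 2 × Fin 2, halfTrig pq.1 (w i) * halfTrig pq.2 (w j) *
        famL i j pq.1 pq.2 N w s := by
  rw [kerD_eq_trig (hw.1 i) (hw.1 j) hs, Fintype.sum_prod_type, Fin.sum_univ_two, Fin.sum_univ_two,
    Fin.sum_univ_two]
  have a1 : ((-1 : ℚ) : ℂ) * w i + ((-1 / 2 : ℚ) : ℂ) = -w i - 1 / 2 := by
    push_cast
    ring
  have a2 : ((-1 : ℚ) : ℂ) * w i + ((1 / 2 : ℚ) : ℂ) = -w i + 1 / 2 := by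
    push_cast
    ring
  have a3 : ((1 : ℚ) : ℂ) * w j + ((-1 / 2 : ℚ) : ℂ) = w j - 1 / 2 := by
    push_cast
    ring
  have a4 : ((1 : ℚ) : ℂ) * w j + ((1 / 2 : ℚ) : ℂ) = w j + 1 / 2 := by
    push_cast
    ring
  simp only [halfTrig, famL, famE1, famE2, famE3, famE4, famP, famQ, a1, a2, a3, a4,
    Matrix.cons_val_zero, Matrix.cons_val_one, Matrix.of_apply, Matrix.cons_val', Matrix.cons_val_fin_one]
  rw [show 4 * s = 2 * s + 2 * s by ring, Complex.cos_add (2 * s) (2 * s),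
    Complex.sin_add (2 * s) (2 * s), Complex.cos_add, Complex.sin_add, Complex.cos_sub,
    Complex.sin_sub]
  have hp := Complex.sin_sq_add_cos_sq (2 * s)
  generalize Complex.cos (2 * s) = C at *
  generalize Complex.sin (2 * s) = S at *
  generalize Complex.cos (Real.pi * w i / 2) = x0
  generalize Complex.sin (Real.pi * w i / 2) = x1
  generalize Complex.cos (Real.pi * w j / 2) = y0
  generalize Complex.sin (Real.pi * w j / 2) = y1
  generalize besselP N (-w i - 1 / 2) s = p1
  generalize besselP N (-w i + 1 / 2) s = p2
  generalize besselP N (w j - 1 / 2) s = p3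
  generalize besselP N (w j + 1 / 2) s = p4
  generalize besselQ N (-w i - 1 / 2) s = q1
  generalize besselQ N (-w i + 1 / 2) s = q2
  generalize besselQ N (w j - 1 / 2) s = q3
  generalize besselQ N (w j + 1 / 2) s = q4
  linear_combination ((x0 * y0 - x1 * y1) * (p1 * p3 + q2 * q4 + q1 * q3 + p2 * p4) / 2 +
    (x0 * y1 + x1 * y0) * (p2 * q4 - q1 * p3 - q2 * p4 + p1 * q3) / 2) * hp

/-- Cyclic products of the kernel are trigonometric sums. -/
lemma trigSum_prod_kerD (u : Fin k → Fin k) (c : Equiv.Perm (Fin k)) :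
    TrigSum k fun _ w s => ∏ l, kerD (w (u l)) (w (u (c l))) s := by
  -- After expanding the product, the point w (u l) is the first argument of the factor l and the
  -- second argument of the factor c⁻¹ l. Its two half-angle functions are collected here.
  have hX : ∀ f : Fin k → Fin 2 × Fin 2, (fun w : Fin k → ℂ =>
      ∏ l, (halfTrig (f l).1 (w (u l)) * halfTrig (f (c.symm l)).2 (w (u l)))) ∈ trigRing k := by
    intro f
    have := prod_mem (t := Finset.univ) fun l (_ : l ∈ Finset.univ) =>
      halfTrig_mul_mem (u l) (f l).1 (f (c.symm l)).2
    convert! this using 1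
    funext w
    simp [Finset.prod_apply]
  have h1 : ∀ f : Fin k → Fin 2 × Fin 2, TrigSum k fun N w s =>
      (∏ l, (halfTrig (f l).1 (w (u l)) * halfTrig (f (c.symm l)).2 (w (u l)))) *
        ∏ l, famL (u l) (u (c l)) (f l).1 (f l).2 N w s := fun f => by
    have := TrigSum.prod Finset.univ (G := fun l => famL (u l) (u (c l)) (f l).1 (f l).2)
      fun l _ => isFactor_famL _ _ _ _
    rw [Finset.card_univ, Fintype.card_fin] at this
    exact this.amp_mul (amp_const ⟨_, hX f⟩)
  refine .congr _ _ (TrigSum.sum Finset.univ fun f _ => h1 f) fun N w hw s hs => ?_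
  simp only [kerD_eq_sum_famL _ _ hw hs]
  rw [Finset.prod_univ_sum, Fintype.piFinset_univ]
  refine Finset.sum_congr rfl fun f _ => ?_
  rw [Finset.prod_mul_distrib, Finset.prod_mul_distrib, Finset.prod_mul_distrib,
    ← Equiv.prod_comp c fun l => halfTrig (f (c.symm l)).2 (w (u l))]
  simp only [Equiv.symm_apply_apply]

end

/-! ### Removable singularities, and traces of products of the matrices B. -/

section

lemma differentiable_kerD {s : ℂ} (hs : s ≠ 0) :
    Differentiable ℂ fun p : ℂ × ℂ => kerD p.1 p.2 s := by
  have h1 : ∀ c : ℂ, Differentiable ℂ fun p : ℂ × ℂ => besselJ (-p.1 + c) (2 * s) := fun c =>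
    (differentiable_besselJ hs).comp (f := fun p : ℂ × ℂ => -p.1 + c) (by fun_prop)
  have h2 : ∀ c : ℂ, Differentiable ℂ fun p : ℂ × ℂ => besselJ (p.2 + c) (2 * s) := fun c =>
    (differentiable_besselJ hs).comp (f := fun p : ℂ × ℂ => p.2 + c) (by fun_prop)
  have : (fun p : ℂ × ℂ => kerD p.1 p.2 s) = fun p => Real.pi * s *
      (besselJ (-p.1 + -(1 / 2)) (2 * s) * besselJ (p.2 + -(1 / 2)) (2 * s) +
        besselJ (-p.1 + 1 / 2) (2 * s) * besselJ (p.2 + 1 / 2) (2 * s)) := by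
    funext p
    simp [kerD, vecV, sub_eq_add_neg]
  rw [this]
  exact ((((h1 _).fun_mul (h2 _))).fun_add ((h1 _).fun_mul (h2 _))).const_mul _

/-- Both sides are continuous in z, so the identity extends from the dense set where B is defined.
-/
lemma kerD_self' {s : ℂ} (hs : s ≠ 0) (z : ℂ) : kerD z z s = Complex.cos (Real.pi * z) := by
  have hd : Dense {z : ℂ | NotHalfInteger z} := by
    have : {z : ℂ | NotHalfInteger z} = (Set.range fun n : ℤ => (n : ℂ) + 1 / 2)ᶜ := by
      ext z
      simp [NotHalfInteger, eq_comm]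
    rw [this]
    exact (Set.countable_range _).dense_compl ℂ
  have hc : Continuous fun z : ℂ => kerD z z s :=
    (differentiable_kerD hs).continuous.comp (f := fun z : ℂ => (z, z)) (by fun_prop)
  exact congr_fun (hc.ext_on hd (g := fun z => Complex.cos (Real.pi * z)) (by fun_prop)
    fun z hz => kerD_self hz hs) z

section goodness

variable {k : ℕ} {g : ℂ → ℂ → ℂ}

/-- The cyclic sum defining the `k`-point function, for a kernel `g`. -/
def cyclicSum (k : ℕ) (g : ℂ → ℂ → ℂ) (w : Fin k → ℂ) : ℂ :=
  -((1 / (k : ℂ)) * ∑ σ : Equiv.Perm (Fin k), (∏ l, g (w (σ l)) (w (σ (finRotate k l)))) /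
    ∏ l, (w (σ l) - w (σ (finRotate k l))))

lemma finRotate_ne (hk : 2 ≤ k) (l : Fin k) : finRotate k l ≠ l := by
  obtain ⟨n, rfl⟩ := Nat.exists_eq_add_of_le' hk
  rw [finRotate_apply]
  simp

lemma finRotate_finRotate_ne (hk : 3 ≤ k) (l : Fin k) : finRotate k (finRotate k l) ≠ l := by
  obtain ⟨n, rfl⟩ := Nat.exists_eq_add_of_le' hk
  rw [finRotate_apply, finRotate_apply, add_assoc]
  intro h
  have h2 : (1 + 1 : Fin (n + 3)) = 0 := by simpa using h
  have := congr_arg Fin.val h2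
  simp only [Fin.val_add, Fin.val_one, Fin.val_zero] at this
  rw [Nat.mod_eq_of_lt (by lia)] at this
  lia

lemma update_injective {u : Fin k → ℂ} (hu : Function.Injective u) {i : Fin k} {x : ℂ}
    (hx : ∀ j, j ≠ i → x ≠ u j) : Function.Injective (Function.update u i x) := by
  intro a b hab
  by_cases ha : a = i <;> by_cases hb : b = i
  · rw [ha, hb]
  · subst ha
    simp [Function.update_of_ne hb] at hab
    exact absurd hab (hx b hb)
  · subst hb
    simp [Function.update_of_ne ha] at hab
    exact absurd hab.symm (hx a ha)
  · simp [Function.update_of_ne ha, Function.update_of_ne hb] at hab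
    exact hu hab

lemma differentiable_update (u : Fin k → ℂ) (i : Fin k) :
    Differentiable ℂ fun x : ℂ => Function.update u i x := by
  rw [differentiable_pi]
  intro j
  by_cases h : j = i
  · subst h
    simp
  · simp [Function.update_of_ne h]

lemma differentiable_kernel_apply (hg : Differentiable ℂ fun p : ℂ × ℂ => g p.1 p.2) (a b : Fin k) :
    Differentiable ℂ fun w : Fin k → ℂ => g (w a) (w b) :=
  hg.comp (f := fun w : Fin k → ℂ => (w a, w b)) (by fun_prop)

lemma differentiableAt_prod {E ι : Type*} [NormedAddCommGroup E] [NormedSpace ℂ E] (t : Finset ι)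
    {f : ι → E → ℂ} {x : E} (h : ∀ i, DifferentiableAt ℂ (f i) x) :
    DifferentiableAt ℂ (fun x => ∏ i ∈ t, f i x) x := by
  classical
  induction t using Finset.induction_on with
  | empty => simp
  | insert a t ha ih =>
    simp only [Finset.prod_insert ha]
    exact (h a).fun_mul ih

lemma differentiableAt_cyclicSum (hk : 2 ≤ k) (hg : Differentiable ℂ fun p : ℂ × ℂ => g p.1 p.2)
    {w : Fin k → ℂ} (hw : Function.Injective w) : DifferentiableAt ℂ (cyclicSum k g) w := by
  unfold cyclicSum
  refine ((DifferentiableAt.fun_sum fun σ _ => ?_).const_mul _).fun_neg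
  have h1 : DifferentiableAt ℂ (fun w : Fin k → ℂ =>
      ∏ l, g (w (σ l)) (w (σ (finRotate k l)))) w :=
    differentiableAt_prod _ fun l => (differentiable_kernel_apply hg _ _) w
  have h2 : DifferentiableAt ℂ (fun w : Fin k → ℂ =>
      ∏ l, (w (σ l) - w (σ (finRotate k l)))) w :=
    differentiableAt_prod _ fun l => by fun_prop
  simp only [div_eq_mul_inv]
  refine h1.fun_mul (h2.fun_inv ?_)
  rw [Finset.prod_ne_zero_iff]
  intro l _ h
  exact finRotate_ne hk l (σ.injective (hw (sub_eq_zero.1 h).symm))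

/-- The unordered pair `{a, b}` is `{i, j}`. -/
def IsPair (i j a b : Fin k) : Prop := (a = i ∧ b = j) ∨ (a = j ∧ b = i)

open Classical in
/-- The difference quotient `(w a - w b) / (w i - w j)` for `{a, b} = {i, j}`, and `w a - w b`
otherwise. -/
def regDiff (i j : Fin k) (w : Fin k → ℂ) (a b : Fin k) : ℂ :=
  if a = i ∧ b = j then 1 else if a = j ∧ b = i then -1 else w a - w b

open Classical in
lemma sub_eq_regDiff (i j : Fin k) (w : Fin k → ℂ) (a b : Fin k) :
    w a - w b = (if IsPair i j a b then w i - w j else 1) * regDiff i j w a b := by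
  unfold regDiff IsPair
  split_ifs with h1 h2 h3 h4 <;> first | (exfalso; tauto) | skip
  · rw [h2.1, h2.2, mul_one]
  · rw [h3.1, h3.2]
    ring
  · ring

open Classical in
-- In a cycle of length at least 3, i and j are neighbours at most once: being neighbours in both
-- orders would close a cycle of length 2. So each summand has at most a simple pole at w_i = w_j.
lemma card_isPair_le (hk : 3 ≤ k) (i j : Fin k) (σ : Equiv.Perm (Fin k)) :
    (Finset.univ.filter fun l => IsPair i j (σ l) (σ (finRotate k l))).card ≤ 1 := by
  rw [Finset.card_le_one]
  intro a ha b hb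
  simp only [Finset.mem_filter, Finset.mem_univ, true_and] at ha hb
  rcases ha with ⟨a1, a2⟩ | ⟨a1, a2⟩ <;> rcases hb with ⟨b1, b2⟩ | ⟨b1, b2⟩
  · exact σ.injective (a1.trans b1.symm)
  · have h1 := σ.injective (a2.trans b1.symm)
    have h2 := σ.injective (b2.trans a1.symm)
    exact absurd (h1 ▸ h2) (finRotate_finRotate_ne hk a)
  · have h1 := σ.injective (a2.trans b1.symm)
    have h2 := σ.injective (b2.trans a1.symm)
    exact absurd (h1 ▸ h2) (finRotate_finRotate_ne hk a)
  · exact σ.injective (a1.trans b1.symm)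

lemma regDiff_ne_zero {u : Fin k → ℂ} (hu : Function.Injective u) {i j : Fin k}
    {a b : Fin k} (hab : a ≠ b) : regDiff i j (Function.update u i (u j)) a b ≠ 0 := by
  unfold regDiff
  split_ifs with h1 h2
  · exact one_ne_zero
  · exact neg_ne_zero.2 one_ne_zero
  · rw [sub_ne_zero]
    intro h
    by_cases ha : a = i <;> by_cases hb : b = i
    · exact hab (ha.trans hb.symm)
    · subst ha
      simp only [Function.update_self, Function.update_of_ne hb] at h
      exact h1 ⟨rfl, (hu h).symm⟩
    · subst hb
      simp only [Function.update_self, Function.update_of_ne ha] at h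
      exact h2 ⟨hu h, rfl⟩
    · simp only [Function.update_of_ne ha, Function.update_of_ne hb] at h
      exact hab (hu h)

lemma continuous_regDiff (i j a b : Fin k) : Continuous fun w : Fin k → ℂ => regDiff i j w a b := by
  unfold regDiff
  split_ifs <;> fun_prop

open Classical in
lemma regDiff_swap {w : Fin k → ℂ} {i j : Fin k} (hij : i ≠ j) (hw : w i = w j) (a b : Fin k) :
    regDiff i j w (Equiv.swap i j a) (Equiv.swap i j b) =
      (if IsPair i j a b then -1 else 1) * regDiff i j w a b := by
  have hv : ∀ c, w (Equiv.swap i j c) = w c := fun c => by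
    rcases eq_or_ne c i with rfl | h1
    · rw [Equiv.swap_apply_left, hw]
    · rcases eq_or_ne c j with rfl | h2
      · rw [Equiv.swap_apply_right, hw]
      · rw [Equiv.swap_apply_of_ne_of_ne h1 h2]
  unfold regDiff IsPair
  rw [hv, hv]
  have e1 : ∀ c, Equiv.swap i j c = i ↔ c = j := fun c => by
    rw [← Equiv.eq_symm_apply, Equiv.symm_swap, Equiv.swap_apply_left]
  have e2 : ∀ c, Equiv.swap i j c = j ↔ c = i := fun c => by
    rw [← Equiv.eq_symm_apply, Equiv.symm_swap, Equiv.swap_apply_right]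
  simp only [e1, e2]
  split_ifs with h1 h2 h3 h4 h5 h6 <;> first | (exfalso; grind) | simp

open Classical in
lemma isPair_swap (i j a b : Fin k) :
    IsPair i j (Equiv.swap i j a) (Equiv.swap i j b) ↔ IsPair i j a b := by
  have e1 : ∀ c, Equiv.swap i j c = i ↔ c = j := fun c => by
    rw [← Equiv.eq_symm_apply, Equiv.symm_swap, Equiv.swap_apply_left]
  have e2 : ∀ c, Equiv.swap i j c = j ↔ c = i := fun c => by
    rw [← Equiv.eq_symm_apply, Equiv.symm_swap, Equiv.swap_apply_right]
  unfold IsPair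
  rw [e1, e2, e1, e2]
  tauto

open Classical in
-- The residues at w_i = w_j cancel in pairs. At the collision point the numerators for σ and (i j)σ
-- agree, while exactly one factor of the regularized denominator, the one coming from {i, j},
-- changes sign.
lemma tendsto_cyclicSum (hk : 3 ≤ k) (hg : Differentiable ℂ fun p : ℂ × ℂ => g p.1 p.2)
    {u : Fin k → ℂ} (hu : Function.Injective u) {i j : Fin k} (hij : i ≠ j) :
    Tendsto (fun x => (x - u j) * cyclicSum k g (Function.update u i x)) (𝓝[≠] (u j)) (𝓝 0) := by
  set v := Function.update u i (u j) with hv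
  set γ : ℂ → Fin k → ℂ := fun x => Function.update u i x with hγ
  have hvij : v i = v j := by simp [hv, Function.update_of_ne hij.symm]
  set n : Equiv.Perm (Fin k) → ℕ := fun σ =>
    (Finset.univ.filter fun l => IsPair i j (σ l) (σ (finRotate k l))).card with hn
  -- L σ is the residue of the summand of σ; it is 0 when i and j are not neighbours.
  set L : Equiv.Perm (Fin k) → ℂ := fun σ => if n σ = 1 then
    (∏ l, g (v (σ l)) (v (σ (finRotate k l)))) / ∏ l, regDiff i j v (σ l) (σ (finRotate k l)) else 0
    with hL
  have hvτ : ∀ c, v (Equiv.swap i j c) = v c := fun c => by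
    rcases eq_or_ne c i with rfl | h1
    · rw [Equiv.swap_apply_left, hvij]
    · rcases eq_or_ne c j with rfl | h2
      · rw [Equiv.swap_apply_right, hvij]
      · rw [Equiv.swap_apply_of_ne_of_ne h1 h2]
  have hτ : ∀ σ, L (Equiv.swap i j * σ) = -L σ := by
    intro σ
    have e : n (Equiv.swap i j * σ) = n σ := by simp [hn, isPair_swap]
    simp only [hL, e, Equiv.Perm.mul_apply, hvτ, regDiff_swap hij hvij, Finset.prod_mul_distrib]
    split_ifs with h
    · rw [Finset.prod_ite, Finset.prod_const_one, Finset.prod_const]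
      simp only [hn] at h
      rw [h, pow_one, mul_one, neg_one_mul, div_neg]
    · simp
  have hsum : ∑ σ, L σ = 0 := by
    have h1 : ∑ σ, L (Equiv.swap i j * σ) = ∑ σ, L σ :=
      Equiv.sum_comp (Equiv.mulLeft (Equiv.swap i j)) L
    rw [Finset.sum_congr rfl fun σ _ => hτ σ, Finset.sum_neg_distrib] at h1
    have : (2 : ℂ) * ∑ σ, L σ = 0 := by linear_combination -h1
    simpa using this
  have hcγ : Tendsto γ (𝓝[≠] (u j)) (𝓝 v) :=
    ((differentiable_update u i).continuous.tendsto (u j)).mono_left nhdsWithin_le_nhds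
  have hx0 : Tendsto (fun x => x - u j) (𝓝[≠] (u j)) (𝓝 0) := by
    have : Tendsto (fun x => x - u j) (𝓝 (u j)) (𝓝 (u j - u j)) :=
      (continuous_id.sub continuous_const).tendsto _
    rw [sub_self] at this
    exact this.mono_left nhdsWithin_le_nhds
  have hterm : ∀ σ : Equiv.Perm (Fin k), Tendsto (fun x => (x - u j) *
      ((∏ l, g (γ x (σ l)) (γ x (σ (finRotate k l)))) /
        ∏ l, (γ x (σ l) - γ x (σ (finRotate k l))))) (𝓝[≠] (u j)) (𝓝 (L σ)) := by
    intro σ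
    have hQ : Tendsto (fun x => (∏ l, g (γ x (σ l)) (γ x (σ (finRotate k l)))) /
        ∏ l, regDiff i j (γ x) (σ l) (σ (finRotate k l))) (𝓝[≠] (u j))
        (𝓝 ((∏ l, g (v (σ l)) (v (σ (finRotate k l)))) /
          ∏ l, regDiff i j v (σ l) (σ (finRotate k l)))) := by
      refine Tendsto.div (tendsto_finsetProd _ fun l _ => ?_) (tendsto_finsetProd _ fun l _ => ?_) ?_
      · exact ((differentiable_kernel_apply hg _ _).continuous.tendsto v).comp hcγ
      · exact ((continuous_regDiff i j _ _).tendsto v).comp hcγ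
      · rw [Finset.prod_ne_zero_iff]
        intro l _
        exact regDiff_ne_zero hu fun h => finRotate_ne (by lia) l (σ.injective h.symm)
    have hden : ∀ x, ∏ l, (γ x (σ l) - γ x (σ (finRotate k l))) =
        (x - u j) ^ n σ * ∏ l, regDiff i j (γ x) (σ l) (σ (finRotate k l)) := by
      intro x
      rw [Finset.prod_congr rfl fun l _ => sub_eq_regDiff i j (γ x) (σ l) (σ (finRotate k l)),
        Finset.prod_mul_distrib, Finset.prod_ite, Finset.prod_const_one, Finset.prod_const, mul_one]
      simp [hγ, Function.update_of_ne hij.symm, hn]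
    simp only [hden]
    have hle : n σ ≤ 1 := card_isPair_le hk i j σ
    by_cases h1 : n σ = 1
    · simp only [hL, h1, if_true]
      refine hQ.congr' ?_
      filter_upwards [self_mem_nhdsWithin] with x hx
      have hx' : x - u j ≠ 0 := sub_ne_zero.2 hx
      rw [pow_one, mul_div_assoc', mul_div_mul_left _ _ hx']
    · have h0 : n σ = 0 := by lia
      simp only [hL, h0, if_neg (zero_ne_one), pow_zero, one_mul]
      simpa using hx0.mul hQ
  have hfin := ((tendsto_finsetSum Finset.univ fun σ _ => hterm σ).const_mul (1 / (k : ℂ))).neg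
  rw [hsum, mul_zero, neg_zero] at hfin
  refine hfin.congr fun x => ?_
  rw [cyclicSum, ← Finset.mul_sum]
  ring

lemma isGoodOn_cyclicSum (hk : 3 ≤ k) (hg : Differentiable ℂ fun p : ℂ × ℂ => g p.1 p.2)
    (r : Fin k → ℝ) : IsGoodOn r (cyclicSum k g) := fun _ hu _ i =>
  ⟨fun _ _ hx' => (differentiableAt_cyclicSum (by lia) hg (update_injective hu hx')).comp _
      (differentiable_update _ i _), fun _ hj => tendsto_cyclicSum hk hg hu hj.symm⟩

/-- The two-point function of a kernel `g`. -/
def pairSum (g : ℂ → ℂ → ℂ) (w : Fin 2 → ℂ) : ℂ :=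
  (g (w 0) (w 1) * g (w 1) (w 0) - g (w 0) (w 0) * g (w 1) (w 1)) / (w 0 - w 1) ^ 2

lemma differentiableAt_pairSum (hg : Differentiable ℂ fun p : ℂ × ℂ => g p.1 p.2)
    {w : Fin 2 → ℂ} (hw : Function.Injective w) : DifferentiableAt ℂ (pairSum g) w := by
  have h := fun a b : Fin 2 => (differentiable_kernel_apply hg a b) w
  have h1 : DifferentiableAt ℂ (fun w : Fin 2 → ℂ =>
      g (w 0) (w 1) * g (w 1) (w 0) - g (w 0) (w 0) * g (w 1) (w 1)) w :=
    ((h _ _).fun_mul (h _ _)).fun_sub ((h _ _).fun_mul (h _ _))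
  have h2 : DifferentiableAt ℂ (fun w : Fin 2 → ℂ => (w 0 - w 1) ^ 2) w := by fun_prop
  have := h1.fun_mul (h2.fun_inv (pow_ne_zero _ (sub_ne_zero.2 (hw.ne (by decide : (0 : Fin 2) ≠ 1)))))
  simpa only [← div_eq_mul_inv, pairSum] using! this

end goodness

/-- The Wronskian-type determinant of `V(a)` and `V(b)`. -/
def detV (a b s : ℂ) : ℂ :=
  besselJ (a - 1 / 2) (2 * s) * besselJ (b + 1 / 2) (2 * s) -
    besselJ (a + 1 / 2) (2 * s) * besselJ (b - 1 / 2) (2 * s)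

lemma differentiable_detV {s : ℂ} (hs : s ≠ 0) (b : ℂ) : Differentiable ℂ fun a => detV a b s := by
  have h2 : ∀ c : ℂ, Differentiable ℂ fun a : ℂ => besselJ (a + c) (2 * s) := fun c =>
    (differentiable_besselJ hs).comp (f := fun a : ℂ => a + c) (by fun_prop)
  have := ((h2 (-(1 / 2))).mul_const (besselJ (b + 1 / 2) (2 * s))).fun_sub
    ((h2 (1 / 2)).mul_const (besselJ (b - 1 / 2) (2 * s)))
  simpa only [detV, sub_eq_add_neg] using this

/-- Lagrange's identity for 2 × 2 determinants. Both determinants vanish at a = b, which gives the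
double zero that cancels (a - b)². -/
lemma kerD_mul_kerD_sub (a b s : ℂ) : kerD a b s * kerD b a s - kerD a a s * kerD b b s =
    -(Real.pi * s) ^ 2 * (detV (-a) (-b) s * detV a b s) := by
  simp [kerD, vecV, detV]
  ring

/-- One determinant divided by x - u tends to a derivative, the other tends to 0; this is enough for
removability. -/
lemma tendsto_pairSum {s : ℂ} (hs : s ≠ 0) (u : ℂ) :
    Tendsto (fun x => (x - u) * ((kerD x u s * kerD u x s - kerD x x s * kerD u u s) /
      (x - u) ^ 2)) (𝓝[≠] u) (𝓝 0) := by
  have h0 : ∀ a, detV a a s = 0 := fun a => by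
    simp only [detV]
    ring
  have h1 : Tendsto (fun x => detV (-x) (-u) s) (𝓝[≠] u) (𝓝 0) := by
    have := ((differentiable_detV hs (-u)).continuous.comp continuous_neg).tendsto u
    simp only [Function.comp_apply, h0] at this
    exact this.mono_left nhdsWithin_le_nhds
  have h2 := ((differentiable_detV hs u) u).hasDerivAt.tendsto_slope
  have h3 := (h1.mul h2).const_mul (-(Real.pi * s) ^ 2)
  rw [zero_mul, mul_zero] at h3
  refine h3.congr' ?_
  filter_upwards [self_mem_nhdsWithin] with x hx
  have hx' : x - u ≠ 0 := sub_ne_zero.2 hx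
  rw [kerD_mul_kerD_sub, slope_def_field, h0]
  field_simp
  ring

lemma isGoodOn_pairSum {s : ℂ} (hs : s ≠ 0) (r : Fin 2 → ℝ) :
    IsGoodOn r (pairSum fun a b => kerD a b s) := by
  refine fun u hu _ i => ⟨fun _ _ hx' => (differentiableAt_pairSum (differentiable_kerD hs)
    (update_injective hu hx')).comp _ (differentiable_update _ i _), fun j hj => ?_⟩
  fin_cases i <;> fin_cases j
  · exact absurd rfl hj
  · refine (tendsto_pairSum hs (u 1)).congr fun x => ?_
    simp [pairSum]
  · refine (tendsto_pairSum hs (u 0)).congr fun x => ?_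
    simp only [pairSum, Fin.mk_one, Fin.zero_eta, Function.update_self, ne_eq, zero_ne_one,
      not_false_eq_true, Function.update_of_ne]
    rw [← neg_sub x (u 0), neg_sq, mul_comm (kerD (u 0) x s), mul_comm (kerD (u 0) (u 0) s)]
  · exact absurd rfl hj

variable {k : ℕ}

lemma trigSum_cyclicSum (hk : 2 ≤ k) :
    TrigSum k fun _ w s => cyclicSum k (fun a b => kerD a b s) w := by
  have hmem : ∀ σ : Equiv.Perm (Fin k), (fun w : Fin k → ℂ => ((-1 / (k : ℚ) : ℚ) : ℂ) *
      ∏ l, (w (σ l) - w (σ (finRotate k l)))⁻¹) ∈ trigRing k := fun σ => by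
    have := mul_mem (const_mem (k := k) (-1 / (k : ℚ))) (prod_mem (t := Finset.univ)
      fun l (_ : l ∈ Finset.univ) => inv_sub_mem (k := k) (i := σ l) (j := σ (finRotate k l))
        fun h => finRotate_ne hk l (σ.injective h).symm)
    convert! this using 1
    funext w
    simp [Finset.prod_apply]
  refine .congr _ _ (TrigSum.sum Finset.univ fun σ _ =>
    (trigSum_prod_kerD (⇑(σ : Equiv.Perm (Fin k))) (finRotate k)).amp_mul
      (amp_const ⟨_, hmem σ⟩)) fun N w hw s hs => ?_
  simp only [cyclicSum, Finset.mul_sum, ← Finset.sum_neg_distrib]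
  refine Finset.sum_congr rfl fun σ _ => ?_
  rw [Finset.prod_inv_distrib]
  push_cast
  ring

lemma trigSum_pairSum : TrigSum 2 fun _ w s => pairSum (fun a b => kerD a b s) w := by
  have h1 := trigSum_prod_kerD (k := 2) id (finRotate 2)
  have hm : (fun w : Fin 2 → ℂ => ((w 0 - w 1)⁻¹) ^ 2) ∈ trigRing 2 :=
    pow_mem (inv_sub_mem (by decide)) 2
  have hm2 : (fun w : Fin 2 → ℂ => ((-1 : ℚ) : ℂ) * (Complex.cos (Real.pi * w 0) *
      Complex.cos (Real.pi * w 1)) * ((w 0 - w 1)⁻¹) ^ 2) ∈ trigRing 2 :=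
    mul_mem (mul_mem (const_mem _) (mul_mem (cos_mem 0) (cos_mem 1))) hm
  refine .congr _ _ (.add _ _ (h1.amp_mul (amp_const ⟨_, hm⟩))
    ((amp_const ⟨_, hm2⟩).trigSum 2)) fun N w hw s hs => ?_
  have hs0 : s ≠ 0 := Complex.slitPlane_ne_zero hs
  simp only [pairSum, kerD_self' hs0, Fin.prod_univ_two]
  simp
  ring

lemma prod_ofFn_vecMulVec : ∀ (n : ℕ) (a b : Fin (n + 1) → Fin 2 → ℂ),
    (List.ofFn fun i => Matrix.vecMulVec (a i) (b i)).prod =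
      (∏ i : Fin n, b i.castSucc ⬝ᵥ a i.succ) • Matrix.vecMulVec (a 0) (b (Fin.last n))
  | 0, a, b => by simp
  | n + 1, a, b => by
    rw [List.ofFn_succ, List.prod_cons, prod_ofFn_vecMulVec n, Matrix.mul_smul,
      Matrix.vecMulVec_mul_vecMulVec, Fin.prod_univ_succ, Matrix.vecMulVec_smul, smul_smul, mul_comm]
    rfl

lemma trace_prod_ofFn_vecMulVec (n : ℕ) (a b : Fin (n + 1) → Fin 2 → ℂ) :
    ((List.ofFn fun i => Matrix.vecMulVec (a i) (b i)).prod).trace =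
      ∏ l, b l ⬝ᵥ a (finRotate (n + 1) l) := by
  rw [prod_ofFn_vecMulVec, Matrix.trace_smul, Matrix.trace_vecMulVec, Fin.prod_univ_castSucc,
    finRotate_last, smul_eq_mul, dotProduct_comm (a 0)]
  congr 1
  exact Finset.prod_congr rfl fun i _ => by
    rw [show i.castSucc = ⟨i, _⟩ from rfl, finRotate_of_lt i.2]; rfl

/-- The trace of a product of rank one matrices is the cyclic product of the pairings between
neighbours; the normalizing factors are redistributed along the cycle. -/
lemma trace_prod_matB {n : ℕ} {z : Fin (n + 1) → ℂ} (hz : ∀ i, NotHalfInteger (z i)) {s : ℂ}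
    (hs : s ≠ 0) : (∏ i, Complex.cos (Real.pi * z i)) *
      ((List.ofFn fun i => matB (z i) s).prod).trace =
        ∏ l, kerD (z l) (z (finRotate (n + 1) l)) s := by
  have h : ∀ i, matB (z i) s = Matrix.vecMulVec
      ((Real.pi * s / Complex.cos (Real.pi * z i)) • vecV (z i) s) (vecV (-z i) s) := fun i => by
    rw [matB_eq (hz i) hs, Matrix.smul_vecMulVec]
  simp only [h]
  rw [trace_prod_ofFn_vecMulVec]
  simp only [dotProduct_smul, smul_eq_mul, Finset.prod_mul_distrib]
  rw [Equiv.prod_comp (finRotate (n + 1)) fun i => (Real.pi : ℂ) * s / Complex.cos (Real.pi * z i),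
    ← mul_assoc, ← Finset.prod_mul_distrib, ← Finset.prod_mul_distrib]
  refine Finset.prod_congr rfl fun l _ => ?_
  have := cos_ne_zero_of_notHalfInteger (hz l)
  rw [kerD]
  field_simp

lemma exists_regular_kernel (hk : 2 ≤ k) : ∃ F : (Fin k → ℂ) → ℂ → ℂ, (TrigSum k fun _ => F) ∧
    (∀ s ∈ Complex.slitPlane, ContinuousOn (fun w => F w s) (injSet k)) ∧
    (∀ s ∈ Complex.slitPlane, ∀ r, IsGoodOn r fun w => F w s) ∧
    ∀ w ∈ injSet k, (∀ i, NotHalfInteger (w i)) → ∀ s ≠ 0,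
      (∏ i, Complex.cos (Real.pi * w i)) * pointFormula k w s = F w s := by
  obtain rfl | hk := hk.eq_or_lt
  · refine ⟨fun w s => pairSum (fun a b => kerD a b s) w, trigSum_pairSum, fun s hs w hw => ?_,
      fun s hs r => isGoodOn_pairSum (Complex.slitPlane_ne_zero hs) r, fun w hw hz s hs => ?_⟩
    · exact (differentiableAt_pairSum (differentiable_kerD
        (Complex.slitPlane_ne_zero hs)) hw).continuousAt.continuousWithinAt
    · have h := trace_prod_matB hz hs
      rw [Fin.prod_univ_two (fun l => kerD _ _ _), Fin.prod_univ_two] at h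
      simp only [List.ofFn_succ, List.ofFn_zero, List.prod_cons, List.prod_nil, mul_one] at h
      -- After multiplication by both cosines, the -1 in H₂ becomes -K(w₀,w₀)K(w₁,w₁).
      simp only [pointFormula, pairSum, kerD_self' hs, Fin.prod_univ_two]
      rw [mul_div_assoc', mul_sub, mul_one]
      congr 2
  · obtain ⟨n, rfl⟩ := Nat.exists_eq_add_of_le' (Nat.succ_le_iff.2 hk)
    refine ⟨fun w s => cyclicSum _ (fun a b => kerD a b s) w, trigSum_cyclicSum (by lia),
      fun s hs w hw => ?_, fun s hs r => isGoodOn_cyclicSum (by lia) (differentiable_kerD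
        (Complex.slitPlane_ne_zero hs)) r, fun w hw hz s hs => ?_⟩
    · exact (differentiableAt_cyclicSum (by lia) (differentiable_kerD
        (Complex.slitPlane_ne_zero hs)) hw).continuousAt.continuousWithinAt
    · change _ * -((1 / ((n + 3 : ℕ) : ℂ)) * _) = _
      rw [mul_neg, mul_left_comm, Finset.mul_sum]
      change _ = -(_ * _)
      congr 2
      refine Finset.sum_congr rfl fun σ _ => ?_
      rw [mul_div_assoc', ← Equiv.prod_comp σ]
      congr 1
      exact trace_prod_matB (fun i => hz (σ i)) hs

end

/-! ### Return to the variables λ, ε, q and the expansion of the k-point functions. -/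

section

lemma notHalfInteger_of_cos_ne_zero {z : ℂ} (h : Complex.cos (Real.pi * z) ≠ 0) :
    NotHalfInteger z := fun n hn => h <| by
  rw [Complex.cos_eq_zero_iff]
  exact ⟨n, by rw [hn]; ring⟩

/-- With s = r/ε the coefficient of s^{-d} acquires the factor ε^d; for |r| ≥ |ε| the point s is in
the sector. -/
lemma UExp.hasPowerExpansion {A : ℂ → ℂ} {c : ℕ → ℂ}
    (h : UExp (Set.univ : Set Unit) (fun _ => A) fun d _ => c d) {ε : ℂ} (hε : ε ≠ 0) :
    HasPowerExpansion ε (fun r => A (r / ε)) fun d => ε ^ d * c d := by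
  intro δ hδ N
  obtain ⟨C, hC⟩ := h δ hδ N
  refine IsBigO.of_bound (C * ‖ε‖ ^ N) ?_
  rw [eventually_inf_principal]
  filter_upwards [(tendsto_norm_cobounded_atTop (E := ℂ)).eventually_ge_atTop ‖ε‖] with r hr harg
  have hε' : 0 < ‖ε‖ := norm_pos_iff.2 hε
  have h1 := hC () trivial (r / ε) ⟨by rw [norm_div, le_div_iff₀ hε', one_mul]; exact hr, harg⟩
  have h2 : ∑ d ∈ Finset.range N, ε ^ d * c d * (r ^ d)⁻¹ =
      ∑ d ∈ Finset.range N, c d * ((r / ε) ^ d)⁻¹ := by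
    refine Finset.sum_congr rfl fun d _ => ?_
    rw [div_pow, inv_div]
    ring
  rw [h2]
  refine h1.trans (le_of_eq ?_)
  rw [norm_inv, norm_pow, norm_div, div_pow]
  field_simp

/-- Near w the cosines stay nonzero, so the limit of the defining formula is the limit of the
regular function divided by their product. -/
lemma tendsto_pointFormula {k : ℕ} {F : (Fin k → ℂ) → ℂ → ℂ}
    (hF : ∀ w ∈ injSet k, (∀ i, NotHalfInteger (w i)) → ∀ s ≠ 0,
      (∏ i, Complex.cos (Real.pi * w i)) * pointFormula k w s = F w s)
    {w : Fin k → ℂ} (hw : ∀ i, NotHalfInteger (w i)) {s L : ℂ} (hs : s ≠ 0)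
    (hL : Tendsto (fun w => F w s) (𝓝[injSet k] w) (𝓝 L)) :
    (∏ i, Complex.cos (Real.pi * w i)) * pointH k w s = L := by
  have hc : Continuous fun w : Fin k → ℂ => ∏ i, Complex.cos (Real.pi * w i) := by fun_prop
  have h0 : (∏ i, Complex.cos (Real.pi * w i)) ≠ 0 :=
    Finset.prod_ne_zero_iff.2 fun i _ => cos_ne_zero_of_notHalfInteger (hw i)
  have h1 : Tendsto (fun w => pointFormula k w s) (𝓝[injSet k] w)
      (𝓝 (L / ∏ i, Complex.cos (Real.pi * w i))) := by
    refine (hL.div ((hc.tendsto w).mono_left nhdsWithin_le_nhds) h0).congr' ?_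
    filter_upwards [self_mem_nhdsWithin,
      nhdsWithin_le_nhds (hc.continuousAt.eventually_ne h0)] with v hv hv0
    change F v s / (∏ i, Complex.cos (Real.pi * v i)) = _
    rw [div_eq_iff hv0, mul_comm, hF v hv (fun i => notHalfInteger_of_cos_ne_zero
      (Finset.prod_ne_zero_iff.1 hv0 i (Finset.mem_univ i))) s hs]
  have := neBot_nhdsWithin_injSet w
  have h2 : pointH k w s = L / ∏ i, Complex.cos (Real.pi * w i) := h1.limUnder_eq
  rw [h2, mul_div_cancel₀ _ h0]

/-- Clearing powers of a variable from a polynomial in quotients. -/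
lemma exists_homogenization {X σ σ' : Type*} (v : X → σ → ℂ) (v' : X → σ' → ℂ) (e : σ')
    (h : ∀ i, ∃ i', (∀ x, v' x e * v x i = v' x i') ∨ ∀ x, v x i = v' x i')
    (P : MvPolynomial σ ℚ) : ∃ (M : ℕ) (P' : MvPolynomial σ' ℚ), ∀ x,
      v' x e ^ M * MvPolynomial.aeval (v x) P = MvPolynomial.aeval (v' x) P' := by
  induction P using MvPolynomial.induction_on with
  | C a => exact ⟨0, MvPolynomial.C a, fun x => by simp⟩
  | add p q hp hq =>
    obtain ⟨M, p', hp⟩ := hp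
    obtain ⟨N, q', hq⟩ := hq
    refine ⟨M + N, MvPolynomial.X e ^ N * p' + MvPolynomial.X e ^ M * q', fun x => ?_⟩
    simp only [map_add, map_mul, map_pow, MvPolynomial.aeval_X, ← hp, ← hq]
    ring
  | mul_X p i hp =>
    obtain ⟨M, p', hp⟩ := hp
    obtain ⟨i', hi | hi⟩ := h i
    · refine ⟨M + 1, p' * MvPolynomial.X i', fun x => ?_⟩
      simp only [map_mul, MvPolynomial.aeval_X, ← hp, ← hi]
      ring
    · refine ⟨M, p' * MvPolynomial.X i', fun x => ?_⟩
      simp only [map_mul, MvPolynomial.aeval_X, ← hp, ← hi]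
      ring

lemma exists_aeval_ne_zero {σ : Type*} {Q : MvPolynomial σ ℚ} (hQ : Q ≠ 0) :
    ∃ w : σ → ℂ, MvPolynomial.aeval w Q ≠ 0 := by
  by_contra! h
  refine hQ (MvPolynomial.funext fun x => ?_)
  have h1 := h (algebraMap ℚ ℂ ∘ x)
  rw [MvPolynomial.aeval_algebraMap_apply] at h1
  simpa [MvPolynomial.coe_aeval_eq_eval] using h1

/-- Substituting w_i = λ_i/ε into numerator and denominator and clearing powers of ε leaves
polynomials in the required variables. -/
lemma IsRatTrig.isTrigRational {k : ℕ} {h : (Fin k → ℂ) → ℂ} (hc : Continuous h) (hr : IsRatTrig h)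
    (d : ℕ) : IsTrigRational k fun l ε => ε ^ d * h fun i => l i / ε := by
  refine ⟨?_, ?_⟩
  · refine (continuous_snd.pow d).continuousOn.mul (hc.comp_continuousOn ?_)
    refine continuousOn_pi.2 fun i => ContinuousOn.div ?_ continuous_snd.continuousOn fun p hp => hp.1
    exact ((continuous_apply i).comp continuous_fst).continuousOn
  · obtain ⟨P, Q, hQ, hPQ⟩ := hr
    obtain ⟨M, Q', hQ'⟩ := exists_homogenization
      (X := {p : (Fin k → ℂ) × ℂ // p.2 ≠ 0}) (fun p i => p.1.1 i / p.1.2)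
      (fun p => ratVars p.1.1 p.1.2) none
      (fun i => ⟨some i, Or.inl fun p => mul_div_cancel₀ _ p.2⟩) Q
    obtain ⟨N, P', hP'⟩ := exists_homogenization
      (X := {p : (Fin k → ℂ) × ℂ // p.2 ≠ 0}) (fun p => trigPt fun i => p.1.1 i / p.1.2)
      (fun p => trigVars p.1.1 p.1.2) (Sum.inl none) (by
        rintro (i | i | i)
        · exact ⟨Sum.inl (some i), Or.inl fun p => mul_div_cancel₀ _ p.2⟩
        · exact ⟨Sum.inr (Sum.inl i), Or.inr fun p => by
            simp [trigPt, trigVars, mul_div_assoc]⟩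
        · exact ⟨Sum.inr (Sum.inr i), Or.inr fun p => by
            simp [trigPt, trigVars, mul_div_assoc]⟩) P
    refine ⟨MvPolynomial.X (Sum.inl none) ^ (M + d) * P', MvPolynomial.X none ^ N * Q',
      mul_ne_zero (pow_ne_zero _ (MvPolynomial.X_ne_zero _)) fun h0 => ?_, fun p hp => ?_⟩
    -- The cleared denominator is nonzero because at ε = 1 it takes the values of the original one.
    · obtain ⟨w, hw⟩ := exists_aeval_ne_zero hQ
      have := hQ' ⟨(w, 1), one_ne_zero⟩
      rw [h0, map_zero] at this
      simp only [ratVars, one_pow, one_mul, div_one] at this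
      exact hw this
    · have h1 := hQ' ⟨p, hp.1⟩
      have h2 := hP' ⟨p, hp.1⟩
      have h3 := hPQ fun i => p.1 i / p.2
      simp only [map_mul, map_pow, MvPolynomial.aeval_X]
      rw [← h1, ← h2, ← h3]
      simp only [ratVars, trigVars, Sum.elim_inl]
      ring

/-- The expansions of the `k`-point functions. -/
lemma exists_expansion_pointH (k : ℕ) (hk : 2 ≤ k) :
    ∃ H Ht : ℕ → ℕ → (Fin k → ℂ) → ℂ → ℂ,
      (∀ d m : ℕ, IsTrigRational k (H d m) ∧ IsTrigRational k (Ht d m)) ∧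
      ∀ (l : Fin k → ℂ) (ε : ℂ), ε ≠ 0 → (∀ i, NotHalfInteger (l i / ε)) →
        HasTrigExpansion ε k
          (fun r => (∏ i, Complex.cos (Real.pi * l i / ε)) * pointH k (fun i => l i / ε) (r / ε))
          (fun m d => if m ≤ d then H d m l ε else 0)
          (fun m d => if m ≤ d then Ht d m l ε else 0) := by
  obtain ⟨F, hT, hc, hg, hF⟩ := exists_regular_kernel hk
  obtain ⟨Ca, Cb, hC, h0, hE⟩ := hT.exists_limit_expansion hc hg
  refine ⟨fun d m l ε => ε ^ d * Ca m d fun i => l i / ε,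
    fun d m l ε => ε ^ d * Cb m d fun i => l i / ε, fun d m =>
    ⟨(hC m d).1.2.isTrigRational (hC m d).1.1 d, (hC m d).2.2.isTrigRational (hC m d).2.1 d⟩,
    fun l ε hε hl => ?_⟩
  obtain ⟨A, B, hA0, hAB, hlim⟩ := hE fun i => l i / ε
  -- The cutoff m ≤ d costs nothing: coefficients of frequency m vanish in degrees below m.
  have ha : ∀ m, (fun d => if m ≤ d then ε ^ d * Ca m d (fun i => l i / ε) else 0) =
      fun d => ε ^ d * Ca m d (fun i => l i / ε) := fun m => funext fun d => by
    split_ifs with h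
    · rfl
    · rw [(h0 m d _ (not_le.1 h)).1, mul_zero]
  have hb : ∀ m, (fun d => if m ≤ d then ε ^ d * Cb m d (fun i => l i / ε) else 0) =
      fun d => ε ^ d * Cb m d (fun i => l i / ε) := fun m => funext fun d => by
    split_ifs with h
    · rfl
    · rw [(h0 m d _ (not_le.1 h)).2, mul_zero]
  refine ⟨fun m r => A m (r / ε), fun m r => B m (r / ε), fun r hr => ?_, ?_, fun m hm => ?_⟩
  · simp only [mul_div_assoc]
    exact tendsto_pointFormula hF hl (Complex.slitPlane_ne_zero hr) (hlim _ hr)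
  · simp only [ha]
    exact hA0.hasPowerExpansion hε
  · simp only [ha, hb]
    exact ⟨(hAB m hm).1.hasPowerExpansion hε, (hAB m hm).2.hasPowerExpansion hε⟩

end

/-! ### Formal amplitudes over ℚ[z] and the non-oscillating part of the one-point function. -/

section

/-- Formal power series in `1/s` with coefficients polynomial in `z`. -/
abbrev ZSeries : Type := PowerSeries (Polynomial ℚ)

namespace ZSeries

/-- The Euler operator in the variable of the power series. -/
def theta (f : ZSeries) : ZSeries := PowerSeries.mk fun n => (n : Polynomial ℚ) * f.coeff n

/-- The derivative with respect to `z`. -/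
def dz (f : ZSeries) : ZSeries := PowerSeries.mk fun n => Polynomial.derivative (f.coeff n)

/-- The variable of the coefficient ring. -/
def zVar : ZSeries := PowerSeries.C Polynomial.X

variable (f g : ZSeries)

@[simp] lemma coeff_theta (n : ℕ) : (theta f).coeff n = n * f.coeff n := PowerSeries.coeff_mk _ _

@[simp] lemma coeff_dz (n : ℕ) : (dz f).coeff n = Polynomial.derivative (f.coeff n) :=
  PowerSeries.coeff_mk _ _

lemma theta_add : theta (f + g) = theta f + theta g := by
  ext1 n
  simp [mul_add]

lemma theta_sub : theta (f - g) = theta f - theta g := by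
  ext1 n
  simp [mul_sub]

lemma theta_neg : theta (-f) = -theta f := by
  ext1 n
  simp

lemma theta_mul : theta (f * g) = theta f * g + f * theta g := by
  ext1 n
  simp only [coeff_theta, map_add, PowerSeries.coeff_mul, Finset.mul_sum, ← Finset.sum_add_distrib]
  refine Finset.sum_congr rfl fun ij hij => ?_
  rw [← Finset.HasAntidiagonal.mem_antidiagonal.1 hij]
  push_cast
  ring

lemma theta_dz : theta (dz f) = dz (theta f) := by
  ext1 n
  simp

lemma dz_add : dz (f + g) = dz f + dz g := by
  ext1 n
  simp

lemma dz_sub : dz (f - g) = dz f - dz g := by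
  ext1 n
  simp

lemma dz_mul : dz (f * g) = dz f * g + f * dz g := by
  ext1 n
  simp only [coeff_dz, map_add, PowerSeries.coeff_mul, ← Finset.sum_add_distrib, map_sum,
    Polynomial.derivative_mul]

lemma dz_X : dz PowerSeries.X = 0 := by
  ext1 n
  rw [coeff_dz, PowerSeries.coeff_X]
  split_ifs <;> simp

lemma dz_zVar : dz zVar = 1 := by
  ext1 n
  rw [coeff_dz, zVar, PowerSeries.coeff_C, PowerSeries.coeff_one]
  split_ifs <;> simp

lemma dz_two : dz 2 = 0 := by
  have h : (2 : ZSeries) = PowerSeries.C (Polynomial.C 2) := by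
    rw [map_ofNat Polynomial.C 2, map_ofNat PowerSeries.C 2]
  ext1 n
  rw [coeff_dz, h, PowerSeries.coeff_C]
  split_ifs <;> simp

lemma coeff_X_mul' (n : ℕ) : (PowerSeries.X * f).coeff n = if n = 0 then 0 else f.coeff (n - 1) := by
  rcases n with _ | n
  · simp
  · simp [PowerSeries.coeff_succ_X_mul]

/-- The polynomials `z ↦ hankelCoeff (z + c) d`. -/
def hankelPoly (c : ℚ) (d : ℕ) : Polynomial ℚ := ∏ j ∈ Finset.range d,
  Polynomial.C (1 / (4 * (j + 1)) : ℚ) * ((Polynomial.X + Polynomial.C c) ^ 2 -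
    Polynomial.C (((j : ℚ) + 1 / 2) ^ 2))

lemma aeval_hankelPoly (c : ℚ) (d : ℕ) (z : ℂ) :
    Polynomial.aeval z (hankelPoly c d) = hankelCoeff (z + c) d := by
  simp only [hankelPoly, hankelCoeff, map_prod, map_mul, map_sub, map_pow, map_add,
    Polynomial.aeval_C, Polynomial.aeval_X]
  refine Finset.prod_congr rfl fun j _ => ?_
  simp only [eq_ratCast]
  push_cast
  ring

lemma hankelPoly_succ (c : ℚ) (d : ℕ) : 4 * ((d : Polynomial ℚ) + 1) * hankelPoly c (d + 1) = hankelPoly c d *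
    ((Polynomial.X + Polynomial.C c) ^ 2 - ((d : Polynomial ℚ) + Polynomial.C (1 / 2)) ^ 2) := by
  have h : (4 * (d + 1) : Polynomial ℚ) * Polynomial.C (1 / (4 * (d + 1)) : ℚ) = 1 := by
    have h1 : (4 * (d + 1) : Polynomial ℚ) = Polynomial.C (4 * (d + 1) : ℚ) := by
      simp [← map_ofNat Polynomial.C 4]
    rw [h1, ← Polynomial.C_mul, mul_one_div_cancel (by positivity), Polynomial.C_1]
  have h2 : Polynomial.C (((d : ℚ) + 1 / 2) ^ 2) =
      ((d : Polynomial ℚ) + Polynomial.C (1 / 2)) ^ 2 := by simp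
  rw [hankelPoly, Finset.prod_range_succ, ← hankelPoly, h2]
  linear_combination (hankelPoly c d * ((Polynomial.X + Polynomial.C c) ^ 2 -
    ((d : Polynomial ℚ) + Polynomial.C (1 / 2)) ^ 2)) * h

lemma two_mul_C_half : (2 : Polynomial ℚ) * Polynomial.C (1 / 2) = 1 := by
  have h1 : (2 : Polynomial ℚ) = Polynomial.C 2 := (map_ofNat Polynomial.C 2).symm
  rw [h1, ← Polynomial.C_mul, mul_one_div_cancel two_ne_zero, Polynomial.C_1]

lemma hankelPoly_relation (d : ℕ) : (Polynomial.X - (d : Polynomial ℚ)) * hankelPoly (1 / 2) d =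
    (Polynomial.X + (d : Polynomial ℚ)) * hankelPoly (-1 / 2) d := by
  induction d with
  | zero => simp [hankelPoly]
  | succ d ih =>
    have h1 := hankelPoly_succ (1 / 2) d
    have h2 := hankelPoly_succ (-1 / 2) d
    have hh := two_mul_C_half
    have hn : Polynomial.C (-1 / 2 : ℚ) = -Polynomial.C (1 / 2) := by rw [neg_div, Polynomial.C_neg]
    rw [hn] at h2
    have h4 : (4 * (d + 1) : Polynomial ℚ) ≠ 0 := by
      have : ((4 * (d + 1) : ℕ) : Polynomial ℚ) ≠ 0 := Nat.cast_ne_zero.2 (by lia)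
      exact_mod_cast this
    refine mul_left_cancel₀ h4 ?_
    push_cast
    generalize Polynomial.C (1 / 2 : ℚ) = e at *
    generalize (Polynomial.X : Polynomial ℚ) = x at *
    generalize hankelPoly (1 / 2) d = k0 at *
    generalize hankelPoly (-1 / 2) d = h0 at *
    generalize hankelPoly (1 / 2) (d + 1) = k1 at *
    generalize hankelPoly (-1 / 2) (d + 1) = h1' at *
    generalize (d : Polynomial ℚ) = n at *
    linear_combination (x - (n + 1)) * h1 - (x + (n + 1)) * h2 +
      (x - (n + 1)) * (x + n + 1) * ih + ((x - n - 1) * k0 * (x - n) + (x + n + 1) * h0 * (x + n)) * hh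

/-- The contiguity relation between the parameters z + 1/2 and z - 1/2; together with
`hankelPoly_relation` it is the coefficient form of the differential system below. -/
lemma hankelPoly_sub (d : ℕ) : 2 * (hankelPoly (1 / 2) (d + 1) - hankelPoly (-1 / 2) (d + 1)) =
    (Polynomial.X + (d : Polynomial ℚ)) * hankelPoly (-1 / 2) d := by
  have ih := hankelPoly_relation d
  have h1 := hankelPoly_succ (1 / 2) d
  have h2 := hankelPoly_succ (-1 / 2) d
  have hh := two_mul_C_half
  have hn : Polynomial.C (-1 / 2 : ℚ) = -Polynomial.C (1 / 2) := by rw [neg_div, Polynomial.C_neg]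
  rw [hn] at h2
  have h4 : (4 * (d + 1) : Polynomial ℚ) ≠ 0 := by
    have : ((4 * (d + 1) : ℕ) : Polynomial ℚ) ≠ 0 := Nat.cast_ne_zero.2 (by lia)
    exact_mod_cast this
  refine mul_left_cancel₀ h4 ?_
  generalize Polynomial.C (1 / 2 : ℚ) = e at *
  generalize (Polynomial.X : Polynomial ℚ) = x at *
  generalize hankelPoly (1 / 2) d = k0 at *
  generalize hankelPoly (-1 / 2) d = h0 at *
  generalize hankelPoly (1 / 2) (d + 1) = k1 at *
  generalize hankelPoly (-1 / 2) (d + 1) = h1' at *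
  generalize (d : Polynomial ℚ) = n at *
  linear_combination 2 * h1 - 2 * h2 + 2 * (x + n + 1) * ih +
    (2 * k0 * (x - n) + 2 * h0 * (x + n)) * hh

/-- The formal cosine amplitude, with parameter `z + c`. -/
def cosSer (c : ℚ) : ZSeries := PowerSeries.mk fun d => hankelPoly c d * ((iPow d).1 : Polynomial ℚ)

/-- The formal sine amplitude, with parameter `z + c`. -/
def sinSer (c : ℚ) : ZSeries := PowerSeries.mk fun d => hankelPoly c d * ((iPow d).2 : Polynomial ℚ)

/-- The formal amplitude `P(z - 1/2)`. -/
def P0 : ZSeries := cosSer (-1 / 2)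
/-- The formal amplitude `Q(z - 1/2)`. -/
def Q0 : ZSeries := sinSer (-1 / 2)
/-- The formal amplitude `P(z + 1/2)`. -/
def P1 : ZSeries := cosSer (1 / 2)
/-- The formal amplitude `Q(z + 1/2)`. -/
def Q1 : ZSeries := sinSer (1 / 2)

/-- With X = 1/s the operator θ is -s d/ds. This lemma and the next three transcribe the first-order
system for √s J_{z-1/2}(2s) and √s J_{z+1/2}(2s) to the cosine and sine amplitudes. -/
lemma theta_P0 : PowerSeries.X * theta P0 = 2 * (Q1 - Q0) - PowerSeries.X * (zVar * P0) := by
  have h2 : (2 : ZSeries) = PowerSeries.C 2 := (map_ofNat PowerSeries.C 2).symm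
  ext1 n
  rw [map_sub, coeff_X_mul', coeff_X_mul', h2, PowerSeries.coeff_C_mul, map_sub]
  rcases n with _ | n
  · simp [Q1, Q0, sinSer, iPow]
  · have := hankelPoly_sub n
    simp only [P0, Q1, Q0, sinSer, cosSer, PowerSeries.coeff_mk, coeff_theta, zVar,
      PowerSeries.coeff_C_mul, iPow, Nat.add_sub_cancel, Nat.succ_ne_zero, if_false]
    linear_combination -((iPow n).1 : Polynomial ℚ) * this

lemma theta_Q0 : PowerSeries.X * theta Q0 = -(2 * (P1 - P0)) - PowerSeries.X * (zVar * Q0) := by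
  have h2 : (2 : ZSeries) = PowerSeries.C 2 := (map_ofNat PowerSeries.C 2).symm
  ext1 n
  rw [map_sub, map_neg, coeff_X_mul', coeff_X_mul', h2, PowerSeries.coeff_C_mul, map_sub]
  rcases n with _ | n
  · simp [P1, P0, cosSer, iPow, hankelPoly]
  · have := hankelPoly_sub n
    simp only [Q0, P1, P0, sinSer, cosSer, PowerSeries.coeff_mk, coeff_theta, zVar,
      PowerSeries.coeff_C_mul, iPow, Nat.add_sub_cancel, Nat.succ_ne_zero, if_false]
    push_cast
    linear_combination -((iPow n).2 : Polynomial ℚ) * this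

lemma theta_P1 : PowerSeries.X * theta P1 = -(2 * (Q1 - Q0)) + PowerSeries.X * (zVar * P1) := by
  have h2 : (2 : ZSeries) = PowerSeries.C 2 := (map_ofNat PowerSeries.C 2).symm
  ext1 n
  rw [map_add, map_neg, coeff_X_mul', coeff_X_mul', h2, PowerSeries.coeff_C_mul, map_sub]
  rcases n with _ | n
  · simp [Q1, Q0, sinSer, iPow]
  · have := hankelPoly_sub n
    have h3 := hankelPoly_relation n
    simp only [P1, Q1, Q0, sinSer, cosSer, PowerSeries.coeff_mk, coeff_theta, zVar,
      PowerSeries.coeff_C_mul, iPow, Nat.add_sub_cancel, Nat.succ_ne_zero, if_false]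
    linear_combination ((iPow n).1 : Polynomial ℚ) * this - ((iPow n).1 : Polynomial ℚ) * h3

lemma theta_Q1 : PowerSeries.X * theta Q1 = 2 * (P1 - P0) + PowerSeries.X * (zVar * Q1) := by
  have h2 : (2 : ZSeries) = PowerSeries.C 2 := (map_ofNat PowerSeries.C 2).symm
  ext1 n
  rw [map_add, coeff_X_mul', coeff_X_mul', h2, PowerSeries.coeff_C_mul, map_sub]
  rcases n with _ | n
  · simp [P1, P0, cosSer, iPow, hankelPoly]
  · have := hankelPoly_sub n
    have h3 := hankelPoly_relation n
    simp only [Q1, P1, P0, sinSer, cosSer, PowerSeries.coeff_mk, coeff_theta, zVar,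
      PowerSeries.coeff_C_mul, iPow, Nat.add_sub_cancel, Nat.succ_ne_zero, if_false]
    push_cast
    linear_combination ((iPow n).2 : Polynomial ℚ) * this - ((iPow n).2 : Polynomial ℚ) * h3

lemma coeff_zero_amplitudes : P0.coeff 0 = 1 ∧ Q0.coeff 0 = 0 ∧ P1.coeff 0 = 1 ∧ Q1.coeff 0 = 0 := by
  simp [P0, Q0, P1, Q1, cosSer, sinSer, iPow, hankelPoly]

lemma coeff_zero_mul (f g : ZSeries) : (f * g).coeff 0 = f.coeff 0 * g.coeff 0 := by
  simp

/-- The system makes θ of the left side vanish, so in characteristic zero only the constant term 1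
remains. It is the formal counterpart of K(z,z) = cos πz. -/
lemma wronskian_eq_one : P0 * P1 + Q0 * Q1 = 1 := by
  have h : theta (P0 * P1 + Q0 * Q1) = 0 := by
    refine mul_left_cancel₀ (PowerSeries.X_ne_zero (R := Polynomial ℚ)) ?_
    rw [theta_add, theta_mul, theta_mul]
    linear_combination P1 * theta_P0 + P0 * theta_P1 + Q1 * theta_Q0 + Q0 * theta_Q1
  ext1 n
  rcases n with _ | n
  · obtain ⟨h1, h2, h3, h4⟩ := coeff_zero_amplitudes
    simp only [coeff_zero_mul, map_add, h1, h2, h3, h4, PowerSeries.coeff_one]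
    simp
  · have h1 := congr_arg (PowerSeries.coeff (n + 1)) h
    rw [coeff_theta, map_zero, mul_eq_zero] at h1
    rw [h1.resolve_left (Nat.cast_ne_zero.2 n.succ_ne_zero), PowerSeries.coeff_one,
      if_neg n.succ_ne_zero]

/-- The difference `P(z - 1/2) Q(z + 1/2) - P(z + 1/2) Q(z - 1/2)`. -/
def cross : ZSeries := P0 * Q1 - P1 * Q0

/-- Twice the non-oscillating part of the logarithmic derivative. -/
def meanSer : ZSeries := -(Q1 * dz P0) + P0 * dz Q1 + P1 * dz Q0 - Q0 * dz P1

/-- Differentiating the system in z, everything cancels except the terms in which the derivative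
hits the explicit z; these are two copies of the cross product. -/
lemma theta_meanSer : theta meanSer = 2 * cross := by
  have d1 := congr_arg dz theta_P0
  have d2 := congr_arg dz theta_Q0
  have d3 := congr_arg dz theta_P1
  have d4 := congr_arg dz theta_Q1
  have hneg : ∀ f, dz (-f) = -dz f := fun f => by
    ext1 n
    simp
  simp only [dz_mul, dz_sub, dz_add, dz_X, dz_two, dz_zVar, hneg, ← theta_dz] at d1 d2 d3 d4
  refine mul_left_cancel₀ (PowerSeries.X_ne_zero (R := Polynomial ℚ)) ?_
  rw [meanSer, cross, theta_sub, theta_add, theta_add, theta_neg, theta_mul, theta_mul, theta_mul,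
    theta_mul]
  linear_combination -dz P0 * theta_Q1 - Q1 * d1 + dz Q1 * theta_P0 + P0 * d4 + dz Q0 * theta_P1 +
    P1 * d2 - dz P1 * theta_Q0 - Q0 * d3

/-- The difference of the squared moduli at `z + 1/2` and `z - 1/2`. -/
def diffSq : ZSeries := P1 ^ 2 + Q1 ^ 2 - (P0 ^ 2 + Q0 ^ 2)

/-- The sum of the squared moduli at `z + 1/2` and `z - 1/2`. -/
def sumSq : ZSeries := P1 ^ 2 + Q1 ^ 2 + (P0 ^ 2 + Q0 ^ 2)

/-- The quadratic expressions `cross`, `diffSq` and `sumSq` form a closed linear system under θ. -/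
lemma theta_cross : PowerSeries.X * theta cross = 2 * diffSq := by
  rw [cross, theta_sub, theta_mul, theta_mul, diffSq]
  linear_combination Q1 * theta_P0 + P0 * theta_Q1 - Q0 * theta_P1 - P1 * theta_Q0

lemma theta_diffSq : PowerSeries.X * theta diffSq =
    2 * (PowerSeries.X * (zVar * sumSq)) - 8 * cross := by
  simp only [diffSq, sumSq, cross, theta_sub, theta_add, pow_two, theta_mul]
  linear_combination 2 * P1 * theta_P1 + 2 * Q1 * theta_Q1 - 2 * P0 * theta_P0 - 2 * Q0 * theta_Q0

lemma theta_sumSq : theta sumSq = 2 * (zVar * diffSq) := by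
  refine mul_left_cancel₀ (PowerSeries.X_ne_zero (R := Polynomial ℚ)) ?_
  simp only [diffSq, sumSq, theta_add, pow_two, theta_mul]
  linear_combination 2 * P1 * theta_P1 + 2 * Q1 * theta_Q1 + 2 * P0 * theta_P0 + 2 * Q0 * theta_Q0

lemma coeff_two_mul (f : ZSeries) (n : ℕ) : (2 * f).coeff n = 2 * f.coeff n := by
  rw [← map_ofNat (PowerSeries.C (R := Polynomial ℚ)) 2, PowerSeries.coeff_C_mul]

lemma coeff_eight_mul (f : ZSeries) (n : ℕ) : (8 * f).coeff n = 8 * f.coeff n := by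
  rw [← map_ofNat (PowerSeries.C (R := Polynomial ℚ)) 8, PowerSeries.coeff_C_mul]

lemma coeff_relations (n : ℕ) : (n : Polynomial ℚ) * cross.coeff n = 2 * diffSq.coeff (n + 1) ∧
    (n : Polynomial ℚ) * diffSq.coeff n =
      2 * (Polynomial.X * sumSq.coeff n) - 8 * cross.coeff (n + 1) ∧
    (n : Polynomial ℚ) * sumSq.coeff n = 2 * (Polynomial.X * diffSq.coeff n) := by
  have h1 := congr_arg (PowerSeries.coeff (n + 1)) theta_cross
  have h2 := congr_arg (PowerSeries.coeff (n + 1)) theta_diffSq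
  have h3 := congr_arg (PowerSeries.coeff n) theta_sumSq
  simp only [map_sub, coeff_two_mul, coeff_eight_mul, PowerSeries.coeff_succ_X_mul, coeff_theta, zVar,
    PowerSeries.coeff_C_mul] at h1 h2 h3
  exact ⟨h1, h2, h3⟩

/-- Eliminating `diffSq` and `sumSq` from the system leaves two terms, two degrees apart. -/
lemma coeff_cross_recurrence (n : ℕ) :
    16 * ((n : Polynomial ℚ) + 2) * cross.coeff (n + 3) =
      ((n : Polynomial ℚ) + 1) * (4 * Polynomial.X ^ 2 - ((n : Polynomial ℚ) + 2) ^ 2) * cross.coeff (n + 1) := by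
  obtain ⟨a1, -, -⟩ := coeff_relations (n + 1)
  obtain ⟨-, b2, b3⟩ := coeff_relations (n + 2)
  push_cast at a1 b2 b3
  change ((n : Polynomial ℚ) + 1) * cross.coeff (n + 1) = 2 * diffSq.coeff (n + 2) at a1
  change ((n : Polynomial ℚ) + 2) * _ = _ - 8 * cross.coeff (n + 3) at b2
  linear_combination -(4 * Polynomial.X ^ 2 - ((n : Polynomial ℚ) + 2) ^ 2) * a1 +
    2 * ((n : Polynomial ℚ) + 2) * b2 + 4 * Polynomial.X * b3

lemma coeff_cross_init : cross.coeff 0 = 0 ∧ 2 * cross.coeff 1 = Polynomial.X ∧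
    cross.coeff 2 = 0 := by
  obtain ⟨h1, h2, h3, h4⟩ := coeff_zero_amplitudes
  have e0 : cross.coeff 0 = 0 := by
    simp only [cross, map_sub, coeff_zero_mul, h2, h4]
    simp
  have s0 : sumSq.coeff 0 = 2 := by
    simp only [sumSq, map_add, pow_two, coeff_zero_mul, h1, h2, h3, h4]
    norm_num
  obtain ⟨a1, a2, -⟩ := coeff_relations 0
  obtain ⟨-, b2, b3⟩ := coeff_relations 1
  rw [s0] at a2
  push_cast at a1 a2 b2 b3
  have h2' : (2 : Polynomial ℚ) ≠ 0 := two_ne_zero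
  have m1 : diffSq.coeff 1 = 0 := by
    refine mul_left_cancel₀ h2' ?_
    linear_combination -a1
  refine ⟨e0, ?_, ?_⟩
  · refine mul_left_cancel₀ h2' (mul_left_cancel₀ h2' ?_)
    linear_combination a2
  · refine mul_left_cancel₀ h2' (mul_left_cancel₀ h2' (mul_left_cancel₀ h2' ?_))
    rw [m1] at b2 b3
    linear_combination b2 + 2 * Polynomial.X * b3

/-- The value of a coefficient. -/
def ev (f : ZSeries) (n : ℕ) (z : ℂ) : ℂ := Polynomial.aeval z (f.coeff n)

lemma ev_cross_even (j : ℕ) (z : ℂ) : ev cross (2 * j) z = 0 := by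
  induction j using Nat.strong_induction_on with
  | _ j ih =>
    rcases j with _ | _ | j
    · simp [ev, coeff_cross_init.1]
    · simp [ev, coeff_cross_init.2.2]
    · have h := congr_arg (Polynomial.aeval z) (coeff_cross_recurrence (2 * j + 1))
      have h2 := ih (j + 1) (by lia)
      simp only [map_mul, map_add, map_natCast, map_one] at h
      change _ = _ * ev cross (2 * (j + 1)) z at h
      rw [h2, mul_zero, mul_eq_zero] at h
      refine h.resolve_left ?_
      rw [map_ofNat, map_ofNat]
      exact_mod_cast (by positivity : (0 : ℕ) < 16 * (2 * j + 1 + 2)).ne'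

lemma prod_Icc_succ (j : ℕ) (z : ℂ) :
    ∏ i ∈ Finset.Icc (-((j + 1 : ℕ) : ℤ)) ((j + 1 : ℕ) : ℤ), (z - i) =
      (z ^ 2 - (j + 1) ^ 2) * ∏ i ∈ Finset.Icc (-(j : ℤ)) (j : ℤ), (z - i) := by
  have h : Finset.Icc (-((j + 1 : ℕ) : ℤ)) ((j + 1 : ℕ) : ℤ) =
      insert (-((j + 1 : ℕ) : ℤ)) (insert ((j + 1 : ℕ) : ℤ) (Finset.Icc (-(j : ℤ)) (j : ℤ))) := by
    ext i
    simp only [Finset.mem_Icc, Finset.mem_insert]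
    lia
  rw [h, Finset.prod_insert, Finset.prod_insert]
  · push_cast
    ring
  · simp
  · simp only [Finset.mem_insert, Finset.mem_Icc]
    lia

/-- For n = 2j the recurrence contributes 4(z² - (j+1)²), which adjoins the factors z ± (j+1), and
the ratio (2j+1)/(2j+2) of double and ordinary factorials up to powers of 2. -/
lemma ev_cross_odd (j : ℕ) (z : ℂ) : ev cross (2 * j + 1) z =
    (((2 * j - 1)‼ : ℕ) * ∏ i ∈ Finset.Icc (-(j : ℤ)) (j : ℤ), (z - i)) /
      ((j ! : ℂ) * 2 ^ (3 * j + 1)) := by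
  induction j with
  | zero =>
    have h := congr_arg (Polynomial.aeval z) coeff_cross_init.2.1
    simp only [map_mul, Polynomial.aeval_X, map_ofNat] at h
    change 2 * ev cross 1 z = z at h
    simp
    linear_combination h / 2
  | succ j ih =>
    have h := congr_arg (Polynomial.aeval z) (coeff_cross_recurrence (2 * j))
    simp only [map_mul, map_add, map_sub, map_pow, Polynomial.aeval_X, map_natCast, map_one,
      map_ofNat] at h
    change _ * ev cross (2 * (j + 1) + 1) z = _ * ev cross (2 * j + 1) z at h
    rw [ih] at h
    have hd : ((2 * (j + 1) - 1)‼ : ℕ) = (2 * j + 1) * (2 * j - 1)‼ := by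
      rcases j with _ | j
      · simp
      · rw [show 2 * (j + 1 + 1) - 1 = (2 * j + 1) + 2 by lia, Nat.doubleFactorial_add_two,
          show 2 * (j + 1) - 1 = 2 * j + 1 by lia]
        ring
    rw [hd, prod_Icc_succ, eq_div_iff (mul_ne_zero (Nat.cast_ne_zero.2 (Nat.factorial_ne_zero _))
      (pow_ne_zero _ two_ne_zero)), Nat.factorial_succ]
    have hf : (j ! : ℂ) ≠ 0 := Nat.cast_ne_zero.2 (Nat.factorial_ne_zero j)
    have hj : (j : ℂ) + 1 ≠ 0 := Nat.cast_add_one_ne_zero j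
    generalize ∏ i ∈ Finset.Icc (-(j : ℤ)) (j : ℤ), (z - (i : ℂ)) = W at *
    generalize ev cross (2 * (j + 1) + 1) z = y at *
    rw [show 3 * (j + 1) + 1 = (3 * j + 1) + 3 by ring, pow_add]
    have h2 : (2 : ℂ) ^ (3 * j + 1) ≠ 0 := pow_ne_zero _ two_ne_zero
    generalize (2 : ℂ) ^ (3 * j + 1) = T at *
    push_cast at h ⊢
    generalize ((2 * j - 1)‼ : ℂ) = D at *
    generalize (j ! : ℂ) = f at *
    field_simp at h
    linear_combination h / 4

end ZSeries

end

/-! ### Degree bounds in z for the oscillating coefficients, and derivatives as Cauchy integrals. -/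

section

namespace ZSeries

/-- The coefficient of order `n` has degree at most `2 n - c` in `z`. -/
def HasWeight (c : ℕ) (f : ZSeries) : Prop := ∀ n m, 2 * n < m + c → (f.coeff n).coeff m = 0

section
variable {c e : ℕ} {f g : ZSeries}

lemma HasWeight.add (hf : HasWeight c f) (hg : HasWeight c g) : HasWeight c (f + g) :=
  fun n m h => by rw [map_add, Polynomial.coeff_add, hf n m h, hg n m h, add_zero]

lemma HasWeight.sub (hf : HasWeight c f) (hg : HasWeight c g) : HasWeight c (f - g) :=
  fun n m h => by rw [map_sub, Polynomial.coeff_sub, hf n m h, hg n m h, sub_zero]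

lemma HasWeight.mul (hf : HasWeight c f) (hg : HasWeight e g) : HasWeight (c + e) (f * g) := by
  intro n m h
  rw [PowerSeries.coeff_mul, Polynomial.finsetSum_coeff]
  refine Finset.sum_eq_zero fun ij hij => ?_
  rw [Polynomial.coeff_mul]
  refine Finset.sum_eq_zero fun ab hab => ?_
  have h1 := Finset.HasAntidiagonal.mem_antidiagonal.1 hij
  have h2 := Finset.HasAntidiagonal.mem_antidiagonal.1 hab
  by_cases h3 : 2 * ij.1 < ab.1 + c
  · rw [hf _ _ h3, zero_mul]
  · rw [hg _ _ (by lia), mul_zero]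

lemma HasWeight.dz (hf : HasWeight c f) : HasWeight (c + 1) (dz f) := fun n m h => by
  rw [coeff_dz, Polynomial.coeff_derivative, hf n (m + 1) (by lia), zero_mul]

lemma HasWeight.const_mul (hf : HasWeight c f) (r : ℚ) :
    HasWeight c (PowerSeries.C (Polynomial.C r) * f) := fun n m h => by
  rw [PowerSeries.coeff_C_mul, Polynomial.coeff_C_mul, hf n m h, mul_zero]

lemma HasWeight.natDegree_le (hf : HasWeight c f) (n : ℕ) :
    (f.coeff n).natDegree ≤ 2 * n - c :=
  Polynomial.natDegree_le_iff_coeff_eq_zero.2 fun m hm => hf n m (by lia)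

lemma HasWeight.coeff_eq_zero (hf : HasWeight c f) {n : ℕ} (hn : 2 * n < c) : f.coeff n = 0 := by
  ext m
  rw [hf n m (by lia), Polynomial.coeff_zero]

end

lemma natDegree_hankelPoly_le (c : ℚ) (d : ℕ) : (hankelPoly c d).natDegree ≤ 2 * d := by
  refine (Polynomial.natDegree_prod_le _ _).trans ?_
  refine (Finset.sum_le_card_nsmul _ _ 2 fun j _ => ?_).trans (by simp [mul_comm])
  compute_degree

lemma coeff_mul_intCast (p : Polynomial ℚ) (a : ℤ) (m : ℕ) :
    (p * (a : Polynomial ℚ)).coeff m = p.coeff m * a := by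
  rw [← map_intCast (Polynomial.C (R := ℚ)) a, Polynomial.coeff_mul_C]

lemma hasWeight_cosSer (c : ℚ) : HasWeight 0 (cosSer c) := fun n m h => by
  rw [cosSer, PowerSeries.coeff_mk, coeff_mul_intCast, Polynomial.coeff_eq_zero_of_natDegree_lt
    ((natDegree_hankelPoly_le c n).trans_lt (by lia)), zero_mul]

lemma hasWeight_sinSer (c : ℚ) : HasWeight 0 (sinSer c) := fun n m h => by
  rw [sinSer, PowerSeries.coeff_mk, coeff_mul_intCast, Polynomial.coeff_eq_zero_of_natDegree_lt
    ((natDegree_hankelPoly_le c n).trans_lt (by lia)), zero_mul]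

/-- The polynomials for z ± 1/2 have the same leading term of degree 2n; `hankelPoly_sub` shows that
their difference has degree at most 2n - 1. -/
lemma coeff_hankelPoly_sub {n m : ℕ} (h : 2 * n < m + 1) :
    (hankelPoly (1 / 2) n - hankelPoly (-1 / 2) n).coeff m = 0 := by
  rcases n with _ | n
  · simp [hankelPoly]
  · have h1 := hankelPoly_sub n
    have h2 : ((Polynomial.X + (n : Polynomial ℚ)) * hankelPoly (-1 / 2) n).natDegree < m := by
      refine (Polynomial.natDegree_mul_le.trans (add_le_add (?_ : _ ≤ 1)
        (natDegree_hankelPoly_le _ n))).trans_lt (by lia)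
      compute_degree
    have h3 := Polynomial.coeff_eq_zero_of_natDegree_lt h2
    rw [← h1, ← map_ofNat Polynomial.C 2, Polynomial.coeff_C_mul] at h3
    simpa using h3

lemma hasWeight_P1_sub : HasWeight 1 (P1 - P0) := fun n m h => by
  simp only [P1, P0, cosSer, map_sub, PowerSeries.coeff_mk]
  rw [← sub_mul, coeff_mul_intCast, coeff_hankelPoly_sub h, zero_mul]

lemma hasWeight_Q1_sub : HasWeight 1 (Q1 - Q0) := fun n m h => by
  simp only [Q1, Q0, sinSer, map_sub, PowerSeries.coeff_mk]
  rw [← sub_mul, coeff_mul_intCast, coeff_hankelPoly_sub h, zero_mul]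

/-- The coefficients of the cosine in the one-point function. -/
def oscCos : ZSeries := PowerSeries.C (Polynomial.C (1 / 2)) * ((P1 - P0) * dz P0 -
  P0 * dz (P1 - P0) + (Q0 * dz (Q1 - Q0) - (Q1 - Q0) * dz Q0))

/-- The coefficients of the sine in the one-point function. -/
def oscSin : ZSeries := PowerSeries.C (Polynomial.C (1 / 2)) * (Q0 * dz (P1 - P0) -
  (P1 - P0) * dz Q0 + (P0 * dz (Q1 - Q0) - (Q1 - Q0) * dz P0))

/-- Every product contains one difference of amplitudes and one z-derivative, and each of these
lowers the degree by one. -/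
lemma hasWeight_oscCos : HasWeight 2 oscCos := by
  have hP : HasWeight 0 P0 := hasWeight_cosSer _
  have hQ : HasWeight 0 Q0 := hasWeight_sinSer _
  exact (((hasWeight_P1_sub.mul hP.dz).sub (hP.mul hasWeight_P1_sub.dz)).add
    ((hQ.mul hasWeight_Q1_sub.dz).sub (hasWeight_Q1_sub.mul hQ.dz))).const_mul _

lemma hasWeight_oscSin : HasWeight 2 oscSin := by
  have hP : HasWeight 0 P0 := hasWeight_cosSer _
  have hQ : HasWeight 0 Q0 := hasWeight_sinSer _
  exact (((hQ.mul hasWeight_P1_sub.dz).sub (hasWeight_P1_sub.mul hQ.dz)).add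
    ((hP.mul hasWeight_Q1_sub.dz).sub (hasWeight_Q1_sub.mul hP.dz))).const_mul _

lemma hasDerivAt_ev (f : ZSeries) (d : ℕ) (z : ℂ) : HasDerivAt (ev f d) (ev (dz f) d z) z := by
  have := (f.coeff d).hasDerivAt_aeval z
  rwa [← coeff_dz] at this

lemma ev_mul (f g : ZSeries) (d : ℕ) (z : ℂ) :
    ev (f * g) d z = ∑ ij ∈ Finset.HasAntidiagonal.antidiagonal d, ev f ij.1 z * ev g ij.2 z := by
  simp [ev, PowerSeries.coeff_mul]

lemma ev_add (f g : ZSeries) (d : ℕ) (z : ℂ) : ev (f + g) d z = ev f d z + ev g d z := by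
  simp [ev]

lemma ev_sub (f g : ZSeries) (d : ℕ) (z : ℂ) : ev (f - g) d z = ev f d z - ev g d z := by
  simp [ev]

lemma ev_neg (f : ZSeries) (d : ℕ) (z : ℂ) : ev (-f) d z = -ev f d z := by
  simp [ev]

/-- The degree in λ/ε is at most 2d - 2, so ε^{d-2} ε^d = ε^{2d-2} clears all denominators. The
grading operator annihilates functions of λ/ε, leaving the factor d from ε^d. -/
lemma isOnePointCoeff_ev {f : ZSeries} (hf : HasWeight 2 f) {d : ℕ} (hd : 1 ≤ d) :
    IsOnePointCoeff d fun l ε => ε ^ d * ev f d (l / ε) := by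
  refine ⟨⟨∑ m ∈ Finset.range (2 * d - 2 + 1), MvPolynomial.C ((f.coeff d).coeff m) *
    MvPolynomial.X 0 ^ m * MvPolynomial.X 1 ^ (2 * d - 2 - m), fun l ε hε => ?_⟩, fun l ε hε => ?_⟩
  · have h1 : ε ^ ((d : ℤ) - 2) * ε ^ d = ε ^ (2 * d - 2) := by
      rw [← zpow_natCast, ← zpow_natCast, ← zpow_add₀ hε]
      congr 1
      lia
    rw [← mul_assoc, h1, ev, Polynomial.aeval_eq_sum_range' (Nat.lt_succ_of_le
      (hf.natDegree_le d)), map_sum, Finset.mul_sum]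
    refine Finset.sum_congr rfl fun m hm => ?_
    have hm' : m ≤ 2 * d - 2 := Nat.lt_succ_iff.1 (Finset.mem_range.1 hm)
    simp only [map_mul, map_pow, MvPolynomial.aeval_X, MvPolynomial.aeval_C, Algebra.smul_def,
      Matrix.cons_val_zero, Matrix.cons_val_one]
    rw [div_pow, ← Nat.sub_add_cancel hm', pow_add, Nat.add_sub_cancel]
    field_simp
  · have h1 : HasDerivAt (fun e : ℂ => e ^ d * ev f d (l / e))
        (d * ε ^ (d - 1) * ev f d (l / ε) + ε ^ d * (ev (dz f) d (l / ε) * (l * -(ε ^ 2)⁻¹))) ε := by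
      have h2 : HasDerivAt (fun e : ℂ => l / e) (l * -(ε ^ 2)⁻¹) ε := by
        simpa only [div_eq_mul_inv] using (hasDerivAt_inv hε).const_mul l
      exact (hasDerivAt_pow d ε).fun_mul ((hasDerivAt_ev f d (l / ε)).comp ε h2)
    have h3 : HasDerivAt (fun x : ℂ => ε ^ d * ev f d (x / ε))
        (ε ^ d * (ev (dz f) d (l / ε) * (1 / ε))) l :=
      ((hasDerivAt_ev f d (l / ε)).comp l ((hasDerivAt_id l).div_const ε)).const_mul _
    rw [grading, h1.deriv, h3.deriv]
    obtain ⟨n, rfl⟩ := Nat.exists_eq_add_of_le' hd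
    rw [Nat.add_sub_cancel]
    generalize ev (dz f) (n + 1) (l / ε) = a
    change _ = _ * (ε ^ (n + 1) * ev f (n + 1) (l / ε))
    generalize ev f (n + 1) (l / ε) = b
    field_simp
    ring

end ZSeries

/-- The derivative at the centre of a circle, as a Cauchy integral. -/
def cauchyDeriv (z : ℂ) (f : ℂ → ℂ) : ℂ :=
  (2 * Real.pi * Complex.I : ℂ)⁻¹ • ∮ b in C(z, 1), ((b - z) ^ 2)⁻¹ • f b

section
variable {z : ℂ} {f g : ℂ → ℂ}

lemma circleIntegrable_kernel (hf : ContinuousOn f (Metric.sphere z 1)) :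
    CircleIntegrable (fun b => ((b - z) ^ 2)⁻¹ • f b) z 1 := by
  have h : ContinuousOn (fun b : ℂ => (b - z) ^ 2) (Metric.sphere z 1) := by fun_prop
  refine ContinuousOn.circleIntegrable zero_le_one ((h.inv₀
    fun b hb => pow_ne_zero _ (sub_ne_zero.2 ?_)).smul hf)
  rintro rfl
  simp at hb

lemma cauchyDeriv_add (hf : ContinuousOn f (Metric.sphere z 1))
    (hg : ContinuousOn g (Metric.sphere z 1)) :
    cauchyDeriv z (fun b => f b + g b) = cauchyDeriv z f + cauchyDeriv z g := by
  simp only [cauchyDeriv, smul_add]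
  rw [circleIntegral.integral_add (circleIntegrable_kernel hf) (circleIntegrable_kernel hg), smul_add]

lemma cauchyDeriv_mul_const (a : ℂ) :
    cauchyDeriv z (fun b => f b * a) = cauchyDeriv z f * a := by
  have : ∀ b, ((b - z) ^ 2)⁻¹ • (f b * a) = a • (((b - z) ^ 2)⁻¹ • f b) := fun b => by
    simp only [smul_eq_mul]
    ring
  simp only [cauchyDeriv, this]
  rw [circleIntegral.integral_smul]
  simp only [smul_eq_mul]
  ring

lemma cauchyDeriv_congr (h : ∀ b ∈ Metric.sphere z 1, f b = g b) :
    cauchyDeriv z f = cauchyDeriv z g := by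
  rw [cauchyDeriv, cauchyDeriv]
  congr 1
  exact circleIntegral.integral_congr zero_le_one fun b hb => by simp only [h b hb]

lemma cauchyDeriv_eq (hf : Differentiable ℂ f) : cauchyDeriv z f = deriv f z :=
  Complex.two_pi_I_inv_smul_circleIntegral_sub_sq_inv_smul_of_differentiable isOpen_univ
    (Set.subset_univ _) hf.differentiableOn (Metric.mem_ball_self one_pos)

lemma norm_cauchyDeriv_le {C : ℝ} (h : ∀ b ∈ Metric.sphere z 1, ‖f b‖ ≤ C) :
    ‖cauchyDeriv z f‖ ≤ C := by
  have := circleIntegral.norm_two_pi_i_inv_smul_integral_le_of_norm_le_const (c := z) (R := 1)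
    (f := fun b => ((b - z) ^ 2)⁻¹ • f b) (C := C) zero_le_one fun b hb => by
      rw [norm_smul, norm_inv, norm_pow, mem_sphere_iff_norm.1 hb]
      simpa using h b hb
  simpa [cauchyDeriv] using this

end

/-- Uniform expansion on the unit circle around `z`, with coefficients which are entire and have the
given values and derivatives at `z`. -/
structure JetExp (z : ℂ) (F : ℂ → ℂ → ℂ) (v w : ℕ → ℂ) : Prop where
  exists_coeff : ∃ c : ℕ → ℂ → ℂ, UExp (Metric.sphere z 1) F c ∧ (∀ d, Differentiable ℂ (c d)) ∧
    ∀ d, c d z = v d ∧ deriv (c d) z = w d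
  cont : ∀ s ∈ Complex.slitPlane, ContinuousOn (fun b => F b s) (Metric.sphere z 1)

section
variable {z : ℂ} {F G : ℂ → ℂ → ℂ} {v w v' w' : ℕ → ℂ}

lemma JetExp.add (hF : JetExp z F v w) (hG : JetExp z G v' w') :
    JetExp z (fun b s => F b s + G b s) (fun d => v d + v' d) fun d => w d + w' d := by
  obtain ⟨c, h1, h2, h3⟩ := hF.exists_coeff
  obtain ⟨e, g1, g2, g3⟩ := hG.exists_coeff
  refine ⟨⟨_, h1.add g1, fun d => (h2 d).fun_add (g2 d), fun d => ⟨?_, ?_⟩⟩,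
    fun s hs => (hF.cont s hs).fun_add (hG.cont s hs)⟩
  · rw [(h3 d).1, (g3 d).1]
  · rw [← (h3 d).2, ← (g3 d).2]
    exact deriv_fun_add (h2 d z) (g2 d z)

lemma JetExp.smul (hF : JetExp z F v w) {a : ℂ → ℂ} (ha : Differentiable ℂ a) :
    JetExp z (fun b s => a b * F b s) (fun d => a z * v d) fun d => deriv a z * v d + a z * w d := by
  obtain ⟨c, h1, h2, h3⟩ := hF.exists_coeff
  obtain ⟨C, hC⟩ := (isCompact_sphere z 1).exists_bound_of_continuousOn ha.continuous.continuousOn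
  refine ⟨⟨_, h1.smul hC, fun d => ha.fun_mul (h2 d), fun d => ⟨?_, ?_⟩⟩,
    fun s hs => ha.continuous.continuousOn.fun_mul (hF.cont s hs)⟩
  · rw [(h3 d).1]
  · rw [← (h3 d).2, ← (h3 d).1]
    exact deriv_fun_mul (ha z) (h2 d z)

lemma JetExp.sub (hF : JetExp z F v w) (hG : JetExp z G v' w') :
    JetExp z (fun b s => F b s - G b s) (fun d => v d - v' d) fun d => w d - w' d := by
  have := hF.add (hG.smul (a := fun _ => -1) (differentiable_const _))
  simpa only [deriv_const, zero_mul, zero_add, neg_one_mul, zero_sub, ← sub_eq_add_neg] using this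

/-- On a circle of radius 1 the Cauchy integral for the derivative is bounded by the supremum, so a
uniform error estimate on the circle suffices. The amplitude needs only continuity in b; only its
coefficients are differentiated. -/
lemma JetExp.uexp_cauchyDeriv (hF : JetExp z F v w) :
    UExp (Set.univ : Set Unit) (fun _ s => cauchyDeriv z fun b => F b s) fun d _ => w d := by
  obtain ⟨c, h1, h2, h3⟩ := hF.exists_coeff
  intro δ hδ N
  obtain ⟨C, hC⟩ := h1 δ hδ N
  refine ⟨C, fun _ _ s hs => ?_⟩
  have hd : Differentiable ℂ fun b => ∑ d ∈ Finset.range N, c d b * (s ^ d)⁻¹ :=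
    Differentiable.fun_sum fun d _ => (h2 d).mul_const _
  have h4 : deriv (fun b => ∑ d ∈ Finset.range N, c d b * (s ^ d)⁻¹) z =
      ∑ d ∈ Finset.range N, w d * (s ^ d)⁻¹ := by
    rw [deriv_fun_sum fun d _ => ((h2 d).mul_const _) z]
    exact Finset.sum_congr rfl fun d _ => by rw [deriv_mul_const (h2 d z), (h3 d).2]
  have h5 := cauchyDeriv_add (z := z) (hF.cont s (sector_subset_slitPlane hδ hs))
    (hd.continuous.continuousOn.mul (continuousOn_const (c := (-1 : ℂ))))
  rw [show cauchyDeriv z ((fun b => ∑ d ∈ Finset.range N, c d b * (s ^ d)⁻¹) * fun _ => (-1 : ℂ)) =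
    cauchyDeriv z (fun b => ∑ d ∈ Finset.range N, c d b * (s ^ d)⁻¹) * -1 from
      cauchyDeriv_mul_const _, cauchyDeriv_eq hd, h4, mul_neg_one, ← sub_eq_add_neg] at h5
  rw [← h5]
  refine norm_cauchyDeriv_le fun b hb => ?_
  have := hC b hb s hs
  simpa [← sub_eq_add_neg] using this

open ZSeries in
lemma jetExp_mul {A : ℂ → ℂ} {f g : ZSeries}
    (hA : UExp (Metric.sphere z 1) (fun _ => A) fun d _ => ev f d z)
    (hF : UExp (Metric.sphere z 1) F fun d b => ev g d b)
    (hc : ∀ s ∈ Complex.slitPlane, ContinuousOn (fun b => F b s) (Metric.sphere z 1)) :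
    JetExp z (fun b s => A s * F b s) (fun d => ev (f * g) d z) fun d => ev (f * dz g) d z := by
  have hd : ∀ d y, HasDerivAt (fun b => ∑ ij ∈ Finset.HasAntidiagonal.antidiagonal d,
      ev f ij.1 z * ev g ij.2 b) (∑ ij ∈ Finset.HasAntidiagonal.antidiagonal d,
        ev f ij.1 z * ev (dz g) ij.2 y) y := fun d y =>
    HasDerivAt.fun_sum fun ij _ => (hasDerivAt_ev g ij.2 y).const_mul _
  refine ⟨⟨_, hA.mul hF, fun d y => (hd d y).differentiableAt, fun d => ⟨?_, ?_⟩⟩,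
    fun s hs => continuousOn_const.fun_mul (hc s hs)⟩
  · rw [ev_mul]
  · rw [ev_mul]
    exact (hd d z).deriv

end

end

/-! ### The expansion of the one-point function. -/

section

/-- Because K(z,z) = cos πz, the bracket in the definition is -1/(πs) times the difference quotient
of K(z,·) at z. -/
lemma cos_mul_pointH1star {z s : ℂ} (hz : NotHalfInteger z) (hs : s ≠ 0) :
    Complex.cos (Real.pi * z) * pointH1star z s = deriv (fun b => kerD z b s) z := by
  have hd : Differentiable ℂ fun b => kerD z b s :=
    (differentiable_kerD hs).comp (f := fun b : ℂ => (z, b)) (by fun_prop)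
  have h0 := pi_s_ne_zero hs
  have h1 : Tendsto (fun b => Dstar z b s -
      Complex.cos (Real.pi * z) / (Real.pi * s * (z - b))) (𝓝[≠] z)
      (𝓝 (-(Real.pi * s)⁻¹ * deriv (fun b => kerD z b s) z)) := by
    refine ((hd z).hasDerivAt.tendsto_slope.const_mul (-(Real.pi * s : ℂ)⁻¹)).congr' ?_
    filter_upwards [self_mem_nhdsWithin] with b hb
    have h2 : b - z ≠ 0 := sub_ne_zero.2 hb
    have h3 : z - b ≠ 0 := sub_ne_zero.2 fun h => hb h.symm
    have h4 : vecV (-z) s ⬝ᵥ vecV b s = kerD z b s / (Real.pi * s) := by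
      rw [kerD, mul_div_cancel_left₀ _ h0]
    rw [slope_def_field, kerD_self' hs, Dstar, h4]
    generalize (Real.pi : ℂ) * s = p at *
    generalize kerD z b s = y
    generalize Complex.cos (Real.pi * z) = c
    rw [← neg_sub z b, ← div_div, ← sub_div, ← sub_div]
    field_simp
  have h2 : pointH1star z s = -((Real.pi * s / Complex.cos (Real.pi * z)) *
      (-(Real.pi * s)⁻¹ * deriv (fun b => kerD z b s) z)) := by
    rw [pointH1star, h1.limUnder_eq]
  have hc := cos_ne_zero_of_notHalfInteger hz
  rw [h2]
  generalize (Real.pi : ℂ) * s = p at *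
  field_simp

namespace ZSeries

lemma ev_cosSer (c : ℚ) (d : ℕ) (z : ℂ) :
    ev (cosSer c) d z = hankelCoeff (z + c) d * (iPow d).1 := by
  rw [ev, cosSer, PowerSeries.coeff_mk, map_mul, aeval_hankelPoly, map_intCast]

lemma ev_sinSer (c : ℚ) (d : ℕ) (z : ℂ) :
    ev (sinSer c) d z = hankelCoeff (z + c) d * (iPow d).2 := by
  rw [ev, sinSer, PowerSeries.coeff_mk, map_mul, aeval_hankelPoly, map_intCast]

lemma ev_one (d : ℕ) (z : ℂ) : ev 1 d z = if d = 0 then 1 else 0 := by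
  rw [ev, PowerSeries.coeff_one]
  split_ifs <;> simp

lemma ev_half_mul (f : ZSeries) (d : ℕ) (z : ℂ) :
    ev (PowerSeries.C (Polynomial.C (1 / 2)) * f) d z = ev f d z / 2 := by
  rw [ev, PowerSeries.coeff_C_mul, map_mul, Polynomial.aeval_C, ← ev]
  simp
  ring

/-- At d = 0 the right side is 0 by the convention for division by zero, and the left side vanishes
as well. -/
lemma ev_meanSer (d : ℕ) (z : ℂ) : ev meanSer d z = 2 * (ev cross d z / d) := by
  rcases d with _ | d
  · have h : meanSer.coeff 0 = 0 := by
      obtain ⟨h1, h2, h3, h4⟩ := coeff_zero_amplitudes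
      simp only [meanSer, map_sub, map_add, map_neg, coeff_zero_mul, coeff_dz, h1, h2, h3, h4]
      simp
    simp [ev, h]
  · have h := congr_arg (fun f => Polynomial.aeval z (PowerSeries.coeff (d + 1) f)) theta_meanSer
    simp only [coeff_theta, coeff_two_mul, map_mul, map_natCast, map_ofNat] at h
    change _ * ev meanSer (d + 1) z = 2 * ev cross (d + 1) z at h
    have : ((d + 1 : ℕ) : ℂ) ≠ 0 := Nat.cast_ne_zero.2 d.succ_ne_zero
    field_simp
    linear_combination h

lemma onePointMean_eq {l ε : ℂ} (hε : ε ≠ 0) (n : ℕ) : onePointMean l ε n =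
    ε ^ n * (if n = 0 then -(Real.pi / 2) * Complex.sin (Real.pi * (l / ε))
      else Complex.sin (Real.pi * (l / ε)) * (ev cross n (l / ε) / n)) := by
  unfold onePointMean
  rw [mul_div_assoc]
  rcases Nat.even_or_odd' n with ⟨j, rfl | rfl⟩
  · have h : ¬ Odd (2 * j) := by simp
    rw [if_neg h, ev_cross_even]
    split_ifs with h0
    · rw [h0]
      simp
    · simp
  · have h : Odd (2 * j + 1) := by simp
    have h0 : 2 * j + 1 ≠ 0 := by lia
    rw [if_neg h0, if_neg h0, if_pos h, show (2 * j + 1 - 1) / 2 = j by lia, ev_cross_odd]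
    have hp : ∏ i ∈ Finset.Icc (-(j : ℤ)) (j : ℤ), (l - ε * i) =
        ε ^ (2 * j + 1) * ∏ i ∈ Finset.Icc (-(j : ℤ)) (j : ℤ), (l / ε - i) := by
      have hc : (Finset.Icc (-(j : ℤ)) (j : ℤ)).card = 2 * j + 1 := by
        rw [Int.card_Icc]
        lia
      rw [← hc, ← Finset.prod_const, ← Finset.prod_mul_distrib]
      refine Finset.prod_congr rfl fun i _ => ?_
      field_simp
    dsimp only
    rw [hp]
    push_cast
    have hf : (j ! : ℂ) ≠ 0 := Nat.cast_ne_zero.2 (Nat.factorial_ne_zero j)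
    have hj : 2 * (j : ℂ) + 1 ≠ 0 := by exact_mod_cast h0
    field_simp

end ZSeries

open ZSeries in
-- K(z,b) is sorted into a part without 4s, with angles π(z+b)/2, and parts with cos 4s and sin 4s,
-- with angles π(z-b)/2. Differentiation at b = z leaves sin πz times a series in the first part,
-- since the series at cos πz is the z-derivative of the constant Wronskian; in the others the
-- angles vanish and only derivatives of amplitudes survive.
lemma exists_expansion_deriv_kerD (z : ℂ) : ∃ A₀ A B : ℂ → ℂ,
    UExp (Set.univ : Set Unit) (fun _ => A₀) (fun d _ =>
      if d = 0 then -(Real.pi / 2) * Complex.sin (Real.pi * z)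
      else Complex.sin (Real.pi * z) * (ev cross d z / d)) ∧
    UExp (Set.univ : Set Unit) (fun _ => A) (fun d _ => ev oscCos d z) ∧
    UExp (Set.univ : Set Unit) (fun _ => B) (fun d _ => ev oscSin d z) ∧
    ∀ s ∈ Complex.slitPlane, deriv (fun b => kerD z b s) z =
      A₀ s + (A s * Complex.cos (4 * s) + B s * Complex.sin (4 * s)) := by
  obtain ⟨N, hN⟩ := exists_nat_ge (‖z‖ + 1)
  have hzN : ‖z‖ ≤ N := by linarith
  have hbN : ∀ b ∈ Metric.sphere z 1, ‖b‖ ≤ N := fun b hb => by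
    have := norm_add_le (b - z) z
    rw [sub_add_cancel, mem_sphere_iff_norm.1 hb] at this
    linarith
  have hhalf : ∀ y : ℂ, ‖y‖ ≤ N → ‖y - 1 / 2‖ ≤ (N + 1 : ℕ) ∧ ‖y + 1 / 2‖ ≤ (N + 1 : ℕ) := by
    intro y hy
    have h2 : ‖(1 / 2 : ℂ)‖ ≤ 1 := by norm_num
    push_cast
    exact ⟨(norm_sub_le _ _).trans (add_le_add hy h2), (norm_add_le _ _).trans (add_le_add hy h2)⟩
  have hz' := hhalf (-z) (by rwa [norm_neg])
  have hB := isBesselAmplitude N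
  set S := Metric.sphere z 1
  have c1 : ((-1 / 2 : ℚ) : ℂ) = -(1 / 2) := by push_cast; ring
  have c2 : ((1 / 2 : ℚ) : ℂ) = 1 / 2 := by push_cast; ring
  -- By evenness in the order, -z - 1/2 has the coefficients of z + 1/2, and -z + 1/2 those of z -
  -- 1/2.
  have n1 : ∀ d, hankelCoeff (-z - 1 / 2) d = hankelCoeff (z + 1 / 2) d := fun d => by
    rw [← hankelCoeff_neg]
    congr 1
    ring
  have n2 : ∀ d, hankelCoeff (-z + 1 / 2) d = hankelCoeff (z + -(1 / 2)) d := fun d => by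
    rw [← hankelCoeff_neg]
    congr 1
    ring
  -- amplitudes with parameters depending on the centre only
  have a1 : UExp S (fun _ => besselP N (-z - 1 / 2)) fun d _ => ev P1 d z :=
    (hB.expP.comp (fun _ : ℂ => -z - 1 / 2) fun _ _ => hz'.1).congr (fun _ _ _ _ => rfl)
      fun d _ _ => by rw [P1, ev_cosSer, n1, c2]
  have a2 : UExp S (fun _ => besselQ N (-z - 1 / 2)) fun d _ => ev Q1 d z :=
    (hB.expQ.comp (fun _ : ℂ => -z - 1 / 2) fun _ _ => hz'.1).congr (fun _ _ _ _ => rfl)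
      fun d _ _ => by rw [Q1, ev_sinSer, n1, c2]
  have a3 : UExp S (fun _ => besselP N (-z + 1 / 2)) fun d _ => ev P0 d z :=
    (hB.expP.comp (fun _ : ℂ => -z + 1 / 2) fun _ _ => hz'.2).congr (fun _ _ _ _ => rfl)
      fun d _ _ => by rw [P0, ev_cosSer, n2, c1]
  have a4 : UExp S (fun _ => besselQ N (-z + 1 / 2)) fun d _ => ev Q0 d z :=
    (hB.expQ.comp (fun _ : ℂ => -z + 1 / 2) fun _ _ => hz'.2).congr (fun _ _ _ _ => rfl)
      fun d _ _ => by rw [Q0, ev_sinSer, n2, c1]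
  -- amplitudes with varying parameters
  have b1 : UExp S (fun b => besselP N (b - 1 / 2)) fun d b => ev P0 d b :=
    (hB.expP.comp (fun b : ℂ => b - 1 / 2) fun b hb => (hhalf b (hbN b hb)).1).congr
      (fun _ _ _ _ => rfl) fun d b _ => by rw [P0, ev_cosSer, c1, ← sub_eq_add_neg]
  have b2 : UExp S (fun b => besselQ N (b - 1 / 2)) fun d b => ev Q0 d b :=
    (hB.expQ.comp (fun b : ℂ => b - 1 / 2) fun b hb => (hhalf b (hbN b hb)).1).congr
      (fun _ _ _ _ => rfl) fun d b _ => by rw [Q0, ev_sinSer, c1, ← sub_eq_add_neg]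
  have b3 : UExp S (fun b => besselP N (b + 1 / 2)) fun d b => ev P1 d b :=
    (hB.expP.comp (fun b : ℂ => b + 1 / 2) fun b hb => (hhalf b (hbN b hb)).2).congr
      (fun _ _ _ _ => rfl) fun d b _ => by rw [P1, ev_cosSer, c2]
  have b4 : UExp S (fun b => besselQ N (b + 1 / 2)) fun d b => ev Q1 d b :=
    (hB.expQ.comp (fun b : ℂ => b + 1 / 2) fun b hb => (hhalf b (hbN b hb)).2).congr
      (fun _ _ _ _ => rfl) fun d b _ => by rw [Q1, ev_sinSer, c2]
  have d1 : ∀ s ∈ Complex.slitPlane, ContinuousOn (fun b => besselP N (b - 1 / 2) s) S :=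
    fun s hs => (hB.contP s hs).comp (by fun_prop) fun b hb => (hhalf b (hbN b hb)).1
  have d2 : ∀ s ∈ Complex.slitPlane, ContinuousOn (fun b => besselQ N (b - 1 / 2) s) S :=
    fun s hs => (hB.contQ s hs).comp (by fun_prop) fun b hb => (hhalf b (hbN b hb)).1
  have d3 : ∀ s ∈ Complex.slitPlane, ContinuousOn (fun b => besselP N (b + 1 / 2) s) S :=
    fun s hs => (hB.contP s hs).comp (by fun_prop) fun b hb => (hhalf b (hbN b hb)).2
  have d4 : ∀ s ∈ Complex.slitPlane, ContinuousOn (fun b => besselQ N (b + 1 / 2) s) S :=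
    fun s hs => (hB.contQ s hs).comp (by fun_prop) fun b hb => (hhalf b (hbN b hb)).2
  have E1 := (jetExp_mul a1 b1 d1).add (jetExp_mul a4 b4 d4)
  have E2 := (jetExp_mul a2 b2 d2).add (jetExp_mul a3 b3 d3)
  have E3 := (jetExp_mul a4 b3 d3).sub (jetExp_mul a1 b2 d2)
  have E4 := (jetExp_mul a3 b4 d4).sub (jetExp_mul a2 b1 d1)
  have hct : Differentiable ℂ fun b : ℂ => Complex.cos (Real.pi * (z + b) / 2) / 2 := by fun_prop
  have hst : Differentiable ℂ fun b : ℂ => Complex.sin (Real.pi * (z + b) / 2) / 2 := by fun_prop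
  have hcu : Differentiable ℂ fun b : ℂ => Complex.cos (Real.pi * (z - b) / 2) / 2 := by fun_prop
  have hsu : Differentiable ℂ fun b : ℂ => Complex.sin (Real.pi * (z - b) / 2) / 2 := by fun_prop
  have ht : HasDerivAt (fun b : ℂ => Real.pi * (z + b) / 2) (Real.pi / 2 : ℂ) z := by
    simpa using (((hasDerivAt_id z).const_add z).const_mul (Real.pi : ℂ)).div_const 2
  have hct' : deriv (fun b : ℂ => Complex.cos (Real.pi * (z + b) / 2) / 2) z =
      -Complex.sin (Real.pi * z) * (Real.pi / 2) / 2 := by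
    rw [(ht.ccos.div_const 2).deriv]
    ring_nf
  have w1 : ∀ d, ev (P1 * P0) d z + ev (Q0 * Q1) d z = if d = 0 then 1 else 0 := fun d => by
    rw [← ev_add, mul_comm P1, wronskian_eq_one, ev_one]
  have w2 : ∀ d, ev (Q1 * Q0) d z + ev (P0 * P1) d z = if d = 0 then 1 else 0 := fun d => by
    rw [← w1 d, mul_comm Q1, mul_comm P1, add_comm]
  have w3 : ∀ d, ev (Q0 * P1) d z - ev (P1 * Q0) d z = 0 := fun d => by
    rw [mul_comm, sub_self]
  have w4 : ∀ d, ev (P0 * Q1) d z - ev (Q1 * P0) d z = 0 := fun d => by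
    rw [mul_comm, sub_self]
  have w5 : ∀ d, ev (P1 * dz P0) d z + ev (Q0 * dz Q1) d z +
      (ev (Q1 * dz Q0) d z + ev (P0 * dz P1) d z) = 0 := fun d => by
    have h := congr_arg dz wronskian_eq_one
    have h1 : dz (1 : ZSeries) = 0 := by
      ext1 n
      rw [coeff_dz, PowerSeries.coeff_one]
      split_ifs <;> simp
    rw [dz_add, dz_mul, dz_mul, h1] at h
    rw [← ev_add, ← ev_add, ← ev_add, show P1 * dz P0 + Q0 * dz Q1 + (Q1 * dz Q0 + P0 * dz P1) = 0
      by linear_combination h]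
    simp [ev]
  -- M is the mean part; X and Y belong to cos 4s and sin 4s.
  have M := ((E1.add E2).smul hct).add ((E4.sub E3).smul hst)
  have X := ((E1.sub E2).smul hcu).add ((E3.add E4).smul hsu)
  have Y := ((E3.add E4).smul hcu).sub ((E1.sub E2).smul hsu)
  refine ⟨_, _, _, M.uexp_cauchyDeriv.congr (fun _ _ _ _ => rfl) fun d _ _ => ?_,
    X.uexp_cauchyDeriv.congr (fun _ _ _ _ => rfl) fun d _ _ => ?_,
    Y.uexp_cauchyDeriv.congr (fun _ _ _ _ => rfl) fun d _ _ => ?_, fun s hs => ?_⟩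
  · have hm := ev_meanSer d z
    simp only [meanSer, ev_sub, ev_add, ev_neg] at hm
    rw [w5, w1, w2, w3, w4, hct', show Real.pi * (z + z) / 2 = Real.pi * z by ring]
    have h6 : ev (P0 * dz Q1) d z - ev (Q1 * dz P0) d z -
        (ev (Q0 * dz P1) d z - ev (P1 * dz Q0) d z) = 2 * (ev cross d z / d) := by
      rw [← hm]
      ring
    rw [h6]
    split_ifs with h0
    · rw [h0]
      simp
      ring
    · ring
  · rw [w1, w2, w3, w4, sub_self z]
    simp only [oscCos, ev_half_mul, ev_add, ev_sub, dz_sub, sub_mul, mul_sub]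
    simp
    ring
  · rw [w1, w2, w3, w4, sub_self z]
    simp only [oscSin, ev_half_mul, ev_add, ev_sub, dz_sub, sub_mul, mul_sub]
    simp
    ring
  · have hs0 := Complex.slitPlane_ne_zero hs
    have hd : Differentiable ℂ fun b => kerD z b s :=
      (differentiable_kerD hs0).comp (f := fun b : ℂ => (z, b)) (by fun_prop)
    rw [← cauchyDeriv_eq hd, ← cauchyDeriv_mul_const, ← cauchyDeriv_mul_const,
      ← cauchyDeriv_add ((X.cont s hs).fun_mul continuousOn_const)
        ((Y.cont s hs).fun_mul continuousOn_const),
      ← cauchyDeriv_add (M.cont s hs) (((X.cont s hs).fun_mul continuousOn_const).fun_add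
        ((Y.cont s hs).fun_mul continuousOn_const))]
    refine cauchyDeriv_congr fun b hb => ?_
    rw [kerD_eq_trig hzN (hbN b hb) hs]
    have e1 : Complex.cos (Real.pi * (z - b) / 2) * Complex.cos (4 * s) -
        Complex.sin (Real.pi * (z - b) / 2) * Complex.sin (4 * s) =
        Complex.cos (2 * s + Real.pi * z / 2) * Complex.cos (2 * s - Real.pi * b / 2) -
        Complex.sin (2 * s + Real.pi * z / 2) * Complex.sin (2 * s - Real.pi * b / 2) := by
      rw [← Complex.cos_add, ← Complex.cos_add]
      congr 1
      ring
    have e2 : Complex.sin (Real.pi * (z - b) / 2) * Complex.cos (4 * s) +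
        Complex.cos (Real.pi * (z - b) / 2) * Complex.sin (4 * s) =
        Complex.sin (2 * s + Real.pi * z / 2) * Complex.cos (2 * s - Real.pi * b / 2) +
        Complex.cos (2 * s + Real.pi * z / 2) * Complex.sin (2 * s - Real.pi * b / 2) := by
      rw [← Complex.sin_add, ← Complex.sin_add]
      congr 1
      ring
    have e3 : Complex.cos (Real.pi * (z + b) / 2) =
        Complex.cos (2 * s + Real.pi * z / 2) * Complex.cos (2 * s - Real.pi * b / 2) +
        Complex.sin (2 * s + Real.pi * z / 2) * Complex.sin (2 * s - Real.pi * b / 2) := by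
      rw [← Complex.cos_sub]
      congr 1
      ring
    have e4 : Complex.sin (Real.pi * (z + b) / 2) =
        Complex.sin (2 * s + Real.pi * z / 2) * Complex.cos (2 * s - Real.pi * b / 2) -
        Complex.cos (2 * s + Real.pi * z / 2) * Complex.sin (2 * s - Real.pi * b / 2) := by
      rw [← Complex.sin_sub]
      congr 1
      ring
    rw [e3, e4]
    generalize Complex.cos (2 * s + Real.pi * z / 2) = ca at *
    generalize Complex.sin (2 * s + Real.pi * z / 2) = sa at *
    generalize Complex.cos (2 * s - Real.pi * b / 2) = cb at *
    generalize Complex.sin (2 * s - Real.pi * b / 2) = sb at *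
    generalize Complex.cos (Real.pi * (z - b) / 2) = cu at *
    generalize Complex.sin (Real.pi * (z - b) / 2) = su at *
    generalize besselP N (-z - 1 / 2) s = p1
    generalize besselP N (-z + 1 / 2) s = p3
    generalize besselP N (b - 1 / 2) s = p2
    generalize besselP N (b + 1 / 2) s = p4
    generalize besselQ N (-z - 1 / 2) s = q1
    generalize besselQ N (-z + 1 / 2) s = q3
    generalize besselQ N (b - 1 / 2) s = q2
    generalize besselQ N (b + 1 / 2) s = q4
    change _ = _ + ((_ + _) * Complex.cos (4 * s) + (_ - _) * Complex.sin (4 * s))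
    linear_combination -(p1 * p2 + q3 * q4 - (q1 * q2 + p3 * p4)) / 2 * e1 -
      (q3 * p4 - p1 * q2 + (p3 * q4 - q1 * p2)) / 2 * e2

/-- The expansion of the one-point function. -/
lemma exists_expansion_pointH1star : ∃ H Ht : ℕ → ℂ → ℂ → ℂ,
    (∀ d : ℕ, 1 ≤ d → IsOnePointCoeff d (H d) ∧ IsOnePointCoeff d (Ht d)) ∧
    ∀ l ε : ℂ, ε ≠ 0 → NotHalfInteger (l / ε) →
      HasTrigExpansion ε 1 (fun r => Complex.cos (Real.pi * l / ε) * pointH1star (l / ε) (r / ε))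
        (fun m d => if m = 0 then onePointMean l ε d else if 1 ≤ d then H d l ε else 0)
        (fun _ d => if 1 ≤ d then Ht d l ε else 0) := by
  refine ⟨fun d l ε => ε ^ d * ZSeries.ev ZSeries.oscCos d (l / ε),
    fun d l ε => ε ^ d * ZSeries.ev ZSeries.oscSin d (l / ε), fun d hd =>
    ⟨ZSeries.isOnePointCoeff_ev ZSeries.hasWeight_oscCos hd,
      ZSeries.isOnePointCoeff_ev ZSeries.hasWeight_oscSin hd⟩, fun l ε hε hl => ?_⟩
  obtain ⟨A₀, A, B, h0, hA, hB, h⟩ := exists_expansion_deriv_kerD (l / ε)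
  -- Weight 2 forces the coefficient of order 0 to vanish, so the restriction to d ≥ 1 is automatic.
  have hvan : ∀ f : ZSeries, ZSeries.HasWeight 2 f →
      (fun d => if 1 ≤ d then ε ^ d * ZSeries.ev f d (l / ε) else 0) =
        fun d => ε ^ d * ZSeries.ev f d (l / ε) := fun f hf => funext fun d => by
    rcases d with _ | d
    · simp [ZSeries.ev, hf.coeff_eq_zero (n := 0) (by norm_num)]
    · simp
  refine ⟨fun m r => if m = 0 then A₀ (r / ε) else A (r / ε), fun _ r => B (r / ε),
    fun r hr => ?_, ?_, fun m hm => ?_⟩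
  · dsimp only
    rw [mul_div_assoc, cos_mul_pointH1star hl (Complex.slitPlane_ne_zero hr), h _ hr]
    simp
  · simp only [if_true, ZSeries.onePointMean_eq hε]
    exact h0.hasPowerExpansion hε
  · have hm' : m ≠ 0 := by
      have := (Finset.mem_Icc.1 hm).1
      lia
    simp only [hm', if_false]
    rw [hvan _ ZSeries.hasWeight_oscCos, hvan _ ZSeries.hasWeight_oscSin]
    exact ⟨hA.hasPowerExpansion hε, hB.hasPowerExpansion hε⟩

end

end P1Points

end

theorem mainTheorem9 :
    (∀ k : ℕ, 2 ≤ k →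
      ∃ H Ht : ℕ → ℕ → (Fin k → ℂ) → ℂ → ℂ,
        (∀ d m : ℕ, P1Points.IsTrigRational k (H d m) ∧ P1Points.IsTrigRational k (Ht d m)) ∧
        ∀ (l : Fin k → ℂ) (ε : ℂ), ε ≠ 0 → (∀ i, P1Points.NotHalfInteger (l i / ε)) →
          -- the variable `r` is the square root `q^{1/2}`
          P1Points.HasTrigExpansion ε k
            (fun r => (∏ i, Complex.cos (Real.pi * l i / ε)) *
              P1Points.pointH k (fun i => l i / ε) (r / ε))
            (fun m d => if m ≤ d then H d m l ε else 0)
            (fun m d => if m ≤ d then Ht d m l ε else 0)) ∧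
    (∃ H Ht : ℕ → ℂ → ℂ → ℂ,
      (∀ d : ℕ, 1 ≤ d →
        P1Points.IsOnePointCoeff d (H d) ∧ P1Points.IsOnePointCoeff d (Ht d)) ∧
      ∀ l ε : ℂ, ε ≠ 0 → P1Points.NotHalfInteger (l / ε) →
        P1Points.HasTrigExpansion ε 1
          (fun r => Complex.cos (Real.pi * l / ε) * P1Points.pointH1star (l / ε) (r / ε))
          (fun m d => if m = 0 then P1Points.onePointMean l ε d
            else if 1 ≤ d then H d l ε else 0)
          (fun _ d => if 1 ≤ d then Ht d l ε else 0)) :=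
  ⟨P1Points.exists_expansion_pointH, P1Points.exists_expansion_pointH1star⟩
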